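/- **Setting.** Let $C$ be a smooth projective complex curve, $M$ a lattice, $N=\operatorname{Hom}(M,\mathbb Z)$, $N_{\mathbb Q}=N\otimes\mathbb Q$ and $T=\operatorname{Spec}\mathbb C[M]$. A *polyhedral divisor* $\mathfrak D=\sum_{y\in C_0}\Delta_y\cdot[y]$ consists of a dense open subset $C_0\subset C$ (the *locus*), a strongly convex polyhedral cone $\sigma\subset N_{\mathbb Q}$ (the *tail*), and, for every closed point $y\in C_0$, a polyhedron $\Delta_y=P_y+\sigma$ with $P_y\ne\emptyset$ a polytope, such that $\Delta_y=\sigma$ for all but finitely many $y$; the $y$ with $\Delta_y\neq\sigma$ are the *special points*; put $\Delta_y=\emptyset$ for $y\notin C_0$. For $m\in\sigma^\vee$ let $\mathfrak D(m)=\sum_{y\in C_0}\min_{v\in\Delta_y}\langle m,v\rangle\,[y]$. Let $\deg\mathfrak D=\sum_{y}\Delta_y$ if $C_0=C$ and $\deg\mathfrak D=\emptyset$ otherwise. $\mathfrak D$ is *proper* if $C_0$ is affine, or if $C_0=C$, $\deg\mathfrak D\subsetneq\sigma$, and for every $m\in\sigma^\vee\cap M$ with $\min_{v\in\deg\mathfrak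 D}\langle m,v\rangle=0$ some multiple $\mathfrak D(rm)$, $r\ge1$, is principal. Put $$A(C_0,\mathfrak D)=\bigoplus_{m\in\sigma^\vee\cap M}H^0\big(C_0,\mathcal O(\lfloor\mathfrak D(m)\rfloor)\big)\chi^m\subset\mathbb C(C)[M],\qquad X(\mathfrak D)=\operatorname{Spec}A(C_0,\mathfrak D).$$ The intersection $\mathfrak D\cap\mathfrak D'$ has coefficients $\Delta_y\cap\Delta'_y$ (its locus is where these are non-empty). A *divisorial fan* $\mathscr E$ on $(C,T)$ is a finite set of proper polyhedral divisors, closed under intersection, such that for all $\mathfrak D,\mathfrak D'\in\mathscr E$ every non-empty $\Delta_y\cap\Delta_y'$ is a face of both $\Delta_y$ and $\Delta_y'$, and $\deg\mathfrak D\cap\sigma''=\deg\mathfrak D'\cap\sigma''$ where $\sigma''$ is the tail of $\mathfrak D\cap\mathfrak D'$. Its $T$-variety $X=X(\mathscr E)$ is glued from the charts $X(\mathfrak D)$, $\mathfrak D\in\mathscr E$, along the charts $X(\mathfrak D\cap\mathfrak D')$. The *hyperspace* $\mathscr N_{\mathbb Q}$ is the set of triples $(y,\nu,\ell)$, $y\in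 C$ a closed point, $\nu\in N_{\mathbb Q}$, $\ell\in\mathbb Q_{\ge0}$, where $(y,\nu,0)$ and $(y',\nu,0)$ are identified for all $y,y'$; $\mathscr N$ is the set of its points with $\nu\in N$, $\ell\in\mathbb Z_{\geq 0}$. The *hypercone* $C(\mathfrak D)$ is the set of the $(y,\nu,\ell)$ with $y\in C_0$ and $(\nu,\ell)$ in the cone generated by $\sigma\times\{0\}$ and $\Delta_y\times\{1\}$. Let $\Gamma\subset C$ be a dense open subset that contains no special point of any $\mathfrak D\in\mathscr E$. Assume that for every closed point $y\in\Gamma$ and every $\mathfrak D\in\mathscr E$ there is a $\mathfrak D'\in\mathscr E$ whose locus contains $y$ and whose tail contains that of $\mathfrak D$ (for instance, that $\Gamma$ lies in all the loci). In particular, if $\mathscr E\ne\emptyset$, $\Gamma\times T$ is an open subset of $X$. Put $$|\mathscr E|_\Gamma=\bigcup_{\mathfrak D\in\mathscr E}C(\mathfrak D)\setminus\{(y,\nu,\ell)\mid y\in\Gamma,\ \ell>0\}.$$ Let $K$ be a field extension of $\mathbb C$, $\mathcal O=K[[t]]$, $\mathcal K=K((t))$, and let $X_\Gamma$ be the set of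 arcs $\alpha:\operatorname{Spec}\mathcal O\to X$ over $\mathbb C$ whose generic point lies in $\Gamma\times T$. Restricting $\alpha$ to $\operatorname{Spec}\mathcal K$ gives a $\mathcal K$-point $\alpha_\Gamma$ of $\Gamma$ and a homomorphism $\alpha_M^\star:\mathbb C[M]\to\mathcal K$. Define $\nu_\alpha\in N$ by $\alpha_M^\star(\chi^m)\in t^{\langle m,\nu_\alpha\rangle}\mathcal O^\star$ for all $m$. If $\alpha_\Gamma$ extends to an $\mathcal O$-point of $\Gamma$, put $\ell_\alpha=0$ (then $y_\alpha$ is irrelevant). Otherwise $\ell_\alpha\ge1$ and $y_\alpha\in C$ are determined by $\alpha_\Gamma^\star(f)\in t^{\ell_\alpha\operatorname{ord}_{y_\alpha}(f)}\mathcal O^\star$ for all $0\ne f\in\mathbb C[\Gamma]$. For $\nu\in N$ let $\mathcal C_\nu\subset T(\mathcal K)$ be the $T(\mathcal O)$-orbit of $t^\nu$, i.e. the set of the homomorphisms $\chi^m\mapsto t^{\langle m,\nu\rangle}\omega(m)$ with $\omega:M\to\mathcal O^\star$ a group homomorphism. **Proposition.** The triple $(y_\alpha,\nu_\alpha,\ell_\alpha)$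 is a well-defined point of $\mathscr N_{\mathbb Q}$ for every $\alpha\in X_\Gamma$, and $\alpha\mapsto(y_\alpha,\nu_\alpha,\ell_\alpha)$ is a surjective map $$\underline{\operatorname{val}}:X_\Gamma\to|\mathscr E|_\Gamma\cap\mathscr N .$$ Moreover, for $(y,\nu,\ell)\in|\mathscr E|_\Gamma\cap\mathscr N$: * if $\ell=0$, then $\underline{\operatorname{val}}^{-1}(y,\nu,0)\cong\Gamma(\mathcal O)\times\mathcal C_\nu$, where $\alpha$ corresponds to the pair of the $\mathcal O$-point of $\Gamma$ extending $\alpha_\Gamma$ and of $\alpha_M^\star$; * if $\ell\ge1$, then $\underline{\operatorname{val}}^{-1}(y,\nu,\ell)\cong\mathcal O^\star\times\mathcal C_\nu$, where, for any fixed uniformizer $\pi\in\mathbb C(C)$ at $y$, $\alpha$ corresponds to the pair $(u,\alpha_M^\star)$ with $\alpha_\Gamma^\star(\pi)=t^{\ell}u$. -/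

import Mathlib

open AlgebraicGeometry CategoryTheory Limits
open scoped Pointwise

noncomputable section

namespace TVariety

/-! ### Smooth projective complex curves -/

/-- The complex point `Spec ℂ`. -/
abbrev SpecC : Scheme.{0} := Spec (CommRingCat.of ℂ)

/-- `C` is a smooth projective curve over `ℂ`: an integral scheme, proper and smooth of relative
dimension one over `ℂ` (a proper curve over a field is projective). -/
class IsSmoothProjectiveCurve (C : Scheme.{0}) [C.Over SpecC] : Prop where
  isIntegral : IsIntegral C
  isProper : IsProper (C ↘ SpecC)
  smooth : SmoothOfRelativeDimension 1 (C ↘ SpecC)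

attribute [instance] IsSmoothProjectiveCurve.isIntegral IsSmoothProjectiveCurve.isProper
  IsSmoothProjectiveCurve.smooth

theorem dvr_of_etale {k S L : Type} [Field k] [CommRing S] [IsDomain S]
    [Algebra (MvPolynomial (Fin 1) k) S] [Algebra.Etale (MvPolynomial (Fin 1) k) S]
    (p : Ideal S) [p.IsMaximal] [CommRing L] [IsDomain L] [Algebra S L]
    [IsLocalization.AtPrime L p] : IsDiscreteValuationRing L := by
  set P := MvPolynomial (Fin 1) k
  have hP : IsPrincipalIdealRing P := IsPrincipalIdealRing.of_surjective
    (MvPolynomial.uniqueAlgEquiv k (Fin 1)).symm.toRingEquiv.toRingHom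
    (MvPolynomial.uniqueAlgEquiv k (Fin 1)).symm.surjective
  let : Algebra k S := ((algebraMap P S).comp MvPolynomial.C).toAlgebra
  have : IsScalarTower k P S := .of_algebraMap_eq' rfl
  have hfp : Algebra.FiniteType k S := .trans (S := MvPolynomial (Fin 1) k) inferInstance inferInstance
  have hS : IsNoetherianRing S := Algebra.FiniteType.isNoetherianRing k S
  have hp : p ≠ ⊥ := by
    intro h
    have hinj : Function.Injective (algebraMap P S) := FaithfulSMul.algebraMap_injective P S
    have hf : IsField S := by
      by_contra hf
      exact (Ideal.bot_lt_of_maximal p hf).ne' h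
    let := hf.toField
    have hfin : Module.Finite k S := finite_of_finite_type_of_isJacobsonRing k S
    have hX : IsAlgebraic k (algebraMap P S (MvPolynomial.X 0)) := Algebra.IsAlgebraic.isAlgebraic _
    exact MvPolynomial.transcendental_X k 0 ((isAlgebraic_algebraMap_iff hinj).1 hX)
  have hloc : IsLocalRing L := IsLocalization.AtPrime.isLocalRing L p
  have hnoe : IsNoetherianRing L := IsLocalization.isNoetherianRing p.primeCompl L hS
  have hnf : ¬ IsField L := IsLocalization.AtPrime.not_isField S hp L
  let q : Ideal P := p.under P
  have hq : p.LiesOver q := ⟨rfl⟩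
  let := Localization.AtPrime.algebraOfLiesOver q p
  have key := ((Algebra.isUnramifiedAt_iff_map_eq P q p).mp inferInstance).2
  have hpr : (IsLocalRing.maximalIdeal (Localization.AtPrime p)).IsPrincipal := by
    rw [← key]
    obtain ⟨a, ha⟩ := hP.principal q
    rw [ha, Ideal.submodule_span_eq, Ideal.map_span, Set.image_singleton]
    exact ⟨_, rfl⟩
  have hnoe' : IsNoetherianRing (Localization.AtPrime p) :=
    IsLocalization.isNoetherianRing p.primeCompl _ hS
  have hnf' : ¬ IsField (Localization.AtPrime p) := IsLocalization.AtPrime.not_isField S hp _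
  have hd : IsDiscreteValuationRing (Localization.AtPrime p) :=
    ((IsDiscreteValuationRing.TFAE (Localization.AtPrime p) hnf').out 0 4).mpr hpr
  exact IsDiscreteValuationRing.RingEquivClass.isDiscreteValuationRing
    (IsLocalization.algEquiv p.primeCompl (Localization.AtPrime p) L).toRingEquiv

section Curve

variable (C : Scheme.{0}) [C.Over SpecC] [IsSmoothProjectiveCurve C]

/-- The closed points of `C`. -/
abbrev ClosedPt (C : Scheme.{0}) : Type := {y : C // IsClosed ({y} : Set C)}

instance stalk_isDiscreteValuationRing (y : ClosedPt C) :
    IsDiscreteValuationRing (C.presheaf.stalk y.1) := by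
  obtain ⟨y, hy⟩ := y
  let f := C ↘ SpecC
  obtain ⟨U, hU, V, hV, hx, e, hf⟩ :=
    SmoothOfRelativeDimension.exists_isStandardSmoothOfRelativeDimension (n := 1) (f := f) y
  have hUt : U = ⊤ := by
    ext z
    simp only [TopologicalSpace.Opens.coe_top, Set.mem_univ, iff_true]
    exact Subsingleton.elim (f y) z ▸ e hx
  subst hUt
  obtain ⟨g, hg, hg'⟩ := hf.exists_etale_mvPolynomial
  let iso : ℂ ≃+* Γ(Spec (.of ℂ), ⊤) := (Scheme.ΓSpecIso (.of ℂ)).symm.commRingCatIsoToRingEquiv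
  let e1 : MvPolynomial (Fin 1) ℂ ≃+* MvPolynomial (Fin 1) Γ(Spec (.of ℂ), ⊤) :=
    MvPolynomial.mapEquiv _ iso
  let : Algebra (MvPolynomial (Fin 1) ℂ) Γ(C, V) := (g.comp e1.toRingHom).toAlgebra
  have : Algebra.Etale (MvPolynomial (Fin 1) ℂ) Γ(C, V) :=
    RingHom.Etale.respectsIso.2 g e1 hg'
  have := hV.primeIdealOf_isMaximal_of_isClosed ⟨y, hx⟩ hy
  have : Nonempty V := ⟨⟨y, hx⟩⟩
  have := hV.isLocalization_stalk ⟨y, hx⟩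
  let := C.presheaf.algebra_section_stalk (U := V) ⟨y, hx⟩
  exact dvr_of_etale (k := ℂ) (hV.primeIdealOf ⟨y, hx⟩).asIdeal

/-- The function field `ℂ(C)` as a `ℂ`-algebra. -/
instance functionFieldAlgebra : Algebra ℂ C.functionField :=
  ((C.presheaf.germ ⊤ (genericPoint C) (TopologicalSpace.Opens.mem_top _)).hom.comp
    ((C ↘ SpecC).appTop.hom.comp (Scheme.ΓSpecIso (CommRingCat.of ℂ)).inv.hom)).toAlgebra

variable {C}

/-- The order `ord_y f` of a rational function `f` at the closed point `y` (with the value `0` for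
`f = 0`). -/
def ord (y : ClosedPt C) (f : C.functionField) : ℤ :=
  -WithZero.log
    ((IsDiscreteValuationRing.maximalIdeal (C.presheaf.stalk y.1)).valuation C.functionField f)

theorem ord_mul (y : ClosedPt C) {f g : C.functionField} (hf : f ≠ 0) (hg : g ≠ 0) :
    ord y (f * g) = ord y f + ord y g := by
  simp only [ord, map_mul]
  rw [WithZero.log_mul (by simpa using hf) (by simpa using hg)]
  ring

theorem ord_add (y : ClosedPt C) {f g : C.functionField} (hf : f ≠ 0) (hg : g ≠ 0)
    (hfg : f + g ≠ 0) : min (ord y f) (ord y g) ≤ ord y (f + g) := by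
  set v := (IsDiscreteValuationRing.maximalIdeal (C.presheaf.stalk y.1)).valuation C.functionField
    with hv
  have h := v.map_add f g
  have hf' : v f ≠ 0 := by simpa using hf
  have hg' : v g ≠ 0 := by simpa using hg
  have hfg' : v (f + g) ≠ 0 := by simpa using hfg
  simp only [ord, ← hv]
  rcases le_max_iff.1 h with h | h
  · exact (min_le_left _ _).trans (neg_le_neg ((WithZero.log_le_log hfg' hf').2 h))
  · exact (min_le_right _ _).trans (neg_le_neg ((WithZero.log_le_log hfg' hg').2 h))

theorem ord_algebraMap (y : ClosedPt C) {c : ℂ} (hc : c ≠ 0) :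
    ord y (algebraMap ℂ C.functionField c) = 0 := by
  have key : ∀ c : ℂ, (IsDiscreteValuationRing.maximalIdeal (C.presheaf.stalk y.1)).valuation
      C.functionField (algebraMap ℂ C.functionField c) ≤ 1 := by
    intro c
    have : algebraMap ℂ C.functionField c =
        algebraMap (C.presheaf.stalk y.1) C.functionField
          (C.presheaf.germ ⊤ y.1 (TopologicalSpace.Opens.mem_top _) ((C ↘ SpecC).appTop.hom
            ((Scheme.ΓSpecIso (CommRingCat.of ℂ)).inv.hom c))) := by
      have : Nonempty (⊤ : C.Opens) := ⟨⟨y.1, TopologicalSpace.Opens.mem_top _⟩⟩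
      exact (Scheme.algebraMap_germ_eq_germToFunctionField (X := C)
        (TopologicalSpace.Opens.mem_top _) _).symm
    rw [this]
    exact IsDedekindDomain.HeightOneSpectrum.valuation_le_one _ _
  have h1 : (IsDiscreteValuationRing.maximalIdeal (C.presheaf.stalk y.1)).valuation
      C.functionField (algebraMap ℂ C.functionField c) = 1 := by
    refine le_antisymm (key c) ?_
    have h2 := key c⁻¹
    rw [map_inv₀, map_inv₀] at h2
    have h0 : (IsDiscreteValuationRing.maximalIdeal (C.presheaf.stalk y.1)).valuation
      C.functionField (algebraMap ℂ C.functionField c) ≠ 0 := by simpa using hc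
    exact (inv_le_one₀ (zero_lt_iff.2 h0)).1 h2
  simp [ord, h1]

end Curve

/-! ### Polyhedral divisors

`M` is a lattice (the character lattice of the torus `T = Spec ℂ[M]`), `N = Hom(M, ℤ)` is its dual
and `N_ℚ = Hom(M, ℚ)`; the pairing of `m ∈ M` with `v ∈ N_ℚ` is `v m`. -/

/-- The rational vector space `N_ℚ`. -/
abbrev NQ (M : Type) [AddCommGroup M] : Type := M →+ ℚ

/-- An integral vector `ν ∈ N` seen in `N_ℚ`. -/
def NQ.ofInt {M : Type} [AddCommGroup M] (ν : M →+ ℤ) : NQ M := (Int.castAddHom ℚ).comp ν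

/-- `F` is a face of `P`: the locus where some linear form attains its
minimum on `P`. -/
def IsFace {V : Type} [AddCommGroup V] [Module ℚ V] (F P : Set V) : Prop :=
  ∃ m : Module.Dual ℚ V, F = {v ∈ P | ∀ w ∈ P, m v ≤ m w}

/-- A `σ`-polyhedral divisor `∑_{y ∈ C₀} Δ_y · [y]` on a dense open subset `C₀` of `C`, where `σ`
is a strongly convex polyhedral cone. We put `Δ_y = ∅` for the points `y` outside `C₀`. -/
structure PolyhedralDivisor (C : Scheme.{0}) (M : Type) [AddCommGroup M] where
  /-- the locus `C₀` -/
  locus : C.Opens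
  locus_nonempty : (locus : Set C).Nonempty
  /-- the tail `σ` -/
  tail : PointedCone ℚ (NQ M)
  tail_fg : tail.FG
  tail_stronglyConvex : ∀ v ∈ tail, -v ∈ tail → v = 0
  /-- the coefficients `Δ_y` -/
  coeff : ClosedPt C → Set (NQ M)
  coeff_polyhedron : ∀ y : ClosedPt C, y.1 ∈ locus →
    ∃ P : Finset (NQ M), P.Nonempty ∧
      coeff y = convexHull ℚ (P : Set (NQ M)) + (tail : Set (NQ M))
  coeff_of_notMem : ∀ y : ClosedPt C, y.1 ∉ locus → coeff y = ∅
  finite_special : {y : ClosedPt C | y.1 ∈ locus ∧ coeff y ≠ (tail : Set (NQ M))}.Finite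

namespace PolyhedralDivisor

section Basic

variable {C : Scheme.{0}} {M : Type} [AddCommGroup M] (D : PolyhedralDivisor C M)

/-- The special points of `D`. -/
def special : Set (ClosedPt C) := {y | y.1 ∈ D.locus ∧ D.coeff y ≠ (D.tail : Set (NQ M))}

/-- `m` lies in the dual cone `σ^∨`. -/
def MemDual (m : M) : Prop := ∀ v ∈ D.tail, 0 ≤ v m

open Classical in
/-- The coefficient `min {⟨m, v⟩ | v ∈ Δ_y}` at `y ∈ C₀` of the `ℚ`-divisor `D(m)`, for
`m ∈ σ^∨`. -/
def eval (m : M) (y : ClosedPt C) : ℚ :=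
  if h : ∃ q : ℚ, IsLeast ((fun v : NQ M => v m) '' D.coeff y) q then h.choose else 0

/-- The degree of `D`: the Minkowski sum of the `Δ_y` if the locus is complete, and the empty set
otherwise. (Almost all `Δ_y` are equal to the tail, which contains `0`.) -/
def deg : Set (NQ M) :=
  {w | D.locus = ⊤ ∧ ∃ v : ClosedPt C →₀ NQ M, (∀ y, v y ∈ D.coeff y) ∧ (v.sum fun _ u => u) = w}

/-- The inclusion order: `D ≤ D'` if the tail and the coefficients (hence also the locus) of `D`
are contained in those of `D'`. -/
instance : Preorder (PolyhedralDivisor C M) where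
  le D D' := D.tail ≤ D'.tail ∧ ∀ y, D.coeff y ⊆ D'.coeff y
  le_refl D := ⟨le_rfl, fun _ => subset_rfl⟩
  le_trans _ _ _ h h' := ⟨h.1.trans h'.1, fun y => (h.2 y).trans (h'.2 y)⟩

/-- `D''` is the intersection `D ∩ D' = ∑ (Δ_y ∩ Δ'_y) · [y]`, whose locus consists of the points
`y` with `Δ_y ∩ Δ'_y ≠ ∅`. -/
def IsInter (D D' D'' : PolyhedralDivisor C M) : Prop :=
  ∀ y, D''.coeff y = D.coeff y ∩ D'.coeff y

variable {D}

theorem coeff_nonempty {y : ClosedPt C} (hy : y.1 ∈ D.locus) : (D.coeff y).Nonempty := by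
  obtain ⟨P, hP, h⟩ := D.coeff_polyhedron y hy
  rw [h]
  exact (hP.to_set.convexHull).add ⟨0, D.tail.zero_mem⟩

theorem mem_locus_of_mem_coeff {y : ClosedPt C} {v : NQ M} (hv : v ∈ D.coeff y) :
    y.1 ∈ D.locus := by
  by_contra h
  rw [D.coeff_of_notMem y h] at hv
  exact hv

theorem exists_isLeast {m : M} (hm : D.MemDual m) {y : ClosedPt C} (hy : y.1 ∈ D.locus) :
    ∃ q : ℚ, IsLeast ((fun v : NQ M => v m) '' D.coeff y) q := by
  obtain ⟨P, hP, h⟩ := D.coeff_polyhedron y hy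
  obtain ⟨v₀, hv₀, hmin⟩ := P.exists_min_image (fun v : NQ M => v m) hP
  refine ⟨v₀ m, ⟨v₀, ?_, rfl⟩, ?_⟩
  · rw [h]
    exact ⟨v₀, subset_convexHull ℚ _ hv₀, 0, D.tail.zero_mem, add_zero _⟩
  · rintro _ ⟨v, hv, rfl⟩
    rw [h] at hv
    obtain ⟨a, ha, b, hb, rfl⟩ := hv
    have hconv : Convex ℚ {v : NQ M | v₀ m ≤ v m} := by
      intro v hv w hw a b ha hb hab
      simp only [Set.mem_ofPred_eq, AddMonoidHom.add_apply, AddMonoidHom.smul_apply,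
        smul_eq_mul] at *
      calc v₀ m = a * v₀ m + b * v₀ m := by rw [← add_mul, hab, one_mul]
        _ ≤ _ := add_le_add (mul_le_mul_of_nonneg_left hv ha) (mul_le_mul_of_nonneg_left hw hb)
    have h1 : v₀ m ≤ a m := convexHull_min (fun v hv => hmin v hv) hconv ha
    have h2 : 0 ≤ b m := hm b hb
    change v₀ m ≤ a m + b m
    linarith

theorem isLeast_eval {m : M} (hm : D.MemDual m) {y : ClosedPt C} (hy : y.1 ∈ D.locus) :
    IsLeast ((fun v : NQ M => v m) '' D.coeff y) (D.eval m y) := by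
  have h := exists_isLeast hm hy
  rw [eval, dif_pos h]
  exact h.choose_spec

theorem MemDual.add {m m' : M} (hm : D.MemDual m) (hm' : D.MemDual m') : D.MemDual (m + m') :=
  fun v hv => by rw [map_add]; exact add_nonneg (hm v hv) (hm' v hv)

theorem eval_add_le {m m' : M} (hm : D.MemDual m) (hm' : D.MemDual m') {y : ClosedPt C}
    (hy : y.1 ∈ D.locus) : D.eval m y + D.eval m' y ≤ D.eval (m + m') y := by
  obtain ⟨v, hv, hv'⟩ := (isLeast_eval (hm.add hm') hy).1
  rw [← hv']
  change _ ≤ v (m + m')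
  rw [map_add]
  exact add_le_add ((isLeast_eval hm hy).2 ⟨v, hv, rfl⟩) ((isLeast_eval hm' hy).2 ⟨v, hv, rfl⟩)

theorem eval_anti {D D' : PolyhedralDivisor C M} (h : D ≤ D') {m : M} (hm : D'.MemDual m)
    {y : ClosedPt C} (hy : y.1 ∈ D.locus) : D'.eval m y ≤ D.eval m y := by
  have hmD : D.MemDual m := fun v hv => hm v (h.1 hv)
  obtain ⟨v, hv, hv'⟩ := (isLeast_eval hmD hy).1
  rw [← hv']
  exact (isLeast_eval hm (mem_locus_of_mem_coeff (h.2 y hv))).2 ⟨v, h.2 y hv, rfl⟩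

theorem eval_zero {y : ClosedPt C} (hy : y.1 ∈ D.locus) : D.eval 0 y = 0 := by
  have h0 : D.MemDual 0 := fun v _ => by simp
  obtain ⟨v, _, hv'⟩ := (isLeast_eval h0 hy).1
  rw [← hv']
  simp

end Basic

section Algebra

variable {C : Scheme.{0}} [C.Over SpecC] [IsSmoothProjectiveCurve C]
  {M : Type} [AddCommGroup M] (D : PolyhedralDivisor C M)

/-- A polyhedral divisor is proper if its locus is affine, or if its locus is complete and
(i) its degree is strictly contained in its tail,
(ii) for `m ∈ σ^∨` with `min ⟨m, deg D⟩ = 0`, some multiple `D(r m)` is principal. -/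
def Proper : Prop :=
  IsAffineOpen D.locus ∨
    (D.locus = ⊤ ∧ D.deg ⊂ (D.tail : Set (NQ M)) ∧
      ∀ m : M, D.MemDual m → IsLeast ((fun v : NQ M => v m) '' D.deg) 0 →
        ∃ r : ℕ, 0 < r ∧ ∃ f : C.functionField, f ≠ 0 ∧
          ∀ y : ClosedPt C, (ord y f : ℚ) = D.eval (r • m) y)

/-- The degree `m` part of `A(C₀, D)`: it is `H⁰(C₀, O(⌊D(m)⌋))` if `m ∈ σ^∨`, and zero
otherwise. -/
def piece (m : M) : Submodule ℂ C.functionField where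
  carrier := {f | f ≠ 0 → D.MemDual m ∧
    ∀ y : ClosedPt C, y.1 ∈ D.locus → 0 ≤ ord y f + ⌊D.eval m y⌋}
  zero_mem' := fun h => absurd rfl h
  add_mem' := by
    intro f g hf hg hfg
    by_cases hf0 : f = 0
    · subst hf0
      rw [zero_add] at hfg ⊢
      exact hg hfg
    by_cases hg0 : g = 0
    · subst hg0
      rw [add_zero] at hfg ⊢
      exact hf hfg
    refine ⟨(hf hf0).1, fun y hy => ?_⟩
    have h1 := (hf hf0).2 y hy
    have h2 := (hg hg0).2 y hy
    rcases min_le_iff.1 (ord_add y hf0 hg0 hfg) with h | h <;> linarith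
  smul_mem' := by
    intro c f hf hcf
    have hc : c ≠ 0 := by
      rintro rfl
      exact hcf (zero_smul _ _)
    have hf0 : f ≠ 0 := by
      rintro rfl
      exact hcf (smul_zero _)
    refine ⟨(hf hf0).1, fun y hy => ?_⟩
    rw [Algebra.smul_def, ord_mul y (by simpa using hc) hf0, ord_algebraMap y hc, zero_add]
    exact (hf hf0).2 y hy

variable {D}

theorem mul_mem_piece {m m' : M} {f g : C.functionField} (hf : f ∈ D.piece m)
    (hg : g ∈ D.piece m') : f * g ∈ D.piece (m + m') := by
  intro hfg
  have hf0 := left_ne_zero_of_mul hfg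
  have hg0 := right_ne_zero_of_mul hfg
  obtain ⟨h1, h1'⟩ := hf hf0
  obtain ⟨h2, h2'⟩ := hg hg0
  refine ⟨h1.add h2, fun y hy => ?_⟩
  have h3 := Int.le_floor_add (D.eval m y) (D.eval m' y)
  have h4 := Int.floor_mono (eval_add_le h1 h2 hy)
  have := h1' y hy
  have := h2' y hy
  rw [ord_mul y hf0 hg0]
  linarith

theorem piece_anti {D D' : PolyhedralDivisor C M} (h : D ≤ D') (m : M) :
    D'.piece m ≤ D.piece m := by
  intro f hf hf0
  obtain ⟨h1, h2⟩ := hf hf0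
  refine ⟨fun v hv => h1 v (h.1 hv), fun y hy => ?_⟩
  obtain ⟨v, hv⟩ := coeff_nonempty hy
  have := h2 y (mem_locus_of_mem_coeff (h.2 y hv))
  have := Int.floor_mono (eval_anti h h1 hy)
  linarith

theorem algebraMap_mem_piece (c : ℂ) : algebraMap ℂ C.functionField c ∈ D.piece 0 := by
  intro hc
  have hc0 : c ≠ 0 := by
    rintro rfl
    exact hc (map_zero _)
  refine ⟨fun v _ => by simp, fun y hy => ?_⟩
  rw [ord_algebraMap y hc0, eval_zero hy]
  simp

variable (D)

/-- The `M`-graded algebra `A(C₀, D) = ⨁_{m ∈ σ^∨ ∩ M} H⁰(C₀, O(⌊D(m)⌋)) χ^m`, as a subalgebra of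
`ℂ(C) ⊗ ℂ[M] = ℂ(C)[M]`. -/
def algebra : Subalgebra ℂ (AddMonoidAlgebra C.functionField M) where
  carrier := {a | ∀ m, a.coeff m ∈ D.piece m}
  mul_mem' := by
    intro a b ha hb m
    classical
    rw [AddMonoidAlgebra.coeff_mul, Finsupp.sum]
    refine Submodule.sum_mem _ fun m₁ _ => Submodule.sum_mem _ fun m₂ _ => ?_
    dsimp only
    split_ifs with h
    · exact h ▸ mul_mem_piece (ha m₁) (hb m₂)
    · exact Submodule.zero_mem _
  add_mem' := fun ha hb m => Submodule.add_mem _ (ha m) (hb m)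
  algebraMap_mem' := by
    intro c m
    rw [AddMonoidAlgebra.coe_algebraMap, Function.comp_apply]
    by_cases h : m = 0
    · subst h
      simpa using algebraMap_mem_piece (D := D) c
    · simp [h]

variable {D} in
theorem algebra_anti {D D' : PolyhedralDivisor C M} (h : D ≤ D') : D'.algebra ≤ D.algebra :=
  fun _ ha m => piece_anti h m (ha m)

/-- The affine `T`-variety `X(D) = Spec A(C₀, D)`. -/
def chart : Scheme.{0} := Spec (CommRingCat.of D.algebra)

variable {D} in
/-- The morphism `X(D) ⟶ X(D')` given by `A(C₀', D') ⊆ A(C₀, D)`, for `D ≤ D'`. -/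
def chartMap {D D' : PolyhedralDivisor C M} (h : D ≤ D') : D.chart ⟶ D'.chart :=
  Spec.map (CommRingCat.ofHom (Subalgebra.inclusion (algebra_anti h)).toRingHom)

/-- The structure morphism of `X(D)`. -/
def chartStr : D.chart ⟶ SpecC := Spec.map (CommRingCat.ofHom (algebraMap ℂ D.algebra))

end Algebra

end PolyhedralDivisor

section Trivial

variable {C : Scheme.{0}} (M : Type) [AddCommGroup M]

open Classical in
/-- The trivial polyhedral divisor on a non-empty open subset `U`: the tail and all the coefficients
are `{0}`. If `U` is affine, then its algebra is `ℂ[U] ⊗ ℂ[M]` and its chart is `U × T`. -/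
def trivialDivisor (U : C.Opens) (hU : Nonempty U) : PolyhedralDivisor C M where
  locus := U
  locus_nonempty := ⟨hU.some.1, hU.some.2⟩
  tail := ⊥
  tail_fg := Submodule.fg_bot
  tail_stronglyConvex v hv _ := by simpa using hv
  coeff y := if y.1 ∈ U then {0} else ∅
  coeff_polyhedron y hy := ⟨{0}, by simp, by simp [hy]⟩
  coeff_of_notMem y hy := by simp [hy]
  finite_special := by
    convert Set.finite_empty
    ext y
    simp only [Set.mem_ofPred_eq, Set.mem_empty_iff_false, iff_false, not_and, not_not]
    intro hy
    simp [hy]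

end Trivial

/-! ### Divisorial fans and their `T`-varieties -/

/-- A divisorial fan on `(C, T)`, where `T` is the torus with character lattice `M`. -/
structure DivisorialFan (C : Scheme.{0}) [C.Over SpecC] [IsSmoothProjectiveCurve C]
    (M : Type) [AddCommGroup M] where
  /-- the polyhedral divisors of the fan -/
  divisors : Set (PolyhedralDivisor C M)
  finite : divisors.Finite
  proper : ∀ D ∈ divisors, D.Proper
  inter : ∀ D ∈ divisors, ∀ D' ∈ divisors, ∃ D'' ∈ divisors, D.IsInter D' D''
  face : ∀ D ∈ divisors, ∀ D' ∈ divisors, ∀ y : ClosedPt C, (D.coeff y ∩ D'.coeff y).Nonempty →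
    IsFace (D.coeff y ∩ D'.coeff y) (D.coeff y) ∧ IsFace (D.coeff y ∩ D'.coeff y) (D'.coeff y)
  deg_inter : ∀ D ∈ divisors, ∀ D' ∈ divisors, ∀ D'' ∈ divisors, D.IsInter D' D'' →
    D.deg ∩ (D''.tail : Set (NQ M)) = D'.deg ∩ (D''.tail : Set (NQ M))

namespace DivisorialFan

section Variety

variable {C : Scheme.{0}} [C.Over SpecC] [IsSmoothProjectiveCurve C]
  {M : Type} [AddCommGroup M] (E : DivisorialFan C M)

/-- The set of special points of the fan. -/
def special : Set (ClosedPt C) := {y | ∃ D ∈ E.divisors, y ∈ D.special}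

/-- The diagram of the affine charts `X(D)`, `D ∈ E`, and of the morphisms between them induced by
the inclusions of polyhedral divisors. -/
def diagram : E.divisors ⥤ Scheme.{0} where
  obj D := D.1.chart
  map f := PolyhedralDivisor.chartMap f.le
  map_id D := by
    refine (congrArg Spec.map ?_).trans (Spec.map_id _)
    ext
    rfl
  map_comp f g := by
    refine Eq.trans (congrArg Spec.map ?_) (Spec.map_comp _ _)
    ext
    rfl

/-- The `T`-variety `X(E)`: the affine charts `X(D)`, `D ∈ E`, are glued along the charts of the
intersections `D ∩ D' ∈ E`. As the fan is closed under intersections, this gluing is the colimit of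
the diagram of all the charts. (It is formed among locally ringed spaces, where all colimits
exist; the colimit of locally ringed spaces along open immersions of schemes is the scheme glued
from them.) -/
def variety : LocallyRingedSpace.{0} := colimit (E.diagram ⋙ Scheme.forgetToLocallyRingedSpace)

/-- The inclusion of the chart `X(D)` in `X(E)`. -/
def chartι (D : E.divisors) : D.1.chart.toLocallyRingedSpace ⟶ E.variety :=
  colimit.ι (E.diagram ⋙ Scheme.forgetToLocallyRingedSpace) D

/-- The structure morphism `X(E) ⟶ Spec ℂ`. -/
def str : E.variety ⟶ SpecC.toLocallyRingedSpace :=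
  colimit.desc (E.diagram ⋙ Scheme.forgetToLocallyRingedSpace)
    { pt := SpecC.toLocallyRingedSpace
      ι :=
        { app := fun D => D.1.chartStr.toLRSHom
          naturality := by
            intro D D' f
            have h : PolyhedralDivisor.chartMap f.le ≫ D'.1.chartStr = D.1.chartStr := by
              refine (Spec.map_comp _ _).symm.trans (congrArg Spec.map ?_)
              ext
              rfl
            exact (congrArg Scheme.Hom.toLRSHom h).trans (Category.comp_id _).symm } }

/-- The morphism `U × T ⟶ X(D) ⟶ X(E)` for an affine open subset `U` over which `D` contains the
trivial divisor. -/
def torusChart (U : C.Opens) (hU : Nonempty U) (D : E.divisors)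
    (h : trivialDivisor M U hU ≤ D.1) :
    (trivialDivisor M U hU).chart.toLocallyRingedSpace ⟶ E.variety :=
  (PolyhedralDivisor.chartMap h).toLRSHom ≫ E.chartι D

/-- The open subset `Γ × T` of `X(E)`, the union of the `U × T` for the affine open subsets `U` of
`Γ`. -/
def openTorus (Γ : C.Opens) : Set E.variety :=
  {x | ∃ (U : C.Opens) (hU : Nonempty U) (D : E.divisors) (h : trivialDivisor M U hU ≤ D.1),
    IsAffineOpen U ∧ U ≤ Γ ∧ x ∈ Set.range (E.torusChart U hU D h).base}

end Variety

end DivisorialFan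

/-! ### The hyperspace -/

section Hyperspace

variable (C : Scheme.{0}) (M : Type) [AddCommGroup M]

/-- The relation `(y, ν, ℓ) ∼ (y', ν', ℓ')` if the two triples are equal, or if `ℓ = ℓ' = 0` and
`ν = ν'`. -/
def hyperspaceSetoid : Setoid (ClosedPt C × NQ M × ℚ≥0) where
  r a b := a = b ∨ (a.2.2 = 0 ∧ b.2.2 = 0 ∧ a.2.1 = b.2.1)
  iseqv := by
    refine ⟨fun _ => Or.inl rfl, ?_, ?_⟩
    · rintro a b (rfl | ⟨h1, h2, h3⟩)
      · exact Or.inl rfl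
      · exact Or.inr ⟨h2, h1, h3.symm⟩
    · rintro a b c (rfl | ⟨h1, h2, h3⟩) (rfl | ⟨h4, h5, h6⟩)
      · exact Or.inl rfl
      · exact Or.inr ⟨h4, h5, h6⟩
      · exact Or.inr ⟨h1, h2, h3⟩
      · exact Or.inr ⟨h1, h5, h3.trans h6⟩

/-- The hyperspace `𝒩_ℚ`: the half-spaces `{y} × N_ℚ × ℚ_{≥ 0}` glued along their boundaries
`N_ℚ × {0}`. -/
def Hyperspace : Type := Quotient (hyperspaceSetoid C M)

variable {C M}

/-- The class of `(y, ν, ℓ)`. -/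
def Hyperspace.mk (y : ClosedPt C) (ν : NQ M) (ℓ : ℚ≥0) : Hyperspace C M :=
  Quotient.mk (hyperspaceSetoid C M) (y, ν, ℓ)

variable (C M) in
/-- The integral points `𝒩` of the hyperspace. -/
def Hyperspace.integral : Set (Hyperspace C M) :=
  {ξ | ∃ (y : ClosedPt C) (ν : M →+ ℤ) (ℓ : ℕ), ξ = .mk y (NQ.ofInt ν) ℓ}

/-- The Cayley cone `C_y(D)`, generated by `σ × {0}` and `Δ_y × {1}`. -/
def PolyhedralDivisor.cayleyCone (D : PolyhedralDivisor C M) (y : ClosedPt C) :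
    PointedCone ℚ (NQ M × ℚ) :=
  PointedCone.hull ℚ
    ((fun v : NQ M => (v, (0 : ℚ))) '' D.tail ∪ (fun v : NQ M => (v, (1 : ℚ))) '' D.coeff y)

/-- The hypercone `C(D)`. -/
def PolyhedralDivisor.hypercone (D : PolyhedralDivisor C M) : Set (Hyperspace C M) :=
  {ξ | ∃ (y : ClosedPt C) (ν : NQ M) (ℓ : ℚ≥0),
    y.1 ∈ D.locus ∧ (ν, (ℓ : ℚ)) ∈ D.cayleyCone y ∧ ξ = .mk y ν ℓ}

/-- The support `|E|_Γ`: the union of the hypercones `C(D)`, `D ∈ E`, minus the points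
`(y, ν, ℓ)` with `y ∈ Γ` and `ℓ > 0`. -/
def DivisorialFan.supportOver [C.Over SpecC] [IsSmoothProjectiveCurve C]
    (E : DivisorialFan C M) (Γ : C.Opens) : Set (Hyperspace C M) :=
  (⋃ D ∈ E.divisors, D.hypercone) \
    {ξ | ∃ (y : ClosedPt C) (ν : NQ M) (ℓ : ℚ≥0), y.1 ∈ Γ ∧ 0 < ℓ ∧ ξ = .mk y ν ℓ}

end Hyperspace

/-! ### Arcs

`K` is a field extension of `ℂ`, `𝒪 = K⟦t⟧` and `𝒦 = K((t))`. -/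

section Arcs

open PowerSeries LaurentSeries

variable (K : Type) [Field K] [Algebra ℂ K]

/-- The morphism `Spec 𝒦 ⟶ Spec 𝒪`, i.e. the inclusion of the generic point. -/
def genericι : Spec (CommRingCat.of K⸨X⸩) ⟶ Spec (CommRingCat.of K⟦X⟧) :=
  Spec.map (CommRingCat.ofHom (algebraMap K⟦X⟧ K⸨X⸩))

variable {K}

/-- `x = t ^ n * u`, in `𝒦`, with `u` an invertible power series. -/
def EqPowMulUnit (x : K⸨X⸩) (n : ℤ) (u : K⟦X⟧ˣ) : Prop :=
  x = HahnSeries.single n (1 : K) * algebraMap K⟦X⟧ K⸨X⸩ u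

variable {C : Scheme.{0}} [C.Over SpecC]

/-- A morphism `Spec R ⟶ U` to an open subset of `C` is a morphism over `ℂ`. -/
def IsOverC {R : Type} [CommRing R] [Algebra ℂ R] {U : C.Opens}
    (g : Spec (CommRingCat.of R) ⟶ U.toScheme) : Prop :=
  g ≫ U.ι ≫ (C ↘ SpecC) = Spec.map (CommRingCat.ofHom (algebraMap ℂ R))

/-- The pull-back `g^*(f) ∈ R` of a regular function `f ∈ ℂ[U]` by `g : Spec R ⟶ U`. -/
def pull {R : Type} [CommRing R] {U : C.Opens} (g : Spec (CommRingCat.of R) ⟶ U.toScheme)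
    (f : Γ(C, U)) : R :=
  (Scheme.ΓSpecIso (CommRingCat.of R)).hom.hom (g.appTop.hom (U.topIso.inv.hom f))

/-- The set `Γ(𝒪)` of `𝒪`-points of an open subset `Γ` of `C`. -/
def CurveArc (Γ : C.Opens) (K : Type) [Field K] [Algebra ℂ K] : Type :=
  {γ : Spec (CommRingCat.of K⟦X⟧) ⟶ Γ.toScheme // IsOverC γ}

/-- A `𝒦`-point of `Γ × T`: a pair of a `𝒦`-point of `Γ` (which corresponds to `α_Γ^*`) and of a
homomorphism `α_M^* : ℂ[M] → 𝒦`. -/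
structure TorusPoint (Γ : C.Opens) (M : Type) [AddCommGroup M] (K : Type) [Field K]
    [Algebra ℂ K] where
  base : Spec (CommRingCat.of K⸨X⸩) ⟶ Γ.toScheme
  base_over : IsOverC base
  char : AddMonoidAlgebra ℂ M →ₐ[ℂ] K⸨X⸩

/-- The set `𝒞_ν` of the `K⸨X⸩`-points `χ^m ↦ t ^ ⟨m, ν⟩ * ω(m)` of `T`, where `ω : M → 𝒪ˣ` runs
through the group homomorphisms. It is the `T(𝒪)`-orbit of the point `χ^m ↦ t ^ ⟨m, ν⟩`. -/
def torusOrbit {M : Type} [AddCommGroup M] (ν : M →+ ℤ) (K : Type) [Field K] [Algebra ℂ K] :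
    Set (AddMonoidAlgebra ℂ M →ₐ[ℂ] K⸨X⸩) :=
  {β | ∃ ω : Multiplicative M →* K⟦X⟧ˣ,
    ∀ m : M, EqPowMulUnit (β (AddMonoidAlgebra.single m 1)) (ν m) (ω (.ofAdd m))}

variable [IsSmoothProjectiveCurve C] {M : Type} [AddCommGroup M]

/-- The `K`-valued arcs `Spec 𝒪 ⟶ X(E)` over `ℂ`. -/
def Arc (E : DivisorialFan C M) (K : Type) [Field K] [Algebra ℂ K] : Type :=
  {α : (Spec (CommRingCat.of K⟦X⟧)).toLocallyRingedSpace ⟶ E.variety //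
    α ≫ E.str = (Spec.map (CommRingCat.ofHom (algebraMap ℂ K⟦X⟧))).toLRSHom}

/-- The set `X_Γ` of the `K`-valued arcs of `X(E)` whose generic point lies in `Γ × T`. -/
def ArcOver (E : DivisorialFan C M) (Γ : C.Opens) (K : Type) [Field K] [Algebra ℂ K] : Type :=
  {α : Arc E K // α.1.base (genericPoint (Spec (CommRingCat.of K⟦X⟧))) ∈ E.openTorus Γ}

/-- The restriction of the arc `α` to the generic point `Spec 𝒦` is the `𝒦`-point `p` of
`Γ × T ⊆ X(E)`: on an affine piece `U × T ⟶ X(E)` it is given by the homomorphism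
`f χ^m ↦ p_Γ^*(f) * p_M^*(χ^m)`. -/
def Arc.HasGenericPoint {E : DivisorialFan C M} {Γ : C.Opens} (α : Arc E K)
    (p : TorusPoint Γ M K) : Prop :=
  ∃ (U : C.Opens) (hU : Nonempty U) (D : E.divisors) (h : trivialDivisor M U hU ≤ D.1)
    (hΓ : U ≤ Γ) (g : Spec (CommRingCat.of K⸨X⸩) ⟶ U.toScheme)
    (ψ : (trivialDivisor M U hU).algebra →ₐ[ℂ] K⸨X⸩),
    IsAffineOpen U ∧ g ≫ C.homOfLE hΓ = p.base ∧
    (∀ (f : Γ(C, U)) (m : M) (a : (trivialDivisor M U hU).algebra),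
      (a : AddMonoidAlgebra C.functionField M) =
          AddMonoidAlgebra.single m (C.germToFunctionField U f) →
        ψ a = pull g f * p.char (AddMonoidAlgebra.single m 1)) ∧
    (genericι K).toLRSHom ≫ α.1 =
      (Spec.map (CommRingCat.ofHom ψ.toRingHom)).toLRSHom ≫ E.torusChart U hU D h

/-- The `𝒦`-point of `Γ` underlying `p` extends to an `𝒪`-point of `Γ`. -/
def TorusPoint.IsHorizontal {Γ : C.Opens} (p : TorusPoint Γ M K) : Prop :=
  ∃ γ : CurveArc Γ K, genericι K ≫ γ.1 = p.base

/-- `ξ = (y, ν, ℓ)` is the triple attached to `p`: `p_M^*(χ^m) = t ^ ⟨m, ν⟩ * ω(m)` with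
`ω(m) ∈ 𝒪ˣ`; if `p` is horizontal then `ℓ = 0`; and otherwise `ℓ ≥ 1` and
`p_Γ^*(f) = t ^ (ℓ * ord_y f) * R(f)` with `R(f) ∈ 𝒪ˣ`, for all `f ≠ 0` in `ℂ[Γ]`. -/
def TorusPoint.HasVal {Γ : C.Opens} [Nonempty Γ] (p : TorusPoint Γ M K) (ξ : Hyperspace C M) :
    Prop :=
  ∃ (y : ClosedPt C) (ν : M →+ ℤ) (ℓ : ℕ), ξ = .mk y (NQ.ofInt ν) ℓ ∧
    (∀ m : M, ∃ u, EqPowMulUnit (p.char (AddMonoidAlgebra.single m 1)) (ν m) u) ∧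
    ((p.IsHorizontal ∧ ℓ = 0) ∨
      (¬ p.IsHorizontal ∧ 1 ≤ ℓ ∧ ∀ f : Γ(C, Γ), f ≠ 0 →
        ∃ u, EqPowMulUnit (pull p.base f) (ℓ * ord y (C.germToFunctionField Γ f)) u))

/-- `p_Γ^*(π) = t ^ ℓ * u` for a rational function `π`, where `p_Γ^*` is extended from `ℂ[Γ]` to
the fractions `π = a / b`, `a, b ∈ ℂ[Γ]`. -/
def TorusPoint.PullEq {Γ : C.Opens} [Nonempty Γ] (p : TorusPoint Γ M K) (π : C.functionField)
    (ℓ : ℕ) (u : K⟦X⟧ˣ) : Prop :=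
  ∀ a b : Γ(C, Γ), b ≠ 0 → C.germToFunctionField Γ a = π * C.germToFunctionField Γ b →
    pull p.base b ≠ 0 ∧ EqPowMulUnit (pull p.base a / pull p.base b) ℓ u

end Arcs

end TVariety

end

/-! A morphism from a local scheme to X(E) factors through one chart, so an arc is a homomorphism
A(D) → 𝒪 for some D in E, and its restriction to Spec 𝒦 is a 𝒦-point p of Γ × T. The curve component
of p extends to an 𝒪-point of the proper curve C; call the image of the closed point of Spec 𝒪 the
limit. If the limit lies in Γ, then p is horizontal. Otherwise the limit is a closed point c outside
Γ, the 𝒦-point lies over the generic point of C, and the order of the pull-back of f is ℓ ord_c f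
for a single ℓ ≥ 1, because f is a power of a uniformizer times a unit at c. Together with the
orders ν of the characters this gives the triple, which depends on p alone.

The heart is a criterion for p to extend to an arc of X(D). Suppose that the limit is c. A
homogeneous element f χ^m of A(D) pulls back to a series of order ℓ ord_c f + ⟨m, ν⟩. This is
nonnegative if ν/ℓ lies in Δ_c (`AdmitsChart.exists_comp_eq`). Conversely, properness of D provides,
for each m in the dual cone, a section of a multiple D(km) with the least order allowed at c; the
inequalities obtained say that ν/ℓ satisfies all the inequalities of support functions defining Δ_c,
hence belongs to it by Farkas' lemma (`admitsChart_of_comp_eq`, `mem_coeff_iff`). In the horizontal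
case the same argument gives ν in the tail. The limit must be in the locus, since otherwise a
function with a pole only there would be a regular element of degree zero with a pull-back of
negative order.

The sections come from Riemann's inequality (`exists_section_of_degree_pos`) when D(m) has positive
degree, possibly after a change outside the locus, and from a principal multiple when the degree is
zero.

The same sections show that the chart maps are open immersions. A homogeneous element of A(D) whose
vanishing order is zero only along the smaller polyhedral divisor D'' has its non-vanishing locus
inside X(D''), and such elements cover X(D'') (`IsOpenFace.exists_isSeparating_notMem`). As the fan
is closed under intersections, X(E) is a scheme glued from its charts. If p extends over two charts,
the criterion shows that it extends over their intersection, so an arc is determined by p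
(`arc_eq_of_hasGenericPoint`).

It remains to describe the points p with a given triple. If ℓ = 0, the curve component is an 𝒪-point
of Γ. If ℓ ≥ 1, it is determined by the pull-back t^ℓ u of a uniformizer, and every u occurs,
because rational functions regular at c have expansions in powers of the uniformizer into which t^ℓ
u can be substituted (`exists_expansionHom`, `lift_eq_of_evalsTo`). All these points extend to arcs
by the criterion. For ℓ = 0 the limit may be any closed point of Γ, and the hypothesis on tails
supplies a chart over it. -/

noncomputable section

namespace TVariety

/-! ### Finitely generated rational cones -/

section Farkas

variable {W V : Type*} [AddCommGroup W] [Module ℚ W] [AddCommGroup V] [Module ℚ V]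

/-- **Farkas' lemma**, after Bartl. -/
theorem mem_hull_of_forall_nonneg (l : List (W →ₗ[ℚ] ℚ)) (b : W →ₗ[ℚ] ℚ)
    (h : ∀ x, (∀ a ∈ l, 0 ≤ a x) → 0 ≤ b x) :
    b ∈ PointedCone.hull ℚ {a | a ∈ l} := by
  induction hn : l.length generalizing l b with
  | zero =>
    obtain rfl := List.length_eq_zero_iff.1 hn
    have hb : b = 0 := by
      ext x
      have h1 := h x (by simp)
      have h2 := h (-x) (by simp)
      rw [map_neg] at h2
      simpa using le_antisymm (by linarith) h1
    rw [hb]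
    exact Submodule.zero_mem _
  | succ n ih =>
    obtain ⟨c, l, rfl⟩ := List.exists_cons_of_length_eq_add_one hn
    have hn' : l.length = n := by simpa using hn
    -- If `c` is superfluous, the induction hypothesis applies directly. Otherwise some point
    -- violates the conclusion and, among the hypotheses, only the one on `c`; it is scaled so that
    -- `c` takes the value `-1`.
    by_cases hl : ∀ x, (∀ a ∈ l, 0 ≤ a x) → 0 ≤ b x
    · exact Submodule.span_mono (fun a ha => List.mem_cons_of_mem c ha) (ih l b hl hn')
    push Not at hl
    obtain ⟨x₁, hx₁, hbx₁⟩ := hl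
    have hc : c x₁ < 0 := by
      by_contra! hc
      refine absurd (h x₁ ?_) hbx₁.not_ge
      simpa using ⟨hc, hx₁⟩
    obtain ⟨x₀, hx₀, hbx₀, hcx₀⟩ : ∃ x₀, (∀ a ∈ l, 0 ≤ a x₀) ∧ b x₀ < 0 ∧ c x₀ = -1 := by
      have hp : 0 < (-c x₁)⁻¹ := inv_pos.2 (neg_pos.2 hc)
      refine ⟨(-c x₁)⁻¹ • x₁, fun a ha => ?_, ?_, ?_⟩
      · rw [map_smul, smul_eq_mul]
        exact mul_nonneg hp.le (hx₁ a ha)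
      · rw [map_smul, smul_eq_mul]
        exact mul_neg_of_pos_of_neg hp hbx₁
      · rw [map_smul, smul_eq_mul, inv_neg, neg_mul, inv_mul_cancel₀ hc.ne]
    have hcone : c ∈ PointedCone.hull ℚ {a | a ∈ c :: l} := PointedCone.subset_hull (by simp)
    -- The map `x ↦ x + c x • x₀` projects onto the kernel of `c`, and `a + a x₀ • c` is the
    -- pull-back of `a` under it. So `c` is eliminated; adding the nonnegative multiple `-b x₀ • c`
    -- recovers `b`.
    have key := ih (l.map fun a => a + a x₀ • c) (b + b x₀ • c) ?_ (by simpa using hn')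
    · have hle : PointedCone.hull ℚ {a | a ∈ l.map fun a => a + a x₀ • c} ≤
          PointedCone.hull ℚ {a | a ∈ c :: l} := by
        refine Submodule.span_le.2 ?_
        intro a' ha'
        obtain ⟨a, ha, rfl⟩ := List.mem_map.1 ha'
        exact Submodule.add_mem _ (PointedCone.subset_hull (List.mem_cons_of_mem c ha))
          (PointedCone.smul_mem _ (hx₀ a ha) hcone)
      have h2 := Submodule.add_mem _ (hle key)
        (PointedCone.smul_mem _ (neg_nonneg.2 hbx₀.le) hcone)
      convert h2 using 1
      module
    · intro x hx
      have := h (x + c x • x₀) ?_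
      · simp only [map_add, map_smul, smul_eq_mul] at this
        simp only [LinearMap.add_apply, LinearMap.smul_apply, smul_eq_mul]
        linarith
      · intro a ha
        rcases List.mem_cons.1 ha with rfl | ha
        · simp [hcx₀]
        · have := hx _ (List.mem_map_of_mem ha)
          simp only [LinearMap.add_apply, LinearMap.smul_apply, smul_eq_mul] at this
          simp only [map_add, map_smul, smul_eq_mul]
          linarith

/-- Farkas' lemma on the dual space, for the evaluations at the generators of `σ` and at `v`; by
reflexivity, a conical combination of evaluations is one of vectors. -/
theorem exists_dual_neg_of_notMem [FiniteDimensional ℚ V] {σ : PointedCone ℚ V} (hσ : σ.FG)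
    {v : V} (hv : v ∉ σ) : ∃ L : Module.Dual ℚ V, (∀ w ∈ σ, 0 ≤ L w) ∧ L v < 0 := by
  by_contra! hcon
  obtain ⟨s, rfl⟩ := hσ
  refine hv ?_
  have h1 := mem_hull_of_forall_nonneg (s.toList.map (Module.Dual.eval ℚ V))
    (Module.Dual.eval ℚ V v) ?_
  · have h2 : {a | a ∈ s.toList.map (Module.Dual.eval ℚ V)} = Module.Dual.eval ℚ V '' s := by
      ext a
      simp
    rw [h2, PointedCone.hull, ← LinearMap.coe_restrictScalars {c : ℚ // 0 ≤ c}, Submodule.span_image] at h1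
    obtain ⟨w, hw, hwv⟩ := h1
    rwa [← (Module.bijective_dual_eval ℚ V).1 hwv]
  · intro L hL
    refine hcon L fun w hw => ?_
    induction hw using Submodule.span_induction with
    | mem w hw => exact hL _ (List.mem_map_of_mem (by simpa using hw))
    | zero => simp
    | add a b _ _ ha hb => rw [map_add]; exact add_nonneg ha hb
    | smul r a _ ha =>
      change 0 ≤ L ((r : ℚ) • a)
      rw [map_smul, smul_eq_mul]
      exact mul_nonneg r.2 ha

end Farkas

/-! ### Rational linear forms and the lattice -/

section Lattice

variable {M : Type} [AddCommGroup M] [Module.Free ℤ M] [Module.Finite ℤ M]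

instance NQ.finiteDimensional : FiniteDimensional ℚ (NQ M) := by
  let b := Module.Free.chooseBasis ℤ M
  let e : NQ M →ₗ[ℚ] (Module.Free.ChooseBasisIndex ℤ M → ℚ) :=
    { toFun := fun v i => v (b i)
      map_add' := fun _ _ => rfl
      map_smul' := fun _ _ => rfl }
  refine FiniteDimensional.of_injective e fun v w h => ?_
  have : v.toIntLinearMap = w.toIntLinearMap := b.ext fun i => congrFun h i
  ext m
  exact DFunLike.congr_fun this m

/-- A linear form on `N_ℚ` is, up to a positive factor, the evaluation at an element of `M`. -/
theorem NQ.exists_eval_eq_mul (L : Module.Dual ℚ (NQ M)) :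
    ∃ (k : ℕ) (m : M), 0 < k ∧ ∀ v : NQ M, v m = k * L v := by
  let b := Module.Free.chooseBasis ℤ M
  let e : Module.Free.ChooseBasisIndex ℤ M → NQ M := fun i => NQ.ofInt (b.coord i).toAddMonoidHom
  have he : ∀ v : NQ M, v = ∑ i, v (b i) • e i := by
    intro v
    have : v.toIntLinearMap = (∑ i, v (b i) • e i : NQ M).toIntLinearMap := by
      classical
      refine b.ext fun j => ?_
      simp [AddMonoidHom.toIntLinearMap, AddMonoidHom.finsetSum_apply, e, NQ.ofInt,
        Finsupp.single_apply]
    ext m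
    exact DFunLike.congr_fun this m
  -- A common denominator of the values of `L` on the dual basis.
  set k := ∏ i, (L (e i)).den with hk
  have hz : ∀ i, ∃ z : ℤ, (z : ℚ) = k * L (e i) := by
    intro i
    obtain ⟨c, hc⟩ := Finset.dvd_prod_of_mem (fun i => (L (e i)).den) (Finset.mem_univ i)
    refine ⟨c * (L (e i)).num, ?_⟩
    rw [hk, hc]
    push_cast
    rw [mul_comm ((L (e i)).den : ℚ), mul_assoc, Rat.den_mul_eq_num]
  choose z hz using hz
  refine ⟨k, ∑ i, z i • b i, Finset.prod_pos fun i _ => (L (e i)).pos, fun v => ?_⟩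
  conv_rhs => rw [he v]
  simp only [map_sum, map_zsmul, map_smul, smul_eq_mul, zsmul_eq_mul, hz, Finset.mul_sum]
  exact Finset.sum_congr rfl fun i _ => by ring

end Lattice

/-! ### Convex geometry of the coefficients -/

namespace PolyhedralDivisor

variable {C : Scheme.{0}} {M : Type} [AddCommGroup M] {D D' D'' : PolyhedralDivisor C M}

theorem add_mem_coeff {y : ClosedPt C} {v w : NQ M} (hv : v ∈ D.coeff y) (hw : w ∈ D.tail) :
    v + w ∈ D.coeff y := by
  obtain ⟨P, -, h⟩ := D.coeff_polyhedron y (mem_locus_of_mem_coeff hv)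
  rw [h] at hv ⊢
  obtain ⟨a, ha, b, hb, rfl⟩ := hv
  exact ⟨a, ha, b + w, D.tail.add_mem hb hw, (add_assoc a b w).symm⟩

theorem nsmul_mem_tail {w : NQ M} (hw : w ∈ D.tail) (n : ℕ) : (n : ℚ) • w ∈ D.tail :=
  PointedCone.smul_mem _ n.cast_nonneg hw

theorem convex_coeff (y : ClosedPt C) : Convex ℚ (D.coeff y) := by
  by_cases hy : y.1 ∈ D.locus
  · obtain ⟨P, -, h⟩ := D.coeff_polyhedron y hy
    rw [h]
    exact (convex_convexHull ℚ _).add (PointedCone.convex D.tail)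
  · rw [D.coeff_of_notMem y hy]
    exact convex_empty

theorem eval_le {m : M} (hm : D.MemDual m) {y : ClosedPt C} {v : NQ M} (hv : v ∈ D.coeff y) :
    D.eval m y ≤ v m :=
  (isLeast_eval hm (mem_locus_of_mem_coeff hv)).2 ⟨v, hv, rfl⟩

theorem exists_eq_eval {m : M} (hm : D.MemDual m) {y : ClosedPt C} (hy : y.1 ∈ D.locus) :
    ∃ v ∈ D.coeff y, v m = D.eval m y :=
  (isLeast_eval hm hy).1

theorem MemDual.nsmul {m : M} (hm : D.MemDual m) (n : ℕ) : D.MemDual (n • m) := fun v hv => by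
  rw [map_nsmul]
  exact nsmul_nonneg (hm v hv) n

theorem eval_nsmul {m : M} (hm : D.MemDual m) (n : ℕ) {y : ClosedPt C} (hy : y.1 ∈ D.locus) :
    D.eval (n • m) y = n * D.eval m y := by
  obtain ⟨v, hv, hvm⟩ := exists_eq_eval hm hy
  refine le_antisymm ?_ ?_
  · have := eval_le (hm.nsmul n) hv
    rwa [map_nsmul, nsmul_eq_mul, hvm] at this
  · obtain ⟨w, hw, hwm⟩ := exists_eq_eval (hm.nsmul n) hy
    rw [← hwm, map_nsmul, nsmul_eq_mul]
    exact mul_le_mul_of_nonneg_left (eval_le hm hw) n.cast_nonneg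

theorem eval_eq_zero {m : M} (hm : D.MemDual m) {y : ClosedPt C}
    (h : D.coeff y = (D.tail : Set (NQ M))) : D.eval m y = 0 := by
  have h0 : (0 : NQ M) ∈ D.coeff y := h ▸ D.tail.zero_mem
  refine le_antisymm (by simpa using eval_le hm h0) ?_
  obtain ⟨v, hv, hvm⟩ := exists_eq_eval hm (mem_locus_of_mem_coeff h0)
  rw [← hvm]
  exact hm v (by rwa [h] at hv)

/-- A coefficient is bounded below, in all the directions of the dual cone, by finitely many of its
points. -/
theorem exists_finset_coeff {y : ClosedPt C} (hy : y.1 ∈ D.locus) :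
    ∃ P : Finset (NQ M), (P : Set (NQ M)) ⊆ D.coeff y ∧
      ∀ m, D.MemDual m → ∀ v ∈ D.coeff y, ∃ p ∈ P, p m ≤ v m := by
  obtain ⟨P, hP, h⟩ := D.coeff_polyhedron y hy
  refine ⟨P, fun p hp => ?_, fun m hm v hv => ?_⟩
  · rw [h]
    exact ⟨p, subset_convexHull ℚ _ hp, 0, D.tail.zero_mem, add_zero p⟩
  · rw [h] at hv
    obtain ⟨a, ha, b, hb, rfl⟩ := hv
    obtain ⟨p, hp, hmin⟩ := P.exists_min_image (fun v : NQ M => v m) hP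
    refine ⟨p, hp, ?_⟩
    have hconv : Convex ℚ {v : NQ M | p m ≤ v m} := by
      intro v hv w hw a b ha hb hab
      simp only [Set.mem_ofPred_eq, AddMonoidHom.add_apply, AddMonoidHom.smul_apply,
        smul_eq_mul] at *
      calc p m = a * p m + b * p m := by rw [← add_mul, hab, one_mul]
        _ ≤ _ := add_le_add (mul_le_mul_of_nonneg_left hv ha) (mul_le_mul_of_nonneg_left hw hb)
    have h1 : p m ≤ a m := convexHull_min (fun v hv => hmin v hv) hconv ha
    have h2 : 0 ≤ b m := hm b hb
    change p m ≤ a m + b m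
    linarith

theorem exists_finset_tail (D : PolyhedralDivisor C M) :
    ∃ S : Finset (NQ M), (S : Set (NQ M)) ⊆ D.tail ∧
      ∀ m : M, (∀ w ∈ S, 0 ≤ w m) → D.MemDual m := by
  obtain ⟨S, hS⟩ := D.tail_fg
  refine ⟨S, fun w hw => hS ▸ Submodule.subset_span hw, fun m hm v hv => ?_⟩
  rw [← hS] at hv
  induction hv using Submodule.span_induction with
  | mem w hw => exact hm w hw
  | zero => simp
  | add a b _ _ ha hb => exact add_nonneg ha hb
  | smul r a _ ha => exact mul_nonneg r.2 ha

/-- A point of the Cayley cone at height `ℓ > 0` lies in `ℓ Δ_y`. -/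
theorem eq_zero_or_pos_of_mem_cayleyCone {y : ClosedPt C} {p : NQ M × ℚ} (hp : p ∈ D.cayleyCone y) :
    (p.2 = 0 ∧ p.1 ∈ D.tail) ∨ (0 < p.2 ∧ p.2⁻¹ • p.1 ∈ D.coeff y) := by
  induction hp using Submodule.span_induction with
  | mem p hp =>
    rcases hp with ⟨v, hv, rfl⟩ | ⟨v, hv, rfl⟩
    · exact Or.inl ⟨rfl, hv⟩
    · exact Or.inr ⟨one_pos, by simpa using hv⟩
  | zero => exact Or.inl ⟨rfl, D.tail.zero_mem⟩
  | add a b _ _ ha hb =>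
    rcases ha with ⟨ha, ha'⟩ | ⟨ha, ha'⟩ <;> rcases hb with ⟨hb, hb'⟩ | ⟨hb, hb'⟩
    · exact Or.inl ⟨by simp [ha, hb], D.tail.add_mem ha' hb'⟩
    · refine Or.inr ⟨by simp [ha, hb], ?_⟩
      have := add_mem_coeff hb' (PointedCone.smul_mem _ (inv_nonneg.2 hb.le) ha')
      simp only [Prod.fst_add, Prod.snd_add, ha, zero_add, smul_add]
      rwa [add_comm]
    · refine Or.inr ⟨by simp [ha, hb], ?_⟩
      have := add_mem_coeff ha' (PointedCone.smul_mem _ (inv_nonneg.2 ha.le) hb')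
      simp only [Prod.fst_add, Prod.snd_add, hb, add_zero, smul_add]
      exact this
    · refine Or.inr ⟨add_pos ha hb, ?_⟩
      have hab : a.2 + b.2 ≠ 0 := (add_pos ha hb).ne'
      have := convex_coeff (D := D) y ha' hb' (a := a.2 / (a.2 + b.2)) (b := b.2 / (a.2 + b.2))
        (by positivity) (by positivity) (by field_simp)
      convert this using 1
      rw [smul_smul, smul_smul, Prod.fst_add, Prod.snd_add, smul_add]
      congr 2 <;> field_simp
  | smul r a _ ha =>
    rcases eq_or_ne r 0 with rfl | hr
    · exact Or.inl ⟨by simp, by simp⟩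
    have hr' : (0 : ℚ) < r := lt_of_le_of_ne r.2 fun h => hr (Subtype.ext h.symm)
    rcases ha with ⟨ha, ha'⟩ | ⟨ha, ha'⟩
    · exact Or.inl ⟨by simp [ha], Submodule.smul_mem _ r ha'⟩
    · refine Or.inr ⟨?_, ?_⟩
      · exact mul_pos hr' ha
      · convert ha' using 1
        change ((r : ℚ) * a.2)⁻¹ • ((r : ℚ) • a.1) = _
        rw [smul_smul]
        congr 1
        field_simp

theorem mem_cayleyCone_zero_iff {y : ClosedPt C} {ν : NQ M} :
    (ν, (0 : ℚ)) ∈ D.cayleyCone y ↔ ν ∈ D.tail := by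
  refine ⟨fun h => ?_, fun h => Submodule.subset_span (Or.inl ⟨ν, h, rfl⟩)⟩
  rcases eq_zero_or_pos_of_mem_cayleyCone h with ⟨-, h1⟩ | ⟨h1, -⟩
  · exact h1
  · exact absurd h1 (lt_irrefl _)

theorem mem_cayleyCone_iff_of_pos {y : ClosedPt C} {ν : NQ M} {ℓ : ℚ} (hℓ : 0 < ℓ) :
    (ν, ℓ) ∈ D.cayleyCone y ↔ ℓ⁻¹ • ν ∈ D.coeff y := by
  constructor
  · intro h
    rcases eq_zero_or_pos_of_mem_cayleyCone h with ⟨h1, -⟩ | ⟨-, h2⟩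
    · exact absurd h1 hℓ.ne'
    · exact h2
  · intro h
    have h1 : (ℓ⁻¹ • ν, (1 : ℚ)) ∈ D.cayleyCone y :=
      PointedCone.subset_hull (Or.inr ⟨_, h, rfl⟩)
    have := PointedCone.smul_mem _ hℓ.le h1
    convert this using 1
    ext1
    · simp [smul_smul, hℓ.ne']
    · simp

section Lattice

variable [Module.Free ℤ M] [Module.Finite ℤ M]

/-- A separating form given by Farkas' lemma, scaled into `M`. -/
theorem exists_memDual_neg {v : NQ M} (hv : v ∉ D.tail) : ∃ m, D.MemDual m ∧ v m < 0 := by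
  obtain ⟨L, hL, hLv⟩ := exists_dual_neg_of_notMem D.tail_fg hv
  obtain ⟨k, m, hk, hm⟩ := NQ.exists_eval_eq_mul L
  have hk' : (0 : ℚ) < k := by exact_mod_cast hk
  refine ⟨m, fun w hw => ?_, ?_⟩
  · rw [hm]
    exact mul_nonneg hk'.le (hL w hw)
  · rw [hm]
    exact mul_neg_of_pos_of_neg hk' hLv

theorem mem_tail_iff {v : NQ M} : v ∈ D.tail ↔ ∀ m, D.MemDual m → 0 ≤ v m := by
  refine ⟨fun h m hm => hm v h, fun h => ?_⟩
  by_contra hv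
  obtain ⟨m, hm, hmv⟩ := exists_memDual_neg hv
  exact absurd (h m hm) hmv.not_ge

/-- The tail is the recession cone of each coefficient: if an element of the dual cone were negative
on `w`, its values along the sequence would drop below its minimum on `Δ_y`. -/
theorem mem_tail_of_forall_add_mem {y : ClosedPt C} {v w : NQ M}
    (h : ∀ n : ℕ, v + (n : ℚ) • w ∈ D.coeff y) : w ∈ D.tail := by
  refine mem_tail_iff.2 fun m hm => ?_
  by_contra! hw
  obtain ⟨n, hn⟩ := exists_nat_gt ((v m - D.eval m y) / (-w m))
  have h1 : D.eval m y ≤ v m + n * w m := eval_le hm (h n)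
  rw [div_lt_iff₀ (neg_pos.2 hw)] at hn
  linarith

theorem tail_le_of_coeff_subset {y : ClosedPt C} (hy : y.1 ∈ D''.locus)
    (h : D''.coeff y ⊆ D.coeff y) : D''.tail ≤ D.tail := by
  obtain ⟨v, hv⟩ := coeff_nonempty hy
  exact fun w hw => mem_tail_of_forall_add_mem (y := y) (v := v) fun n =>
    h (add_mem_coeff hv (nsmul_mem_tail hw n))

/-- `IsInter` says nothing about tails; they are recovered as recession cones of the coefficients at
one point. -/
theorem tail_eq_of_isInter (hex : ∃ y : ClosedPt C, y.1 ∈ D''.locus)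
    (h : D.IsInter D' D'') : D''.tail = D.tail ⊓ D'.tail := by
  obtain ⟨y, hy⟩ := hex
  refine le_antisymm (le_inf ?_ ?_) ?_
  · exact tail_le_of_coeff_subset hy (by rw [h y]; exact Set.inter_subset_left)
  · exact tail_le_of_coeff_subset hy (by rw [h y]; exact Set.inter_subset_right)
  · rintro w ⟨hw, hw'⟩
    obtain ⟨v, hv⟩ := coeff_nonempty hy
    rw [h y] at hv
    refine mem_tail_of_forall_add_mem (y := y) (v := v) fun n => ?_
    rw [h y]
    exact ⟨add_mem_coeff hv.1 (nsmul_mem_tail hw n), add_mem_coeff hv.2 (nsmul_mem_tail hw' n)⟩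

/-- A polyhedron is determined by its support function. If `v` is not in `Δ_y`, then `(v, 1)` is
separated from the cone over `Δ_y` by a form on `N_ℚ × ℚ`; up to a positive factor this form
restricts on `N_ℚ × {1}` to an element of `M` plus a constant. -/
theorem mem_coeff_iff {y : ClosedPt C} (hy : y.1 ∈ D.locus) {v : NQ M} :
    v ∈ D.coeff y ↔ ∀ m, D.MemDual m → D.eval m y ≤ v m := by
  refine ⟨fun h m hm => eval_le hm h, fun h => ?_⟩
  classical
  by_contra hv
  obtain ⟨P, hP, hPc⟩ := D.coeff_polyhedron y hy
  obtain ⟨S, hS⟩ := D.tail_fg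
  -- the cone over `Δ_y` is finitely generated
  let T : Finset (NQ M × ℚ) := S.image (fun v => (v, (0 : ℚ))) ∪ P.image fun v => (v, (1 : ℚ))
  have hT : PointedCone.hull ℚ (T : Set (NQ M × ℚ)) ≤ D.cayleyCone y := by
    refine Submodule.span_mono ?_
    intro p hp
    simp only [T, Finset.coe_union, Finset.coe_image] at hp
    rcases hp with ⟨v, hv, rfl⟩ | ⟨v, hv, rfl⟩
    · exact Or.inl ⟨v, hS ▸ Submodule.subset_span hv, rfl⟩
    · refine Or.inr ⟨v, ?_, rfl⟩
      rw [hPc]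
      exact ⟨v, subset_convexHull ℚ _ hv, 0, D.tail.zero_mem, add_zero v⟩
  have hv' : (v, (1 : ℚ)) ∉ PointedCone.hull ℚ (T : Set (NQ M × ℚ)) := fun h =>
    hv (by simpa using (mem_cayleyCone_iff_of_pos one_pos).1 (hT h))
  obtain ⟨L, hL, hLv⟩ := exists_dual_neg_of_notMem ⟨T, rfl⟩ hv'
  obtain ⟨k, m, hk, hm⟩ := NQ.exists_eval_eq_mul (L.comp (LinearMap.inl ℚ (NQ M) ℚ))
  have hk' : (0 : ℚ) < k := by exact_mod_cast hk
  have hsplit : ∀ (w : NQ M), (k : ℚ) * L (w, 1) = w m + k * L (0, 1) := by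
    intro w
    rw [hm w, ← mul_add, LinearMap.comp_apply, LinearMap.inl_apply, ← map_add]
    simp
  have hmD : D.MemDual m := by
    intro w hw
    rw [← hS] at hw
    induction hw using Submodule.span_induction with
    | mem w hw =>
      rw [hm w, LinearMap.comp_apply, LinearMap.inl_apply]
      refine mul_nonneg hk'.le (hL _ (PointedCone.subset_hull ?_))
      simp only [T, Finset.coe_union, Finset.coe_image]
      exact Or.inl ⟨w, hw, rfl⟩
    | zero => simp
    | add a b _ _ ha hb => exact add_nonneg ha hb
    | smul r a _ ha => exact mul_nonneg r.2 ha
  obtain ⟨v₀, hv₀, hv₀m⟩ := exists_eq_eval hmD hy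
  obtain ⟨p, hpP, hp⟩ : ∃ p ∈ P, p m ≤ v₀ m := by
    rw [hPc] at hv₀
    obtain ⟨a, ha, b, hb, rfl⟩ := hv₀
    obtain ⟨p, hp, hmin⟩ := P.exists_min_image (fun v : NQ M => v m) hP
    refine ⟨p, hp, ?_⟩
    have hconv : Convex ℚ {v : NQ M | p m ≤ v m} := by
      intro v hv w hw a b ha hb hab
      simp only [Set.mem_ofPred_eq, AddMonoidHom.add_apply, AddMonoidHom.smul_apply,
        smul_eq_mul] at *
      calc p m = a * p m + b * p m := by rw [← add_mul, hab, one_mul]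
        _ ≤ _ := add_le_add (mul_le_mul_of_nonneg_left hv ha) (mul_le_mul_of_nonneg_left hw hb)
    have h1 : p m ≤ a m := convexHull_min (fun v hv => hmin v hv) hconv ha
    have h2 : 0 ≤ b m := hmD b hb
    change p m ≤ a m + b m
    linarith
  have h1 : 0 ≤ L (p, 1) := by
    refine hL _ (PointedCone.subset_hull ?_)
    simp only [T, Finset.coe_union, Finset.coe_image]
    exact Or.inr ⟨p, hpP, rfl⟩
  have h2 := hsplit p
  have h3 := hsplit v
  have h4 := h m hmD
  have h5 : 0 ≤ (k : ℚ) * L (p, 1) := mul_nonneg hk'.le h1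
  have h6 : (k : ℚ) * L (v, 1) < 0 := mul_neg_of_pos_of_neg hk' hLv
  linarith

/-- If `Δ''_y` is a face of `Δ_y` then it is cut out by an element of `M`, and so is the tail of
`D''`. -/
theorem exists_memDual_of_isFace (hle : D'' ≤ D) {y : ClosedPt C} (hy : y.1 ∈ D''.locus)
    (hF : IsFace (D''.coeff y) (D.coeff y)) :
    ∃ m, D.MemDual m ∧ (∀ v, v ∈ D''.coeff y ↔ v ∈ D.coeff y ∧ v m = D.eval m y) ∧
      ∀ w, w ∈ D''.tail ↔ w ∈ D.tail ∧ w m = 0 := by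
  obtain ⟨L, hL⟩ := hF
  obtain ⟨k, m, hk, hm⟩ := NQ.exists_eval_eq_mul L
  have hk' : (0 : ℚ) < k := by exact_mod_cast hk
  have hcmp : ∀ v w : NQ M, L v ≤ L w ↔ v m ≤ w m := fun v w => by
    rw [hm, hm, mul_le_mul_iff_right₀ hk']
  obtain ⟨v₀, hv₀⟩ := coeff_nonempty hy
  have hv₀' := hv₀
  rw [hL] at hv₀'
  -- A form with a minimum on `Δ_y` cannot decrease along the tail.
  have hmD : D.MemDual m := by
    intro w hw
    have := (hcmp _ _).1 (hv₀'.2 _ (add_mem_coeff hv₀'.1 hw))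
    rw [AddMonoidHom.add_apply] at this
    linarith
  have hc : ∀ v, v ∈ D''.coeff y ↔ v ∈ D.coeff y ∧ v m = D.eval m y := by
    intro v
    rw [hL]
    refine and_congr_right fun hv => ⟨fun h => ?_, fun h w hw => ?_⟩
    · obtain ⟨w, hw, hwm⟩ := exists_eq_eval hmD (mem_locus_of_mem_coeff hv)
      exact le_antisymm (hwm ▸ (hcmp _ _).1 (h w hw)) (eval_le hmD hv)
    · rw [hcmp, h]
      exact eval_le hmD hw
  refine ⟨m, hmD, hc, fun w => ⟨fun hw => ⟨hle.1 hw, ?_⟩, fun hw => ?_⟩⟩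
  · have h1 := ((hc _).1 (add_mem_coeff hv₀ hw)).2
    have h2 := ((hc _).1 hv₀).2
    rw [AddMonoidHom.add_apply] at h1
    linarith
  · refine mem_tail_of_forall_add_mem (y := y) (v := v₀) fun n => (hc _).2
      ⟨add_mem_coeff ((hc _).1 hv₀).1 (nsmul_mem_tail hw.1 n), ?_⟩
    rw [AddMonoidHom.add_apply, AddMonoidHom.smul_apply, hw.2, smul_zero, add_zero]
    exact ((hc _).1 hv₀).2

/-- A lattice point in the interior of the dual cone. By strong convexity, `-w` is outside the tail
for each nonzero generator `w`, so some element of the dual cone is positive on `w`; these elements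
are added up. -/
theorem exists_memDual_forall_eq_zero (D : PolyhedralDivisor C M) :
    ∃ m, D.MemDual m ∧ ∀ w ∈ D.tail, w m = 0 → w = 0 := by
  classical
  obtain ⟨S, hS⟩ := D.tail_fg
  have hST : ∀ w ∈ S, w ∈ D.tail := fun w hw => hS ▸ Submodule.subset_span hw
  have h : ∀ w ∈ S, ∃ m, D.MemDual m ∧ (w ≠ 0 → 0 < w m) := by
    intro w hw
    by_cases h0 : w = 0
    · exact ⟨0, fun v _ => by simp, fun h => absurd h0 h⟩
    · obtain ⟨m, hm, hm'⟩ := exists_memDual_neg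
        (fun h => h0 (D.tail_stronglyConvex w (hST w hw) h) : -w ∉ D.tail)
      refine ⟨m, hm, fun _ => ?_⟩
      rw [AddMonoidHom.neg_apply] at hm'
      linarith
  choose! m hm hm' using h
  have hsum : D.MemDual (∑ w ∈ S, m w) := fun v hv => by
    rw [map_sum]
    exact Finset.sum_nonneg fun w hw => hm w hw v hv
  refine ⟨∑ w ∈ S, m w, hsum, ?_⟩
  have key : ∀ v ∈ D.tail, v = 0 ∨ 0 < v (∑ w ∈ S, m w) := by
    intro v hv
    rw [← hS] at hv
    induction hv using Submodule.span_induction with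
    | mem w hw =>
      by_cases h0 : w = 0
      · exact Or.inl h0
      · right
        rw [map_sum]
        exact Finset.sum_pos' (fun u hu => hm u hu w (hST w hw)) ⟨w, hw, hm' w hw h0⟩
    | zero => exact Or.inl rfl
    | add a b _ _ ha hb =>
      rcases ha with rfl | ha
      · simpa using hb
      · rcases hb with rfl | hb
        · exact Or.inr (by simpa using ha)
        · exact Or.inr (add_pos ha hb)
    | smul r a _ ha =>
      rcases eq_or_ne r 0 with rfl | hr
      · exact Or.inl (by simp)
      rcases ha with rfl | ha
      · exact Or.inl (by simp)
      · have hr' : (0 : ℚ) < r := lt_of_le_of_ne r.2 fun h => hr (Subtype.ext h.symm)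
        exact Or.inr (mul_pos hr' ha)
  intro w hw hw0
  rcases key w hw with h | h
  · exact h
  · exact absurd hw0 h.ne'

end Lattice

end PolyhedralDivisor

/-! ### Points and orders on a smooth projective curve -/

section Curve

variable {C : Scheme.{0}} [C.Over SpecC] [IsSmoothProjectiveCurve C]

variable (C) in
theorem isNoetherian_curve : IsNoetherian C := by
  have h1 : IsLocallyNoetherian C := LocallyOfFiniteType.isLocallyNoetherian (C ↘ SpecC)
  have h2 : CompactSpace C := (quasiCompact_iff_compactSpace (C ↘ SpecC)).1 inferInstance
  exact {}

variable (C) in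
theorem jacobsonSpace_curve : JacobsonSpace C :=
  LocallyOfFiniteType.jacobsonSpace (C ↘ SpecC)

variable (C) in
theorem isSeparated_curve : C.IsSeparated := by
  refine ⟨?_⟩
  have : (C ↘ SpecC) ≫ terminal.from SpecC = terminal.from C := Subsingleton.elim _ _
  rw [← this]
  infer_instance

theorem ringOfStalk_prime_eq (y : ClosedPt C) (p : PrimeSpectrum (C.presheaf.stalk y.1)) :
    p = ⊥ ∨ p = IsLocalRing.closedPoint _ := by
  by_cases h : p.asIdeal = ⊥
  · exact Or.inl (PrimeSpectrum.ext h)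
  · right
    have := Ring.DimensionLEOne.maximalOfPrime h p.2
    exact PrimeSpectrum.ext (IsLocalRing.eq_maximalIdeal this)

/-- The closure of `x` contains a closed point `y`. Both `x` and the generic point come from the
spectrum of the local ring at `y`, a discrete valuation ring, which has only two primes. -/
theorem eq_genericPoint_or_isClosed (x : C) : x = genericPoint C ∨ IsClosed ({x} : Set C) := by
  have := isNoetherian_curve C
  obtain ⟨y, hy, hyc⟩ := IsClosed.exists_closed_singleton (isClosed_closure (s := {x}))
    (Set.singleton_nonempty x).closure
  have hxy : x ⤳ y := specializes_iff_mem_closure.2 hy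
  obtain ⟨p, hp⟩ : x ∈ Set.range (C.fromSpecStalk y) := by
    rw [Scheme.range_fromSpecStalk]
    exact hxy
  obtain ⟨q, hq⟩ : genericPoint C ∈ Set.range (C.fromSpecStalk y) := by
    rw [Scheme.range_fromSpecStalk]
    exact genericPoint_specializes y
  rcases ringOfStalk_prime_eq ⟨y, hyc⟩ p with h | h
  · rcases ringOfStalk_prime_eq ⟨y, hyc⟩ q with h' | h'
    · left
      rw [← hp, ← hq]
      exact congrArg _ (h.trans h'.symm)
    · left
      have h1 : genericPoint C = y := by
        rw [← hq]
        exact (congrArg _ h').trans Scheme.fromSpecStalk_closedPoint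
      have h2 : y ⤳ x := h1 ▸ genericPoint_specializes x
      rw [h1]
      exact (hxy.antisymm h2).eq
  · right
    have : x = y := by
      rw [← hp]
      exact (congrArg _ h).trans Scheme.fromSpecStalk_closedPoint
    rwa [this]

theorem genericPoint_mem (U : C.Opens) [h : Nonempty U] : genericPoint C ∈ U :=
  ((genericPoint_spec C).mem_open_set_iff U.isOpen).2 (by simpa using h)

theorem exists_closedPt_mem (U : C.Opens) [h : Nonempty U] : ∃ y : ClosedPt C, y.1 ∈ U := by
  have := jacobsonSpace_curve C
  obtain ⟨y, hy, hyc⟩ := nonempty_inter_closedPoints (Z := (U : Set C)) ⟨_, h.some.2⟩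
    U.isOpen.isLocallyClosed
  exact ⟨⟨y, hyc⟩, hy⟩

theorem exists_closedPt_notMem {U : C.Opens} (hU : U ≠ ⊤) : ∃ y : ClosedPt C, y.1 ∉ U := by
  have := isNoetherian_curve C
  have hne : (U : Set C)ᶜ.Nonempty := by
    rw [Set.nonempty_compl]
    exact fun h => hU (TopologicalSpace.Opens.ext h)
  obtain ⟨y, hy, hyc⟩ := IsClosed.exists_closed_singleton U.isOpen.isClosed_compl hne
  exact ⟨⟨y, hyc⟩, hy⟩

/-- The stalk at the generic point is a field, those at the closed points are not. -/
theorem genericPoint_not_isClosed : ¬ IsClosed ({genericPoint C} : Set C) := by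
  intro h
  have key : ∀ y : ClosedPt C, ¬ IsField (C.presheaf.stalk y.1) := fun y =>
    IsDiscreteValuationRing.not_isField _
  exact key ⟨genericPoint C, h⟩ (inferInstance : Field C.functionField).toIsField

/-- The complement is a finite union of irreducible closed sets. The generic point of each is not
that of `C`, so it is closed, and each of these sets is a single point. -/
theorem finite_closedPt_notMem (U : C.Opens) [Nonempty U] : {y : ClosedPt C | y.1 ∉ U}.Finite := by
  have := isNoetherian_curve C
  obtain ⟨S, hS, hSc, hSi, hSU⟩ :=
    TopologicalSpace.NoetherianSpace.exists_finite_set_isClosed_irreducible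
      U.isOpen.isClosed_compl
  have hsub : ∀ t ∈ S, t.Subsingleton := by
    intro t ht
    obtain ⟨x, hx⟩ := QuasiSober.sober (hSi t ht) (hSc t ht)
    have hxU : x ∉ U := by
      have : x ∈ ⋃₀ S := ⟨t, ht, hx.mem⟩
      rw [← hSU] at this
      exact this
    rcases eq_genericPoint_or_isClosed x with rfl | h
    · exact absurd (genericPoint_mem U) hxU
    · rw [← hx.def, h.closure_eq]
      exact Set.subsingleton_singleton
  have hfin : (⋃₀ S).Finite := hS.sUnion fun t ht => (hsub t ht).finite
  rw [← hSU] at hfin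
  exact hfin.preimage Subtype.val_injective.injOn

/-- The closed points are dense, `C` being Jacobson. If they were finite in number they would form a
closed set, which would contain the generic point. -/
instance infinite_closedPt : Infinite (ClosedPt C) := by
  have := jacobsonSpace_curve C
  by_contra hfin
  rw [not_infinite_iff_finite] at hfin
  have h1 : (closedPoints C).Finite := Set.finite_coe_iff.1 hfin
  have h2 : IsClosed (closedPoints C) := by
    rw [← Set.biUnion_of_singleton (closedPoints C)]
    exact h1.isClosed_biUnion fun x hx => hx
  have h3 := closure_closedPoints (X := C)
  rw [h2.closure_eq] at h3
  exact genericPoint_not_isClosed (h3.ge (Set.mem_univ (genericPoint C)))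

/-! #### Orders -/

/-- The valuation of the function field at a closed point. -/
abbrev placeVal (y : ClosedPt C) : Valuation C.functionField (WithZero (Multiplicative ℤ)) :=
  (IsDiscreteValuationRing.maximalIdeal (C.presheaf.stalk y.1)).valuation C.functionField

theorem ord_zero (y : ClosedPt C) : ord y (0 : C.functionField) = 0 := by simp [ord]

theorem ord_one (y : ClosedPt C) : ord y (1 : C.functionField) = 0 := by simp [ord]

theorem ord_inv (y : ClosedPt C) (f : C.functionField) : ord y f⁻¹ = -ord y f := by
  simp [ord, WithZero.log_inv]

theorem ord_pow (y : ClosedPt C) (f : C.functionField) (n : ℕ) : ord y (f ^ n) = n * ord y f := by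
  simp [ord, WithZero.log_pow]

theorem ord_zpow (y : ClosedPt C) (f : C.functionField) (n : ℤ) : ord y (f ^ n) = n * ord y f := by
  simp [ord, WithZero.log_zpow]

theorem ord_prod (y : ClosedPt C) {ι : Type*} (s : Finset ι) (f : ι → C.functionField)
    (hf : ∀ i ∈ s, f i ≠ 0) : ord y (∏ i ∈ s, f i) = ∑ i ∈ s, ord y (f i) := by
  classical
  induction s using Finset.induction_on with
  | empty => simp [ord_one]
  | insert a s ha ih =>
    rw [Finset.prod_insert ha, Finset.sum_insert ha, ord_mul y (hf a (by simp))
      (Finset.prod_ne_zero_iff.2 fun i hi => hf i (by simp [hi])), ih fun i hi => hf i (by simp [hi])]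

theorem ord_nonneg_iff (y : ClosedPt C) {f : C.functionField} (hf : f ≠ 0) :
    0 ≤ ord y f ↔ f ∈ Set.range (algebraMap (C.presheaf.stalk y.1) C.functionField) := by
  have hv : placeVal y f ≠ 0 := by simpa using hf
  have h1 : 0 ≤ ord y f ↔ placeVal y f ≤ 1 := by
    rw [ord, neg_nonneg, ← WithZero.log_one, WithZero.log_le_log hv one_ne_zero]
  rw [h1]
  constructor
  · intro h
    obtain ⟨n, d, hnd⟩ :=
      IsDedekindDomain.HeightOneSpectrum.exists_primeCompl_mul_eq_of_integer _ f h
    have hd : IsUnit d.1 := by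
      by_contra hd
      exact d.2 ((IsLocalRing.mem_maximalIdeal _).2 hd)
    obtain ⟨u, hu⟩ := hd
    refine ⟨n * ↑u⁻¹, ?_⟩
    have hu0 : algebraMap (C.presheaf.stalk y.1) C.functionField u ≠ 0 :=
      ((u.isUnit).map _).ne_zero
    rw [map_mul, ← hnd, ← hu, mul_assoc, ← map_mul, Units.mul_inv, map_one, mul_one]
  · rintro ⟨a, rfl⟩
    exact IsDedekindDomain.HeightOneSpectrum.valuation_le_one _ _

theorem ord_pos_iff (y : ClosedPt C) {a : C.presheaf.stalk y.1} (ha : a ≠ 0) :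
    0 < ord y (algebraMap _ C.functionField a) ↔ a ∈ IsLocalRing.maximalIdeal _ := by
  have ha' : algebraMap _ C.functionField a ≠ 0 := by
    simpa using ha
  have hv : placeVal y (algebraMap _ C.functionField a) ≠ 0 := by simpa using ha
  rw [ord, neg_pos, ← WithZero.log_one, WithZero.log_lt_log hv one_ne_zero]
  exact IsDedekindDomain.HeightOneSpectrum.valuation_lt_one_iff_mem _ _

theorem ord_algebraMap_nonneg (y : ClosedPt C) (a : C.presheaf.stalk y.1) :
    0 ≤ ord y (algebraMap _ C.functionField a) := by
  by_cases ha : a = 0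
  · simp [ha, ord_zero]
  · exact (ord_nonneg_iff y (by simpa using ha)).2 ⟨a, rfl⟩

theorem exists_ord_eq_one (y : ClosedPt C) : ∃ π : C.functionField, π ≠ 0 ∧ ord y π = 1 := by
  obtain ⟨π, hπ⟩ := IsDedekindDomain.HeightOneSpectrum.valuation_exists_uniformizer
    C.functionField (IsDiscreteValuationRing.maximalIdeal (C.presheaf.stalk y.1))
  refine ⟨π, ?_, ?_⟩
  · rintro rfl
    rw [map_zero] at hπ
    exact WithZero.exp_ne_zero hπ.symm
  · rw [ord, hπ]
    simp

theorem ord_germ_nonneg {U : C.Opens} [Nonempty U] {y : ClosedPt C} (hy : y.1 ∈ U) (s : Γ(C, U)) :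
    0 ≤ ord y (C.germToFunctionField U s) := by
  rw [← Scheme.algebraMap_germ_eq_germToFunctionField (X := C) hy]
  exact ord_algebraMap_nonneg _ _

theorem finite_ord_ne_zero {f : C.functionField} (hf : f ≠ 0) : {y | ord y f ≠ 0}.Finite := by
  obtain ⟨U, -, s, hU, rfl, hs⟩ := exists_isUnit_germ_eq C f hf
  refine (finite_closedPt_notMem U).subset fun y hy hyU => hy ?_
  obtain ⟨u, rfl⟩ := hs
  have h1 := ord_germ_nonneg hyU (u : Γ(C, U))
  have h2 := ord_germ_nonneg hyU ((u⁻¹ : _ˣ) : Γ(C, U))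
  have h3 : C.germToFunctionField U (u : Γ(C, U)) * C.germToFunctionField U ↑u⁻¹ = 1 := by
    rw [← map_mul, Units.mul_inv, map_one]
  have h4 : C.germToFunctionField U ((u⁻¹ : _ˣ) : Γ(C, U)) ≠ 0 := right_ne_zero_of_mul_eq_one h3
  have h5 := ord_mul y hf h4
  rw [h3, ord_one] at h5
  linarith

theorem germToFunctionField_res {U V : C.Opens} [Nonempty U] [Nonempty V] (h : V ≤ U)
    (s : Γ(C, U)) : C.germToFunctionField V (C.presheaf.map (homOfLE h).op s) =
      C.germToFunctionField U s :=
  C.presheaf.germ_res_apply (homOfLE h) _ (genericPoint_mem V) s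

theorem exists_germ_of_mem_range {x : C} {f : C.functionField}
    (hf : f ∈ Set.range (algebraMap (C.presheaf.stalk x) C.functionField)) (U : C.Opens)
    (hx : x ∈ U) : ∃ (V : C.Opens) (_ : Nonempty V) (s : Γ(C, V)), x ∈ V ∧ V ≤ U ∧
      C.germToFunctionField V s = f := by
  obtain ⟨a, rfl⟩ := hf
  obtain ⟨W, hW, s, rfl⟩ := C.presheaf.exists_germ_eq a
  have : Nonempty W := ⟨⟨x, hW⟩⟩
  have : Nonempty (W ⊓ U : C.Opens) := ⟨⟨x, hW, hx⟩⟩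
  refine ⟨W ⊓ U, this, C.presheaf.map (homOfLE inf_le_left).op s, ⟨hW, hx⟩, inf_le_right, ?_⟩
  rw [germToFunctionField_res, Scheme.algebraMap_germ_eq_germToFunctionField]

/-- A rational function which is regular at all the closed points of `U` is regular on `U`. -/
theorem exists_section_of_ord_nonneg (U : C.Opens) [Nonempty U] {f : C.functionField}
    (hf : f ≠ 0 → ∀ y : ClosedPt C, y.1 ∈ U → 0 ≤ ord y f) :
    ∃ s : Γ(C, U), C.germToFunctionField U s = f := by
  by_cases hf0 : f = 0
  · exact ⟨0, by simp [hf0]⟩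
  have key : ∀ y : {y : ClosedPt C // y.1 ∈ U}, ∃ (V : C.Opens) (_ : Nonempty V) (s : Γ(C, V)),
      y.1.1 ∈ V ∧ V ≤ U ∧ C.germToFunctionField V s = f := fun y =>
    exists_germ_of_mem_range ((ord_nonneg_iff _ hf0).1 (hf hf0 y.1 y.2)) U y.2
  choose V hV s hyV hVU hs using key
  have hcov : U ≤ iSup V := by
    intro x hx
    rcases eq_genericPoint_or_isClosed x with rfl | h
    · obtain ⟨y, hy⟩ := exists_closedPt_mem U
      exact TopologicalSpace.Opens.mem_iSup.2 ⟨⟨y, hy⟩, genericPoint_mem _⟩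
    · exact TopologicalSpace.Opens.mem_iSup.2 ⟨⟨⟨x, h⟩, hx⟩, hyV _⟩
  -- The local lifts of `f` agree on overlaps, because sections embed in the function field.
  obtain ⟨t, ht, -⟩ := TopCat.Sheaf.existsUnique_gluing' C.sheaf V U (fun i => homOfLE (hVU i))
    hcov s (by
      intro i j
      have hne : Nonempty (V i ⊓ V j : C.Opens) :=
        ⟨⟨_, genericPoint_mem (V i), genericPoint_mem (V j)⟩⟩
      refine C.germToFunctionField_injective (V i ⊓ V j) ?_
      exact (germToFunctionField_res inf_le_left (s i)).trans
        ((hs i).trans ((germToFunctionField_res inf_le_right (s j)).trans (hs j)).symm))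
  obtain ⟨y, hy⟩ := exists_closedPt_mem U
  refine ⟨t, ?_⟩
  rw [← hs ⟨y, hy⟩, ← ht ⟨y, hy⟩]
  exact (germToFunctionField_res (hVU _) t).symm

theorem algebraMap_eq_germToFunctionField (c : ℂ) [Nonempty (⊤ : C.Opens)] :
    algebraMap ℂ C.functionField c = C.germToFunctionField ⊤ ((C ↘ SpecC).appTop.hom
      ((Scheme.ΓSpecIso (CommRingCat.of ℂ)).inv.hom c)) := rfl

/-- A rational function without poles is constant. -/
theorem mem_range_algebraMap_of_ord_nonneg {f : C.functionField}
    (hf : f ≠ 0 → ∀ y : ClosedPt C, 0 ≤ ord y f) : f ∈ Set.range (algebraMap ℂ C.functionField) := by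
  have : Nonempty (⊤ : C.Opens) := ⟨⟨genericPoint C, trivial⟩⟩
  obtain ⟨s, rfl⟩ := exists_section_of_ord_nonneg ⊤ (fun h y _ => hf h y)
  let φ : ℂ →+* Γ(C, ⊤) := (C ↘ SpecC).appTop.hom.comp
    (Scheme.ΓSpecIso (CommRingCat.of ℂ)).inv.hom
  -- Global functions on the proper integral curve are finite over `ℂ`, which is algebraically
  -- closed.
  have hφ : φ.IsIntegral := by
    have h1 := (finite_appTop_of_universallyClosed ℂ (C ↘ SpecC)).to_isIntegral
    exact RingHom.isIntegral_respectsIso.2 (C ↘ SpecC).appTop.hom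
      (Scheme.ΓSpecIso (CommRingCat.of ℂ)).symm.commRingCatIsoToRingEquiv h1
  have := (IsAlgClosed.ringHom_bijective_of_isIntegral φ hφ).2 s
  obtain ⟨c, rfl⟩ := this
  exact ⟨c, rfl⟩

/-- Were `C` affine, every rational function would be a quotient of global functions, that is, of
constants; but a uniformizer has order one. -/
theorem not_isAffineOpen_top : ¬ IsAffineOpen (⊤ : C.Opens) := by
  intro h
  have hne : Nonempty (⊤ : C.Opens) := ⟨⟨genericPoint C, trivial⟩⟩
  have hfr := functionField_isFractionRing_of_isAffineOpen C ⊤ h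
  obtain ⟨y⟩ : Nonempty (ClosedPt C) := inferInstance
  obtain ⟨π, hπ, hπ1⟩ := exists_ord_eq_one y
  obtain ⟨a, b, hb, rfl⟩ := IsFractionRing.div_surjective (A := Γ(C, ⊤)) π
  have hord : ∀ s : Γ(C, ⊤), ord y (algebraMap _ C.functionField s) = 0 := by
    intro s
    obtain ⟨c, hc⟩ := mem_range_algebraMap_of_ord_nonneg (f := algebraMap _ C.functionField s)
      fun _ z => ord_germ_nonneg (U := ⊤) trivial s
    rw [← hc]
    by_cases hc0 : c = 0
    · rw [hc0, map_zero, ord_zero]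
    · exact ord_algebraMap y hc0
  have ha : algebraMap Γ(C, ⊤) C.functionField a ≠ 0 := fun h => hπ (by rw [h, zero_div])
  have hb' : algebraMap Γ(C, ⊤) C.functionField b ≠ 0 := fun h => hπ (by rw [h, div_zero])
  rw [div_eq_mul_inv, ord_mul y ha (inv_ne_zero hb'), ord_inv, hord, hord] at hπ1
  simp at hπ1

end Curve

/-! ### Finiteness of the function field over a rational subfield -/

section Finiteness

open scoped IntermediateField IntermediateField.algebraAdjoinAdjoin

/-- As `S` is étale over a polynomial ring in one variable, `F` is algebraic over the field of
rational functions and has transcendence degree one. So `h` is a transcendence basis, and `F` is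
both algebraic and finitely generated over `k(h)`. -/
theorem finiteDimensional_adjoin_of_etale {k S F : Type} [Field k] [CommRing S] [IsDomain S]
    [Field F] [Algebra k S] [Algebra k F] [Algebra S F] [IsScalarTower k S F] [IsFractionRing S F]
    [Algebra (MvPolynomial (Fin 1) k) S] [IsScalarTower k (MvPolynomial (Fin 1) k) S]
    [Algebra.Etale (MvPolynomial (Fin 1) k) S] {h : F} (hh : Transcendental k h) :
    FiniteDimensional k⟮h⟯ F := by
  set P := MvPolynomial (Fin 1) k
  have hfp : Algebra.FiniteType k S :=
    .trans (S := MvPolynomial (Fin 1) k) inferInstance inferInstance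
  have hess0 : Algebra.EssFiniteType S F := .of_isLocalization _ (nonZeroDivisors S)
  have hess : Algebra.EssFiniteType k F := .comp k S F
  let : Algebra P F := ((algebraMap S F).comp (algebraMap P S)).toAlgebra
  have : IsScalarTower P S F := .of_algebraMap_eq' rfl
  have : IsScalarTower k P F := .of_algebraMap_eq fun c => by
    rw [IsScalarTower.algebraMap_apply P S F, ← IsScalarTower.algebraMap_apply k P S,
      ← IsScalarTower.algebraMap_apply k S F]
  have hinj : Function.Injective (algebraMap P F) :=
    (IsFractionRing.injective S F).comp (FaithfulSMul.algebraMap_injective P S)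
  have : FaithfulSMul P F := (faithfulSMul_iff_algebraMap_injective P F).2 hinj
  let : Algebra (FractionRing P) F := FractionRing.liftAlgebra P F
  have hfu0 : Algebra.FormallyUnramified S F :=
    Algebra.FormallyUnramified.of_isLocalization (nonZeroDivisors S)
  have hfu1 : Algebra.FormallyUnramified P F := .comp P S F
  have hfu : Algebra.FormallyUnramified (FractionRing P) F := .of_restrictScalars P _ _
  have hess2 : Algebra.EssFiniteType P F := .of_comp k P F
  have hess3 : Algebra.EssFiniteType (FractionRing P) F := .of_comp P _ F
  have hsep : Algebra.IsSeparable (FractionRing P) F := Algebra.FormallyUnramified.isSeparable _ _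
  have halg : Algebra.IsAlgebraic P F :=
    (IsFractionRing.comap_isAlgebraic_iff (K := FractionRing P)).2 inferInstance
  have htr : Algebra.trdeg k F = 1 := by
    rw [← _root_.trdeg_add_eq k P (A := F), trdeg_eq_zero (R := P) (A := F),
      MvPolynomial.trdeg_of_isDomain]
    simp
  have hind : AlgebraicIndependent k (fun _ : Fin 1 => h) :=
    (algebraicIndependent_singleton_iff (0 : Fin 1)).2 hh
  have hbasis := hind.isTranscendenceBasis_of_trdeg_le_of_finite (by rw [htr]; simp)
  have halg2 := hbasis.isAlgebraic
  have hr : Set.range (fun _ : Fin 1 => h) = {h} := Set.range_const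
  rw [hr] at halg2
  have halg3 : Algebra.IsAlgebraic k⟮h⟯ F :=
    (IsFractionRing.comap_isAlgebraic_iff (A := Algebra.adjoin k {h}) (K := k⟮h⟯)).1 halg2
  have hess4 : Algebra.EssFiniteType k⟮h⟯ F := .of_comp k _ F
  obtain ⟨s, hs⟩ := IntermediateField.fg_top k⟮h⟯ F
  have hfin : FiniteDimensional k⟮h⟯ (IntermediateField.adjoin k⟮h⟯ (s : Set F)) :=
    IntermediateField.finiteDimensional_adjoin fun x _ => Algebra.IsIntegral.isIntegral x
  rw [hs] at hfin
  exact IntermediateField.topEquiv.toLinearEquiv.finiteDimensional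

end Finiteness

section Curve

variable {C : Scheme.{0}} [C.Over SpecC] [IsSmoothProjectiveCurve C]

open scoped IntermediateField IntermediateField.algebraAdjoinAdjoin

theorem algebraMap_functionField_apply (V : C.Opens) [Nonempty V] (c : ℂ) :
    algebraMap ℂ C.functionField c = C.germToFunctionField V
      (C.presheaf.map (homOfLE le_top).op ((C ↘ SpecC).appTop.hom
        ((Scheme.ΓSpecIso (CommRingCat.of ℂ)).inv.hom c))) := by
  have : Nonempty (⊤ : C.Opens) := ⟨⟨genericPoint C, trivial⟩⟩
  rw [germToFunctionField_res]
  rfl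

/-- The function field is finite over `ℂ(h)` for every non-constant `h`. -/
theorem finiteDimensional_adjoin {h : C.functionField}
    (hh : h ∉ Set.range (algebraMap ℂ C.functionField)) : FiniteDimensional ℂ⟮h⟯ C.functionField := by
  let f := C ↘ SpecC
  obtain ⟨U, hU, V, hV, hx, e, hf⟩ :=
    SmoothOfRelativeDimension.exists_isStandardSmoothOfRelativeDimension (n := 1) (f := f)
      (genericPoint C)
  have hUt : U = ⊤ := by
    ext z
    simp only [TopologicalSpace.Opens.coe_top, Set.mem_univ, iff_true]
    exact Subsingleton.elim (f (genericPoint C)) z ▸ e hx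
  subst hUt
  obtain ⟨g, hg, hg'⟩ := hf.exists_etale_mvPolynomial
  let iso : ℂ ≃+* Γ(Spec (.of ℂ), ⊤) := (Scheme.ΓSpecIso (.of ℂ)).symm.commRingCatIsoToRingEquiv
  let e1 : MvPolynomial (Fin 1) ℂ ≃+* MvPolynomial (Fin 1) Γ(Spec (.of ℂ), ⊤) :=
    MvPolynomial.mapEquiv _ iso
  let : Algebra (MvPolynomial (Fin 1) ℂ) Γ(C, V) := (g.comp e1.toRingHom).toAlgebra
  have : Algebra.Etale (MvPolynomial (Fin 1) ℂ) Γ(C, V) :=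
    RingHom.Etale.respectsIso.2 g e1 hg'
  have : Nonempty V := ⟨⟨_, hx⟩⟩
  let : Algebra ℂ Γ(C, V) :=
    ((algebraMap (MvPolynomial (Fin 1) ℂ) Γ(C, V)).comp MvPolynomial.C).toAlgebra
  have : IsScalarTower ℂ (MvPolynomial (Fin 1) ℂ) Γ(C, V) := .of_algebraMap_eq' rfl
  have : IsFractionRing Γ(C, V) C.functionField := functionField_isFractionRing_of_isAffineOpen C V hV
  have : IsScalarTower ℂ Γ(C, V) C.functionField := by
    refine .of_algebraMap_eq fun c => ?_
    rw [algebraMap_functionField_apply V]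
    refine congrArg (C.germToFunctionField V) ?_
    change _ = g (e1 (MvPolynomial.C c))
    have h1 : e1 (MvPolynomial.C c) = MvPolynomial.C (iso c) := by
      simp [e1]
    rw [h1]
    have h2 := RingHom.congr_fun hg (iso c)
    refine Eq.trans ?_ h2.symm
    simp only [Scheme.Hom.appLE]
    rfl
  refine finiteDimensional_adjoin_of_etale (k := ℂ) (S := Γ(C, V)) ?_
  intro halg
  have := IntermediateField.isAlgebraic_adjoin_simple halg.isIntegral
  exact hh (IsAlgClosed.algebraMap_bijective_of_isIntegral (k := ℂ) (K := ℂ⟮h⟯) |>.2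
    ⟨h, IntermediateField.mem_adjoin_simple_self ℂ h⟩ |>.imp fun c hc => congrArg Subtype.val hc)

/-- Morphisms between affine schemes which agree after a dominant base change are equal. -/
theorem Spec_hom_ext_of_injective {R S T : CommRingCat.{0}} (φ : S ⟶ T)
    (hφ : Function.Injective φ.hom) {g₁ g₂ : Spec S ⟶ Spec R}
    (h : Spec.map φ ≫ g₁ = Spec.map φ ≫ g₂) : g₁ = g₂ := by
  obtain ⟨a, rfl⟩ := Spec.map_surjective g₁
  obtain ⟨b, rfl⟩ := Spec.map_surjective g₂
  rw [← Spec.map_comp, ← Spec.map_comp] at h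
  have h' := Spec.map_injective h
  congr 1
  ext x
  exact hφ (RingHom.congr_fun (congrArg CommRingCat.Hom.hom h') x)

/-! ### Valuative criteria and local rings of the curve -/

section Valuative

variable {R K : Type} [CommRing R] [IsDomain R] [ValuationRing R] [Field K] [Algebra R K]
  [IsFractionRing R K]

/-- The valuative criterion of separatedness. The morphisms need not be assumed to agree over `ℂ`:
this follows from their agreement on `Spec K`. -/
theorem hom_ext_of_valuationRing {l₁ l₂ : Spec (CommRingCat.of R) ⟶ C}
    (h : Spec.map (CommRingCat.ofHom (algebraMap R K)) ≫ l₁ =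
      Spec.map (CommRingCat.ofHom (algebraMap R K)) ≫ l₂) : l₁ = l₂ := by
  have h2 : l₁ ≫ (C ↘ SpecC) = l₂ ≫ (C ↘ SpecC) :=
    Spec_hom_ext_of_injective (CommRingCat.ofHom (algebraMap R K)) (IsFractionRing.injective R K)
      (by rw [← Category.assoc, h, Category.assoc])
  let S : ValuativeCommSq (C ↘ SpecC) :=
    { R := R
      K := K
      i₁ := Spec.map (CommRingCat.ofHom (algebraMap R K)) ≫ l₁
      i₂ := l₁ ≫ (C ↘ SpecC)
      commSq := ⟨by simp⟩ }
  have := IsSeparated.valuativeCriterion (C ↘ SpecC) S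
  have h3 : (⟨l₁, rfl, rfl⟩ : S.commSq.LiftStruct) = ⟨l₂, h.symm, h2.symm⟩ := Subsingleton.elim _ _
  exact congrArg CommSq.LiftStruct.l h3

theorem exists_lift_of_valuationRing (i₁ : Spec (CommRingCat.of K) ⟶ C)
    (i₂ : Spec (CommRingCat.of R) ⟶ SpecC)
    (h : i₁ ≫ (C ↘ SpecC) = Spec.map (CommRingCat.ofHom (algebraMap R K)) ≫ i₂) :
    ∃ l : Spec (CommRingCat.of R) ⟶ C, Spec.map (CommRingCat.ofHom (algebraMap R K)) ≫ l = i₁ ∧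
      l ≫ (C ↘ SpecC) = i₂ := by
  let S : ValuativeCommSq (C ↘ SpecC) :=
    { R := R
      K := K
      i₁ := i₁
      i₂ := i₂
      commSq := ⟨h⟩ }
  have huc : UniversallyClosed (C ↘ SpecC) := inferInstance
  rw [UniversallyClosed.eq_valuativeCriterion] at huc
  obtain ⟨⟨l, h1, h2⟩⟩ := huc.1 S
  exact ⟨l, h1, h2⟩

end Valuative

/-- The local rings of distinct closed points are not comparable. -/
theorem exists_ord_nonneg_ord_neg {y z : ClosedPt C} (hyz : y ≠ z) :
    ∃ f : C.functionField, f ≠ 0 ∧ 0 ≤ ord y f ∧ ord z f < 0 := by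
  by_contra! hcon
  refine hyz ?_
  have hmem : ∀ a : C.presheaf.stalk y.1, algebraMap _ C.functionField a ∈
      (algebraMap (C.presheaf.stalk z.1) C.functionField).range := by
    intro a
    by_cases ha : a = 0
    · rw [ha, map_zero]
      exact Subring.zero_mem _
    · have h0 : algebraMap _ C.functionField a ≠ 0 := by simpa using ha
      exact (ord_nonneg_iff z h0).1 (hcon _ h0 (ord_algebraMap_nonneg y a))
  have hinj : Function.Injective (algebraMap (C.presheaf.stalk z.1) C.functionField) :=
    IsFractionRing.injective _ _
  let j : C.presheaf.stalk y.1 →+* C.presheaf.stalk z.1 :=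
    ((RingEquiv.ofLeftInverse (Function.leftInverse_invFun hinj)).symm.toRingHom).comp
      ((algebraMap (C.presheaf.stalk y.1) C.functionField).codRestrict _ hmem)
  have hj : (algebraMap (C.presheaf.stalk z.1) C.functionField).comp j =
      algebraMap (C.presheaf.stalk y.1) C.functionField := by
    ext a
    exact congrArg Subtype.val ((RingEquiv.ofLeftInverse
      (Function.leftInverse_invFun hinj)).apply_symm_apply ⟨_, hmem a⟩)
  -- If the local ring at `y` were contained in that at `z`, the spectrum of the latter would map to
  -- `C` in two ways which agree at the generic point, hence are equal. Then `z` would specialize to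
  -- `y`, and `z` is closed.
  have key : C.fromSpecStalk z.1 = Spec.map (CommRingCat.ofHom j) ≫ C.fromSpecStalk y.1 := by
    refine hom_ext_of_valuationRing (R := C.presheaf.stalk z.1) (K := C.functionField) ?_
    rw [← Category.assoc, ← Spec.map_comp, ← CommRingCat.ofHom_comp, hj]
    exact (Scheme.SpecMap_stalkSpecializes_fromSpecStalk (genericPoint_specializes z.1)).trans
      (Scheme.SpecMap_stalkSpecializes_fromSpecStalk (genericPoint_specializes y.1)).symm
  have hz : z.1 ∈ Set.range (C.fromSpecStalk y.1) := by
    exact ⟨_, (congrArg (fun g : Spec (C.presheaf.stalk z.1) ⟶ C =>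
      g (IsLocalRing.closedPoint _)) key).symm.trans Scheme.fromSpecStalk_closedPoint⟩
  rw [Scheme.range_fromSpecStalk] at hz
  have : z.1 ∈ closure {z.1} ∧ y.1 ∈ closure {z.1} := ⟨subset_closure rfl, hz.mem_closure⟩
  rw [z.2.closure_eq] at this
  exact Subtype.ext this.2

/-- The residue fields of the closed points are `ℂ`. -/
theorem exists_ord_sub_pos (y : ClosedPt C) {f : C.functionField} (hf : 0 ≤ ord y f) :
    ∃ c : ℂ, f = algebraMap ℂ _ c ∨ 0 < ord y (f - algebraMap ℂ _ c) := by
  by_cases hf0 : f = 0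
  · exact ⟨0, Or.inl (by rw [hf0, map_zero])⟩
  obtain ⟨a, rfl⟩ := (ord_nonneg_iff y hf0).1 hf
  let g := C ↘ SpecC
  let i := (residueFieldIsoBase g y.1 y.2).inv
  -- The isomorphism of `ℂ` with the residue field is the structure map; this is read off from the
  -- morphisms of spectra.
  have hi : i = (Scheme.ΓSpecIso _).inv ≫ g.appTop ≫ C.presheaf.germ ⊤ y.1 trivial ≫
      C.residue y.1 := by
    have h1 := congrArg Scheme.Hom.appTop (SpecMap_residueFieldIsoBase_inv g y.1 y.2)
    have h2 : i = (Scheme.ΓSpecIso _).inv ≫ (Spec.map i).appTop ≫ (Scheme.ΓSpecIso _).hom := by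
      rw [Scheme.ΓSpecIso_naturality, Iso.inv_hom_id_assoc]
    rw [h2, h1, Scheme.fromSpecResidueField, Scheme.Hom.comp_appTop, Scheme.Hom.comp_appTop,
      Scheme.fromSpecStalk_appTop]
    simp only [Category.assoc]
    congr 3
    rw [Scheme.ΓSpecIso_naturality]
    simp
  have hsurj : Function.Surjective i.hom := by
    have : IsIso i := inferInstance
    exact (ConcreteCategory.isIso_iff_bijective i).1 this |>.2
  obtain ⟨c, hc⟩ := hsurj (C.residue y.1 a)
  have : Nonempty (⊤ : C.Opens) := ⟨⟨y.1, trivial⟩⟩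
  set b : C.presheaf.stalk y.1 := C.presheaf.germ ⊤ y.1 trivial (g.appTop.hom
    ((Scheme.ΓSpecIso _).inv.hom c)) with hb
  have hb' : algebraMap _ C.functionField b = algebraMap ℂ _ c :=
    Scheme.algebraMap_germ_eq_germToFunctionField (X := C) (U := ⊤) (x := y.1) trivial _
  have hres : C.residue y.1 b = C.residue y.1 a := by
    rw [← hc, hi]
    rfl
  refine ⟨c, ?_⟩
  rw [← hb', ← map_sub]
  by_cases hab : a - b = 0
  · left
    rw [sub_eq_zero.1 hab]
  · right
    rw [ord_pos_iff y hab, ← IsLocalRing.residue_eq_zero_iff, map_sub, sub_eq_zero]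
    exact hres.symm

end Curve

/-! ### Riemann's inequality -/

section Riemann

variable {C : Scheme.{0}} [C.Over SpecC] [IsSmoothProjectiveCurve C]

/-- The rational functions of order at least `n` at `y`. -/
def ordGE (y : ClosedPt C) (n : ℤ) : Submodule ℂ C.functionField where
  carrier := {f | f ≠ 0 → n ≤ ord y f}
  zero_mem' := fun h => absurd rfl h
  add_mem' := by
    intro f g hf hg hfg
    by_cases hf0 : f = 0
    · subst hf0
      rw [zero_add] at hfg ⊢
      exact hg hfg
    by_cases hg0 : g = 0
    · subst hg0
      rw [add_zero] at hfg ⊢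
      exact hf hfg
    exact (le_min (hf hf0) (hg hg0)).trans (ord_add y hf0 hg0 hfg)
  smul_mem' := by
    intro c f hf hcf
    have hc : c ≠ 0 := by
      rintro rfl
      exact hcf (zero_smul _ _)
    have hf0 : f ≠ 0 := by
      rintro rfl
      exact hcf (smul_zero _)
    rw [Algebra.smul_def, ord_mul y (by simpa using hc) hf0, ord_algebraMap y hc, zero_add]
    exact hf hf0

theorem mem_ordGE {y : ClosedPt C} {n : ℤ} {f : C.functionField} :
    f ∈ ordGE y n ↔ (f ≠ 0 → n ≤ ord y f) := Iff.rfl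

theorem ordGE_mono {y : ClosedPt C} {n n' : ℤ} (h : n' ≤ n) : ordGE y n ≤ ordGE y n' :=
  fun _ hf hf0 => h.trans (hf hf0)

theorem mul_mem_ordGE {y : ClosedPt C} {n n' : ℤ} {f g : C.functionField} (hf : f ∈ ordGE y n)
    (hg : g ∈ ordGE y n') : f * g ∈ ordGE y (n + n') := by
  intro h
  rw [ord_mul y (left_ne_zero_of_mul h) (right_ne_zero_of_mul h)]
  exact add_le_add (hf (left_ne_zero_of_mul h)) (hg (right_ne_zero_of_mul h))

theorem algebraMap_mem_ordGE (y : ClosedPt C) (c : ℂ) : algebraMap ℂ C.functionField c ∈ ordGE y 0 := by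
  intro h
  rw [ord_algebraMap y (by rintro rfl; simp at h)]

/-- The sections of the divisor `G`: the rational functions `f` with `div f + G ≥ 0`. -/
def sections (G : ClosedPt C →₀ ℤ) : Submodule ℂ C.functionField := ⨅ y, ordGE y (-G y)

theorem mem_sections {G : ClosedPt C →₀ ℤ} {f : C.functionField} :
    f ∈ sections G ↔ (f ≠ 0 → ∀ y, 0 ≤ ord y f + G y) := by
  simp only [sections, Submodule.mem_iInf, mem_ordGE]
  exact ⟨fun h hf y => by linarith [h y hf], fun h y hf => by linarith [h hf y]⟩

theorem sections_mono {G G' : ClosedPt C →₀ ℤ} (h : G ≤ G') : sections G ≤ sections G' :=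
  iInf_mono fun y => ordGE_mono (neg_le_neg (h y))

/-- If there is a new section, let `g` be one. For any other section `f`, the quotient `f / g` is
regular at `z`; subtracting from `f` its value there times `g` leaves a section of `G`. -/
theorem sections_add_single_le (G : ClosedPt C →₀ ℤ) (z : ClosedPt C) :
    ∃ g : C.functionField, sections (G + .single z 1) ≤ sections G ⊔ Submodule.span ℂ {g} := by
  classical
  by_cases h : sections (G + .single z 1) ≤ sections G
  · exact ⟨0, h.trans le_sup_left⟩
  obtain ⟨g, hg, hgG⟩ := SetLike.not_le_iff_exists.1 h
  refine ⟨g, fun f hf => ?_⟩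
  have hg0 : g ≠ 0 := by
    rintro rfl
    exact hgG (Submodule.zero_mem _)
  have hne : ∀ y, y ≠ z → (G + Finsupp.single z (1 : ℤ)) y = G y := by
    intro y hy
    simp [Finsupp.single_eq_of_ne hy]
  have hez : (G + Finsupp.single z (1 : ℤ)) z = G z + 1 := by simp
  have hgz : ord z g = -G z - 1 := by
    have h1 := mem_sections.1 hg hg0
    by_contra hcon
    refine hgG (mem_sections.2 fun _ y => ?_)
    have h2 := h1 y
    by_cases hy : y = z
    · subst hy
      rw [hez] at h2
      omega
    · rwa [hne y hy] at h2
  by_cases hf0 : f = 0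
  · rw [hf0]
    exact Submodule.zero_mem _
  have hfz : 0 ≤ ord z (f * g⁻¹) := by
    have h1 := mem_sections.1 hf hf0 z
    rw [hez] at h1
    rw [ord_mul z hf0 (inv_ne_zero hg0), ord_inv]
    omega
  obtain ⟨c, hc⟩ := exists_ord_sub_pos z hfz
  have hsub : f - c • g ∈ sections G := by
    refine mem_sections.2 fun hne0 y => ?_
    have h2 : f - c • g ∈ sections (G + .single z 1) :=
      Submodule.sub_mem _ hf (Submodule.smul_mem _ _ hg)
    have h3 := mem_sections.1 h2 hne0 y
    by_cases hy : y = z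
    · subst hy
      have h4 : f - c • g = (f * g⁻¹ - algebraMap ℂ _ c) * g := by
        rw [sub_mul, inv_mul_cancel_right₀ hg0, Algebra.smul_def]
      have h5 : f * g⁻¹ - algebraMap ℂ _ c ≠ 0 := by
        intro h0
        rw [h4, h0, zero_mul] at hne0
        exact hne0 rfl
      rcases hc with hc | hc
      · exact absurd (sub_eq_zero.2 hc) h5
      · rw [h4, ord_mul y h5 hg0]
        omega
    · rwa [hne y hy] at h3
  rw [← sub_add_cancel f (c • g)]
  exact Submodule.add_mem_sup hsub (Submodule.smul_mem _ _ (Submodule.mem_span_singleton_self g))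

theorem degree_nonneg {G : ClosedPt C →₀ ℤ} (h : 0 ≤ G) : 0 ≤ G.degree := by
  rw [Finsupp.degree_apply]
  exact Finset.sum_nonneg fun y _ => h y

/-- Every larger divisor is reached by adding one point at a time; the induction is on the degree of
the difference. -/
theorem divisor_le_induction {p : (ClosedPt C →₀ ℤ) → Prop} {G : ClosedPt C →₀ ℤ} (h0 : p G)
    (h1 : ∀ G' z, G ≤ G' → p G' → p (G' + .single z 1)) {G' : ClosedPt C →₀ ℤ} (h : G ≤ G') :
    p G' := by
  classical
  obtain ⟨n, hn⟩ : ∃ n : ℕ, (G' - G).degree = n :=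
    Int.eq_ofNat_of_zero_le (degree_nonneg (sub_nonneg.2 h))
  induction n generalizing G' with
  | zero =>
    have h2 : G' = G := by
      rw [Finsupp.degree_apply] at hn
      have h3 := (Finset.sum_eq_zero_iff_of_nonneg fun y _ => (sub_nonneg.2 h) y).1 hn
      ext y
      by_cases hy : y ∈ (G' - G).support
      · have := h3 y hy
        simp only [Finsupp.coe_sub, Pi.sub_apply] at this
        omega
      · have := Finsupp.notMem_support_iff.1 hy
        simp only [Finsupp.coe_sub, Pi.sub_apply] at this
        omega
    rwa [h2]
  | succ n ih =>
    have h2 : ∃ z, G z < G' z := by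
      by_contra! hcon
      have : G' = G := le_antisymm hcon h
      rw [this, sub_self, map_zero] at hn
      omega
    obtain ⟨z, hz⟩ := h2
    have h3 : G ≤ G' - .single z 1 := by
      intro y
      by_cases hy : y = z
      · subst hy
        simp only [Finsupp.coe_sub, Pi.sub_apply, Finsupp.single_eq_same]
        omega
      · simpa [Finsupp.single_eq_of_ne hy] using h y
    have h4 := h1 _ z h3 (ih h3 (by
      rw [sub_right_comm, map_sub, hn, Finsupp.degree_single]
      simp))
    rwa [sub_add_cancel] at h4

theorem sections_zero : sections (0 : ClosedPt C →₀ ℤ) = Submodule.span ℂ {1} := by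
  apply le_antisymm
  · intro f hf
    obtain ⟨c, rfl⟩ := mem_range_algebraMap_of_ord_nonneg (f := f)
      fun h y => by simpa using mem_sections.1 hf h y
    rw [Algebra.algebraMap_eq_smul_one]
    exact Submodule.smul_mem _ _ (Submodule.mem_span_singleton_self 1)
  · rw [Submodule.span_singleton_le_iff_mem]
    exact mem_sections.2 fun _ y => by simp [ord_one]

instance finiteDimensional_sections (G : ClosedPt C →₀ ℤ) : FiniteDimensional ℂ (sections G) := by
  have h1 : ∀ G' : ClosedPt C →₀ ℤ, 0 ≤ G' → FiniteDimensional ℂ (sections G') := by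
    intro G' hG'
    refine divisor_le_induction (p := fun G' => FiniteDimensional ℂ (sections G')) ?_ ?_ hG'
    · rw [sections_zero]
      infer_instance
    · intro G' z _ h
      obtain ⟨g, hg⟩ := sections_add_single_le G' z
      exact Submodule.finiteDimensional_of_le hg
  have := h1 (G ⊔ 0) le_sup_right
  exact Submodule.finiteDimensional_of_le (sections_mono (le_sup_left : G ≤ G ⊔ 0))

/-- The defect `deg G - l(G)`. -/
def defect (G : ClosedPt C →₀ ℤ) : ℤ := G.degree - Module.finrank ℂ (sections G)

theorem finrank_span_singleton_le (g : C.functionField) :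
    Module.finrank ℂ (Submodule.span ℂ {g}) ≤ 1 := by
  classical
  simpa using finrank_span_le_card (R := ℂ) ({g} : Set C.functionField)

/-- An added point raises the degree by one and the dimension by at most one. -/
theorem defect_mono {G G' : ClosedPt C →₀ ℤ} (h : G ≤ G') : defect G ≤ defect G' := by
  refine divisor_le_induction (p := fun G' => defect G ≤ defect G') le_rfl ?_ h
  intro G' z _ hG'
  refine hG'.trans ?_
  obtain ⟨g, hg⟩ := sections_add_single_le G' z
  have h1 := (Submodule.finrank_mono hg).trans
    ((Submodule.finrank_add_le_finrank_add_finrank _ _).trans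
      (Nat.add_le_add_left (finrank_span_singleton_le g) _))
  simp only [defect, map_add, Finsupp.degree_single]
  omega

/-- The zero divisor has the defect `-1`, and the defect is monotone. -/
theorem finrank_sections_le {G : ClosedPt C →₀ ℤ} (h : 0 ≤ G) :
    (Module.finrank ℂ (sections G) : ℤ) ≤ G.degree + 1 := by
  have h1 := defect_mono h
  have h2 : Module.finrank ℂ (sections (0 : ClosedPt C →₀ ℤ)) = 1 := by
    rw [sections_zero, finrank_span_singleton one_ne_zero]
  simp only [defect, map_zero, h2] at h1
  omega

/-- The principal divisor of `f` (which is `0` for `f = 0`). -/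
def divisor (f : C.functionField) : ClosedPt C →₀ ℤ :=
  Finsupp.ofSupportFinite (fun y => ord y f) (by
    by_cases hf : f = 0
    · convert Set.finite_empty
      ext y
      simp [hf, ord_zero]
    · exact finite_ord_ne_zero hf)

@[simp]
theorem divisor_apply (f : C.functionField) (y : ClosedPt C) : divisor f y = ord y f := rfl

theorem finrank_sections_add_divisor (G : ClosedPt C →₀ ℤ) {f : C.functionField} (hf : f ≠ 0) :
    Module.finrank ℂ (sections (G + divisor f)) = Module.finrank ℂ (sections G) := by
  have key : ∀ (G : ClosedPt C →₀ ℤ) {f : C.functionField}, f ≠ 0 →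
      Module.finrank ℂ (sections (G + divisor f)) ≤ Module.finrank ℂ (sections G) := by
    intro G f hf
    refine LinearMap.finrank_le_finrank_of_injective
      (f := ((LinearMap.mulLeft ℂ f).restrict (p := sections (G + divisor f)) (q := sections G) ?_)) ?_
    · intro g hg
      rw [LinearMap.mulLeft_apply, mem_sections]
      intro hfg y
      have := mem_sections.1 hg (right_ne_zero_of_mul hfg) y
      rw [ord_mul y hf (right_ne_zero_of_mul hfg)]
      simp only [Finsupp.coe_add, Pi.add_apply, divisor_apply] at this
      linarith
    · intro a b hab
      exact Subtype.ext (mul_left_cancel₀ hf (congrArg Subtype.val hab))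
  refine le_antisymm (key G hf) ?_
  have h := key (G + divisor f) (inv_ne_zero hf)
  have : G + divisor f + divisor f⁻¹ = G := by
    ext y
    simp [ord_inv]
  rwa [this] at h

/-! #### Poles -/

/-- The divisor of poles of `h`. -/
def poles (h : C.functionField) : ClosedPt C →₀ ℤ := divisor h⁻¹ ⊔ 0

theorem poles_apply (h : C.functionField) (y : ClosedPt C) : poles h y = max (-ord y h) 0 := by
  simp [poles, Finsupp.sup_apply, ord_inv]

theorem poles_nonneg (h : C.functionField) : 0 ≤ poles h := le_sup_right

/-- All but finitely many translates of `f` by constants have no zero in a given finite set. -/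
theorem exists_sub_algebraMap_ord_le (f : C.functionField) (S : Set (ClosedPt C)) (hS : S.Finite) :
    ∃ c : ℂ, f - algebraMap ℂ _ c ≠ 0 ∧ ∀ y ∈ S, ord y (f - algebraMap ℂ _ c) ≤ 0 := by
  have h1 : {c : ℂ | f = algebraMap ℂ _ c}.Subsingleton := fun a ha b hb =>
    (algebraMap ℂ C.functionField).injective (ha.symm.trans hb)
  have h2 : ∀ y : ClosedPt C, {c : ℂ | 0 < ord y (f - algebraMap ℂ _ c)}.Subsingleton := by
    intro y a ha b hb
    by_contra hab
    have h3 : algebraMap ℂ C.functionField (b - a) ∈ ordGE y 1 := by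
      have : algebraMap ℂ C.functionField (b - a) =
          (f - algebraMap ℂ _ a) - (f - algebraMap ℂ _ b) := by
        rw [map_sub]
        ring
      rw [this]
      exact Submodule.sub_mem _ (fun _ => ha) (fun _ => hb)
    have h4 := h3 (by simpa [sub_eq_zero] using Ne.symm hab)
    rw [ord_algebraMap y (sub_ne_zero.2 (Ne.symm hab))] at h4
    omega
  have h3 : ({c : ℂ | f = algebraMap ℂ _ c} ∪
      ⋃ y ∈ S, {c : ℂ | 0 < ord y (f - algebraMap ℂ _ c)}).Finite :=
    h1.finite.union (hS.biUnion fun y _ => (h2 y).finite)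
  obtain ⟨c, hc⟩ := h3.exists_notMem
  simp only [Set.mem_union, Set.mem_ofPred_eq, Set.mem_iUnion, not_or, not_exists, not_lt] at hc
  exact ⟨c, sub_ne_zero.2 hc.1, fun y hy => hc.2 y hy⟩

/-- Functions which are invertible at `y` and vanish on a finite set. -/
theorem exists_ord_eq_zero_ord_pos (y : ClosedPt C) (S : Finset (ClosedPt C)) (hy : y ∉ S) :
    ∃ w : C.functionField, w ≠ 0 ∧ ord y w = 0 ∧ ∀ z ∈ S, 0 < ord z w := by
  have key : ∀ z : S, ∃ w : C.functionField, w ≠ 0 ∧ ord y w = 0 ∧ 0 < ord z.1 w ∧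
      ∀ x ∈ S, 0 ≤ ord x w := by
    intro z
    have hyz : y ≠ z.1 := fun h => hy (h ▸ z.2)
    -- A function regular at `y` with a pole at `z` is translated by a constant so as to have no
    -- zero at `y` or on `S`. Its inverse is a unit at `y`, vanishes at `z` and has no pole on `S`;
    -- the product over all `z` is taken.
    obtain ⟨f, hf, hfy, hfz⟩ := exists_ord_nonneg_ord_neg hyz
    obtain ⟨c, hc, hcS⟩ := exists_sub_algebraMap_ord_le f ({y} ∪ (S : Set (ClosedPt C)))
      ((Set.finite_singleton y).union S.finite_toSet)
    have h1 : 0 ≤ ord y (f - algebraMap ℂ _ c) :=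
      (Submodule.sub_mem (ordGE y 0) (fun _ => hfy) (algebraMap_mem_ordGE y c)) hc
    have h2 : ord z.1 (f - algebraMap ℂ _ c) < 0 := by
      by_contra hcon
      have := Submodule.add_mem (ordGE z.1 0) (fun _ => not_lt.1 hcon) (algebraMap_mem_ordGE z.1 c)
      rw [sub_add_cancel] at this
      exact absurd (this hf) (not_le.2 hfz)
    refine ⟨(f - algebraMap ℂ _ c)⁻¹, inv_ne_zero hc, ?_, ?_, fun x hx => ?_⟩
    · rw [ord_inv]
      have := hcS y (by simp)
      omega
    · rw [ord_inv]
      omega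
    · rw [ord_inv]
      have := hcS x (Or.inr hx)
      omega
  choose w hw hwy hwz hwS using key
  refine ⟨∏ z, w z, Finset.prod_ne_zero_iff.2 fun z _ => hw z, ?_, fun x hx => ?_⟩
  · rw [ord_prod _ _ _ fun z _ => hw z]
    exact Finset.sum_eq_zero fun z _ => hwy z
  · rw [ord_prod _ _ _ fun z _ => hw z]
    exact Finset.sum_pos' (fun z _ => hwS z x hx) ⟨⟨x, hx⟩, Finset.mem_univ _, hwz ⟨x, hx⟩⟩

end Riemann

section Riemann

variable {C : Scheme.{0}} [C.Over SpecC] [IsSmoothProjectiveCurve C]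

open scoped IntermediateField IntermediateField.algebraAdjoinAdjoin Polynomial

theorem transcendental_of_notMem_range {h : C.functionField}
    (hh : h ∉ Set.range (algebraMap ℂ C.functionField)) : Transcendental ℂ h := by
  intro halg
  have := IntermediateField.isAlgebraic_adjoin_simple halg.isIntegral
  exact hh (IsAlgClosed.algebraMap_bijective_of_isIntegral (k := ℂ) (K := ℂ⟮h⟯) |>.2
    ⟨h, IntermediateField.mem_adjoin_simple_self ℂ h⟩ |>.imp fun c hc => congrArg Subtype.val hc)

/-- Write `p = X ^ v * q` with `q` nonzero at `0`. At a zero of `h` the factor `q(h)` is a unit, so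
one `v` serves all the zeros of `h`. -/
theorem exists_ord_aeval_eq {h : C.functionField}
    (hh : h ∉ Set.range (algebraMap ℂ C.functionField)) {p : ℂ[X]} (hp : p ≠ 0) :
    ∃ v : ℕ, ∀ y : ClosedPt C, 0 < ord y h → ord y (Polynomial.aeval h p) = v * ord y h := by
  have hinj := transcendental_iff_injective.1 (transcendental_of_notMem_range hh)
  have hh0 : h ≠ 0 := by
    rintro rfl
    exact hh ⟨0, map_zero _⟩
  obtain ⟨q, hq, hq'⟩ := Polynomial.exists_eq_pow_rootMultiplicity_mul_and_not_dvd p hp 0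
  rw [map_zero, sub_zero] at hq hq'
  refine ⟨Polynomial.rootMultiplicity 0 p, fun y hy => ?_⟩
  have hq0 : q ≠ 0 := by
    rintro rfl
    exact hq' (dvd_zero _)
  have haq : Polynomial.aeval h q ≠ 0 := fun h0 => hq0 (hinj (h0.trans (map_zero _).symm))
  have hqc : q.coeff 0 ≠ 0 := fun h0 => hq' (Polynomial.X_dvd_iff.2 h0)
  have hint : ∀ r : ℂ[X], Polynomial.aeval h r ∈ ordGE y 0 := by
    intro r
    rw [Polynomial.aeval_eq_sum_range]
    refine Submodule.sum_mem _ fun i _ => Submodule.smul_mem _ _ fun _ => ?_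
    rw [ord_pow]
    positivity
  have h1 : ord y (Polynomial.aeval h q) = 0 := by
    refine le_antisymm ?_ (hint q haq)
    by_contra hcon
    have h2 : algebraMap ℂ C.functionField (q.coeff 0) ∈ ordGE y 1 := by
      have h3 : algebraMap ℂ C.functionField (q.coeff 0) =
          Polynomial.aeval h q - h * Polynomial.aeval h q.divX := by
        have h4 := congrArg (Polynomial.aeval h) (Polynomial.X_mul_divX_add q)
        simp only [map_add, map_mul, Polynomial.aeval_X, Polynomial.aeval_C] at h4
        linear_combination h4
      rw [h3]
      refine Submodule.sub_mem _ (fun _ => by omega) ?_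
      exact mul_mem_ordGE (n := 1) (n' := 0) (fun _ => hy) (hint _)
    have h4 := h2 (by simpa using hqc)
    rw [ord_algebraMap y hqc] at h4
    omega
  conv_lhs => rw [hq]
  rw [map_mul, map_pow, Polynomial.aeval_X, ord_mul y (pow_ne_zero _ hh0) haq, h1, ord_pow, add_zero]

/-- Take `π ^ j * w ^ n` with `π` a uniformizer at `y` and `w` a unit at `y` which vanishes on the
rest of `S`. The exponent `n` outweighs the poles of `π ^ j` on `S` for `j < e y`. -/
theorem exists_family_ord (S : Finset (ClosedPt C)) (e : ClosedPt C → ℕ) (y : ClosedPt C) :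
    ∃ f : ℕ → C.functionField, (∀ j, f j ≠ 0) ∧ (∀ j, ord y (f j) = j) ∧
      ∀ j < e y, ∀ z ∈ S, z ≠ y → (e z : ℤ) ≤ ord z (f j) := by
  classical
  obtain ⟨π, hπ, hπy⟩ := exists_ord_eq_one y
  obtain ⟨w, hw, hwy, hwz⟩ := exists_ord_eq_zero_ord_pos y (S.erase y) (by simp)
  refine ⟨fun j => π ^ j * w ^ (∑ z ∈ S, (e z + e y * (ord z π).natAbs)), fun j => ?_, fun j => ?_,
    fun j hj z hz hzy => ?_⟩
  · positivity
  · rw [ord_mul y (by positivity) (by positivity), ord_pow, ord_pow, hπy, hwy]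
    simp
  · rw [ord_mul z (by positivity) (by positivity), ord_pow, ord_pow]
    have h1 := hwz z (by simp [hz, hzy])
    have h2 : e z + e y * (ord z π).natAbs ≤ ∑ z ∈ S, (e z + e y * (ord z π).natAbs) :=
      Finset.single_le_sum (f := fun z => e z + e y * (ord z π).natAbs) (fun _ _ => Nat.zero_le _) hz
    set n := ∑ z ∈ S, (e z + e y * (ord z π).natAbs)
    have h3 : (e z : ℤ) + e y * |ord z π| ≤ n := by
      rw [Int.abs_eq_natAbs]
      exact_mod_cast h2
    have h4 : -((e y : ℤ) * |ord z π|) ≤ j * ord z π := by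
      rw [neg_le]
      calc -((j : ℤ) * ord z π) ≤ |(j : ℤ) * ord z π| := neg_le_abs _
        _ = j * |ord z π| := by rw [abs_mul, Nat.abs_cast]
        _ ≤ e y * |ord z π| := mul_le_mul_of_nonneg_right (by exact_mod_cast hj.le) (abs_nonneg _)
    have h5 : (n : ℤ) ≤ n * ord z w := le_mul_of_one_le_right (Int.natCast_nonneg _) h1
    linarith

/-- For each zero `y` of `h`, of order `e y`, take functions of orders `0, …, e y - 1` at `y` which
vanish to order at least `e z` at every other zero `z`. Comparing orders at a suitable zero shows
that they are linearly independent over `ℂ(h)`; there are as many of them as the degree of the zeros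
of `h`. -/
theorem degree_poles_inv_le {h : C.functionField}
    (hh : h ∉ Set.range (algebraMap ℂ C.functionField)) :
    (poles h⁻¹).degree ≤ Module.finrank ℂ⟮h⟯ C.functionField := by
  classical
  have := finiteDimensional_adjoin hh
  have hinj := transcendental_iff_injective.1 (transcendental_of_notMem_range hh)
  have hp : ∀ y, poles h⁻¹ y = max (ord y h) 0 := fun y => by rw [poles_apply, ord_inv, neg_neg]
  set S := (poles h⁻¹).support with hS
  have hSpos : ∀ y ∈ S, 0 < ord y h := by
    intro y hy
    by_contra hcon
    refine (Finsupp.mem_support_iff.1 hy) ?_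
    rw [hp, max_eq_right (not_lt.1 hcon)]
  let e : ClosedPt C → ℕ := fun y => (ord y h).toNat
  have he : ∀ y ∈ S, (e y : ℤ) = ord y h := fun y hy => Int.toNat_of_nonneg (hSpos y hy).le
  choose f hf hfy hfz using exists_family_ord S e
  let ι := Σ y : S, Fin (e y.1)
  let b : ι → C.functionField := fun i => f i.1.1 i.2
  have hb : LinearIndependent ℂ⟮h⟯ b := by
    -- Denominators are cleared: the coefficients of a relation may be taken in `ℂ[h]`. Each nonzero
    -- coefficient then has, at every zero `y` of `h`, the order `v * ord y h` with `v` independent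
    -- of `y`.
    rw [← LinearIndependent.iff_fractionRing (Algebra.adjoin ℂ {h}), Fintype.linearIndependent_iff]
    intro g hg
    by_contra! hcon
    have hgp : ∀ i, ∃ p : ℂ[X], Polynomial.aeval h p = (g i : C.functionField) := fun i => by
      exact (Algebra.adjoin_singleton_eq_range_aeval ℂ h).le (g i).2
    choose p hp' using hgp
    have hp0 : ∀ i, g i ≠ 0 → p i ≠ 0 := fun i hi h0 => hi (Subtype.ext (by rw [← hp', h0]; simp))
    have hv : ∀ i, ∃ v : ℕ, g i ≠ 0 → ∀ y : ClosedPt C, 0 < ord y h →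
        ord y (g i : C.functionField) = v * ord y h := by
      intro i
      by_cases hi : g i = 0
      · exact ⟨0, fun h0 => absurd hi h0⟩
      · obtain ⟨v, hv⟩ := exists_ord_aeval_eq hh (hp0 i hi)
        exact ⟨v, fun _ y hy => by rw [← hp']; exact hv y hy⟩
    choose v hv using hv
    have hg0 : ∀ i, g i ≠ 0 → (g i : C.functionField) ≠ 0 := fun i hi h0 => hi (Subtype.ext h0)
    have ht : ∀ i, g i ≠ 0 → ∀ y ∈ S, ord y (g i • b i) = v i * ord y h + ord y (b i) := by
      intro i hi y hy
      rw [Algebra.smul_def, ← hv i hi y (hSpos y hy)]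
      exact ord_mul y (hg0 i hi) (hf _ _)
    -- Choose a coefficient with the least `v`, and let `y` be the zero to which it is attached.
    -- Among the terms attached to `y`, the one of least order at `y`, with index `i1`, will have a
    -- smaller order than all the other terms, so it cannot be cancelled.
    obtain ⟨i0, hi0, hmin⟩ := Finset.exists_min_image (Finset.univ.filter fun i => g i ≠ 0) v
      (by obtain ⟨i, hi⟩ := hcon; exact ⟨i, by simpa using hi⟩)
    simp only [Finset.mem_filter, Finset.mem_univ, true_and] at hi0 hmin
    set y := i0.1.1 with hy
    have hyS : y ∈ S := i0.1.2
    obtain ⟨i1, hi1, hmin1⟩ := Finset.exists_min_image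
      (Finset.univ.filter fun i => g i ≠ 0 ∧ i.1.1 = y) (fun i => ord y (g i • b i))
      ⟨i0, Finset.mem_filter.2 ⟨Finset.mem_univ _, hi0, rfl⟩⟩
    simp only [Finset.mem_filter, Finset.mem_univ, true_and] at hi1 hmin1
    have hbi : ∀ i : ι, i.1.1 = y → ord y (b i) = (i.2 : ℕ) ∧ ((i.2 : ℕ) : ℤ) < ord y h := by
      rintro ⟨⟨z, hz⟩, j⟩ rfl
      refine ⟨hfy _ _, ?_⟩
      rw [← he _ hz]
      exact_mod_cast j.2
    have hlt : ord y (g i1 • b i1) < (v i0 + 1) * ord y h := by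
      refine (hmin1 i0 ⟨hi0, rfl⟩).trans_lt ?_
      rw [ht i0 hi0 y hyS]
      have := hbi i0 rfl
      linarith
    have hother : ∀ i ∈ Finset.univ.erase i1, g i • b i ∈ ordGE y (ord y (g i1 • b i1) + 1) := by
      intro i hi hne
      have hgi : g i ≠ 0 := by
        intro h0
        rw [h0, zero_smul] at hne
        exact hne rfl
      by_cases hiy : i.1.1 = y
      · refine lt_of_le_of_ne (hmin1 i ⟨hgi, hiy⟩) fun heq => ?_
        -- The orders of the terms attached to `y` are distinct, because they are distinct modulo
        -- `ord y h`.
        rw [ht i hgi y hyS, ht i1 hi1.1 y hyS, (hbi i hiy).1, (hbi i1 hi1.2).1] at heq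
        have h1 := (hbi i hiy).2
        have h2 := (hbi i1 hi1.2).2
        have h3 : ((i.2 : ℕ) : ℤ) = (i1.2 : ℕ) := by
          have h5 := congrArg (· % ord y h) heq
          simp only [add_comm ((v _ : ℤ) * _),
            Int.add_mul_emod_self_right] at h5
          rw [Int.emod_eq_of_lt (by positivity) h2, Int.emod_eq_of_lt (by positivity) h1] at h5
          exact h5.symm
        refine (Finset.mem_erase.1 hi).1 ?_
        have h6 : i.1 = i1.1 := Subtype.ext (hiy.trans hi1.2.symm)
        obtain ⟨a, j⟩ := i
        obtain ⟨a', j'⟩ := i1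
        simp only at h6
        subst h6
        have : j = j' := Fin.ext (by exact_mod_cast h3)
        rw [this]
      -- A term attached to another zero has order at least `(v i0 + 1) * ord y h` at `y`, by the
      -- choice of the functions.
      · rw [ht i hgi y hyS]
        have h1 : (e y : ℤ) ≤ ord y (b i) := hfz _ _ i.2.2 y hyS (Ne.symm hiy)
        rw [he y hyS] at h1
        have h2 : (v i0 : ℤ) * ord y h ≤ v i * ord y h :=
          mul_le_mul_of_nonneg_right (by exact_mod_cast hmin i hgi) (hSpos y hyS).le
        linarith
    have hsum : g i1 • b i1 ∈ ordGE y (ord y (g i1 • b i1) + 1) := by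
      rw [← Finset.add_sum_erase _ _ (Finset.mem_univ i1)] at hg
      have h1 := Submodule.neg_mem _ (Submodule.sum_mem _ hother)
      rwa [← eq_neg_of_add_eq_zero_left hg] at h1
    have hne : g i1 • b i1 ≠ 0 := by
      rw [Algebra.smul_def]
      exact mul_ne_zero (hg0 i1 hi1.1) (hf _ _)
    have := hsum hne
    omega
  have hcard := hb.fintype_card_le_finrank
  have h1 : (poles h⁻¹).degree = (Fintype.card ι : ℤ) := by
    rw [Fintype.card_sigma, Finsupp.degree_apply, ← Finset.sum_coe_sort]
    push_cast
    refine Finset.sum_congr rfl fun y _ => ?_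
    rw [Fintype.card_fin, he _ y.2, hp, max_eq_left (hSpos _ y.2).le]
  rw [h1]
  exact_mod_cast hcard

/-- The poles of `b` where `h` is regular are cancelled by powers of `h - h(y)`, which are
polynomials in `h`. -/
theorem exists_mul_ord_nonneg {h b : C.functionField}
    (hh : h ∉ Set.range (algebraMap ℂ C.functionField)) (hb : b ≠ 0) :
    ∃ q : ℂ⟮h⟯, q ≠ 0 ∧ ∀ y, 0 ≤ ord y h → 0 ≤ ord y ((q : C.functionField) * b) := by
  classical
  let T : Finset (ClosedPt C) := (finite_ord_ne_zero hb).toFinset.filter fun y => 0 ≤ ord y h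
  have hc : ∀ y : T, ∃ c : ℂ, 0 < ord y.1 (h - algebraMap ℂ _ c) := by
    intro y
    obtain ⟨c, hc⟩ := exists_ord_sub_pos y.1 (Finset.mem_filter.1 y.2).2
    exact ⟨c, hc.resolve_left fun h0 => hh ⟨c, h0.symm⟩⟩
  choose c hc using hc
  let q : ℂ⟮h⟯ := ∏ y : T, (IntermediateField.AdjoinSimple.gen ℂ h - algebraMap ℂ _ (c y)) ^
    (ord y.1 b).natAbs
  have hq : (q : C.functionField) = ∏ y : T, (h - algebraMap ℂ _ (c y)) ^ (ord y.1 b).natAbs := by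
    simp only [q]
    rw [← IntermediateField.algebraMap_apply, map_prod]
    simp
  have hne : ∀ y : T, (h - algebraMap ℂ _ (c y)) ^ (ord y.1 b).natAbs ≠ 0 := fun y =>
    pow_ne_zero _ (sub_ne_zero.2 fun h0 => hh ⟨c y, h0.symm⟩)
  have hq0 : (q : C.functionField) ≠ 0 := by
    rw [hq]
    exact Finset.prod_ne_zero_iff.2 fun y _ => hne y
  refine ⟨q, fun h0 => hq0 (by rw [h0]; rfl), fun y hy => ?_⟩
  rw [ord_mul y hq0 hb, hq, ord_prod _ _ _ fun z _ => hne z]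
  have hterm : ∀ z : T, 0 ≤ ord y ((h - algebraMap ℂ _ (c z)) ^ (ord z.1 b).natAbs) := by
    intro z
    rw [ord_pow]
    refine mul_nonneg (Int.natCast_nonneg _) ?_
    exact (Submodule.sub_mem (ordGE y 0) (fun _ => hy) (algebraMap_mem_ordGE y _))
      (sub_ne_zero.2 fun h0 => hh ⟨c z, h0.symm⟩)
  by_cases hyT : y ∈ T
  · have h1 := Finset.single_le_sum (fun z _ => hterm z) (Finset.mem_univ (⟨y, hyT⟩ : T))
    have h2 : ((ord y b).natAbs : ℤ) ≤ ord y ((h - algebraMap ℂ _ (c ⟨y, hyT⟩)) ^ (ord y b).natAbs) := by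
      rw [ord_pow]
      exact le_mul_of_one_le_right (Int.natCast_nonneg _) (hc ⟨y, hyT⟩)
    have h3 := neg_abs_le (ord y b)
    rw [Int.abs_eq_natAbs] at h3
    linarith
  · have h1 : ord y b = 0 := by
      by_contra h0
      exact hyT (by simp [T, h0, hy])
    rw [h1, add_zero]
    exact Finset.sum_nonneg fun z _ => hterm z

/-- Choose a basis of the function field over `ℂ(h)` whose elements have poles only at poles of `h`.
Multiplied by `h ^ a` with `a ≤ j`, its elements are independent over `ℂ`, and their poles are
bounded by a multiple `j + c` of those of `h`, with `c` independent of `j`. -/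
theorem exists_le_finrank_sections {h : C.functionField}
    (hh : h ∉ Set.range (algebraMap ℂ C.functionField)) :
    ∃ c : ℕ, ∀ j : ℕ, (j + 1) * Module.finrank ℂ⟮h⟯ C.functionField ≤
      Module.finrank ℂ (sections ((j + c) • poles h)) := by
  classical
  have := finiteDimensional_adjoin hh
  have hh0 : h ≠ 0 := by
    rintro rfl
    exact hh ⟨0, map_zero _⟩
  let b := Module.finBasis ℂ⟮h⟯ C.functionField
  choose q hq0 hq using fun i => exists_mul_ord_nonneg hh (b.ne_zero i)
  let b' : Fin (Module.finrank ℂ⟮h⟯ C.functionField) → C.functionField :=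
    (fun i => Units.mk0 (q i) (hq0 i)) • b
  have hb' : LinearIndependent ℂ⟮h⟯ b' := b.linearIndependent.units_smul _
  have hb'e : ∀ i, b' i = (q i : C.functionField) * b i := fun i => rfl
  have hb0 : ∀ i, b' i ≠ 0 := fun i => hb'.ne_zero i
  have hbound : ∀ i, ∃ c : ℕ, ∀ y, 0 ≤ ord y (b' i) + c * poles h y := by
    intro i
    refine ⟨∑ y ∈ (finite_ord_ne_zero (hb0 i)).toFinset, (ord y (b' i)).natAbs, fun y => ?_⟩
    by_cases hy : 0 ≤ ord y h
    · have h1 := hq i y hy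
      have h2 := poles_nonneg h y
      rw [← hb'e] at h1
      exact add_nonneg h1 (mul_nonneg (Int.natCast_nonneg _) h2)
    · by_cases hy0 : ord y (b' i) = 0
      · have h2 := poles_nonneg h y
        exact add_nonneg hy0.ge (mul_nonneg (Int.natCast_nonneg _) h2)
      · have h1 : (ord y (b' i)).natAbs ≤
            ∑ y ∈ (finite_ord_ne_zero (hb0 i)).toFinset, (ord y (b' i)).natAbs :=
          Finset.single_le_sum (f := fun y => (ord y (b' i)).natAbs) (fun _ _ => Nat.zero_le _)
            (by simpa using hy0)
        have h2 : 1 ≤ poles h y := by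
          rw [poles_apply]
          exact le_max_of_le_left (by omega)
        set n := ∑ y ∈ (finite_ord_ne_zero (hb0 i)).toFinset, (ord y (b' i)).natAbs
        have h3 := neg_abs_le (ord y (b' i))
        rw [Int.abs_eq_natAbs] at h3
        have h4 : (n : ℤ) ≤ n * poles h y := le_mul_of_one_le_right (Int.natCast_nonneg _) h2
        have h5 : ((ord y (b' i)).natAbs : ℤ) ≤ n := by exact_mod_cast h1
        linarith
  choose c hc using hbound
  refine ⟨∑ i, c i, fun j => ?_⟩
  have hpow : LinearIndependent ℂ (fun a : Fin (j + 1) =>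
      (IntermediateField.AdjoinSimple.gen ℂ h) ^ (a : ℕ)) := by
    have htr : Transcendental ℂ (IntermediateField.AdjoinSimple.gen ℂ h) := by
      intro halg
      refine transcendental_of_notMem_range hh ?_
      have := halg.algebraMap (A := C.functionField)
      rwa [IntermediateField.AdjoinSimple.algebraMap_gen] at this
    have h1 := (Polynomial.basisMonomials ℂ).linearIndependent.map'
      (Polynomial.aeval (R := ℂ) (IntermediateField.AdjoinSimple.gen ℂ h)).toLinearMap
      (LinearMap.ker_eq_bot.2 (transcendental_iff_injective.1 htr))
    have h2 := h1.comp (fun a : Fin (j + 1) => (a : ℕ)) Fin.val_injective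
    have h3 : (fun a : Fin (j + 1) => (IntermediateField.AdjoinSimple.gen ℂ h) ^ (a : ℕ)) =
        (⇑(Polynomial.aeval (R := ℂ) (IntermediateField.AdjoinSimple.gen ℂ h)).toLinearMap ∘
          ⇑(Polynomial.basisMonomials ℂ)) ∘ fun a : Fin (j + 1) => (a : ℕ) := by
      ext a
      simp [Polynomial.coe_basisMonomials]
    rw [h3]
    exact h2
  have hprod := linearIndependent_smul hpow hb'
  have hmem : ∀ p : Fin (j + 1) × Fin (Module.finrank ℂ⟮h⟯ C.functionField),
      (IntermediateField.AdjoinSimple.gen ℂ h) ^ (p.1 : ℕ) • b' p.2 ∈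
        sections ((j + ∑ i, c i) • poles h) := by
    intro p
    have h1 : (IntermediateField.AdjoinSimple.gen ℂ h) ^ (p.1 : ℕ) • b' p.2 =
      h ^ (p.1 : ℕ) * b' p.2 := rfl
    rw [h1, mem_sections]
    intro _ y
    rw [ord_mul y (pow_ne_zero _ hh0) (hb0 _), ord_pow]
    have h2 := hc p.2 y
    have h3 : (c p.2 : ℤ) ≤ ∑ i, (c i : ℤ) :=
      Finset.single_le_sum (f := fun i => (c i : ℤ)) (fun _ _ => Int.natCast_nonneg _)
        (Finset.mem_univ _)
    have h4 : -poles h y ≤ ord y h := by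
      rw [poles_apply]
      have := le_max_left (-ord y h) 0
      linarith
    have h5 : ((p.1 : ℕ) : ℤ) ≤ j := by exact_mod_cast Nat.lt_succ_iff.1 p.1.2
    have h6 := poles_nonneg h y
    have h7 : ((p.1 : ℕ) : ℤ) * -poles h y ≤ (p.1 : ℕ) * ord y h :=
      mul_le_mul_of_nonneg_left h4 (Int.natCast_nonneg _)
    have h8 : ((p.1 : ℕ) : ℤ) * poles h y ≤ j * poles h y := mul_le_mul_of_nonneg_right h5 h6
    have h9 : (c p.2 : ℤ) * poles h y ≤ (∑ i, (c i : ℤ)) * poles h y :=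
      mul_le_mul_of_nonneg_right h3 h6
    simp only [Finsupp.coe_smul, Pi.smul_apply, nsmul_eq_mul]
    push_cast
    linarith
  have hind : LinearIndependent ℂ (fun p : Fin (j + 1) × Fin (Module.finrank ℂ⟮h⟯ C.functionField) =>
      (⟨_, hmem p⟩ : sections ((j + ∑ i, c i) • poles h))) :=
    LinearIndependent.of_comp (Submodule.subtype _) hprod
  simpa using hind.fintype_card_le_finrank

theorem inv_notMem_range {h : C.functionField}
    (hh : h ∉ Set.range (algebraMap ℂ C.functionField)) :
    h⁻¹ ∉ Set.range (algebraMap ℂ C.functionField) := by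
  rintro ⟨c, hc⟩
  exact hh ⟨c⁻¹, by rw [map_inv₀, hc, inv_inv]⟩

theorem adjoin_inv (h : C.functionField) : ℂ⟮h⁻¹⟯ = ℂ⟮h⟯ := by
  apply le_antisymm
  · rw [IntermediateField.adjoin_simple_le_iff]
    exact inv_mem (IntermediateField.mem_adjoin_simple_self ℂ h)
  · rw [IntermediateField.adjoin_simple_le_iff]
    have := inv_mem (IntermediateField.mem_adjoin_simple_self ℂ h⁻¹)
    rwa [inv_inv] at this

/-- One inequality is the bound on zeros, for `h⁻¹`. For the other, multiples of the divisor of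
poles have at least `(j + 1) n` independent sections, and at most `(j + c) d + 1` since they are
effective; the growth in `j` is compared. -/
theorem degree_poles {h : C.functionField}
    (hh : h ∉ Set.range (algebraMap ℂ C.functionField)) :
    (poles h).degree = Module.finrank ℂ⟮h⟯ C.functionField := by
  apply le_antisymm
  · have := degree_poles_inv_le (inv_notMem_range hh)
    rwa [inv_inv, adjoin_inv] at this
  · obtain ⟨c, hc⟩ := exists_le_finrank_sections hh
    by_contra! hcon
    set n : ℤ := (Module.finrank ℂ⟮h⟯ C.functionField : ℤ)
    set d := (poles h).degree
    have h1 : ∀ j : ℕ, ((j : ℤ) + 1) * n ≤ (j + c) * d + 1 := by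
      intro j
      have h2 := finrank_sections_le (G := (j + c) • poles h) (nsmul_nonneg (poles_nonneg h) _)
      have h3 : (((j + 1) * Module.finrank ℂ⟮h⟯ C.functionField : ℕ) : ℤ) ≤
        (Module.finrank ℂ (sections ((j + c) • poles h)) : ℤ) := by exact_mod_cast hc j
      push_cast at h3
      rw [map_nsmul, nsmul_eq_mul] at h2
      push_cast at h2
      exact h3.trans h2
    have hd : 0 ≤ d := degree_nonneg (poles_nonneg h)
    -- For this `j`, the inequality together with `d + 1 ≤ n` reduces to `d + 1 ≤ 0`.
    have h2 := h1 (c * d.toNat + 1)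
    have h3 : (d.toNat : ℤ) = d := Int.toNat_of_nonneg hd
    push_cast at h2
    rw [h3] at h2
    have h4 : ((c : ℤ) * d + 1 + 1) * (d + 1) ≤ (c * d + 1 + 1) * n :=
      mul_le_mul_of_nonneg_left hcon (by positivity)
    nlinarith

/-- The zeros of `f` are the poles of `f⁻¹`, and `f` and `f⁻¹` generate the same subfield. -/
theorem degree_divisor (f : C.functionField) : (divisor f).degree = 0 := by
  by_cases hf : f ∈ Set.range (algebraMap ℂ C.functionField)
  · obtain ⟨c, rfl⟩ := hf
    have : divisor (algebraMap ℂ C.functionField c) = 0 := by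
      ext y
      by_cases hc : c = 0
      · simp [hc, ord_zero]
      · simp [ord_algebraMap y hc]
    rw [this, map_zero]
  · have h1 : divisor f + poles f = poles f⁻¹ := by
      ext y
      simp only [Finsupp.coe_add, Pi.add_apply, divisor_apply, poles_apply, ord_inv, neg_neg]
      rcases le_total (ord y f) 0 with h | h
      · rw [max_eq_left (by omega), max_eq_right h]
        omega
      · rw [max_eq_right (by omega), max_eq_left h]
        omega
    have h2 := congrArg Finsupp.degree h1
    rw [map_add, degree_poles hf, degree_poles (inv_notMem_range hf), adjoin_inv] at h2
    omega

theorem defect_add_divisor (G : ClosedPt C →₀ ℤ) {f : C.functionField} (hf : f ≠ 0) :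
    defect (G + divisor f) = defect G := by
  rw [defect, defect, finrank_sections_add_divisor G hf, map_add, degree_divisor, add_zero]

theorem exists_le_add_divisor {G G' : ClosedPt C →₀ ℤ} (h : sections (G' - G) ≠ ⊥) :
    ∃ f : C.functionField, f ≠ 0 ∧ G ≤ G' + divisor f := by
  obtain ⟨f, hf, hf0⟩ := Submodule.exists_mem_ne_zero_of_ne_bot h
  refine ⟨f, hf0, fun y => ?_⟩
  have := mem_sections.1 hf hf0 y
  simp only [Finsupp.coe_sub, Pi.sub_apply, Finsupp.coe_add, Pi.add_apply, divisor_apply] at this ⊢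
  linarith

variable (C) in
theorem exists_notMem_range_algebraMap :
    ∃ h : C.functionField, h ∉ Set.range (algebraMap ℂ C.functionField) := by
  obtain ⟨y⟩ : Nonempty (ClosedPt C) := inferInstance
  obtain ⟨π, hπ, hπ1⟩ := exists_ord_eq_one y
  refine ⟨π, ?_⟩
  rintro ⟨c, rfl⟩
  rw [ord_algebraMap y (by rintro rfl; simp at hπ)] at hπ1
  omega

variable (C) in
/-- Riemann's inequality. -/
theorem exists_defect_le : ∃ c : ℤ, ∀ G : ClosedPt C →₀ ℤ, defect G ≤ c := by
  obtain ⟨h, hh⟩ := exists_notMem_range_algebraMap C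
  obtain ⟨c, hc⟩ := exists_le_finrank_sections hh
  have := finiteDimensional_adjoin hh
  set n : ℤ := (Module.finrank ℂ⟮h⟯ C.functionField : ℤ) with hn
  have hn1 : 1 ≤ n := by
    have : 0 < Module.finrank ℂ⟮h⟯ C.functionField := Module.finrank_pos
    omega
  have hl : ∀ j : ℕ, ((j : ℤ) + 1) * n ≤ Module.finrank ℂ (sections ((j + c) • poles h)) := by
    intro j
    have := hc j
    rw [hn]
    exact_mod_cast this
  refine ⟨c * n, fun G => ?_⟩
  have hG : G ≤ G ⊔ 0 := le_sup_left
  refine (defect_mono hG).trans ?_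
  set G' := G ⊔ 0
  have hG' : 0 ≤ G'.degree := degree_nonneg le_sup_right
  set j := G'.degree.toNat with hj
  have hj' : (j : ℤ) = G'.degree := Int.toNat_of_nonneg hG'
  -- Subtracting `G'`, effective of degree `j`, lowers the dimension by at most `j`, and at least `j
  -- + 1` sections are available. So, up to linear equivalence, `G'` lies below a multiple of the
  -- poles of `h`.
  have hne : sections ((j + c) • poles h - G') ≠ ⊥ := by
    intro h0
    have h1 : defect ((j + c) • poles h - G') ≤ defect ((j + c) • poles h) :=
      defect_mono (sub_le_self _ le_sup_right)
    rw [defect, defect, h0, finrank_bot, map_sub] at h1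
    have h2 := hl j
    have h3 : ((j : ℤ) + 1) * 1 ≤ (j + 1) * n := mul_le_mul_of_nonneg_left hn1 (by positivity)
    push_cast at h1
    linarith
  obtain ⟨f, hf0, hf⟩ := exists_le_add_divisor hne
  refine (defect_mono hf).trans ?_
  rw [defect_add_divisor _ hf0, defect, map_nsmul, degree_poles hh, nsmul_eq_mul]
  have h2 := hl j
  push_cast
  linarith

variable (C) in
/-- Divisors of large degree have the largest possible defect. -/
theorem exists_defect_eq : ∃ d g : ℤ, ∀ G : ClosedPt C →₀ ℤ, d ≤ G.degree → defect G = g := by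
  obtain ⟨c, hc⟩ := exists_defect_le C
  obtain ⟨g, ⟨G₀, hG₀⟩, hg⟩ := Int.exists_greatest_of_bdd (P := fun g => ∃ G : ClosedPt C →₀ ℤ,
    defect G = g) ⟨c, by rintro _ ⟨G, rfl⟩; exact hc G⟩ ⟨_, 0, rfl⟩
  refine ⟨G₀.degree + c + 1, g, fun G hG => le_antisymm (hg _ ⟨G, rfl⟩) ?_⟩
  -- `G₀` has the largest defect. If `G - G₀` had no section, its defect would be its degree, which
  -- exceeds the bound `c`.
  have hne : sections (G - G₀) ≠ ⊥ := by
    intro h0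
    have h1 := hc (G - G₀)
    rw [defect, h0, finrank_bot, map_sub] at h1
    push_cast at h1
    linarith
  obtain ⟨f, hf0, hf⟩ := exists_le_add_divisor hne
  have := defect_mono hf
  rwa [hG₀, defect_add_divisor _ hf0] at this

/-- Multiples of a divisor of positive degree have sections with prescribed behaviour. -/
theorem exists_section_of_degree_pos {G : ClosedPt C →₀ ℤ} (hG : 0 < G.degree) (y : ClosedPt C)
    (B : Finset (ClosedPt C)) (hy : y ∉ B) :
    ∃ k₀ : ℕ, ∀ k : ℕ, k₀ ≤ k → ∃ f : C.functionField, f ≠ 0 ∧ (∀ z, 0 ≤ ord z f + k * G z) ∧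
      ord y f + k * G y = 0 ∧ ∀ z ∈ B, 0 < ord z f + k * G z := by
  classical
  obtain ⟨d, g, hdg⟩ := exists_defect_eq C
  let β : ClosedPt C →₀ ℤ := ∑ z ∈ B, Finsupp.single z 1
  have hβ : ∀ z, β z = if z ∈ B then 1 else 0 := by
    intro z
    simp [β, Finsupp.finsetSum_apply, Finsupp.single_apply]
  -- Past this bound, `k G - β` and `k G - β - y` both have the maximal defect, so the first has one
  -- more section than the second; such a section has the exact order at `y` and vanishes along `B`.
  refine ⟨(β.degree + 1 + d).toNat, fun k hk => ?_⟩
  have hk' : β.degree + 1 + d ≤ k := Int.toNat_le.1 hk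
  have hkG : (k : ℤ) ≤ k * G.degree := le_mul_of_one_le_right (Int.natCast_nonneg _) hG
  have h1 := hdg (k • G - β) (by
    rw [map_sub, map_nsmul, nsmul_eq_mul]
    linarith)
  have h2 := hdg (k • G - β - .single y 1) (by
    rw [map_sub, map_sub, map_nsmul, nsmul_eq_mul, Finsupp.degree_single]
    linarith)
  have h3 : ¬ sections (k • G - β) ≤ sections (k • G - β - .single y 1) := by
    intro hle
    have h4 := Submodule.finrank_mono hle
    rw [defect] at h1 h2
    rw [map_sub _ _ (Finsupp.single y (1 : ℤ)), Finsupp.degree_single] at h2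
    omega
  obtain ⟨f, hf, hf'⟩ := SetLike.not_le_iff_exists.1 h3
  have hf0 : f ≠ 0 := by
    rintro rfl
    exact hf' (Submodule.zero_mem _)
  have h4 := mem_sections.1 hf hf0
  simp only [Finsupp.sub_apply, Finsupp.smul_apply, nsmul_eq_mul, hβ] at h4
  refine ⟨f, hf0, fun z => ?_, ?_, fun z hz => ?_⟩
  · have := h4 z
    split_ifs at this <;> linarith
  · by_contra hcon
    refine hf' (mem_sections.2 fun _ z => ?_)
    have h5 := h4 z
    simp only [Finsupp.sub_apply, Finsupp.smul_apply, nsmul_eq_mul, hβ]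
    by_cases hz : z = y
    · subst hz
      rw [if_neg hy] at h5 ⊢
      rw [Finsupp.single_eq_same]
      omega
    · rw [Finsupp.single_eq_of_ne hz]
      omega
  · have := h4 z
    rw [if_pos hz] at this
    linarith

end Riemann

namespace PolyhedralDivisor

/-! ### Homogeneous elements cutting out a face of a polyhedral divisor -/

section Separating

open Filter

variable {C : Scheme.{0}} [C.Over SpecC] [IsSmoothProjectiveCurve C]
  {M : Type} [AddCommGroup M] {D D' D'' : PolyhedralDivisor C M}

theorem mem_piece_iff {m : M} {f : C.functionField} :
    f ∈ D.piece m ↔ (f ≠ 0 → D.MemDual m ∧ ∀ y, ∀ v ∈ D.coeff y, 0 ≤ (ord y f : ℚ) + v m) := by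
  refine forall_congr' fun _ => and_congr_right fun hm => ⟨fun h y v hv => ?_, fun h y hy => ?_⟩
  · have h1 := h y (mem_locus_of_mem_coeff hv)
    have h2 := Int.floor_le (D.eval m y)
    have h3 := eval_le hm hv
    have h4 : (0 : ℚ) ≤ ord y f + ⌊D.eval m y⌋ := by exact_mod_cast h1
    linarith
  · obtain ⟨v, hv, hvm⟩ := exists_eq_eval hm hy
    have h1 := h y v hv
    rw [hvm] at h1
    have h2 : -ord y f ≤ ⌊D.eval m y⌋ := by
      rw [Int.le_floor]
      push_cast
      linarith
    linarith

/-- If `g χ^m'` is regular where `f χ^m` is invertible, then it becomes regular when it is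
multiplied by a power of `f χ^m`. -/
theorem eventually_pow_mul_mem_piece {m m' : M} {f g : C.functionField} (hf : f ≠ 0)
    (hm : D.MemDual m) (hfm : ∀ y, ∀ v ∈ D.coeff y, 0 ≤ (ord y f : ℚ) + v m)
    (htail : ∀ w ∈ D.tail, w m = 0 → 0 ≤ w m')
    (hcoeff : g ≠ 0 → ∀ y, ∀ v ∈ D.coeff y, (ord y f : ℚ) + v m = 0 → 0 ≤ (ord y g : ℚ) + v m') :
    ∀ᶠ r : ℕ in atTop, f ^ r * g ∈ D.piece (r • m + m') := by
  classical
  by_cases hg : g = 0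
  · simp [hg]
  have hlarge : ∀ a b : ℚ, 0 ≤ a → (a = 0 → 0 ≤ b) → ∀ᶠ r : ℕ in atTop, 0 ≤ r * a + b := by
    intro a b ha hab
    rcases ha.eq_or_lt with h0 | h0
    · refine Eventually.of_forall fun r => ?_
      have := hab h0.symm
      rw [← h0]
      simpa using this
    · obtain ⟨n, hn⟩ := exists_nat_ge (-b / a)
      filter_upwards [eventually_ge_atTop n] with r hr
      have h1 : (n : ℚ) ≤ r := by exact_mod_cast hr
      have h2 := (div_le_iff₀ h0).1 (hn.trans h1)
      linarith
  obtain ⟨S, hS, hSm⟩ := D.exists_finset_tail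
  have h1 : ∀ᶠ r : ℕ in atTop, D.MemDual (r • m + m') := by
    have : ∀ᶠ r : ℕ in atTop, ∀ w ∈ S, 0 ≤ r * w m + w m' :=
      (eventually_all_finset S).2 fun w hw => hlarge _ _ (hm w (hS hw)) (htail w (hS hw))
    filter_upwards [this] with r hr
    refine hSm _ fun w hw => ?_
    rw [map_add, map_nsmul, nsmul_eq_mul]
    exact hr w hw
  -- Outside this finite set the coefficient is the tail, or empty, and `f`, `g` have order zero, so
  -- that membership of the degree in the dual cone suffices. At the remaining points it is enough
  -- to test finitely many elements of the coefficient.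
  have hBfin : ({y | y.1 ∈ D.locus ∧ D.coeff y ≠ (D.tail : Set (NQ M))} ∪ {y | ord y f ≠ 0} ∪
      {y | ord y g ≠ 0}).Finite :=
    (D.finite_special.union (finite_ord_ne_zero hf)).union (finite_ord_ne_zero hg)
  have hP : ∀ y : ClosedPt C, ∃ P : Finset (NQ M), (P : Set (NQ M)) ⊆ D.coeff y ∧
      (∀ m, D.MemDual m → ∀ v ∈ D.coeff y, ∃ p ∈ P, p m ≤ v m) := by
    intro y
    by_cases hy : y.1 ∈ D.locus
    · exact exists_finset_coeff hy
    · exact ⟨∅, by simp, by simp [D.coeff_of_notMem y hy]⟩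
  choose P hPs hP using hP
  have h2 : ∀ᶠ r : ℕ in atTop, ∀ y ∈ hBfin.toFinset, ∀ v ∈ P y,
      0 ≤ r * ((ord y f : ℚ) + v m) + ((ord y g : ℚ) + v m') :=
    (eventually_all_finset _).2 fun y _ => (eventually_all_finset _).2 fun v hv =>
      hlarge _ _ (hfm y v (hPs y hv)) (hcoeff hg y v (hPs y hv))
  filter_upwards [h1, h2] with r hr1 hr2
  refine mem_piece_iff.2 fun _ => ⟨hr1, fun y v hv => ?_⟩
  rw [ord_mul y (pow_ne_zero _ hf) hg, ord_pow]
  push_cast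
  by_cases hy : y ∈ hBfin.toFinset
  · obtain ⟨p, hp, hpv⟩ := hP y _ hr1 v hv
    have := hr2 y hy p hp
    simp only [map_add, map_nsmul, nsmul_eq_mul] at hpv ⊢
    linarith
  · rw [Set.Finite.mem_toFinset] at hy
    simp only [Set.mem_union, Set.mem_ofPred_eq, not_or, not_and, not_not] at hy
    rw [hy.1.2, hy.2]
    have h3 := hy.1.1 (mem_locus_of_mem_coeff hv)
    rw [h3] at hv
    have := hr1 v hv
    simpa using this

/-- `f χ^m` is a homogeneous regular function on `X(D)` whose non-vanishing locus is contained in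
`X(D'')`. -/
structure IsSeparating (D D'' : PolyhedralDivisor C M) (m : M) (f : C.functionField) : Prop where
  ne_zero : f ≠ 0
  memDual : D.MemDual m
  nonneg : ∀ y, ∀ v ∈ D.coeff y, 0 ≤ (ord y f : ℚ) + v m
  mem_tail : ∀ w ∈ D.tail, w m = 0 → w ∈ D''.tail
  mem_coeff : ∀ y, ∀ v ∈ D.coeff y, (ord y f : ℚ) + v m = 0 → v ∈ D''.coeff y

theorem IsSeparating.mem_piece {m : M} {f : C.functionField} (h : D.IsSeparating D'' m f) :
    f ∈ D.piece m :=
  mem_piece_iff.2 fun _ => ⟨h.memDual, h.nonneg⟩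

/-- A sum of nonnegative numbers is zero only if both are, so a product separates the intersection.
-/
theorem IsSeparating.mul {D₁ D₂ : PolyhedralDivisor C M} {m m' : M} {f g : C.functionField}
    (hf : D.IsSeparating D₁ m f) (hg : D.IsSeparating D₂ m' g)
    (ht : D₁.tail ⊓ D₂.tail ≤ D''.tail) (hc : ∀ y, D₁.coeff y ∩ D₂.coeff y ⊆ D''.coeff y) :
    D.IsSeparating D'' (m + m') (f * g) where
  ne_zero := mul_ne_zero hf.ne_zero hg.ne_zero
  memDual := hf.memDual.add hg.memDual
  nonneg y v hv := by
    have h1 := hf.nonneg y v hv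
    have h2 := hg.nonneg y v hv
    rw [ord_mul y hf.ne_zero hg.ne_zero, map_add]
    push_cast
    linarith
  mem_tail w hw h := by
    have h1 := hf.memDual w hw
    have h2 := hg.memDual w hw
    rw [map_add] at h
    exact ht ⟨hf.mem_tail w hw (by linarith), hg.mem_tail w hw (by linarith)⟩
  mem_coeff y v hv h := by
    have h1 := hf.nonneg y v hv
    have h2 := hg.nonneg y v hv
    rw [ord_mul y hf.ne_zero hg.ne_zero, map_add] at h
    push_cast at h
    exact hc y ⟨hf.mem_coeff y v hv (by linarith), hg.mem_coeff y v hv (by linarith)⟩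

theorem IsSeparating.eventually_pow_mul_mem_piece {m m' : M} {f g : C.functionField}
    (h : D.IsSeparating D'' m f) (hg : g ∈ D''.piece m') :
    ∀ᶠ r : ℕ in atTop, f ^ r * g ∈ D.piece (r • m + m') := by
  by_cases hg0 : g = 0
  · simp [hg0]
  · have h1 := mem_piece_iff.1 hg hg0
    exact PolyhedralDivisor.eventually_pow_mul_mem_piece h.ne_zero h.memDual h.nonneg
      (fun w hw hwm => h1.1 w (h.mem_tail w hw hwm))
      fun _ y v hv hvm => h1.2 y v (h.mem_coeff y v hv hvm)

theorem single_mem_algebra {m : M} {f : C.functionField} (hf : f ∈ D.piece m) :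
    AddMonoidAlgebra.single m f ∈ D.algebra := by
  classical
  intro m'
  by_cases h : m = m'
  · subst h
    simpa using hf
  · simp [h]

/-- This places `A(D'')` inside the localization of `A(D)` at `f χ^m`; one exponent serves the
finitely many homogeneous components. -/
theorem IsSeparating.exists_pow_mul_mem_algebra {m : M} {f : C.functionField}
    (h : D.IsSeparating D'' m f) {a : AddMonoidAlgebra C.functionField M} (ha : a ∈ D''.algebra) :
    ∃ r : ℕ, AddMonoidAlgebra.single m f ^ r * a ∈ D.algebra := by
  classical
  have h1 : ∀ᶠ r : ℕ in atTop, ∀ m' ∈ a.coeff.support, f ^ r * a.coeff m' ∈ D.piece (r • m + m') :=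
    (eventually_all_finset _).2 fun m' _ => h.eventually_pow_mul_mem_piece (ha m')
  obtain ⟨r, hr⟩ := h1.exists
  refine ⟨r, ?_⟩
  have h2 : a = ∑ m' ∈ a.coeff.support, AddMonoidAlgebra.single m' (a.coeff m') := by
    ext m'
    simp [AddMonoidAlgebra.coeff_sum, Finsupp.finsetSum_apply, Finsupp.single_apply]
    try tauto
  rw [h2, Finset.mul_sum, AddMonoidAlgebra.single_pow]
  refine Subalgebra.sum_mem _ fun m' hm' => ?_
  rw [AddMonoidAlgebra.single_mul_single]
  exact single_mem_algebra (hr m' hm')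

end Separating

end PolyhedralDivisor

/-! ### Degrees, and separating elements for open faces -/

namespace PolyhedralDivisor

section Degree

variable {C : Scheme.{0}} {M : Type} [AddCommGroup M] {D D'' : PolyhedralDivisor C M}

theorem mem_deg_iff {x : NQ M} :
    x ∈ D.deg ↔ D.locus = ⊤ ∧ ∃ w : ClosedPt C →₀ NQ M, (∀ y, w y ∈ D.coeff y) ∧ w.degree = x :=
  Iff.rfl

/-- Choices made point by point become a finitely supported family, and so yield an element of the
degree, if `0` is chosen wherever the coefficient is the tail. -/
theorem exists_finsupp_coeff (htop : D.locus = ⊤) {p : ClosedPt C → NQ M → Prop}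
    (hp : ∀ y, ∃ v ∈ D.coeff y, p y v) (hp0 : ∀ y, D.coeff y = (D.tail : Set (NQ M)) → p y 0) :
    ∃ w : ClosedPt C →₀ NQ M, ∀ y, w y ∈ D.coeff y ∧ p y (w y) := by
  classical
  choose v hv hpv using hp
  let w : ClosedPt C → NQ M := fun y => if D.coeff y = (D.tail : Set (NQ M)) then 0 else v y
  have hw : (Function.support w).Finite := by
    refine D.finite_special.subset fun y hy => ⟨htop ▸ trivial, fun h => hy ?_⟩
    simp [w, h]
  refine ⟨Finsupp.ofSupportFinite w hw, fun y => ?_⟩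
  change w y ∈ D.coeff y ∧ p y (w y)
  by_cases h : D.coeff y = (D.tail : Set (NQ M))
  · have h0 : w y = 0 := by simp [w, h]
    rw [h0]
    exact ⟨h ▸ D.tail.zero_mem, hp0 y h⟩
  · have h0 : w y = v y := by simp [w, h]
    rw [h0]
    exact ⟨hv y, hpv y⟩

theorem exists_finsupp_coeff_update {w : ClosedPt C →₀ NQ M} (hw : ∀ y, w y ∈ D.coeff y)
    {y : ClosedPt C} {v : NQ M} (hv : v ∈ D.coeff y) :
    ∃ w' : ClosedPt C →₀ NQ M, (∀ z, w' z ∈ D.coeff z) ∧ w' y = v ∧ (∀ z, z ≠ y → w' z = w z) ∧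
      w'.degree = w.degree + (v - w y) := by
  classical
  refine ⟨w + Finsupp.single y (v - w y), fun z => ?_, by simp, fun z hz => ?_, by
    rw [map_add, Finsupp.degree_single]⟩
  · by_cases hz : z = y
    · subst hz
      simpa using hv
    · simpa [Finsupp.single_eq_of_ne hz] using hw z
  · simp [Finsupp.single_eq_of_ne hz]

theorem degree_apply_eq_sum (w : ClosedPt C →₀ NQ M) (m : M) :
    w.degree m = ∑ z ∈ w.support, w z m := by
  rw [Finsupp.degree_apply, AddMonoidHom.finsetSum_apply]

theorem eval_of_notMem (m : M) {y : ClosedPt C} (hy : y.1 ∉ D.locus) : D.eval m y = 0 := by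
  rw [eval, dif_neg]
  rintro ⟨q, ⟨v, hv, -⟩, -⟩
  exact hy (mem_locus_of_mem_coeff hv)

/-- A linear form which vanishes on the tail attains its maximum on the coefficients. -/
theorem exists_coeff_max {m : M} (hm : ∀ w ∈ D.tail, w m = 0) {y : ClosedPt C}
    (hy : y.1 ∈ D.locus) : ∃ v ∈ D.coeff y, ∀ u ∈ D.coeff y, u m ≤ v m := by
  have h1 : D.MemDual (-m) := fun w hw => by rw [map_neg, hm w hw, neg_zero]
  obtain ⟨v, hv, hvm⟩ := exists_eq_eval h1 hy
  refine ⟨v, hv, fun u hu => ?_⟩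
  have := eval_le h1 hu
  rw [← hvm, map_neg, map_neg] at this
  linarith

end Degree

section OpenFace

variable {C : Scheme.{0}} [C.Over SpecC] [IsSmoothProjectiveCurve C]
  {M : Type} [AddCommGroup M] {D D' D'' : PolyhedralDivisor C M}

theorem locus_eq_top_of_le (hle : D'' ≤ D) (htop : D''.locus = ⊤) : D.locus = ⊤ := by
  by_contra h
  obtain ⟨y, hy⟩ := exists_closedPt_notMem h
  obtain ⟨v, hv⟩ := coeff_nonempty (D := D'') (y := y) (htop ▸ trivial)
  exact hy (mem_locus_of_mem_coeff (hle.2 y hv))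

theorem Proper.of_locus_eq_top (h : D.Proper) (htop : D.locus = ⊤) :
    D.deg ⊂ (D.tail : Set (NQ M)) ∧
      ∀ m : M, D.MemDual m → IsLeast ((fun v : NQ M => v m) '' D.deg) 0 →
        ∃ r : ℕ, 0 < r ∧ ∃ f : C.functionField, f ≠ 0 ∧
          ∀ y : ClosedPt C, (ord y f : ℚ) = D.eval (r • m) y := by
  rcases h with h | h
  · rw [htop] at h
    exact absurd h not_isAffineOpen_top
  · exact h.2

/-- The conditions on `D''` and `D` under which `X(D'')` is an open subset of `X(D)`. -/
structure IsOpenFace (D D'' : PolyhedralDivisor C M) : Prop where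
  le : D'' ≤ D
  face : ∀ y : ClosedPt C, y.1 ∈ D''.locus → IsFace (D''.coeff y) (D.coeff y)
  proper : D.Proper
  deg : D.locus = ⊤ → D.deg ∩ (D''.tail : Set (NQ M)) = D''.deg
  locus : D''.locus = ⊤ ∨ IsAffineOpen D''.locus

/-- A multiple of `D(m)` extends to an integral divisor of positive degree. -/
theorem exists_divisor_degree_pos {m : M} (hm : D.MemDual m)
    (hpos : D.locus = ⊤ → ∀ w ∈ D.deg, 0 < w m) :
    ∃ (k : ℕ) (G : ClosedPt C →₀ ℤ), 0 < k ∧ 0 < G.degree ∧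
      ∀ y : ClosedPt C, y.1 ∈ D.locus → (G y : ℚ) = k * D.eval m y := by
  classical
  -- A common denominator of the values at the special points; elsewhere they are zero.
  let k : ℕ := ∏ y ∈ D.finite_special.toFinset, (D.eval m y).den
  have hk : 0 < k := Finset.prod_pos fun y _ => (D.eval m y).den_pos
  have hk' : (0 : ℚ) < k := by exact_mod_cast hk
  have hsp : ∀ y, y ∉ D.finite_special.toFinset → D.eval m y = 0 := by
    intro y hy
    rw [Set.Finite.mem_toFinset, Set.mem_ofPred_eq, not_and, not_not] at hy
    by_cases hyl : y.1 ∈ D.locus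
    · exact eval_eq_zero hm (hy hyl)
    · exact eval_of_notMem m hyl
  have hint : ∀ y, ∃ n : ℤ, (n : ℚ) = k * D.eval m y := by
    intro y
    by_cases hy : y ∈ D.finite_special.toFinset
    · obtain ⟨c, hc⟩ := Finset.dvd_prod_of_mem (fun y => (D.eval m y).den) hy
      refine ⟨c * (D.eval m y).num, ?_⟩
      have h1 : (k : ℚ) = (D.eval m y).den * c := by exact_mod_cast hc
      rw [h1]
      push_cast
      conv_rhs => rw [mul_comm ((D.eval m y).den : ℚ), mul_assoc, Rat.den_mul_eq_num]
    · exact ⟨0, by rw [hsp y hy]; simp⟩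
  choose n hn using hint
  have hn0 : ∀ y, D.eval m y = 0 → n y = 0 := fun y hy => by
    have := hn y
    rw [hy, mul_zero] at this
    exact_mod_cast this
  let G : ClosedPt C →₀ ℤ := Finsupp.ofSupportFinite n
    (D.finite_special.subset fun y hy => by
      by_contra hcon
      exact hy (hn0 y (hsp y (by simpa using hcon))))
  have hG : ∀ y, (G y : ℚ) = k * D.eval m y := hn
  by_cases htop : D.locus = ⊤
  · refine ⟨k, G, hk, ?_, fun y _ => hG y⟩
    -- Points where `m` is minimal on each coefficient add up to an element of the degree on which
    -- `m` takes the value `deg D(m)`.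
    obtain ⟨w, hw⟩ := exists_finsupp_coeff htop (p := fun y v => v m = D.eval m y)
      (fun y => exists_eq_eval hm (htop ▸ trivial)) (fun y hy => by
        rw [eval_eq_zero hm hy]
        rfl)
    have hwd : w.degree ∈ D.deg := mem_deg_iff.2 ⟨htop, w, fun y => (hw y).1, rfl⟩
    have h1 : (G.degree : ℚ) = k * w.degree m := by
      rw [degree_apply_eq_sum, Finsupp.degree_apply, Finset.mul_sum]
      push_cast
      rw [Finset.sum_subset (s₂ := w.support)]
      · exact Finset.sum_congr rfl fun y _ => by rw [hG, (hw y).2]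
      · intro y hy
        rw [Finsupp.mem_support_iff] at hy ⊢
        intro h0
        refine hy (hn0 y ?_)
        rw [← (hw y).2, h0]
        rfl
      · intro y _ hy
        rw [Finsupp.notMem_support_iff.1 hy]
        rfl
    have h2 : 0 < w.degree m := hpos htop _ hwd
    have h3 : (0 : ℚ) < G.degree := by
      rw [h1]
      exact mul_pos hk' h2
    exact_mod_cast h3
  · obtain ⟨p, hp⟩ := exists_closedPt_notMem htop
    -- Only the values on the locus are prescribed, so a missing point `p` can carry any degree.
    refine ⟨k, G + Finsupp.single p (|G.degree| + 1), hk, ?_, fun y hy => ?_⟩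
    · rw [map_add, Finsupp.degree_single]
      have := neg_abs_le G.degree
      linarith
    · have : y ≠ p := fun h0 => hp (h0 ▸ hy)
      rw [Finsupp.add_apply, Finsupp.single_eq_of_ne this, add_zero, hG]

/-- A multiple of `D(m)` has a section which does not vanish at a given point. -/
theorem Proper.exists_mem_piece_ord_eq (h : D.Proper) {m : M} (hm : D.MemDual m) {y : ClosedPt C}
    (hy : y.1 ∈ D.locus) : ∃ (k : ℕ) (f : C.functionField), 0 < k ∧ f ≠ 0 ∧ f ∈ D.piece (k • m) ∧
      (ord y f : ℚ) = -(k * D.eval m y) := by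
  -- Either Riemann's inequality applies to a divisor of positive degree, or the minimum of `m` on
  -- the degree is zero and properness makes a multiple of `D(m)` principal.
  by_cases hpos : D.locus = ⊤ → ∀ w ∈ D.deg, 0 < w m
  · obtain ⟨k₀, G, hk₀, hGdeg, hG⟩ := exists_divisor_degree_pos hm hpos
    obtain ⟨k₁, hk₁⟩ := exists_section_of_degree_pos hGdeg y ∅ (by simp)
    obtain ⟨f, hf, hfnn, hfy, -⟩ := hk₁ (k₁ + 1) (Nat.le_succ _)
    refine ⟨(k₁ + 1) * k₀, f, Nat.mul_pos (Nat.succ_pos _) hk₀, hf,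
      mem_piece_iff.2 fun _ => ⟨hm.nsmul _, fun z v hv => ?_⟩, ?_⟩
    · have h1 : (0 : ℚ) ≤ ord z f + (k₁ + 1 : ℕ) * G z := by exact_mod_cast hfnn z
      rw [hG z (mem_locus_of_mem_coeff hv)] at h1
      have h2 := mul_le_mul_of_nonneg_left (eval_le hm hv)
        (Nat.cast_nonneg (α := ℚ) ((k₁ + 1) * k₀))
      rw [map_nsmul, nsmul_eq_mul]
      rw [Nat.cast_mul, mul_assoc] at h2
      rw [Nat.cast_mul, mul_assoc]
      linarith
    · have h1 : (ord y f : ℚ) + (k₁ + 1 : ℕ) * G y = 0 := by exact_mod_cast hfy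
      rw [hG y hy] at h1
      rw [Nat.cast_mul, mul_assoc]
      linarith
  · push Not at hpos
    obtain ⟨htop, w, hw, hwm⟩ := hpos
    obtain ⟨hdt, hprin⟩ := h.of_locus_eq_top htop
    obtain ⟨r, hr, f, hf, hord⟩ := hprin m hm ⟨⟨w, hw, le_antisymm hwm (hm w (hdt.1 hw))⟩, by
      rintro _ ⟨x, hx, rfl⟩
      exact hm x (hdt.1 hx)⟩
    have hord' : ∀ z, (ord z f⁻¹ : ℚ) = -(r * D.eval m z) := fun z => by
      rw [ord_inv, ← eval_nsmul hm r (htop ▸ trivial), ← hord]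
      push_cast
      rfl
    refine ⟨r, f⁻¹, hr, inv_ne_zero hf, mem_piece_iff.2 fun _ => ⟨hm.nsmul r, fun z v hv => ?_⟩,
      hord' y⟩
    rw [hord', map_nsmul, nsmul_eq_mul]
    have h2 := mul_le_mul_of_nonneg_left (eval_le hm hv) (Nat.cast_nonneg (α := ℚ) r)
    linarith

variable [Module.Free ℤ M] [Module.Finite ℤ M]

/-- Let `m` cut out the face at one point `y₀`. The condition on degrees forces the same `m` to cut
out the faces at all points and to have minimum zero on the degree of `D`. Properness then makes a
multiple of `D(m)` principal, which gives a separating element invertible on `X(D'')`. -/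
theorem IsOpenFace.exists_isSeparating_of_locus_eq_top (h : D.IsOpenFace D'')
    (htop : D''.locus = ⊤) :
    ∃ m f, D.IsSeparating D'' m f ∧ f⁻¹ ∈ D''.piece (-m) := by
  have htop' := locus_eq_top_of_le h.le htop
  have hdeg := h.deg htop'
  obtain ⟨hdt, hprin⟩ := h.proper.of_locus_eq_top htop'
  have hloc : ∀ y : ClosedPt C, y.1 ∈ D''.locus := fun y => htop ▸ trivial
  have hm : ∀ y : ClosedPt C, ∃ m, D.MemDual m ∧
      (∀ v, v ∈ D''.coeff y ↔ v ∈ D.coeff y ∧ v m = D.eval m y) ∧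
      ∀ w, w ∈ D''.tail ↔ w ∈ D.tail ∧ w m = 0 := fun y =>
    exists_memDual_of_isFace h.le (hloc y) (h.face y (hloc y))
  choose my hmy hmyc hmyt using hm
  obtain ⟨y₀⟩ : Nonempty (ClosedPt C) := inferInstance
  set m := my y₀
  have hmd : D.MemDual m := hmy y₀
  have hmt := hmyt y₀
  obtain ⟨w₀, hw₀⟩ := exists_finsupp_coeff (D := D'') htop (p := fun _ _ => True)
    (fun y => (coeff_nonempty (hloc y)).imp fun v hv => ⟨hv, trivial⟩) fun _ _ => trivial
  have hzero : ∀ w : ClosedPt C →₀ NQ M, (∀ y, w y ∈ D''.coeff y) → w.degree m = 0 := by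
    intro w hw
    have : w.degree ∈ D''.deg := mem_deg_iff.2 ⟨htop, w, hw, rfl⟩
    rw [← hdeg] at this
    exact ((hmt _).1 this.2).2
  have hnn : ∀ w : ClosedPt C →₀ NQ M, (∀ y, w y ∈ D.coeff y) → 0 ≤ w.degree m := fun w hw =>
    hmd _ (hdt.1 (mem_deg_iff.2 ⟨htop', w, hw, rfl⟩))
  -- `m` vanishes on `D''.deg`. If a component at `y` were not minimal for `m`, replacing it by a
  -- minimal one would give an element of `D.deg`, hence of the tail, with a negative value.
  have hmin : ∀ y, ∀ v ∈ D''.coeff y, v m = D.eval m y := by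
    intro y v hv
    refine le_antisymm ?_ (eval_le hmd (h.le.2 y hv))
    obtain ⟨w, hw, hwy, -, -⟩ := exists_finsupp_coeff_update (fun y => (hw₀ y).1) hv
    obtain ⟨v', hv', hvm'⟩ := exists_eq_eval hmd (y := y) (htop' ▸ trivial)
    obtain ⟨w', hw', -, -, hwd⟩ := exists_finsupp_coeff_update (fun y => h.le.2 y (hw y)) hv'
    have h1 := hnn w' hw'
    rw [hwd, AddMonoidHom.add_apply, hzero w hw, AddMonoidHom.sub_apply, hwy, hvm'] at h1
    linarith
  -- Complete `v` by points of the other coefficients of `D''` at which `my y` is largest. The sum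
  -- is in `D.deg` and kills `m`, so it is also a sum of points `u z` of `D''.coeff z`. As the other
  -- terms were maximal, `my y` is at least as large on `u y` as on `v`; but `u y` is on the face,
  -- where `my y` is minimal.
  have hface : ∀ y, ∀ v ∈ D.coeff y, v m = D.eval m y → v ∈ D''.coeff y := by
    intro y v hv hvm
    rw [hmyc]
    refine ⟨hv, le_antisymm ?_ (eval_le (hmy y) hv)⟩
    obtain ⟨w, hw⟩ := exists_finsupp_coeff (D := D'') htop
      (p := fun z v => ∀ u ∈ D''.coeff z, u (my y) ≤ v (my y))
      (fun z => exists_coeff_max (fun w hw => ((hmyt y w).1 hw).2) (hloc z)) (fun z hz u hu => by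
        rw [hz] at hu
        exact (((hmyt y u).1 hu).2).le)
    obtain ⟨w', hw', hwy', hwz', hwd'⟩ := exists_finsupp_coeff_update
      (fun z => h.le.2 z (hw z).1) hv
    have h1 : w'.degree ∈ D.deg := mem_deg_iff.2 ⟨htop', w', hw', rfl⟩
    have h2 : w'.degree m = 0 := by
      rw [hwd', AddMonoidHom.add_apply, hzero w fun z => (hw z).1, AddMonoidHom.sub_apply, hvm,
        hmin y _ (hw y).1, sub_self, add_zero]
    have h3 : w'.degree ∈ D''.deg := by
      rw [← hdeg]
      exact ⟨h1, (hmt _).2 ⟨hdt.1 h1, h2⟩⟩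
    obtain ⟨-, u, hu, hud⟩ := mem_deg_iff.1 h3
    have h4 : u.degree (my y) = w'.degree (my y) := by rw [hud]
    have h5 : (u - w').degree (my y) = 0 := by
      rw [map_sub, AddMonoidHom.sub_apply, h4, sub_self]
    rw [degree_apply_eq_sum] at h5
    have h6 : ∀ z ∈ (u - w').support, z ≠ y → (u - w') z (my y) ≤ 0 := by
      intro z _ hz
      rw [Finsupp.sub_apply, AddMonoidHom.sub_apply, hwz' z hz]
      have := (hw z).2 _ (hu z)
      linarith
    have h7 : 0 ≤ (u - w') y (my y) := by
      by_contra! hneg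
      have h8 : ∑ z ∈ (u - w').support, (u - w') z (my y) < 0 := by
        refine Finset.sum_neg' (fun z hz => ?_) ⟨y, ?_, hneg⟩
        · by_cases hzy : z = y
          · rw [hzy]
            exact hneg.le
          · exact h6 z hz hzy
        · rw [Finsupp.mem_support_iff]
          intro h0
          rw [h0] at hneg
          exact lt_irrefl _ hneg
      linarith
    rw [Finsupp.sub_apply, AddMonoidHom.sub_apply, hwy', ((hmyc y _).1 (hu y)).2] at h7
    linarith
  have hleast : IsLeast ((fun v : NQ M => v m) '' D.deg) 0 := by
    refine ⟨⟨w₀.degree, mem_deg_iff.2 ⟨htop', w₀, fun y => h.le.2 y (hw₀ y).1, rfl⟩,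
      hzero w₀ fun y => (hw₀ y).1⟩, ?_⟩
    rintro _ ⟨x, hx, rfl⟩
    exact hmd _ (hdt.1 hx)
  obtain ⟨r, hr, f, hf, hord⟩ := hprin m hmd hleast
  have hr' : (0 : ℚ) < r := by exact_mod_cast hr
  have hord' : ∀ y, (ord y f : ℚ) = r * D.eval m y := fun y => by
    rw [hord, eval_nsmul hmd r (htop' ▸ trivial)]
  refine ⟨r • m, f⁻¹, ⟨inv_ne_zero hf, hmd.nsmul r, fun y v hv => ?_, fun w hw hwm => ?_,
    fun y v hv hvm => ?_⟩, ?_⟩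
  · rw [ord_inv, map_nsmul, nsmul_eq_mul]
    push_cast
    rw [hord']
    have := mul_le_mul_of_nonneg_left (eval_le hmd hv) hr'.le
    linarith
  · rw [map_nsmul, nsmul_eq_mul] at hwm
    exact (hmt w).2 ⟨hw, (mul_eq_zero.1 hwm).resolve_left hr'.ne'⟩
  · refine hface y v hv ?_
    rw [ord_inv, map_nsmul, nsmul_eq_mul] at hvm
    push_cast at hvm
    rw [hord'] at hvm
    have h1 : (r : ℚ) * v m = r * D.eval m y := by linarith
    exact mul_left_cancel₀ hr'.ne' h1
  · rw [inv_inv]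
    refine mem_piece_iff.2 fun _ => ⟨fun w hw => ?_, fun y v hv => ?_⟩
    · rw [map_neg, map_nsmul, ((hmt w).1 hw).2]
      simp
    · rw [map_neg, map_nsmul, nsmul_eq_mul, hord', hmin y v hv]
      linarith

/-- The product of `f χ^m` with the element `g χ^(-m)` of `A(D'')` is a function on the locus of
`D''` which does not vanish at the given `y`. These functions will generate the unit ideal when the
locus is affine. -/
theorem IsOpenFace.exists_isSeparating_of_locus_ne_top (h : D.IsOpenFace D'')
    (hne : D''.locus ≠ ⊤) {y : ClosedPt C} (hy : y.1 ∈ D''.locus) :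
    ∃ m f g, D.IsSeparating D'' m f ∧ g ∈ D''.piece (-m) ∧ g ≠ 0 ∧ ord y (f * g) = 0 := by
  classical
  obtain ⟨m, hm, hmc, hmt⟩ := exists_memDual_of_isFace h.le hy (h.face y hy)
  -- `m` is positive on `D.deg`: an element killed by `m` would belong to `D''.deg`, which is empty
  -- since the locus of `D''` is not complete.
  obtain ⟨k₀, G, hk₀, hGdeg, hG⟩ := exists_divisor_degree_pos hm fun htop w hw => by
    have hw' := (h.proper.of_locus_eq_top htop).1.1 hw
    refine lt_of_le_of_ne (hm w hw') fun h0 => hne ?_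
    have h3 : w ∈ D''.deg := by
      rw [← h.deg htop]
      exact ⟨hw, (hmt w).2 ⟨hw', h0.symm⟩⟩
    exact (mem_deg_iff.1 h3).1
  have hyD : y.1 ∈ D.locus := by
    obtain ⟨v, hv⟩ := coeff_nonempty hy
    exact mem_locus_of_mem_coeff (h.le.2 y hv)
  have : Nonempty D''.locus := ⟨⟨y.1, hy⟩⟩
  -- The section `f` of a multiple of `G` is made to vanish at the points of this set other than
  -- `y`, which excludes the equality case there. Away from the set the coefficients are the tails,
  -- or `D` has no coefficient.
  have hBfin := ((D.finite_special.union D''.finite_special).union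
    (finite_closedPt_notMem D''.locus))
  obtain ⟨k₁, hk₁⟩ := exists_section_of_degree_pos hGdeg y (hBfin.toFinset.erase y) (by simp)
  obtain ⟨f, hf, hfnn, hfy, hfB⟩ := hk₁ (k₁ + 1) (Nat.le_succ _)
  set k := k₁ + 1
  have hk : (0 : ℚ) < (k * k₀ : ℕ) := by
    have : 0 < k * k₀ := Nat.mul_pos (Nat.succ_pos _) hk₀
    exact_mod_cast this
  have hcomp : ∀ z, ∀ v ∈ D.coeff z, (k : ℚ) * G z ≤ v ((k * k₀) • m) := by
    intro z v hv
    rw [hG z (mem_locus_of_mem_coeff hv), map_nsmul, nsmul_eq_mul, ← mul_assoc, ← Nat.cast_mul]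
    exact mul_le_mul_of_nonneg_left (eval_le hm hv) hk.le
  have hB : ∀ z : ClosedPt C, z ≠ y → z ∉ hBfin.toFinset.erase y → z.1 ∈ D''.locus ∧
      (z.1 ∈ D.locus → D.coeff z = (D.tail : Set (NQ M))) ∧
      D''.coeff z = (D''.tail : Set (NQ M)) := by
    intro z hz hzB
    simp only [Finset.mem_erase, hz, ne_eq, not_false_eq_true, true_and, Set.Finite.mem_toFinset,
      Set.mem_union, Set.mem_ofPred_eq, not_or, not_and, not_not] at hzB
    exact ⟨hzB.2, hzB.1.1, hzB.1.2 hzB.2⟩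
  have hsep : D.IsSeparating D'' ((k * k₀) • m) f := by
    refine ⟨hf, hm.nsmul _, fun z v hv => ?_, fun w hw hwm => ?_, fun z v hv hvm => ?_⟩
    · have h1 := hcomp z v hv
      have h2 : (0 : ℚ) ≤ ord z f + k * G z := by exact_mod_cast hfnn z
      linarith
    · rw [map_nsmul, nsmul_eq_mul] at hwm
      exact (hmt w).2 ⟨hw, (mul_eq_zero.1 hwm).resolve_left hk.ne'⟩
    · have h1 := hcomp z v hv
      by_cases hz : z = y
      · subst hz
        have h2 : (ord z f : ℚ) + k * G z = 0 := by exact_mod_cast hfy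
        rw [hmc]
        refine ⟨hv, ?_⟩
        have h3 : ((k * k₀ : ℕ) : ℚ) * v m = (k * k₀ : ℕ) * D.eval m z := by
          rw [hG z hyD] at h2
          rw [map_nsmul, nsmul_eq_mul] at hvm
          push_cast at hvm ⊢
          linarith
        exact mul_left_cancel₀ hk.ne' h3
      · by_cases hzB : z ∈ hBfin.toFinset.erase y
        · have h2 : (0 : ℚ) < ord z f + k * G z := by exact_mod_cast hfB z hzB
          linarith
        · obtain ⟨-, h2, h3⟩ := hB z hz hzB
          have hzD := mem_locus_of_mem_coeff hv
          have h4 := h2 hzD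
          rw [h3]
          rw [h4] at hv
          refine (hmt v).2 ⟨hv, ?_⟩
          have h5 : (0 : ℚ) ≤ ord z f + k * G z := by exact_mod_cast hfnn z
          rw [hG z hzD, eval_eq_zero hm h4] at h5
          rw [map_nsmul, nsmul_eq_mul] at hvm
          have h6 := mul_nonneg hk.le (hm v hv)
          have h7 : ((k * k₀ : ℕ) : ℚ) * v m = 0 := by linarith
          exact (mul_eq_zero.1 h7).resolve_left hk.ne'
  obtain ⟨p, hp⟩ := exists_closedPt_notMem hne
  have hyp : y ≠ p := fun h0 => hp (h0 ▸ hy)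
  have hB'fin := D''.finite_special.union (finite_ord_ne_zero hf)
  -- On the locus of `D''` the function `s` is regular, and it is a unit at `y`; it vanishes at the
  -- other special points of `D''` and at the other zeros and poles of `f` there. A power of `s`
  -- then makes `f⁻¹ χ^(-m)` regular on `X(D'')`.
  obtain ⟨j₁, hj₁⟩ := exists_section_of_degree_pos (G := Finsupp.single p 1) (by simp) y
    (hB'fin.toFinset.erase y) (by simp)
  obtain ⟨s, hs, hsnn, hsy, hsB⟩ := hj₁ j₁ le_rfl
  have hsp : ∀ z : ClosedPt C, z.1 ∈ D''.locus → (Finsupp.single p (1 : ℤ)) z = 0 := by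
    intro z hz
    have : z ≠ p := fun h0 => hp (h0 ▸ hz)
    exact Finsupp.single_eq_of_ne this
  have hsy' : ord y s = 0 := by
    rw [hsp y hy] at hsy
    linarith
  have htl : ∀ w ∈ D''.tail, w ((k * k₀) • m) = 0 := fun w hw => by
    rw [map_nsmul, ((hmt w).1 hw).2, smul_zero]
  have hy0 : ∀ v ∈ D''.coeff y, (ord y f : ℚ) + v ((k * k₀) • m) = 0 := by
    intro v hv
    have h2 : (ord y f : ℚ) + k * G y = 0 := by exact_mod_cast hfy
    rw [hG y hyD] at h2
    rw [map_nsmul, nsmul_eq_mul, ((hmc v).1 hv).2]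
    push_cast
    linarith
  obtain ⟨r, hr⟩ := (eventually_pow_mul_mem_piece (D := D'') (m := 0) (m' := -((k * k₀) • m))
    (f := s) (g := f⁻¹) hs (fun w _ => by simp) (fun z v hv => by
      have hz := mem_locus_of_mem_coeff hv
      have := hsnn z
      rw [hsp z hz, mul_zero, add_zero] at this
      rw [map_zero, add_zero]
      exact_mod_cast this) (fun w hw _ => by rw [map_neg, htl w hw, neg_zero])
    (fun _ z v hv hvs => by
      rw [ord_inv, map_neg]
      push_cast
      by_cases hz : z = y
      · subst hz
        have := hy0 v hv
        linarith
      · have hzl := mem_locus_of_mem_coeff hv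
        have hzB : z ∉ hB'fin.toFinset.erase y := by
          intro hzB
          have h1 := hsB z hzB
          rw [hsp z hzl, mul_zero, add_zero] at h1
          rw [map_zero, add_zero] at hvs
          have : ord z s = 0 := by exact_mod_cast hvs
          omega
        simp only [Finset.mem_erase, hz, ne_eq, not_false_eq_true, true_and,
          Set.Finite.mem_toFinset, Set.mem_union, Set.mem_ofPred_eq, not_or, not_and,
          not_not] at hzB
        have h1 := hzB.1 hzl
        rw [h1] at hv
        rw [hzB.2, htl v hv]
        simp)).exists
  rw [smul_zero, zero_add] at hr
  refine ⟨_, f, _, hsep, hr, mul_ne_zero (pow_ne_zero _ hs) (inv_ne_zero hf), ?_⟩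
  rw [mul_comm (s ^ r), mul_inv_cancel_left₀ hf, ord_pow, hsy', mul_zero]

end OpenFace

end PolyhedralDivisor

/-- Regular functions without common zeros at the closed points of an affine open subset generate
the unit ideal. -/
theorem ideal_eq_top_of_forall_ord_eq_zero {C : Scheme.{0}} [C.Over SpecC]
    [IsSmoothProjectiveCurve C] {U : C.Opens} [Nonempty U] (hU : IsAffineOpen U)
    (J : Ideal Γ(C, U)) (hJ : ∀ y : ClosedPt C, y.1 ∈ U → ∃ s ∈ J,
      C.germToFunctionField U s ≠ 0 ∧ ord y (C.germToFunctionField U s) = 0) : J = ⊤ := by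
  rw [← Ideal.span_eq J]
  refine (IsAffineOpen.iSup_basicOpen_eq_self_iff hU (s := (J : Set Γ(C, U)))).1 ?_
  refine le_antisymm (iSup_le fun s => C.basicOpen_le s.1) fun x hx => ?_
  have hcl : ∀ y : ClosedPt C, y.1 ∈ U → y.1 ∈ ⨆ s : (J : Set Γ(C, U)), C.basicOpen s.1 := by
    intro y hy
    obtain ⟨s, hs, hs0, hsy⟩ := hJ y hy
    refine TopologicalSpace.Opens.mem_iSup.2 ⟨⟨s, hs⟩, ?_⟩
    rw [Scheme.mem_basicOpen _ _ _ hy]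
    by_contra hnu
    have h1 := Scheme.algebraMap_germ_eq_germToFunctionField (X := C) hy s
    have h2 : C.presheaf.germ U y.1 hy s ≠ 0 := by
      intro h0
      rw [h0, map_zero] at h1
      exact hs0 h1.symm
    have h3 := (ord_pos_iff y h2).2 ((IsLocalRing.mem_maximalIdeal _).2 hnu)
    rw [h1, hsy] at h3
    exact lt_irrefl _ h3
  rcases eq_genericPoint_or_isClosed x with rfl | h
  · obtain ⟨y, hy⟩ := exists_closedPt_mem U
    have : Nonempty (⨆ s : (J : Set Γ(C, U)), C.basicOpen s.1 : C.Opens) := ⟨⟨_, hcl y hy⟩⟩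
    exact genericPoint_mem _
  · exact hcl ⟨x, h⟩ hx

/-! ### Covering the chart of an open face -/

namespace PolyhedralDivisor

variable {C : Scheme.{0}} [C.Over SpecC] [IsSmoothProjectiveCurve C]
  {M : Type} [AddCommGroup M] {D D' D'' : PolyhedralDivisor C M}

theorem germToFunctionField_mem_piece [Nonempty D.locus] (s : Γ(C, D.locus)) :
    C.germToFunctionField D.locus s ∈ D.piece 0 := by
  refine mem_piece_iff.2 fun _ => ⟨fun w _ => by simp, fun y v hv => ?_⟩
  rw [map_zero, add_zero]
  exact_mod_cast ord_germ_nonneg (mem_locus_of_mem_coeff hv) s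

/-- The regular functions on the locus, seen as regular functions of degree `0`. -/
def sectionHom (D : PolyhedralDivisor C M) [Nonempty D.locus] : Γ(C, D.locus) →+* D.algebra :=
  ((AddMonoidAlgebra.singleZeroRingHom (R := C.functionField) (M := M)).comp
    (C.germToFunctionField D.locus).hom).codRestrict D.algebra
      fun s => single_mem_algebra (germToFunctionField_mem_piece s)

theorem coe_sectionHom [Nonempty D.locus] (s : Γ(C, D.locus)) :
    (D.sectionHom s : AddMonoidAlgebra C.functionField M) =
      AddMonoidAlgebra.single 0 (C.germToFunctionField D.locus s) := rfl

/-- The homogeneous element `f χ^m` of the algebra of `D`. -/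
abbrev homogeneous {m : M} {f : C.functionField} (hf : f ∈ D.piece m) : D.algebra :=
  ⟨AddMonoidAlgebra.single m f, single_mem_algebra hf⟩

theorem homogeneous_mul {m m' : M} {f g : C.functionField} (hf : f ∈ D.piece m)
    (hg : g ∈ D.piece m') :
    homogeneous hf * homogeneous hg = homogeneous (mul_mem_piece hf hg) :=
  Subtype.ext (AddMonoidAlgebra.single_mul_single _ _ _ _)

section

variable [Module.Free ℤ M] [Module.Finite ℤ M]

/-- The non-vanishing loci of the separating elements cover the chart of an open face. -/
theorem IsOpenFace.exists_isSeparating_notMem (h : D.IsOpenFace D'') (p : Ideal D''.algebra)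
    [hp : p.IsPrime] : ∃ (m : M) (f : C.functionField) (hs : D.IsSeparating D'' m f),
      homogeneous (piece_anti h.le m hs.mem_piece) ∉ p := by
  by_contra! hcon
  by_cases htop : D''.locus = ⊤
  -- Over a complete locus a separating element is a unit of `A(D'')`.
  · obtain ⟨m, f, hs, hg⟩ := h.exists_isSeparating_of_locus_eq_top htop
    have h1 := p.mul_mem_right (homogeneous hg) (hcon m f hs)
    have h2 : homogeneous (piece_anti h.le m hs.mem_piece) * homogeneous hg = 1 := by
      refine Subtype.ext ((AddMonoidAlgebra.single_mul_single _ _ _ _).trans ?_)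
      rw [add_neg_cancel, mul_inv_cancel₀ hs.ne_zero]
      rfl
    rw [h2] at h1
    exact hp.ne_top ((Ideal.eq_top_iff_one p).2 h1)
  · have : Nonempty D''.locus := D''.locus_nonempty.to_subtype
    -- Over an affine locus, if `p` contained all the separating elements, its part of degree zero
    -- would contain functions without common zero.
    have h1 := ideal_eq_top_of_forall_ord_eq_zero (h.locus.resolve_left htop)
      (p.comap D''.sectionHom) (by
        intro y hy
        obtain ⟨m, f, g, hs, hg, hg0, hfg⟩ := h.exists_isSeparating_of_locus_ne_top htop hy
        have h2 := mul_mem_piece (piece_anti h.le m hs.mem_piece) hg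
        rw [add_neg_cancel] at h2
        obtain ⟨s, hs'⟩ := exists_section_of_ord_nonneg D''.locus (f := f * g)
          fun h0 z hz => by
            obtain ⟨v, hv⟩ := coeff_nonempty hz
            have := (mem_piece_iff.1 h2 h0).2 z v hv
            rw [map_zero, add_zero] at this
            exact_mod_cast this
        refine ⟨s, ?_, ?_, ?_⟩
        · have h3 := p.mul_mem_right (homogeneous hg) (hcon m f hs)
          rw [homogeneous_mul] at h3
          rw [Ideal.mem_comap]
          convert h3 using 1
          refine Subtype.ext ?_
          rw [coe_sectionHom, hs']
          exact congrArg (fun i => AddMonoidAlgebra.single i (f * g)) (add_neg_cancel m).symm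
        · rw [hs']
          exact mul_ne_zero hs.ne_zero hg0
        · rw [hs', hfg])
    exact (Ideal.IsPrime.comap D''.sectionHom).ne_top h1

end

end PolyhedralDivisor

/-! ### Ring extensions which are local isomorphisms -/

section OpenImmersion

variable {R S : Type} [CommRing R] [CommRing S] {φ : R →+* S}

/-- Powers of `s` carry all of `S` into the subring `R`, so both rings have the same localization at
`s`. -/
theorem isLocalization_away_comp (hφ : Function.Injective φ) {s : R}
    (hs : ∀ a, ∃ r : ℕ, φ s ^ r * a ∈ φ.range) :
    letI := ((algebraMap S (Localization.Away (φ s))).comp φ).toAlgebra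
    IsLocalization.Away s (Localization.Away (φ s)) := by
  let := ((algebraMap S (Localization.Away (φ s))).comp φ).toAlgebra
  have hmap : ∀ x : R, algebraMap R (Localization.Away (φ s)) x =
      algebraMap S (Localization.Away (φ s)) (φ x) := fun x => rfl
  have hu : IsUnit (algebraMap S (Localization.Away (φ s)) (φ s)) :=
    IsLocalization.Away.algebraMap_isUnit (φ s)
  refine { map_units := ?_, surj := ?_, exists_of_eq := ?_ }
  · rintro ⟨_, n, rfl⟩
    rw [hmap, map_pow, map_pow]
    exact hu.pow n
  · intro z
    obtain ⟨n, a, ha⟩ := IsLocalization.Away.surj (φ s) z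
    obtain ⟨r, b, hb⟩ := hs a
    refine ⟨⟨b, ⟨s ^ (r + n), r + n, rfl⟩⟩, ?_⟩
    simp only [hmap, hb, map_mul, map_pow, pow_add]
    rw [← ha]
    ring
  · intro x y hxy
    rw [hmap, hmap] at hxy
    obtain ⟨⟨_, n, rfl⟩, hc⟩ := IsLocalization.exists_of_eq (M := Submonoid.powers (φ s)) hxy
    refine ⟨⟨s ^ n, n, rfl⟩, hφ ?_⟩
    simpa using hc

theorem eq_of_comap_eq {p q : PrimeSpectrum S} {s : R} (hs : ∀ a, ∃ r : ℕ, φ s ^ r * a ∈ φ.range)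
    (hsp : φ s ∉ p.asIdeal) (h : PrimeSpectrum.comap φ p = PrimeSpectrum.comap φ q) : p = q := by
  have hcom : ∀ b, φ b ∈ p.asIdeal ↔ φ b ∈ q.asIdeal := fun b =>
    SetLike.ext_iff.1 (congrArg PrimeSpectrum.asIdeal h) b
  ext a
  obtain ⟨r, b, hb⟩ := hs a
  have hp : a ∈ p.asIdeal ↔ φ b ∈ p.asIdeal := by
    rw [hb]
    refine ⟨fun ha => Ideal.mul_mem_left _ _ ha, fun ha => ?_⟩
    exact (p.2.mem_or_mem ha).resolve_left fun h0 => hsp (p.2.mem_of_pow_mem _ h0)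
  have hq : a ∈ q.asIdeal ↔ φ b ∈ q.asIdeal := by
    rw [hb]
    refine ⟨fun ha => Ideal.mul_mem_left _ _ ha, fun ha => ?_⟩
    exact (q.2.mem_or_mem ha).resolve_left fun h0 =>
      hsp ((hcom s).2 (q.2.mem_of_pow_mem _ h0))
  rw [hp, hq, hcom]

/-- Near each point of `Spec S` the map is the inclusion of a principal open subset of `Spec R`;
injectivity on points follows from the same hypothesis. -/
theorem isOpenImmersion_Spec_map_of_injective (hφ : Function.Injective φ)
    (h : ∀ p : PrimeSpectrum S, ∃ s, (∀ a, ∃ r : ℕ, φ s ^ r * a ∈ φ.range) ∧ φ s ∉ p.asIdeal) :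
    IsOpenImmersion (Spec.map (CommRingCat.ofHom φ)) := by
  refine IsOpenImmersion.of_forall_source_exists _ ?_ ?_
  · intro p q hpq
    obtain ⟨s, hs, hsp⟩ := h p
    exact eq_of_comap_eq hs hsp hpq
  · intro p
    obtain ⟨s, hs, hsp⟩ := h p
    refine ⟨Spec (CommRingCat.of (Localization.Away (φ s))),
      Spec.map (CommRingCat.ofHom (algebraMap S (Localization.Away (φ s)))),
      IsOpenImmersion.of_isLocalization (φ s), ?_, ?_⟩
    · have h1 := PrimeSpectrum.localization_away_comap_range (Localization.Away (φ s)) (φ s)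
      have h2 : p ∈ (PrimeSpectrum.basicOpen (φ s) : Set (PrimeSpectrum S)) := hsp
      rw [← h1] at h2
      exact h2
    · let := ((algebraMap S (Localization.Away (φ s))).comp φ).toAlgebra
      have := isLocalization_away_comp hφ hs
      rw [← Spec.map_comp, ← CommRingCat.ofHom_comp]
      exact IsOpenImmersion.of_isLocalization (R := R) (S := Localization.Away (φ s)) s

theorem mem_range_comap_of_notMem (hφ : Function.Injective φ) {q : PrimeSpectrum R} {s : R}
    (hs : ∀ a, ∃ r : ℕ, φ s ^ r * a ∈ φ.range) (hsq : s ∉ q.asIdeal) :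
    ∃ p : PrimeSpectrum S, PrimeSpectrum.comap φ p = q := by
  let := ((algebraMap S (Localization.Away (φ s))).comp φ).toAlgebra
  have := isLocalization_away_comp hφ hs
  have h1 := PrimeSpectrum.localization_away_comap_range (R := R) (Localization.Away (φ s)) s
  have h2 : q ∈ (PrimeSpectrum.basicOpen s : Set (PrimeSpectrum R)) := hsq
  rw [← h1] at h2
  obtain ⟨p, hp⟩ := h2
  exact ⟨PrimeSpectrum.comap (algebraMap S (Localization.Away (φ s))) p, hp⟩

end OpenImmersion

/-! ### Charts of open faces and their intersections -/

namespace PolyhedralDivisor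

variable {C : Scheme.{0}} [C.Over SpecC] [IsSmoothProjectiveCurve C]
  {M : Type} [AddCommGroup M] {D D' D'' : PolyhedralDivisor C M}

/-- The inclusion of the algebra of `D` in that of a smaller polyhedral divisor. -/
abbrev algebraInclusion (h : D'' ≤ D) : D.algebra →+* D''.algebra :=
  (Subalgebra.inclusion (algebra_anti h)).toRingHom

theorem algebraInclusion_injective (h : D'' ≤ D) : Function.Injective (algebraInclusion h) :=
  Subalgebra.inclusion_injective _

theorem IsSeparating.exists_pow_mul_mem_range (h : D'' ≤ D) {m : M} {f : C.functionField}
    (hs : D.IsSeparating D'' m f) (a : D''.algebra) :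
    ∃ r : ℕ, algebraInclusion h (homogeneous hs.mem_piece) ^ r * a ∈ (algebraInclusion h).range := by
  obtain ⟨r, hr⟩ := hs.exists_pow_mul_mem_algebra a.2
  exact ⟨r, ⟨_, hr⟩, rfl⟩

section

variable [Module.Free ℤ M] [Module.Finite ℤ M]

theorem IsOpenFace.isOpenImmersion (h : D.IsOpenFace D'') : IsOpenImmersion (chartMap h.le) := by
  refine isOpenImmersion_Spec_map_of_injective (algebraInclusion_injective h.le) fun p => ?_
  obtain ⟨m, f, hs, hsp⟩ := h.exists_isSeparating_notMem p.asIdeal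
  exact ⟨_, hs.exists_pow_mul_mem_range h.le, hsp⟩

/-- Inside `X(D)`, the intersection of `X(D₁)` and `X(D₂)` is `X(D₁ ∩ D₂)`. -/
theorem IsOpenFace.exists_chartMap_eq {D₁ D₂ D₃ : PolyhedralDivisor C M} (h₁ : D.IsOpenFace D₁)
    (h₂ : D.IsOpenFace D₂) (h₃₁ : D₃ ≤ D₁) (h₃₂ : D₃ ≤ D₂) (ht : D₁.tail ⊓ D₂.tail ≤ D₃.tail)
    (hc : ∀ y, D₁.coeff y ∩ D₂.coeff y ⊆ D₃.coeff y) (x₁ : PrimeSpectrum D₁.algebra)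
    (x₂ : PrimeSpectrum D₂.algebra)
    (hx : PrimeSpectrum.comap (algebraInclusion h₁.le) x₁ =
      PrimeSpectrum.comap (algebraInclusion h₂.le) x₂) :
    ∃ x : D₃.chart, chartMap h₃₁ x = x₁ ∧ chartMap h₃₂ x = x₂ := by
  obtain ⟨m, f, hs, hsp⟩ := h₁.exists_isSeparating_notMem x₁.asIdeal
  obtain ⟨m', f', hs', hsp'⟩ := h₂.exists_isSeparating_notMem x₂.asIdeal
  -- The product of the two separating elements separates `D₃` and does not vanish at the common
  -- image `q`, so `q` lifts to `X(D₃)`.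
  have hmul := hs.mul hs' ht hc
  let q : PrimeSpectrum D.algebra := PrimeSpectrum.comap (algebraInclusion h₁.le) x₁
  have hq : q = PrimeSpectrum.comap (algebraInclusion h₂.le) x₂ := hx
  have h1 : homogeneous hs.mem_piece ∉ q.asIdeal := hsp
  have h2 : homogeneous hs'.mem_piece ∉ q.asIdeal := by
    rw [hq]
    exact hsp'
  have h3 : homogeneous hmul.mem_piece ∉ q.asIdeal := by
    have : homogeneous hmul.mem_piece = homogeneous hs.mem_piece * homogeneous hs'.mem_piece :=
      (homogeneous_mul _ _).symm
    rw [this]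
    exact fun h => (q.2.mem_or_mem h).elim h1 h2
  obtain ⟨x, hx'⟩ := mem_range_comap_of_notMem (algebraInclusion_injective (h₃₁.trans h₁.le))
    (hmul.exists_pow_mul_mem_range (h₃₁.trans h₁.le)) h3
  have hinj : ∀ (D' : PolyhedralDivisor C M) (h' : D.IsOpenFace D') (h'' : D₃ ≤ D') (x' : D'.chart),
      PrimeSpectrum.comap (algebraInclusion h'.le) x' = q →
      (chartMap h'' : D₃.chart ⟶ D'.chart) x = x' := by
    intro D' h' h'' x' hx2
    have := h'.isOpenImmersion
    refine (chartMap h'.le).isOpenEmbedding.injective ?_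
    exact hx'.trans hx2.symm
  exact ⟨x, hinj D₁ h₁ h₃₁ x₁ rfl, hinj D₂ h₂ h₃₂ x₂ hq.symm⟩

end

end PolyhedralDivisor

/-! ### Points of charts with values in a local ring -/

section Extension

variable {R S L : Type} [CommRing R] [CommRing S] [CommRing L] {φ : R →+* S}

theorem exists_comp_eq_of_isUnit (hφ : Function.Injective φ) {s : R}
    (hs : ∀ a, ∃ r : ℕ, φ s ^ r * a ∈ φ.range) (ρ : R →+* L) (hu : IsUnit (ρ s)) :
    ∃ ρ' : S →+* L, ρ'.comp φ = ρ := by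
  let := ((algebraMap S (Localization.Away (φ s))).comp φ).toAlgebra
  have := isLocalization_away_comp hφ hs
  refine ⟨(IsLocalization.Away.lift (S := Localization.Away (φ s)) s hu).comp
    (algebraMap S (Localization.Away (φ s))), ?_⟩
  rw [RingHom.comp_assoc]
  exact IsLocalization.Away.lift_comp s hu

theorem ringHom_ext_of_isUnit {s : R} (hs : ∀ a, ∃ r : ℕ, φ s ^ r * a ∈ φ.range)
    {ρ ρ' : S →+* L} (h : ρ.comp φ = ρ'.comp φ) (hu : IsUnit (ρ (φ s))) : ρ = ρ' := by
  ext a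
  obtain ⟨r, b, hb⟩ := hs a
  have h1 : ∀ x, ρ (φ x) = ρ' (φ x) := fun x => RingHom.congr_fun h x
  have h2 := h1 b
  rw [hb, map_mul, map_mul, map_pow, map_pow, ← h1 s] at h2
  exact (hu.pow r).mul_left_cancel h2

end Extension

namespace PolyhedralDivisor

variable {C : Scheme.{0}} [C.Over SpecC] [IsSmoothProjectiveCurve C]
  {M : Type} [AddCommGroup M] [Module.Free ℤ M] [Module.Finite ℤ M] {D D' D'' : PolyhedralDivisor C M}

variable {L : Type} [CommRing L] [IsLocalRing L]

/-- The maximal ideal of `L` pulls back to a prime of `A(D'')`, which some separating element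
avoids. -/
theorem IsOpenFace.exists_isSeparating_isUnit (h : D.IsOpenFace D'') (ρ : D''.algebra →+* L) :
    ∃ (m : M) (f : C.functionField) (hs : D.IsSeparating D'' m f),
      IsUnit (ρ (algebraInclusion h.le (homogeneous hs.mem_piece))) := by
  obtain ⟨m, f, hs, hn⟩ := h.exists_isSeparating_notMem ((IsLocalRing.maximalIdeal L).comap ρ)
  refine ⟨m, f, hs, ?_⟩
  by_contra hcon
  exact hn ((IsLocalRing.mem_maximalIdeal _).2 hcon)

theorem IsOpenFace.ringHom_ext (h : D.IsOpenFace D'') {ρ ρ' : D''.algebra →+* L}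
    (hρ : ρ.comp (algebraInclusion h.le) = ρ'.comp (algebraInclusion h.le)) : ρ = ρ' := by
  obtain ⟨m, f, hs, hu⟩ := h.exists_isSeparating_isUnit ρ
  exact ringHom_ext_of_isUnit (hs.exists_pow_mul_mem_range h.le) hρ hu

/-- The product of two separating elements becomes a unit in `L`, so the homomorphism extends from
`A(D)` to `A(D₃)`; uniqueness of extensions gives the compatibilities. -/
theorem IsOpenFace.exists_common_extension {D₁ D₂ D₃ : PolyhedralDivisor C M}
    (h₁ : D.IsOpenFace D₁) (h₂ : D.IsOpenFace D₂) (h₃₁ : D₃ ≤ D₁) (h₃₂ : D₃ ≤ D₂)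
    (ht : D₁.tail ⊓ D₂.tail ≤ D₃.tail) (hc : ∀ y, D₁.coeff y ∩ D₂.coeff y ⊆ D₃.coeff y)
    {ρ₁ : D₁.algebra →+* L} {ρ₂ : D₂.algebra →+* L}
    (hρ : ρ₁.comp (algebraInclusion h₁.le) = ρ₂.comp (algebraInclusion h₂.le)) :
    ∃ ρ₃ : D₃.algebra →+* L, ρ₃.comp (algebraInclusion h₃₁) = ρ₁ ∧
      ρ₃.comp (algebraInclusion h₃₂) = ρ₂ := by
  obtain ⟨m, f, hs, hu⟩ := h₁.exists_isSeparating_isUnit ρ₁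
  obtain ⟨m', f', hs', hu'⟩ := h₂.exists_isSeparating_isUnit ρ₂
  have hmul := hs.mul hs' ht hc
  have hu'' : IsUnit ((ρ₁.comp (algebraInclusion h₁.le)) (homogeneous hmul.mem_piece)) := by
    have h1 : homogeneous hmul.mem_piece = homogeneous hs.mem_piece * homogeneous hs'.mem_piece :=
      (homogeneous_mul _ _).symm
    rw [h1, map_mul]
    refine IsUnit.mul hu ?_
    rw [hρ]
    exact hu'
  obtain ⟨ρ₃, h₃⟩ := exists_comp_eq_of_isUnit (algebraInclusion_injective (h₃₁.trans h₁.le))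
    (hmul.exists_pow_mul_mem_range (h₃₁.trans h₁.le)) (ρ₁.comp (algebraInclusion h₁.le)) hu''
  exact ⟨ρ₃, h₁.ringHom_ext h₃, h₂.ringHom_ext (h₃.trans hρ)⟩

/-- The degree is stable under adding elements of the tail, so with `0` it would contain the whole
tail. -/
theorem zero_notMem_deg (h : D.Proper) : (0 : NQ M) ∉ D.deg := by
  intro h0
  obtain ⟨htop, w, hw, hw0⟩ := mem_deg_iff.1 h0
  obtain ⟨hdt, -⟩ := h.of_locus_eq_top htop
  obtain ⟨y⟩ : Nonempty (ClosedPt C) := inferInstance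
  refine hdt.2 fun t ht => ?_
  obtain ⟨w', hw', -, -, hd⟩ := exists_finsupp_coeff_update hw (add_mem_coeff (hw y) ht)
  refine mem_deg_iff.2 ⟨htop, w', hw', ?_⟩
  rw [hd, hw0]
  abel

theorem mem_coeff_trivialDivisor {U : C.Opens} {hU : Nonempty U} {y : ClosedPt C} {v : NQ M} :
    v ∈ (trivialDivisor M U hU).coeff y ↔ y.1 ∈ U ∧ v = 0 := by
  simp only [trivialDivisor]
  split_ifs with h <;> simp [h]

/-- The origin is a face of the tail, cut out by an interior point of the dual cone; the condition
on degrees holds because `0` is not in the degree. This makes `U × T` open in `X(D)`. -/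
theorem isOpenFace_trivialDivisor {U : C.Opens} {hU : Nonempty U} (hUa : IsAffineOpen U)
    (h : trivialDivisor M U hU ≤ D) (hD : D.Proper)
    (hsp : ∀ y : ClosedPt C, y.1 ∈ U → D.coeff y = (D.tail : Set (NQ M))) :
    D.IsOpenFace (trivialDivisor M U hU) where
  le := h
  face y hy := by
    obtain ⟨m, hm, hm0⟩ := exists_memDual_forall_eq_zero D
    have h1 : (trivialDivisor M U hU).coeff y = {0} := by
      ext v
      rw [mem_coeff_trivialDivisor]
      exact and_iff_right hy
    refine ⟨{ toFun := fun v => v m, map_add' := fun _ _ => rfl, map_smul' := fun _ _ => rfl }, ?_⟩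
    rw [h1, hsp y hy]
    ext v
    simp only [Set.mem_singleton_iff, LinearMap.coe_mk, AddHom.coe_mk, Set.mem_ofPred_eq,
      SetLike.mem_coe]
    refine ⟨?_, fun hv => ?_⟩
    · rintro rfl
      exact ⟨D.tail.zero_mem, fun w hw => hm w hw⟩
    · exact hm0 v hv.1 (le_antisymm (hv.2 0 D.tail.zero_mem) (hm v hv.1))
  proper := hD
  deg htop := by
    have h1 : (trivialDivisor M U hU).deg = ∅ := by
      refine Set.eq_empty_iff_forall_notMem.2 fun x hx => ?_
      have h2 : U = ⊤ := (mem_deg_iff.1 hx).1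
      rw [h2] at hUa
      exact not_isAffineOpen_top hUa
    rw [h1]
    refine Set.eq_empty_iff_forall_notMem.2 fun x hx => ?_
    have h2 : x = 0 := by simpa [trivialDivisor] using hx.2
    exact zero_notMem_deg hD (h2 ▸ hx.1)
  locus := Or.inr hUa

end PolyhedralDivisor

/-! ### The scheme `X(E)` and its local points -/

namespace DivisorialFan

open PolyhedralDivisor

variable {C : Scheme.{0}} [C.Over SpecC] [IsSmoothProjectiveCurve C]
  {M : Type} [AddCommGroup M] {E : DivisorialFan C M}

theorem locus_eq_top_or_isAffineOpen {D : PolyhedralDivisor C M} (hD : D ∈ E.divisors) :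
    D.locus = ⊤ ∨ IsAffineOpen D.locus :=
  (E.proper D hD).elim Or.inr fun h => Or.inl h.1

theorem isOpenFace {D D'' : PolyhedralDivisor C M} (hD : D ∈ E.divisors) (hD'' : D'' ∈ E.divisors)
    (h : D'' ≤ D) : D.IsOpenFace D'' where
  le := h
  face y hy := by
    have h1 : D.coeff y ∩ D''.coeff y = D''.coeff y := Set.inter_eq_right.2 (h.2 y)
    have h2 := (E.face D hD D'' hD'' y (h1.symm ▸ coeff_nonempty hy)).1
    rwa [h1] at h2
  proper := E.proper D hD
  deg _ := by
    rw [E.deg_inter D hD D'' hD'' D'' hD'' fun y => (Set.inter_eq_right.2 (h.2 y)).symm]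
    refine Set.inter_eq_left.2 fun x hx => ?_
    exact ((E.proper D'' hD'').of_locus_eq_top (mem_deg_iff.1 hx).1).1.1 hx
  locus := locus_eq_top_or_isAffineOpen hD''

variable [Module.Free ℤ M] [Module.Finite ℤ M]

theorem exists_closedPt_mem_locus (D : PolyhedralDivisor C M) : ∃ y : ClosedPt C, y.1 ∈ D.locus := by
  have : Nonempty D.locus := D.locus_nonempty.to_subtype
  exact exists_closedPt_mem D.locus

/-- The intersection of two elements of a divisorial fan. -/
theorem exists_inter {D D' : PolyhedralDivisor C M} (hD : D ∈ E.divisors) (hD' : D' ∈ E.divisors) :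
    ∃ D'' ∈ E.divisors, D'' ≤ D ∧ D'' ≤ D' ∧ D''.tail = D.tail ⊓ D'.tail ∧
      ∀ y, D''.coeff y = D.coeff y ∩ D'.coeff y := by
  obtain ⟨D'', hD'', hi⟩ := E.inter D hD D' hD'
  have ht := tail_eq_of_isInter (exists_closedPt_mem_locus D'') hi
  refine ⟨D'', hD'', ⟨ht ▸ inf_le_left, fun y => ?_⟩, ⟨ht ▸ inf_le_right, fun y => ?_⟩, ht, hi⟩
  · rw [hi y]
    exact Set.inter_subset_left
  · rw [hi y]
    exact Set.inter_subset_right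

instance isOpenImmersion_diagram_map {D D' : E.divisors} (f : D ⟶ D') :
    IsOpenImmersion (E.diagram.map f) :=
  (isOpenFace D'.2 D.2 f.le).isOpenImmersion

/-- For a diagram of open immersions with this property the colimit is a gluing: the charts are open
in it, cover it, and meet only along smaller charts. Stability of the fan under intersection is what
provides it. -/
instance isLocallyDirected_diagram : (E.diagram ⋙ Scheme.forget).IsLocallyDirected where
  cond := by
    intro D₁ D₂ D f₁ f₂ x₁ x₂ hx
    obtain ⟨D₃, hD₃, h₁, h₂, ht, hc⟩ := exists_inter D₁.2 D₂.2
    obtain ⟨x, hx1, hx2⟩ := (isOpenFace D.2 D₁.2 f₁.le).exists_chartMap_eq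
      (isOpenFace D.2 D₂.2 f₂.le) h₁ h₂ ht.ge (fun y => (hc y).ge) x₁ x₂ hx
    exact ⟨⟨D₃, hD₃⟩, homOfLE h₁, homOfLE h₂, x, hx1, hx2⟩

variable (E) in
/-- The locally ringed space `X(E)` is a scheme. -/
def varietyIso : (colimit E.diagram).toLocallyRingedSpace ≅ E.variety :=
  preservesColimitIso Scheme.forgetToLocallyRingedSpace E.diagram

theorem ι_comp_varietyIso (D : E.divisors) :
    (colimit.ι E.diagram D).toLRSHom ≫ (varietyIso E).hom = E.chartι D :=
  ι_preservesColimitIso_hom Scheme.forgetToLocallyRingedSpace E.diagram D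

theorem chartι_comp_varietyIso_inv (D : E.divisors) :
    E.chartι D ≫ (varietyIso E).inv = (colimit.ι E.diagram D).toLRSHom :=
  (Iso.eq_comp_inv _).2 (ι_comp_varietyIso D) |>.symm

theorem chartMap_comp_chartι {D D' : E.divisors} (h : D.1 ≤ D'.1) :
    (chartMap h).toLRSHom ≫ E.chartι D' = E.chartι D :=
  colimit.w (E.diagram ⋙ Scheme.forgetToLocallyRingedSpace) (homOfLE h : D ⟶ D')

section Local

variable {R : Type} [CommRing R]

/-- The `R`-point of `X(D)` given by a homomorphism `A(D) → R`. -/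
def chartHom (D : PolyhedralDivisor C M) (φ : D.algebra →+* R) :
    Spec (CommRingCat.of R) ⟶ D.chart :=
  Spec.map (CommRingCat.ofHom φ)

theorem chartHom_comp_chartMap {D D' : PolyhedralDivisor C M} (h : D ≤ D') (φ : D.algebra →+* R) :
    chartHom D φ ≫ chartMap h = chartHom D' (φ.comp (algebraInclusion h)) :=
  (Spec.map_comp _ _).symm

theorem exists_chartHom_eq {D : PolyhedralDivisor C M} (g : Spec (CommRingCat.of R) ⟶ D.chart) :
    ∃ φ, chartHom D φ = g := by
  obtain ⟨φ, hφ⟩ := Spec.map_surjective (R := CommRingCat.of D.algebra) g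
  exact ⟨φ.hom, hφ⟩

/-- The `R`-point of `X(E)` in the chart `X(D)` given by a homomorphism `A(D) → R`. -/
def chartPoint (D : E.divisors) (φ : D.1.algebra →+* R) :
    (Spec (CommRingCat.of R)).toLocallyRingedSpace ⟶ E.variety :=
  (chartHom D.1 φ).toLRSHom ≫ E.chartι D

theorem chartPoint_comp_algebraInclusion {D D' : E.divisors} (h : D.1 ≤ D'.1)
    (φ : D.1.algebra →+* R) :
    chartPoint D' (φ.comp (algebraInclusion h)) = chartPoint D φ := by
  rw [chartPoint, chartPoint, ← chartMap_comp_chartι h, ← chartHom_comp_chartMap h]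
  exact Category.assoc _ _ _

theorem chartPoint_comp_varietyIso_inv (D : E.divisors) (φ : D.1.algebra →+* R) :
    chartPoint D φ ≫ (varietyIso E).inv =
      (show Spec (CommRingCat.of R) ⟶ colimit E.diagram from
        chartHom D.1 φ ≫ colimit.ι E.diagram D).toLRSHom := by
  rw [chartPoint]
  refine (Category.assoc _ _ _).trans ?_
  rw [chartι_comp_varietyIso_inv]
  rfl

theorem chartPoint_injective (D : E.divisors) {φ φ' : D.1.algebra →+* R}
    (h : chartPoint D φ = chartPoint D φ') : φ = φ' := by
  have h1 := congrArg (· ≫ (varietyIso E).inv) h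
  simp only [chartPoint_comp_varietyIso_inv] at h1
  have h2 := Scheme.Hom.ext' h1
  have h3 := (cancel_mono (colimit.ι E.diagram D)).1 h2
  have h4 := Spec.map_injective h3
  exact congrArg CommRingCat.Hom.hom h4

/-- A local scheme maps into every open subset which contains the image of its closed point. -/
theorem exists_eq_chartPoint [IsLocalRing R]
    (α : (Spec (CommRingCat.of R)).toLocallyRingedSpace ⟶ E.variety) :
    ∃ (D : E.divisors) (φ : D.1.algebra →+* R), α = chartPoint D φ := by
  let β : Spec (CommRingCat.of R) ⟶ colimit E.diagram := ⟨α ≫ (varietyIso E).inv⟩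
  obtain ⟨D, x, hx⟩ := Scheme.IsLocallyDirected.ι_jointly_surjective E.diagram
    (β (IsLocalRing.closedPoint R))
  have hrange : Set.range β ⊆ Set.range (colimit.ι E.diagram D) := by
    have h1 : β ⁻¹ᵁ (colimit.ι E.diagram D).opensRange = ⊤ :=
      (IsLocalRing.closedPoint_mem_iff _).1 ⟨x, hx⟩
    rintro _ ⟨z, rfl⟩
    have h2 : z ∈ β ⁻¹ᵁ (colimit.ι E.diagram D).opensRange := h1 ▸ trivial
    exact h2
  let g : Spec (CommRingCat.of R) ⟶ E.diagram.obj D :=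
    IsOpenImmersion.lift (colimit.ι E.diagram D) β hrange
  have h3 : g ≫ colimit.ι E.diagram D = β := IsOpenImmersion.lift_fac _ _ _
  obtain ⟨φ, hφ⟩ := exists_chartHom_eq (D := D.1) g
  refine ⟨D, φ, (cancel_mono (varietyIso E).inv).1 ?_⟩
  rw [chartPoint_comp_varietyIso_inv, hφ]
  exact congrArg Scheme.Hom.toLRSHom h3.symm

/-- Two charts through which a local point of `X(E)` factors. -/
theorem exists_chartPoint_eq [IsLocalRing R] {D₁ D₂ D₃ : E.divisors} (h₃₁ : D₃.1 ≤ D₁.1)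
    (h₃₂ : D₃.1 ≤ D₂.1) (ht : D₁.1.tail ⊓ D₂.1.tail ≤ D₃.1.tail)
    (hc : ∀ y, D₁.1.coeff y ∩ D₂.1.coeff y ⊆ D₃.1.coeff y) {φ₁ : D₁.1.algebra →+* R}
    {φ₂ : D₂.1.algebra →+* R} (h : chartPoint D₁ φ₁ = chartPoint D₂ φ₂) :
    ∃ φ₃ : D₃.1.algebra →+* R, φ₃.comp (algebraInclusion h₃₁) = φ₁ ∧
      φ₃.comp (algebraInclusion h₃₂) = φ₂ := by
  have h1 := congrArg (· ≫ (varietyIso E).inv) h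
  simp only [chartPoint_comp_varietyIso_inv] at h1
  have h2 := congrArg (fun f : Spec (CommRingCat.of R) ⟶ colimit E.diagram =>
    f (IsLocalRing.closedPoint R)) (Scheme.Hom.ext' h1)
  beta_reduce at h2
  obtain ⟨D₀, f₁, f₂, x, hx₁, hx₂⟩ := Scheme.IsLocallyDirected.ι_eq_ι_iff E.diagram |>.1 h2
  -- The two images of the closed point come from a chart below both, hence below `D₃`. So the local
  -- point of `X(D₁)` lies in the open subset `X(D₃)`.
  have h₀₃ : D₀.1 ≤ D₃.1 := ⟨(le_inf f₁.le.1 f₂.le.1).trans ht, fun y =>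
    (Set.subset_inter (f₁.le.2 y) (f₂.le.2 y)).trans (hc y)⟩
  have hF := isOpenFace D₁.2 D₃.2 h₃₁
  have := hF.isOpenImmersion
  have hrange : Set.range (chartHom D₁.1 φ₁) ⊆ Set.range (chartMap h₃₁) := by
    have h3 : chartHom D₁.1 φ₁ ⁻¹ᵁ (chartMap h₃₁).opensRange = ⊤ := by
      refine (IsLocalRing.closedPoint_mem_iff _).1 ⟨chartMap h₀₃ x, ?_⟩
      refine Eq.trans ?_ hx₁
      exact (Scheme.Hom.comp_apply _ _ _).symm.trans
        (congrArg (fun f : D₀.1.chart ⟶ D₁.1.chart => f x) (Spec.map_comp _ _).symm)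
    rintro _ ⟨z, rfl⟩
    have h2 : z ∈ chartHom D₁.1 φ₁ ⁻¹ᵁ (chartMap h₃₁).opensRange := h3 ▸ trivial
    exact h2
  obtain ⟨φ₃, hφ₃⟩ := exists_chartHom_eq
    (IsOpenImmersion.lift (chartMap h₃₁) (chartHom D₁.1 φ₁) hrange)
  have h5 : chartHom D₁.1 (φ₃.comp (algebraInclusion h₃₁)) = chartHom D₁.1 φ₁ := by
    rw [← chartHom_comp_chartMap, hφ₃]
    exact IsOpenImmersion.lift_fac _ _ _
  have h6 : φ₃.comp (algebraInclusion h₃₁) = φ₁ :=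
    congrArg CommRingCat.Hom.hom (Spec.map_injective h5)
  refine ⟨φ₃, h6, chartPoint_injective D₂ ?_⟩
  rw [chartPoint_comp_algebraInclusion, ← h, ← h6, chartPoint_comp_algebraInclusion]

end Local

end DivisorialFan

/-! ### Orders of Laurent series -/

section Laurent

open PowerSeries LaurentSeries

variable {K : Type} [Field K]

theorem algebraMap_laurentSeries_injective : Function.Injective (algebraMap K⟦X⟧ K⸨X⸩) :=
  IsFractionRing.injective _ _

theorem algebraMap_laurentSeries_apply [Algebra ℂ K] (c : ℂ) :
    algebraMap K⟦X⟧ K⸨X⸩ (algebraMap ℂ K⟦X⟧ c) = algebraMap ℂ K⸨X⸩ c := rfl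

theorem algebraMap_laurentSeries_ne_zero {a : K⟦X⟧} (ha : a ≠ 0) : algebraMap K⟦X⟧ K⸨X⸩ a ≠ 0 :=
  (map_ne_zero_iff _ algebraMap_laurentSeries_injective).2 ha

theorem EqPowMulUnit.ne_zero {x : K⸨X⸩} {n : ℤ} {u : K⟦X⟧ˣ} (h : EqPowMulUnit x n u) : x ≠ 0 := by
  rw [h]
  exact mul_ne_zero (by simp) (algebraMap_laurentSeries_ne_zero u.ne_zero)

theorem order_algebraMap_nonneg (a : K⟦X⟧) : 0 ≤ (algebraMap K⟦X⟧ K⸨X⸩ a).order := by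
  by_cases ha : a = 0
  · simp [ha]
  by_contra! h
  refine algebraMap_laurentSeries_ne_zero ha (HahnSeries.coeff_order_eq_zero.1 ?_)
  rw [LaurentSeries.coe_algebraMap] at h ⊢
  rw [PowerSeries.coeff_coe, if_pos h]

theorem order_algebraMap_unit (u : K⟦X⟧ˣ) : (algebraMap K⟦X⟧ K⸨X⸩ u).order = 0 := by
  have h1 := HahnSeries.order_mul (algebraMap_laurentSeries_ne_zero u.ne_zero)
    (algebraMap_laurentSeries_ne_zero (u⁻¹).ne_zero)
  rw [← map_mul, Units.mul_inv, map_one, HahnSeries.order_one] at h1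
  have h2 := order_algebraMap_nonneg (u : K⟦X⟧)
  have h3 := order_algebraMap_nonneg ((u⁻¹ : K⟦X⟧ˣ) : K⟦X⟧)
  lia

theorem EqPowMulUnit.order_eq {x : K⸨X⸩} {n : ℤ} {u : K⟦X⟧ˣ} (h : EqPowMulUnit x n u) :
    x.order = n := by
  rw [h, HahnSeries.order_mul (by simp) (algebraMap_laurentSeries_ne_zero u.ne_zero),
    HahnSeries.order_single one_ne_zero,
    order_algebraMap_unit, add_zero]

theorem EqPowMulUnit.unit_unique {x : K⸨X⸩} {n : ℤ} {u u' : K⟦X⟧ˣ} (h : EqPowMulUnit x n u)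
    (h' : EqPowMulUnit x n u') : u = u' := by
  have h1 : HahnSeries.single n (1 : K) ≠ 0 := by simp
  exact Units.ext (algebraMap_laurentSeries_injective (mul_left_cancel₀ h1 (h.symm.trans h')))

theorem exists_eqPowMulUnit {x : K⸨X⸩} (hx : x ≠ 0) : ∃ u, EqPowMulUnit x x.order u := by
  have hu : IsUnit x.powerSeriesPart := by
    rw [PowerSeries.isUnit_iff_constantCoeff, ← PowerSeries.coeff_zero_eq_constantCoeff_apply,
      LaurentSeries.powerSeriesPart_coeff]
    simpa [HahnSeries.coeff_order_eq_zero] using hx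
  refine ⟨hu.unit, ?_⟩
  rw [EqPowMulUnit, IsUnit.unit_spec, LaurentSeries.coe_algebraMap]
  exact (LaurentSeries.single_order_mul_powerSeriesPart x).symm

/-- Reduces the conditions on units to orders. As the order of `0` is `0`, the condition `x ≠ 0` has
to be kept. -/
theorem eqPowMulUnit_iff {x : K⸨X⸩} {n : ℤ} : (∃ u, EqPowMulUnit x n u) ↔ x ≠ 0 ∧ x.order = n :=
  ⟨fun ⟨_, h⟩ => ⟨h.ne_zero, h.order_eq⟩, fun ⟨h, h'⟩ => h' ▸ exists_eqPowMulUnit h⟩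

theorem order_nonneg_iff {x : K⸨X⸩} (hx : x ≠ 0) :
    0 ≤ x.order ↔ x ∈ Set.range (algebraMap K⟦X⟧ K⸨X⸩) := by
  refine ⟨fun h => ?_, ?_⟩
  · obtain ⟨u, hu⟩ := exists_eqPowMulUnit hx
    obtain ⟨n, hn⟩ := Int.eq_ofNat_of_zero_le h
    refine ⟨(PowerSeries.X : K⟦X⟧) ^ n * u, ?_⟩
    rw [hu, hn, map_mul, LaurentSeries.coe_algebraMap, HahnSeries.ofPowerSeries_X_pow]
  · rintro ⟨a, rfl⟩
    exact order_algebraMap_nonneg a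

theorem isUnit_iff_order_eq_zero {a : K⟦X⟧} (ha : a ≠ 0) :
    IsUnit a ↔ (algebraMap K⟦X⟧ K⸨X⸩ a).order = 0 := by
  refine ⟨?_, fun h => ?_⟩
  · rintro ⟨u, rfl⟩
    exact order_algebraMap_unit u
  · obtain ⟨u, hu⟩ := exists_eqPowMulUnit (x := algebraMap K⟦X⟧ K⸨X⸩ a) (algebraMap_laurentSeries_ne_zero ha)
    rw [h, EqPowMulUnit] at hu
    have : a = u := algebraMap_laurentSeries_injective (by rw [hu]; simp)
    exact this ▸ u.isUnit

theorem order_zpow {x : K⸨X⸩} (hx : x ≠ 0) (n : ℤ) : (x ^ n).order = n * x.order := by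
  cases n with
  | ofNat n => simp [HahnSeries.order_pow]
  | negSucc n =>
    have h1 := HahnSeries.order_mul (zpow_ne_zero (Int.negSucc n) hx) (pow_ne_zero (n + 1) hx)
    rw [zpow_negSucc, inv_mul_cancel₀ (pow_ne_zero _ hx), HahnSeries.order_one,
      HahnSeries.order_pow, nsmul_eq_mul] at h1
    rw [zpow_negSucc, Int.negSucc_eq]
    push_cast at h1
    linarith

end Laurent

section Pull

variable {C : Scheme.{0}} {R S : Type} [CommRing R] [CommRing S]

theorem pull_eq {U : C.Opens} (g : Spec (CommRingCat.of R) ⟶ U.toScheme) (f : Γ(C, U)) :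
    pull g f = (U.topIso.inv ≫ g.appTop ≫ (Scheme.ΓSpecIso (CommRingCat.of R)).hom).hom f := rfl

theorem pull_eq_appLE {U : C.Opens} (g : Spec (CommRingCat.of R) ⟶ U.toScheme) (f : Γ(C, U))
    (h : ⊤ ≤ (g ≫ U.ι) ⁻¹ᵁ U) : pull g f =
      ((g ≫ U.ι).appLE U ⊤ h ≫ (Scheme.ΓSpecIso (CommRingCat.of R)).hom).hom f := by
  have h1 : U.topIso.inv ≫ g.appTop = (g ≫ U.ι).appLE U ⊤ h := by
    rw [← Scheme.Hom.appLE_comp_appLE g U.ι U ⊤ ⊤ (by simp) (by simp), Scheme.Opens.ι_appLE]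
    exact congrArg (fun i => C.presheaf.map i ≫ g.appLE ⊤ ⊤ _) (Subsingleton.elim _ _)
  rw [pull_eq, ← h1]
  rfl

theorem pull_Spec_map_comp {U : C.Opens} (φ : R →+* S)
    (g : Spec (CommRingCat.of R) ⟶ U.toScheme) (f : Γ(C, U)) :
    pull (Spec.map (CommRingCat.ofHom φ) ≫ g) f = φ (pull g f) := by
  rw [pull_eq, pull_eq, Scheme.Hom.comp_appTop, Category.assoc, Scheme.ΓSpecIso_naturality]
  rfl

end Pull

/-! ### Values of rational functions at local points of the curve -/

section Points

variable {C : Scheme.{0}} [C.Over SpecC] [IsSmoothProjectiveCurve C]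
  {R S : Type} [CommRing R] [IsLocalRing R] [CommRing S] [IsLocalRing S]

/-- The value at `f` of the local point `g` of `C` is `r`: the rational function `f` is regular at
the image of the closed point, and its pull-back is `r`. -/
def EvalsTo (g : Spec (CommRingCat.of R) ⟶ C) (f : C.functionField) (r : R) : Prop :=
  ∃ a : C.presheaf.stalk (g (IsLocalRing.closedPoint R)),
    algebraMap _ C.functionField a = f ∧ (Scheme.stalkClosedPointTo g).hom a = r

/-- Passing through the equivalence between local points and pairs of a point and a local
homomorphism avoids transport between stalks at equal points. -/
theorem evalsTo_Spec_map_comp_fromSpecStalk {x : C} (θ : C.presheaf.stalk x →+* R) [hθ : IsLocalHom θ]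
    {f : C.functionField} {r : R} :
    EvalsTo (Spec.map (CommRingCat.ofHom θ) ≫ C.fromSpecStalk x) f r ↔
      ∃ a : C.presheaf.stalk x, algebraMap _ C.functionField a = f ∧ θ a = r := by
  have key : ∀ s : (Σ x, { f : C.presheaf.stalk x ⟶ CommRingCat.of R // IsLocalHom f.hom }),
      EvalsTo ((SpecToEquivOfLocalRing C (CommRingCat.of R)).symm s) f r ↔
      ∃ a : C.presheaf.stalk s.1, algebraMap _ C.functionField a = f ∧ s.2.1.hom a = r := by
    intro s
    obtain ⟨g, rfl⟩ := (SpecToEquivOfLocalRing C (CommRingCat.of R)).surjective s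
    rw [Equiv.symm_apply_apply]
    rfl
  exact key ⟨x, CommRingCat.ofHom θ, hθ⟩

theorem exists_eq_Spec_map_comp_fromSpecStalk (g : Spec (CommRingCat.of R) ⟶ C) :
    ∃ θ : C.presheaf.stalk (g (IsLocalRing.closedPoint R)) →+* R, IsLocalHom θ ∧
      g = Spec.map (CommRingCat.ofHom θ) ≫ C.fromSpecStalk _ :=
  ⟨(Scheme.stalkClosedPointTo g).hom, inferInstance,
    (Scheme.Spec_stalkClosedPointTo_fromSpecStalk g).symm⟩

variable {g g' : Spec (CommRingCat.of R) ⟶ C} {f f' : C.functionField} {r r' : R}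

theorem algebraMap_stalk_injective (x : C) :
    Function.Injective (algebraMap (C.presheaf.stalk x) C.functionField) :=
  IsFractionRing.injective _ _

theorem EvalsTo.unique (h : EvalsTo g f r) (h' : EvalsTo g f r') : r = r' := by
  obtain ⟨a, ha, rfl⟩ := h
  obtain ⟨b, hb, rfl⟩ := h'
  rw [algebraMap_stalk_injective _ (ha.trans hb.symm)]

theorem EvalsTo.add (h : EvalsTo g f r) (h' : EvalsTo g f' r') : EvalsTo g (f + f') (r + r') := by
  obtain ⟨a, rfl, rfl⟩ := h
  obtain ⟨b, rfl, rfl⟩ := h'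
  exact ⟨a + b, map_add _ _ _, map_add _ _ _⟩

theorem EvalsTo.sub (h : EvalsTo g f r) (h' : EvalsTo g f' r') : EvalsTo g (f - f') (r - r') := by
  obtain ⟨a, rfl, rfl⟩ := h
  obtain ⟨b, rfl, rfl⟩ := h'
  exact ⟨a - b, map_sub _ _ _, map_sub _ _ _⟩

theorem EvalsTo.mul (h : EvalsTo g f r) (h' : EvalsTo g f' r') : EvalsTo g (f * f') (r * r') := by
  obtain ⟨a, rfl, rfl⟩ := h
  obtain ⟨b, rfl, rfl⟩ := h'
  exact ⟨a * b, map_mul _ _ _, map_mul _ _ _⟩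

theorem evalsTo_zero : EvalsTo g 0 0 := ⟨0, map_zero _, map_zero _⟩

theorem evalsTo_one : EvalsTo g 1 1 := ⟨1, map_one _, map_one _⟩

theorem EvalsTo.pow (h : EvalsTo g f r) (n : ℕ) : EvalsTo g (f ^ n) (r ^ n) := by
  obtain ⟨a, rfl, rfl⟩ := h
  exact ⟨a ^ n, map_pow _ _ _, map_pow _ _ _⟩

theorem EvalsTo.ne_zero (h : EvalsTo g f r) (hr : r ≠ 0) : f ≠ 0 := by
  rintro rfl
  exact hr (h.unique evalsTo_zero)

theorem EvalsTo.inv (h : EvalsTo g f r) (hr : r * r' = 1) : EvalsTo g f⁻¹ r' := by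
  obtain ⟨a, rfl, rfl⟩ := h
  obtain ⟨u, rfl⟩ := isUnit_of_map_unit (Scheme.stalkClosedPointTo g).hom a (IsUnit.of_mul_eq_one _ hr)
  refine ⟨(u⁻¹ : (C.presheaf.stalk _)ˣ), ?_, ?_⟩
  · refine eq_inv_of_mul_eq_one_left ?_
    rw [← map_mul, Units.inv_mul, map_one]
  · refine (left_inv_eq_right_inv ?_ hr)
    rw [← map_mul, Units.inv_mul, map_one]

/-- A local point amounts to the image of the closed point and a homomorphism from the stalk there,
and the stalk lies in the function field. -/
theorem hom_ext_of_evalsTo (hx : g (IsLocalRing.closedPoint R) = g' (IsLocalRing.closedPoint R))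
    (h : ∀ f r r', EvalsTo g f r → EvalsTo g' f r' → r = r') : g = g' := by
  obtain ⟨θ, hθ, hg⟩ := exists_eq_Spec_map_comp_fromSpecStalk g
  obtain ⟨θ', hθ', hg'⟩ := exists_eq_Spec_map_comp_fromSpecStalk g'
  generalize g (IsLocalRing.closedPoint R) = x at *
  generalize g' (IsLocalRing.closedPoint R) = x' at *
  subst hx hg hg'
  have : θ = θ' := by
    ext a
    exact h _ _ _ ((evalsTo_Spec_map_comp_fromSpecStalk θ).2 ⟨a, rfl, rfl⟩)
      ((evalsTo_Spec_map_comp_fromSpecStalk θ').2 ⟨a, rfl, rfl⟩)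
  rw [this]

theorem exists_evalsTo_iff : (∃ r, EvalsTo g f r) ↔
    f ∈ Set.range (algebraMap (C.presheaf.stalk (g (IsLocalRing.closedPoint R))) C.functionField) :=
  ⟨fun ⟨_, a, ha, _⟩ => ⟨a, ha⟩, fun ⟨a, ha⟩ => ⟨_, a, ha, rfl⟩⟩

theorem exists_evalsTo_of_eq_genericPoint (hg : g (IsLocalRing.closedPoint R) = genericPoint C)
    (f : C.functionField) : ∃ r, EvalsTo g f r := by
  rw [exists_evalsTo_iff, hg]
  refine ⟨f, ?_⟩
  change (C.presheaf.stalkSpecializes _).hom f = f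
  rw [TopCat.Presheaf.stalkSpecializes_refl]
  rfl

theorem exists_evalsTo_of_ord_nonneg (y : ClosedPt C) (hg : g (IsLocalRing.closedPoint R) = y.1)
    (hf : f ≠ 0 → 0 ≤ ord y f) : ∃ r, EvalsTo g f r := by
  by_cases h0 : f = 0
  · exact ⟨0, h0 ▸ evalsTo_zero⟩
  rw [exists_evalsTo_iff, hg]
  exact (ord_nonneg_iff y h0).1 (hf h0)

theorem EvalsTo.ord_nonneg (y : ClosedPt C) (hg : g (IsLocalRing.closedPoint R) = y.1)
    (h : EvalsTo g f r) : 0 ≤ ord y f := by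
  by_cases h0 : f = 0
  · rw [h0, ord_zero]
  refine (ord_nonneg_iff y h0).2 ?_
  rw [← hg]
  exact exists_evalsTo_iff.1 ⟨r, h⟩

theorem EvalsTo.isUnit_iff (y : ClosedPt C) (hg : g (IsLocalRing.closedPoint R) = y.1)
    (h : EvalsTo g f r) (hf : f ≠ 0) : IsUnit r ↔ ord y f = 0 := by
  refine ⟨fun hr => ?_, fun h0 => ?_⟩
  · obtain ⟨r', hr'⟩ := hr.exists_right_inv
    have h1 := (h.inv hr').ord_nonneg y hg
    rw [ord_inv] at h1
    have h2 := h.ord_nonneg y hg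
    lia
  · obtain ⟨r', hr'⟩ := exists_evalsTo_of_ord_nonneg (f := f⁻¹) y hg
      fun _ => by rw [ord_inv, h0, neg_zero]
    have h1 := h.mul hr'
    rw [mul_inv_cancel₀ hf] at h1
    exact IsUnit.of_mul_eq_one _ (h1.unique evalsTo_one)

theorem EvalsTo.isUnit (hg : g (IsLocalRing.closedPoint R) = genericPoint C)
    (h : EvalsTo g f r) (hf : f ≠ 0) : IsUnit r := by
  obtain ⟨r', hr'⟩ := exists_evalsTo_of_eq_genericPoint hg f⁻¹
  have h1 := h.mul hr'
  rw [mul_inv_cancel₀ hf] at h1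
  exact IsUnit.of_mul_eq_one _ (h1.unique evalsTo_one)

theorem evalsTo_pull {U : C.Opens} [Nonempty U] (g : Spec (CommRingCat.of R) ⟶ U.toScheme)
    (f : Γ(C, U)) : EvalsTo (g ≫ U.ι) (C.germToFunctionField U f) (pull g f) := by
  have hx : (g ≫ U.ι) (IsLocalRing.closedPoint R) ∈ U :=
    (g (IsLocalRing.closedPoint R)).2
  refine ⟨C.presheaf.germ U _ hx f, Scheme.algebraMap_germ_eq_germToFunctionField (X := C) hx f, ?_⟩
  rw [pull_eq_appLE _ _ (fun z _ => (g z).2)]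
  refine (congrArg (fun φ => CommRingCat.Hom.hom φ f)
    (Scheme.germ_stalkClosedPointTo (R := CommRingCat.of R) (g ≫ U.ι) U hx)).trans ?_
  refine congrArg (fun φ : Γ(C, U) ⟶ CommRingCat.of R => φ.hom f) ?_
  rw [Iso.trans_hom, ← Category.assoc, Scheme.Hom.app_eq_appLE]
  congr 1

theorem EvalsTo.exists_pull (h : EvalsTo g f r) : ∃ (U : C.Opens) (_ : Nonempty U)
    (g₀ : Spec (CommRingCat.of R) ⟶ U.toScheme) (s : Γ(C, U)), g₀ ≫ U.ι = g ∧
      C.germToFunctionField U s = f ∧ pull g₀ s = r := by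
  obtain ⟨V, hV, s, hxV, -, hs⟩ := exists_germ_of_mem_range (exists_evalsTo_iff.1 ⟨r, h⟩) ⊤ trivial
  have hrange : Set.range g ⊆ Set.range V.ι := by
    rw [Scheme.Opens.range_ι]
    rintro _ ⟨z, rfl⟩
    have h1 := Scheme.preimage_eq_top_of_closedPoint_mem (R := CommRingCat.of R) g hxV
    have h2 : z ∈ g ⁻¹ᵁ V := h1 ▸ trivial
    exact h2
  refine ⟨V, hV, IsOpenImmersion.lift V.ι g hrange, s, IsOpenImmersion.lift_fac _ _ _, hs, ?_⟩
  have h1 := evalsTo_pull (IsOpenImmersion.lift V.ι g hrange) s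
  rw [IsOpenImmersion.lift_fac, hs] at h1
  exact h1.unique h

theorem evalsTo_algebraMap {φ : ℂ →+* R}
    (h : g ≫ (C ↘ SpecC) = Spec.map (CommRingCat.ofHom φ)) (c : ℂ) :
    EvalsTo g (algebraMap ℂ C.functionField c) (φ c) := by
  have : Nonempty (⊤ : C.Opens) := ⟨⟨genericPoint C, trivial⟩⟩
  refine ⟨C.presheaf.germ ⊤ _ trivial ((C ↘ SpecC).appTop.hom
    ((Scheme.ΓSpecIso (CommRingCat.of ℂ)).inv.hom c)), ?_, ?_⟩
  · rw [algebraMap_eq_germToFunctionField]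
    exact Scheme.algebraMap_germ_eq_germToFunctionField (X := C) _ _
  · refine (congrArg (fun φ => CommRingCat.Hom.hom φ _)
      (Scheme.germ_stalkClosedPointTo (R := CommRingCat.of R) g ⊤ trivial)).trans ?_
    have h1 : (C ↘ SpecC).appTop ≫ g.appTop ≫ (Scheme.ΓSpecIso (CommRingCat.of R)).hom =
        (Scheme.ΓSpecIso (CommRingCat.of ℂ)).hom ≫ CommRingCat.ofHom φ := by
      rw [← Scheme.ΓSpecIso_naturality, ← h, Scheme.Hom.comp_appTop, Category.assoc]
    have h2 : (Scheme.ΓSpecIso (CommRingCat.of ℂ)).inv ≫ (C ↘ SpecC).appTop ≫ g.appTop ≫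
        (Scheme.ΓSpecIso (CommRingCat.of R)).hom = CommRingCat.ofHom φ := by
      rw [h1, Iso.inv_hom_id_assoc]
    refine Eq.trans ?_ (congrArg (fun φ => CommRingCat.Hom.hom φ c) h2)
    refine congrArg (fun ψ : Γ(C, ⊤) ⟶ CommRingCat.of R => ψ.hom _)
      (a₂ := g.appTop ≫ (Scheme.ΓSpecIso (CommRingCat.of R)).hom) ?_
    exact congrArg (g.appTop ≫ ·) ((congrArg (· ≫ (Scheme.ΓSpecIso (CommRingCat.of R)).hom)
      ((Spec (CommRingCat.of R)).presheaf.map_id _)).trans (Category.id_comp _))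

theorem comp_over_eq_iff [Algebra ℂ R] :
    g ≫ (C ↘ SpecC) = Spec.map (CommRingCat.ofHom (algebraMap ℂ R)) ↔
      ∀ c : ℂ, EvalsTo g (algebraMap ℂ C.functionField c) (algebraMap ℂ R c) := by
  refine ⟨fun h => evalsTo_algebraMap h, fun h => ?_⟩
  obtain ⟨φ, hφ⟩ := Spec.map_surjective (g ≫ (C ↘ SpecC))
  rw [← hφ]
  congr 1
  ext c
  exact (evalsTo_algebraMap (φ := φ.hom) hφ.symm c).unique (h c)

theorem EvalsTo.comp (φ : R →+* S) (h : EvalsTo g f r) :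
    EvalsTo (Spec.map (CommRingCat.ofHom φ) ≫ g) f (φ r) := by
  obtain ⟨U, hU, g₀, s, rfl, rfl, rfl⟩ := h.exists_pull
  rw [← Category.assoc, ← pull_Spec_map_comp]
  exact evalsTo_pull _ s

end Points

section AffinePoint

variable {C : Scheme.{0}} {R : Type} [CommRing R] {U : C.Opens}

theorem exists_pull_eq (hU : IsAffineOpen U) (τ : Γ(C, U) →+* R) :
    ∃ g : Spec (CommRingCat.of R) ⟶ U.toScheme, ∀ f, pull g f = τ f := by
  have h1 : ∀ f, pull (R := Γ(C, U)) hU.isoSpec.inv f = f := by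
    intro f
    rw [pull_eq]
    have h2 : U.topIso.inv ≫ hU.isoSpec.inv.appTop ≫ (Scheme.ΓSpecIso Γ(C, U)).hom = 𝟙 _ := by
      rw [hU.isoSpec_inv_appTop, Category.assoc, Iso.inv_hom_id, Category.comp_id,
        Iso.inv_hom_id]
    exact congrArg (fun φ => CommRingCat.Hom.hom φ f) h2
  refine ⟨Spec.map (CommRingCat.ofHom τ) ≫ hU.isoSpec.inv, fun f => ?_⟩
  have h3 := pull_Spec_map_comp (R := Γ(C, U)) τ hU.isoSpec.inv f
  rw [h1] at h3
  exact h3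

theorem hom_ext_of_pull (hU : IsAffineOpen U) {g g' : Spec (CommRingCat.of R) ⟶ U.toScheme}
    (h : ∀ f, pull g f = pull g' f) : g = g' := by
  have := hU.isoSpec.isIso_hom
  obtain ⟨a, ha⟩ := Spec.map_surjective (g ≫ hU.isoSpec.hom)
  obtain ⟨b, hb⟩ := Spec.map_surjective (g' ≫ hU.isoSpec.hom)
  have key : ∀ (g : Spec (CommRingCat.of R) ⟶ U.toScheme) (a : Γ(C, U) ⟶ CommRingCat.of R),
      Spec.map a = g ≫ hU.isoSpec.hom → ∀ f, pull g f = a.hom f := by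
    intro g a ha f
    have h1 : U.topIso.inv ≫ g.appTop = (Scheme.ΓSpecIso Γ(C, U)).inv ≫ (Spec.map a).appTop := by
      rw [ha, Scheme.Hom.comp_appTop, hU.isoSpec_hom_appTop, Category.assoc, Iso.inv_hom_id_assoc]
    rw [pull_eq, reassoc_of% h1, Scheme.ΓSpecIso_naturality, Iso.inv_hom_id_assoc]
  rw [← cancel_mono hU.isoSpec.hom, ← ha, ← hb]
  congr 1
  ext f
  rw [← key g a ha, ← key g' b hb, h]

end AffinePoint

/-! ### Homomorphisms out of `A(D)` -/

namespace PolyhedralDivisor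

variable {C : Scheme.{0}} [C.Over SpecC] [IsSmoothProjectiveCurve C]
  {M : Type} [AddCommGroup M] {D : PolyhedralDivisor C M}

/-- The homogeneous elements generate the algebra of `D`. -/
theorem eq_top_of_homogeneous_mem {S : Subring D.algebra}
    (h : ∀ (m : M) (f : C.functionField) (hf : f ∈ D.piece m), homogeneous hf ∈ S) : S = ⊤ := by
  refine eq_top_iff.2 fun a _ => ?_
  have h1 : a = ∑ m ∈ a.1.coeff.support, homogeneous (a.2 m) := by
    refine Subtype.ext ?_
    rw [AddSubmonoidClass.coe_finsetSum]
    exact a.1.sum_coeff_single.symm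
  rw [h1]
  exact sum_mem fun m _ => h m _ _

theorem ringHom_ext_of_homogeneous {L : Type} [Semiring L] {ρ ρ' : D.algebra →+* L}
    (h : ∀ (m : M) (f : C.functionField) (hf : f ∈ D.piece m),
      ρ (homogeneous hf) = ρ' (homogeneous hf)) : ρ = ρ' := by
  refine RingHom.ext fun a => ?_
  have h1 : RingHom.eqLocus ρ ρ' = ⊤ := eq_top_of_homogeneous_mem h
  have h2 : a ∈ RingHom.eqLocus ρ ρ' := h1 ▸ trivial
  exact h2

theorem exists_comp_eq_of_homogeneous {R L : Type} [CommRing R] [CommRing L] {φ : R →+* L}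
    (hφ : Function.Injective φ) {ρ : D.algebra →+* L}
    (h : ∀ (m : M) (f : C.functionField) (hf : f ∈ D.piece m), ρ (homogeneous hf) ∈ φ.range) :
    ∃ ρ₀ : D.algebra →+* R, φ.comp ρ₀ = ρ := by
  have h1 : φ.range.comap ρ = ⊤ := eq_top_of_homogeneous_mem h
  have h2 : ∀ a, ρ a ∈ φ.range := fun a => by
    have h3 : a ∈ φ.range.comap ρ := h1 ▸ trivial
    exact h3
  refine ⟨(RingEquiv.ofLeftInverse (Function.leftInverse_invFun hφ)).symm.toRingHom.comp
    (ρ.codRestrict φ.range h2), RingHom.ext fun a => ?_⟩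
  exact congrArg Subtype.val ((RingEquiv.ofLeftInverse
    (Function.leftInverse_invFun hφ)).apply_symm_apply ⟨ρ a, h2 a⟩)

/-- If all the coefficients lie in `R` then `A(D) ⊆ R[M]`, and `θ` and `χ` define a homomorphism on
`R[M]`. -/
theorem exists_ringHom_homogeneous {R L : Type} [CommRing R] [CommRing L]
    {ι : R →+* C.functionField} (hι : Function.Injective ι) (θ : R →+* L)
    (χ : Multiplicative M →* L) (hD : ∀ (m : M), ∀ f ∈ D.piece m, f ∈ ι.range) :
    ∃ ρ : D.algebra →+* L, ∀ (m : M) (r : R) (hr : ι r ∈ D.piece m),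
      ρ (homogeneous hr) = θ r * χ (.ofAdd m) := by
  let j := AddMonoidAlgebra.mapRingHom M ι
  have hj : Function.Injective j := by
    intro a b hab
    refine AddMonoidAlgebra.ext (Finsupp.ext fun m => hι ?_)
    rw [← AddMonoidAlgebra.coeff_mapRingHom, ← AddMonoidAlgebra.coeff_mapRingHom]
    exact congrArg (fun x => AddMonoidAlgebra.coeff x m) hab
  obtain ⟨ρ₀, hρ₀⟩ := exists_comp_eq_of_homogeneous (D := D) (ρ := D.algebra.val.toRingHom) hj
    (by
      intro m f hf
      obtain ⟨r, rfl⟩ := hD m f hf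
      exact ⟨AddMonoidAlgebra.single m r, AddMonoidAlgebra.mapRingHom_single _ _ _⟩)
  let q : AddMonoidAlgebra R M →+* L :=
    AddMonoidAlgebra.liftNCRingHom θ χ fun _ _ => Commute.all _ _
  refine ⟨q.comp ρ₀, fun m r hr => ?_⟩
  have h1 : ρ₀ (homogeneous hr) = AddMonoidAlgebra.single m r :=
    hj ((RingHom.congr_fun hρ₀ (homogeneous hr)).trans
      (AddMonoidAlgebra.mapRingHom_single _ _ _).symm)
  rw [RingHom.comp_apply, h1]
  exact AddMonoidAlgebra.liftNC_single _ _ _ _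

variable [Module.Free ℤ M] [Module.Finite ℤ M] {U : C.Opens} {hU : Nonempty U}

theorem germ_mem_piece_trivialDivisor (m : M) (s : Γ(C, U)) :
    C.germToFunctionField U s ∈ (trivialDivisor M U hU).piece m := by
  rw [mem_piece_iff]
  refine fun _ => ⟨fun v hv => ?_, fun y v hv => ?_⟩
  · have h1 : v = 0 := by simpa [trivialDivisor] using hv
    simp [h1]
  · obtain ⟨hy, rfl⟩ := mem_coeff_trivialDivisor.1 hv
    have := ord_germ_nonneg hy s
    simpa using this

theorem exists_germ_eq_of_mem_piece_trivialDivisor {m : M} {f : C.functionField}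
    (hf : f ∈ (trivialDivisor M U hU).piece m) : ∃ s : Γ(C, U), C.germToFunctionField U s = f := by
  refine exists_section_of_ord_nonneg U fun hf0 y hy => ?_
  have h1 := (mem_piece_iff.1 hf hf0).2 y 0 (mem_coeff_trivialDivisor.2 ⟨hy, rfl⟩)
  simpa using h1

theorem trivialDivisor_mono {W : C.Opens} {hW : Nonempty W} (h : W ≤ U) :
    trivialDivisor M W hW ≤ trivialDivisor M U hU := by
  refine ⟨le_rfl, fun y v hv => ?_⟩
  obtain ⟨hy, rfl⟩ := mem_coeff_trivialDivisor.1 hv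
  exact mem_coeff_trivialDivisor.2 ⟨h hy, rfl⟩

theorem le_locus_of_trivialDivisor_le (h : trivialDivisor M U hU ≤ D) : U ≤ D.locus := by
  intro x hx
  obtain rfl | hxc := eq_genericPoint_or_isClosed x
  · have : Nonempty D.locus := D.locus_nonempty.to_subtype
    exact genericPoint_mem _
  · exact mem_locus_of_mem_coeff (h.2 ⟨x, hxc⟩ (mem_coeff_trivialDivisor.2 ⟨hx, rfl⟩))

end PolyhedralDivisor

/-! ### Points of `Γ × T` and their restrictions to the algebras -/

namespace TorusPoint

open PolyhedralDivisor LaurentSeries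

variable {C : Scheme.{0}} [C.Over SpecC] [IsSmoothProjectiveCurve C]
  {M : Type} [AddCommGroup M] {D D' : PolyhedralDivisor C M} {Γ : C.Opens}
  {K : Type} [Field K] [Algebra ℂ K]

/-- The `𝒦`-point of the curve underlying a `𝒦`-point of `Γ × T`. -/
def curvePoint (p : TorusPoint Γ M K) : Spec (CommRingCat.of K⸨X⸩) ⟶ C := p.base ≫ Γ.ι

/-- The image of the `𝒦`-point of the curve underlying a `𝒦`-point of `Γ × T`. -/
def center (p : TorusPoint Γ M K) : C := p.curvePoint (IsLocalRing.closedPoint K⸨X⸩)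

/-- The value of the character `χ^m`. -/
abbrev charAt (p : TorusPoint Γ M K) (m : M) : K⸨X⸩ := p.char (AddMonoidAlgebra.single m 1)

/-- The homomorphism `ρ : A(D) → 𝒦` is the restriction of the `𝒦`-point `p` of `Γ × T`: the
coefficients of `A(D)` are regular at the image of `p`, and `ρ(f χ^m) = p_Γ^*(f) * p_M^*(χ^m)`. -/
def RestrictsTo (p : TorusPoint Γ M K) (D : PolyhedralDivisor C M) (ρ : D.algebra →+* K⸨X⸩) :
    Prop :=
  ∀ (m : M) (f : C.functionField) (hf : f ∈ D.piece m),
    ∃ r, EvalsTo p.curvePoint f r ∧ ρ (homogeneous hf) = r * p.charAt m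

variable {p p' : TorusPoint Γ M K}

theorem center_mem (p : TorusPoint Γ M K) : p.center ∈ Γ :=
  (p.base (IsLocalRing.closedPoint K⸨X⸩)).2

theorem charAt_add (p : TorusPoint Γ M K) (m m' : M) :
    p.charAt (m + m') = p.charAt m * p.charAt m' := by
  rw [charAt, ← mul_one (1 : ℂ), ← AddMonoidAlgebra.single_mul_single, map_mul]

theorem charAt_zero (p : TorusPoint Γ M K) : p.charAt 0 = 1 := map_one p.char

theorem charAt_ne_zero (p : TorusPoint Γ M K) (m : M) : p.charAt m ≠ 0 := by
  refine left_ne_zero_of_mul (b := p.charAt (-m)) ?_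
  rw [← charAt_add, add_neg_cancel, charAt_zero]
  exact one_ne_zero

/-- The characters of a point, as a homomorphism of monoids. -/
def charHom (p : TorusPoint Γ M K) : Multiplicative M →* K⸨X⸩ where
  toFun m := p.charAt m.toAdd
  map_one' := p.charAt_zero
  map_mul' m m' := p.charAt_add m.toAdd m'.toAdd

theorem RestrictsTo.unique {ρ ρ' : D.algebra →+* K⸨X⸩} (h : p.RestrictsTo D ρ)
    (h' : p.RestrictsTo D ρ') : ρ = ρ' := by
  refine ringHom_ext_of_homogeneous fun m f hf => ?_
  obtain ⟨r, hr, h1⟩ := h m f hf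
  obtain ⟨r', hr', h1'⟩ := h' m f hf
  rw [h1, h1', hr.unique hr']

theorem RestrictsTo.comp_algebraInclusion {ρ : D.algebra →+* K⸨X⸩} (h : p.RestrictsTo D ρ)
    (hD : D ≤ D') : p.RestrictsTo D' (ρ.comp (algebraInclusion hD)) :=
  fun m f hf => h m f (piece_anti hD m hf)

theorem exists_restrictsTo (h : ∀ (m : M), ∀ f ∈ D.piece m, ∃ r, EvalsTo p.curvePoint f r) :
    ∃ ρ, p.RestrictsTo D ρ := by
  obtain ⟨ρ, hρ⟩ := exists_ringHom_homogeneous (D := D)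
    (algebraMap_stalk_injective (C := C) (p.curvePoint (IsLocalRing.closedPoint K⸨X⸩)))
    (Scheme.stalkClosedPointTo p.curvePoint).hom p.charHom
    (fun m f hf => exists_evalsTo_iff.1 (h m f hf))
  refine ⟨ρ, fun m f hf => ?_⟩
  obtain ⟨a, rfl⟩ := exists_evalsTo_iff.1 (h m f hf)
  exact ⟨_, ⟨a, rfl, rfl⟩, hρ m a hf⟩

theorem RestrictsTo.map_algebraMap {ρ : D.algebra →+* K⸨X⸩} (h : p.RestrictsTo D ρ) (c : ℂ) :
    ρ (algebraMap ℂ D.algebra c) = algebraMap ℂ K⸨X⸩ c := by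
  obtain ⟨r, hr, h1⟩ := h 0 _ (algebraMap_mem_piece c)
  have hover : p.curvePoint ≫ (C ↘ SpecC) = Spec.map (CommRingCat.ofHom (algebraMap ℂ K⸨X⸩)) :=
    (Category.assoc _ _ _).trans p.base_over
  rw [charAt_zero, mul_one, hr.unique (comp_over_eq_iff.1 hover c)] at h1
  rw [← h1]
  exact congrArg ρ (Subtype.ext (congrFun AddMonoidAlgebra.coe_algebraMap c))

variable [Module.Free ℤ M] [Module.Finite ℤ M]

/-- All rational functions are regular at the generic point. At a closed point of `Γ` in the locus
the coefficient contains `0`, which forces the coefficients of `A(D)` to be regular. -/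
theorem exists_restrictsTo_of_center_mem (hx : p.center ∈ D.locus)
    (hsp : ∀ y : ClosedPt C, y.1 ∈ Γ → y.1 ∈ D.locus → D.coeff y = (D.tail : Set (NQ M))) :
    ∃ ρ, p.RestrictsTo D ρ := by
  refine exists_restrictsTo fun m f hf => ?_
  obtain hg | hc := eq_genericPoint_or_isClosed p.center
  · exact exists_evalsTo_of_eq_genericPoint hg f
  · refine exists_evalsTo_of_ord_nonneg ⟨p.center, hc⟩ rfl fun hf0 => ?_
    have h1 := (mem_piece_iff.1 hf hf0).2 ⟨p.center, hc⟩ 0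
      (by rw [hsp ⟨_, hc⟩ p.center_mem hx]; exact D.tail.zero_mem)
    simpa using h1

variable {U : C.Opens} {hU : Nonempty U}

theorem RestrictsTo.charAt_eq {ψ : (trivialDivisor M U hU).algebra →+* K⸨X⸩}
    (h : p.RestrictsTo (trivialDivisor M U hU) ψ) (m : M)
    (hm : (1 : C.functionField) ∈ (trivialDivisor M U hU).piece m) :
    ψ (homogeneous hm) = p.charAt m := by
  obtain ⟨r, hr, h1⟩ := h m 1 hm
  rw [h1, hr.unique evalsTo_one, one_mul]

theorem one_mem_piece_trivialDivisor (m : M) :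
    (1 : C.functionField) ∈ (trivialDivisor M U hU).piece m := by
  have h := germ_mem_piece_trivialDivisor (hU := hU) m (1 : Γ(C, U))
  rwa [map_one] at h

theorem exists_base_eq (hx : p.center ∈ U) (hUΓ : U ≤ Γ) :
    ∃ g : Spec (CommRingCat.of K⸨X⸩) ⟶ U.toScheme, g ≫ C.homOfLE hUΓ = p.base := by
  have hrange : Set.range p.curvePoint ⊆ Set.range U.ι := by
    rw [Scheme.Opens.range_ι]
    rintro _ ⟨z, rfl⟩
    have h1 := Scheme.preimage_eq_top_of_closedPoint_mem (R := CommRingCat.of K⸨X⸩) p.curvePoint hx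
    have h2 : z ∈ p.curvePoint ⁻¹ᵁ U := h1 ▸ trivial
    exact h2
  refine ⟨IsOpenImmersion.lift U.ι p.curvePoint hrange, ?_⟩
  rw [← cancel_mono Γ.ι, Category.assoc, Scheme.homOfLE_ι, IsOpenImmersion.lift_fac]
  rfl

theorem comp_ι_eq_curvePoint {hUΓ : U ≤ Γ} {g : Spec (CommRingCat.of K⸨X⸩) ⟶ U.toScheme}
    (hg : g ≫ C.homOfLE hUΓ = p.base) : g ≫ U.ι = p.curvePoint := by
  rw [curvePoint, ← hg, Category.assoc, Scheme.homOfLE_ι]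

/-- The right-hand side is the condition in `Arc.HasGenericPoint`. It covers all homogeneous
elements because the pieces of the trivial divisor are the regular functions on `U`. -/
theorem restrictsTo_trivialDivisor_iff {hUΓ : U ≤ Γ}
    {g : Spec (CommRingCat.of K⸨X⸩) ⟶ U.toScheme} (hg : g ≫ C.homOfLE hUΓ = p.base)
    {ψ : (trivialDivisor M U hU).algebra →+* K⸨X⸩} :
    p.RestrictsTo (trivialDivisor M U hU) ψ ↔
      ∀ (f : Γ(C, U)) (m : M) (a : (trivialDivisor M U hU).algebra),
        (a : AddMonoidAlgebra C.functionField M) =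
          AddMonoidAlgebra.single m (C.germToFunctionField U f) → ψ a = pull g f * p.charAt m := by
  have key : ∀ f : Γ(C, U), EvalsTo p.curvePoint (C.germToFunctionField U f) (pull g f) := by
    intro f
    rw [← comp_ι_eq_curvePoint hg]
    exact evalsTo_pull g f
  refine ⟨fun h f m a ha => ?_, fun h m f hf => ?_⟩
  · obtain ⟨r, hr, h1⟩ := h m _ (germ_mem_piece_trivialDivisor m f)
    rw [← (key f).unique hr] at h1
    rw [← h1]
    exact congrArg ψ (Subtype.ext ha)
  · obtain ⟨s, rfl⟩ := exists_germ_eq_of_mem_piece_trivialDivisor hf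
    exact ⟨_, key s, h s m _ rfl⟩

theorem ext_of_restrictsTo (hUa : IsAffineOpen U) (hUΓ : U ≤ Γ) (hx : p.center ∈ U)
    (hx' : p'.center ∈ U) {ψ : (trivialDivisor M U hU).algebra →+* K⸨X⸩}
    (h : p.RestrictsTo (trivialDivisor M U hU) ψ) (h' : p'.RestrictsTo (trivialDivisor M U hU) ψ) :
    p = p' := by
  obtain ⟨g, hg⟩ := exists_base_eq hx hUΓ
  obtain ⟨g', hg'⟩ := exists_base_eq hx' hUΓ
  have hchar : p.char = p'.char := by
    refine AddMonoidAlgebra.algHom_ext (fun m => ?_) (Subsingleton.elim _ _)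
    exact (h.charAt_eq m (one_mem_piece_trivialDivisor m)).symm.trans
      (h'.charAt_eq m (one_mem_piece_trivialDivisor m))
  have hgg : g = g' := by
    refine hom_ext_of_pull hUa fun f => ?_
    have h1 := (restrictsTo_trivialDivisor_iff hg).1 h f 0
      (homogeneous (germ_mem_piece_trivialDivisor 0 f)) rfl
    have h2 := (restrictsTo_trivialDivisor_iff hg').1 h' f 0
      (homogeneous (germ_mem_piece_trivialDivisor 0 f)) rfl
    rw [charAt_zero, mul_one] at h1 h2
    exact h1.symm.trans h2
  have hbase : p.base = p'.base := by rw [← hg, ← hg', hgg]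
  cases p
  cases p'
  simp_all

/-- The part of degree zero is `ℂ[U]`, which gives the curve component, and the elements `χ^m` give
the characters. -/
theorem exists_torusPoint (hUa : IsAffineOpen U) (hUΓ : U ≤ Γ)
    (ψ : (trivialDivisor M U hU).algebra →+* K⸨X⸩)
    (hψ : ∀ c : ℂ, ψ (algebraMap ℂ _ c) = algebraMap ℂ K⸨X⸩ c) :
    ∃ p : TorusPoint Γ M K, p.center ∈ U ∧ p.RestrictsTo (trivialDivisor M U hU) ψ := by
  have : Nonempty (trivialDivisor M U hU).locus := hU
  let τ : Γ(C, U) →+* (trivialDivisor M U hU).algebra := (trivialDivisor M U hU).sectionHom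
  have hτ : ∀ f, (τ f : AddMonoidAlgebra C.functionField M) =
    AddMonoidAlgebra.single 0 (C.germToFunctionField U f) := fun f => rfl
  obtain ⟨g, hg⟩ := exists_pull_eq hUa (ψ.comp τ)
  let χ : Multiplicative M →* K⸨X⸩ :=
    { toFun := fun m => ψ (homogeneous (one_mem_piece_trivialDivisor m.toAdd))
      map_one' := map_one ψ
      map_mul' := fun m m' => by
        rw [← map_mul, homogeneous_mul]
        exact congrArg ψ (Subtype.ext (congrArg (AddMonoidAlgebra.single _) (mul_one _).symm)) }
  have hover : (g ≫ U.ι) ≫ (C ↘ SpecC) = Spec.map (CommRingCat.ofHom (algebraMap ℂ K⸨X⸩)) := by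
    rw [comp_over_eq_iff]
    intro c
    have h1 := evalsTo_pull g (C.presheaf.map (homOfLE le_top).op ((C ↘ SpecC).appTop.hom
        ((Scheme.ΓSpecIso (CommRingCat.of ℂ)).inv.hom c)))
    rw [← algebraMap_functionField_apply, hg] at h1
    convert h1 using 1
    rw [← hψ c, RingHom.comp_apply]
    refine congrArg ψ (Subtype.ext ?_)
    rw [hτ]
    exact (congrFun AddMonoidAlgebra.coe_algebraMap c).trans
      (congrArg (AddMonoidAlgebra.single 0) (algebraMap_functionField_apply U c))
  let p : TorusPoint Γ M K :=
    { base := g ≫ C.homOfLE hUΓ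
      base_over := by
        rw [IsOverC, Category.assoc, Scheme.homOfLE_ι_assoc, ← Category.assoc]
        exact hover
      char := AddMonoidAlgebra.lift ℂ K⸨X⸩ M χ }
  have hchar : ∀ m, p.charAt m = χ (.ofAdd m) := fun m =>
    (AddMonoidAlgebra.lift_single _ _ _).trans
      ((Algebra.smul_def _ _).trans (by rw [map_one, one_mul]))
  refine ⟨p, ?_, (restrictsTo_trivialDivisor_iff (g := g) rfl).2 ?_⟩
  · rw [center, ← comp_ι_eq_curvePoint (p := p) (g := g) rfl]
    exact (g (IsLocalRing.closedPoint K⸨X⸩)).2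
  · intro f m a ha
    rw [hg, hchar, RingHom.comp_apply]
    change _ = ψ _ * ψ _
    rw [← map_mul]
    refine congrArg ψ (Subtype.ext ?_)
    rw [ha]
    refine Eq.trans ?_ (AddMonoidAlgebra.single_mul_single _ _ _ _).symm
    rw [zero_add, mul_one]
    rfl

/-- The point read off from `ψ` on `W` has the same restriction to `U` as `p`, so it is `p`. -/
theorem RestrictsTo.of_comp_algebraInclusion {W : C.Opens} {hW : Nonempty W}
    (hUa : IsAffineOpen U) (hWa : IsAffineOpen W) (hUΓ : U ≤ Γ) (hWU : W ≤ U) (hx : p.center ∈ U)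
    {ψ : (trivialDivisor M W hW).algebra →+* K⸨X⸩}
    (h : p.RestrictsTo (trivialDivisor M U hU)
      (ψ.comp (algebraInclusion (trivialDivisor_mono (hW := hW) hWU)))) :
    p.center ∈ W ∧ p.RestrictsTo (trivialDivisor M W hW) ψ := by
  obtain ⟨p', hx', hp'⟩ := exists_torusPoint hWa (hWU.trans hUΓ) ψ (fun c => h.map_algebraMap c)
  have h1 := ext_of_restrictsTo hUa hUΓ hx (hWU hx') h (hp'.comp_algebraInclusion _)
  rw [h1]
  exact ⟨hx', hp'⟩

end TorusPoint

/-! ### Generic points of arcs -/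

open PolyhedralDivisor DivisorialFan PowerSeries LaurentSeries

variable {C : Scheme.{0}} [C.Over SpecC] [IsSmoothProjectiveCurve C]
  {M : Type} [AddCommGroup M] [Module.Free ℤ M] [Module.Finite ℤ M] {E : DivisorialFan C M}
  {Γ : C.Opens} {K : Type} [Field K] [Algebra ℂ K]

theorem coeff_eq_tail_of_mem (hs : ∀ y : ClosedPt C, y.1 ∈ Γ → y ∉ E.special)
    {D : PolyhedralDivisor C M} (hD : D ∈ E.divisors) {y : ClosedPt C} (hy : y.1 ∈ Γ)
    (hyD : y.1 ∈ D.locus) : D.coeff y = (D.tail : Set (NQ M)) := by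
  by_contra h
  exact hs y hy ⟨D, hD, hyD, h⟩

theorem trivialDivisor_le (hs : ∀ y : ClosedPt C, y.1 ∈ Γ → y ∉ E.special)
    {D : PolyhedralDivisor C M} (hD : D ∈ E.divisors) {U : C.Opens} {hU : Nonempty U}
    (hUΓ : U ≤ Γ) (hUD : U ≤ D.locus) : trivialDivisor M U hU ≤ D := by
  refine ⟨bot_le, fun y v hv => ?_⟩
  obtain ⟨hy, rfl⟩ := mem_coeff_trivialDivisor.1 hv
  rw [coeff_eq_tail_of_mem hs hD (hUΓ hy) (hUD hy)]
  exact D.tail.zero_mem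

theorem isOpenFace_trivialDivisor_of_le (hs : ∀ y : ClosedPt C, y.1 ∈ Γ → y ∉ E.special)
    {D : PolyhedralDivisor C M} (hD : D ∈ E.divisors) {U : C.Opens} {hU : Nonempty U}
    (hUa : IsAffineOpen U) (hUΓ : U ≤ Γ) (hUD : U ≤ D.locus) :
    D.IsOpenFace (trivialDivisor M U hU) :=
  isOpenFace_trivialDivisor hUa (trivialDivisor_le hs hD hUΓ hUD) (E.proper D hD)
    fun _ hy => coeff_eq_tail_of_mem hs hD (hUΓ hy) (hUD hy)

theorem exists_isAffineOpen_mem {x : C} {V : C.Opens} (hx : x ∈ V) :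
    ∃ U : C.Opens, IsAffineOpen U ∧ x ∈ U ∧ U ≤ V := by
  obtain ⟨_, ⟨U, hU, rfl⟩, hxU, hUV⟩ := C.isBasis_affineOpens.exists_subset_of_mem_open hx V.2
  exact ⟨U, hU, hxU, hUV⟩

theorem nonempty_inf (U V : C.Opens) [Nonempty U] [Nonempty V] : Nonempty (U ⊓ V : C.Opens) :=
  ⟨⟨genericPoint C, genericPoint_mem U, genericPoint_mem V⟩⟩

theorem isAffineOpen_inf {U V : C.Opens} (hU : IsAffineOpen U) (hV : V = ⊤ ∨ IsAffineOpen V) :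
    IsAffineOpen (U ⊓ V) := by
  obtain rfl | hV := hV
  · rwa [inf_top_eq]
  · have := isSeparated_curve C
    exact hU.inf hV

theorem exists_restrictsTo_trivialDivisor (hs : ∀ y : ClosedPt C, y.1 ∈ Γ → y ∉ E.special)
    {p : TorusPoint Γ M K} {D : PolyhedralDivisor C M} (hD : D ∈ E.divisors)
    (hx : p.center ∈ D.locus) {ρ : D.algebra →+* K⸨X⸩} (hρ : p.RestrictsTo D ρ) :
    ∃ (U : C.Opens) (hU : Nonempty U) (hF : D.IsOpenFace (trivialDivisor M U hU))
      (ψ : (trivialDivisor M U hU).algebra →+* K⸨X⸩), IsAffineOpen U ∧ U ≤ Γ ∧ U ≤ D.locus ∧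
        p.center ∈ U ∧ p.RestrictsTo (trivialDivisor M U hU) ψ ∧
        ψ.comp (algebraInclusion hF.le) = ρ := by
  obtain ⟨U, hUa, hxU, hU⟩ := exists_isAffineOpen_mem (V := Γ ⊓ D.locus) ⟨p.center_mem, hx⟩
  have hUn : Nonempty U := ⟨⟨_, hxU⟩⟩
  have hF := isOpenFace_trivialDivisor_of_le (hU := hUn) hs hD hUa (hU.trans inf_le_left)
    (hU.trans inf_le_right)
  obtain ⟨ψ, hψ⟩ := TorusPoint.exists_restrictsTo_of_center_mem (p := p)
    (D := trivialDivisor M U hUn) hxU (by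
      intro y _ hy
      ext v
      rw [mem_coeff_trivialDivisor]
      exact and_iff_right hy)
  exact ⟨U, hUn, hF, ψ, hUa, hU.trans inf_le_left, hU.trans inf_le_right, hxU, hψ,
    (hψ.comp_algebraInclusion hF.le).unique hρ⟩

/-- Independence of the chart. The common point of `X(E)` comes from the intersection `D₃`; together
with `U × T` it extends to `W × T` for a smaller affine `W`, and from there `p` restricts to `D'`.
-/
theorem TorusPoint.RestrictsTo.of_chartPoint_eq
    (hs : ∀ y : ClosedPt C, y.1 ∈ Γ → y ∉ E.special) {p : TorusPoint Γ M K} {D D' : E.divisors}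
    {ρ : D.1.algebra →+* K⸨X⸩} {ρ' : D'.1.algebra →+* K⸨X⸩} (h : chartPoint D ρ = chartPoint D' ρ')
    (hx : p.center ∈ D.1.locus) (hρ : p.RestrictsTo D.1 ρ) :
    p.center ∈ D'.1.locus ∧ p.RestrictsTo D'.1 ρ' := by
  obtain ⟨U, hU, hF, ψ, hUa, hUΓ, hUD, hxU, hψ, rfl⟩ :=
    exists_restrictsTo_trivialDivisor hs D.2 hx hρ
  obtain ⟨D₃, hD₃, h₃₁, h₃₂, ht, hc⟩ := exists_inter D.2 D'.2
  obtain ⟨ρ₃, hρ₃, rfl⟩ := exists_chartPoint_eq (D₃ := ⟨D₃, hD₃⟩) h₃₁ h₃₂ ht.ge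
    (fun y => (hc y).ge) h
  have : Nonempty D₃.locus := D₃.locus_nonempty.to_subtype
  have hW := nonempty_inf U D₃.locus
  have hWD₃ : trivialDivisor M _ hW ≤ D₃ := trivialDivisor_le hs hD₃ (inf_le_left.trans hUΓ) inf_le_right
  obtain ⟨ψW, h1, h2⟩ := hF.exists_common_extension (isOpenFace D.2 hD₃ h₃₁)
    (trivialDivisor_mono (hW := hW) inf_le_left) hWD₃ inf_le_left
    (by
      rintro y v ⟨hv, hv'⟩
      obtain ⟨hy, rfl⟩ := mem_coeff_trivialDivisor.1 hv
      exact mem_coeff_trivialDivisor.2 ⟨⟨hy, mem_locus_of_mem_coeff hv'⟩, rfl⟩) hρ₃.symm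
  obtain ⟨hxW, hψW⟩ := TorusPoint.RestrictsTo.of_comp_algebraInclusion hUa
    (isAffineOpen_inf hUa (locus_eq_top_or_isAffineOpen hD₃)) hUΓ inf_le_left hxU (h1 ▸ hψ)
  refine ⟨le_locus_of_trivialDivisor_le (hWD₃.trans h₃₂) hxW, ?_⟩
  rw [← h2]
  exact hψW.comp_algebraInclusion (hWD₃.trans h₃₂)

theorem TorusPoint.eq_of_restrictsTo (hs : ∀ y : ClosedPt C, y.1 ∈ Γ → y ∉ E.special)
    {p p' : TorusPoint Γ M K} {D : PolyhedralDivisor C M} (hD : D ∈ E.divisors)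
    {ρ : D.algebra →+* K⸨X⸩} (hx : p.center ∈ D.locus) (hρ : p.RestrictsTo D ρ)
    (hx' : p'.center ∈ D.locus) (hρ' : p'.RestrictsTo D ρ) : p = p' := by
  obtain ⟨U, hU, hF, ψ, hUa, hUΓ, hUD, hxU, hψ, rfl⟩ := exists_restrictsTo_trivialDivisor hs hD hx hρ
  obtain ⟨U', hU', hF', ψ', hUa', hUΓ', hUD', hxU', hψ', h⟩ :=
    exists_restrictsTo_trivialDivisor hs hD hx' hρ'
  have hW := nonempty_inf U U'
  obtain ⟨ψW, h1, h2⟩ := hF.exists_common_extension hF' (trivialDivisor_mono (hW := hW) inf_le_left)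
    (trivialDivisor_mono inf_le_right) inf_le_left
    (by
      rintro y v ⟨hv, hv'⟩
      obtain ⟨hy, rfl⟩ := mem_coeff_trivialDivisor.1 hv
      exact mem_coeff_trivialDivisor.2 ⟨⟨hy, mem_locus_of_mem_coeff hv'⟩, rfl⟩) h.symm
  have hWa := isAffineOpen_inf hUa (Or.inr hUa')
  obtain ⟨hxW, hψW⟩ := RestrictsTo.of_comp_algebraInclusion hUa hWa hUΓ inf_le_left hxU (h1 ▸ hψ)
  obtain ⟨hxW', hψW'⟩ := RestrictsTo.of_comp_algebraInclusion hUa' hWa hUΓ' inf_le_right hxU'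
    (h2 ▸ hψ')
  exact ext_of_restrictsTo hWa (inf_le_left.trans hUΓ) hxW hxW' hψW hψW'

theorem Spec_map_comp_torusChart {U : C.Opens} {hU : Nonempty U} {D : E.divisors}
    (h : trivialDivisor M U hU ≤ D.1) {R : Type} [CommRing R]
    (ψ : (trivialDivisor M U hU).algebra →+* R) :
    (chartHom _ ψ).toLRSHom ≫ E.torusChart U hU D h = chartPoint D (ψ.comp (algebraInclusion h)) := by
  rw [chartPoint, ← chartHom_comp_chartMap h ψ, torusChart, ← Category.assoc]
  rfl

/-- Eliminates the auxiliary affine open subset of `Γ`, which leaves a condition on the algebra of a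
chart. -/
theorem hasGenericPoint_iff (hs : ∀ y : ClosedPt C, y.1 ∈ Γ → y ∉ E.special) {α : Arc E K}
    {p : TorusPoint Γ M K} : α.HasGenericPoint p ↔
      ∃ (D : E.divisors) (ρ : D.1.algebra →+* K⸨X⸩), p.center ∈ D.1.locus ∧ p.RestrictsTo D.1 ρ ∧
        (genericι K).toLRSHom ≫ α.1 = chartPoint D ρ := by
  constructor
  · rintro ⟨U, hU, D, h, hΓ, g, ψ, hUa, hg, hψ, hα⟩
    have hxU : p.center ∈ U := by
      rw [TorusPoint.center, ← TorusPoint.comp_ι_eq_curvePoint hg]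
      exact (g (IsLocalRing.closedPoint K⸨X⸩)).2
    refine ⟨D, (ψ.toRingHom).comp (algebraInclusion h), le_locus_of_trivialDivisor_le h hxU,
      ((TorusPoint.restrictsTo_trivialDivisor_iff hg).2 hψ).comp_algebraInclusion h, ?_⟩
    rw [hα]
    exact Spec_map_comp_torusChart h ψ.toRingHom
  · rintro ⟨D, ρ, hx, hρ, hα⟩
    obtain ⟨U, hU, hF, ψ, hUa, hUΓ, hUD, hxU, hψ, rfl⟩ :=
      exists_restrictsTo_trivialDivisor hs D.2 hx hρ
    obtain ⟨g, hg⟩ := TorusPoint.exists_base_eq hxU hUΓ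
    refine ⟨U, hU, D, hF.le, hUΓ, g, ⟨ψ, hψ.map_algebraMap⟩, hUa, hg,
      (TorusPoint.restrictsTo_trivialDivisor_iff hg).1 hψ, ?_⟩
    rw [hα]
    exact (Spec_map_comp_torusChart hF.le ψ).symm

theorem HasGenericPoint.unique (hs : ∀ y : ClosedPt C, y.1 ∈ Γ → y ∉ E.special) {α : Arc E K}
    {p p' : TorusPoint Γ M K} (h : α.HasGenericPoint p) (h' : α.HasGenericPoint p') : p = p' := by
  obtain ⟨D, ρ, hx, hρ, hα⟩ := (hasGenericPoint_iff hs).1 h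
  obtain ⟨D', ρ', hx', hρ', hα'⟩ := (hasGenericPoint_iff hs).1 h'
  obtain ⟨hx₁, hρ₁⟩ := hρ.of_chartPoint_eq hs (hα.symm.trans hα') hx
  exact TorusPoint.eq_of_restrictsTo hs D'.2 hx₁ hρ₁ hx' hρ'

theorem genericι_closedPoint : genericι K (IsLocalRing.closedPoint K⸨X⸩) =
    genericPoint (Spec (CommRingCat.of K⟦X⟧)) := by
  rw [genericPoint_eq_bot_of_affine]
  refine PrimeSpectrum.ext ?_
  change Ideal.comap (algebraMap K⟦X⟧ K⸨X⸩) (IsLocalRing.maximalIdeal K⸨X⸩) = ⊥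
  rw [IsLocalRing.maximalIdeal_eq_bot]
  exact (RingHom.injective_iff_ker_eq_bot _).1 algebraMap_laurentSeries_injective

/-- The generic point of an arc in the chart of `D`. -/
theorem genericι_comp_chartPoint {D : E.divisors} (φ : D.1.algebra →+* K⟦X⟧) :
    (genericι K).toLRSHom ≫ chartPoint D φ = chartPoint D ((algebraMap K⟦X⟧ K⸨X⸩).comp φ) := by
  rw [chartPoint, chartPoint, ← Category.assoc]
  refine congrArg (fun g : Spec (CommRingCat.of K⸨X⸩) ⟶ D.1.chart => g.toLRSHom ≫ E.chartι D) ?_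
  exact (Spec.map_comp _ _).symm

theorem chartPoint_comp_str {D : E.divisors} {R : Type} [CommRing R] (φ : D.1.algebra →+* R) :
    chartPoint D φ ≫ E.str =
      (Spec.map (CommRingCat.ofHom (φ.comp (algebraMap ℂ D.1.algebra)))).toLRSHom := by
  have h1 : E.chartι D ≫ E.str = D.1.chartStr.toLRSHom := colimit.ι_desc _ _
  rw [chartPoint]
  refine (Category.assoc _ _ _).trans ?_
  rw [h1]
  exact congrArg Scheme.Hom.toLRSHom (Spec.map_comp _ _).symm

/-- The image of the one point of `Spec 𝒦` lies in some open `U × T`, so the restriction of the arc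
to `Spec 𝒦` factors through it and gives a homomorphism from which the point is read off. -/
theorem exists_hasGenericPoint (hs : ∀ y : ClosedPt C, y.1 ∈ Γ → y ∉ E.special)
    (α : ArcOver E Γ K) : ∃ p : TorusPoint Γ M K, α.1.HasGenericPoint p := by
  obtain ⟨α, U, hU, D, h, hUa, hUΓ, z, hz⟩ := α
  have hF : D.1.IsOpenFace (trivialDivisor M U hU) := isOpenFace_trivialDivisor_of_le hs D.2 hUa hUΓ
    (le_locus_of_trivialDivisor_le h)
  let β : Spec (CommRingCat.of K⸨X⸩) ⟶ colimit E.diagram :=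
    ⟨((genericι K).toLRSHom ≫ α.1) ≫ (varietyIso E).inv⟩
  let j : (trivialDivisor M U hU).chart ⟶ colimit E.diagram := chartMap h ≫ colimit.ι E.diagram D
  have hι : IsOpenImmersion (colimit.ι E.diagram D) := inferInstance
  have : IsOpenImmersion j :=
    MorphismProperty.comp_mem @IsOpenImmersion (chartMap h) (colimit.ι E.diagram D)
      hF.isOpenImmersion hι
  have hj : j.toLRSHom = E.torusChart U hU D h ≫ (varietyIso E).inv := by
    rw [torusChart]
    refine Eq.trans ?_ (Category.assoc _ _ _).symm
    rw [chartι_comp_varietyIso_inv]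
    rfl
  have hrange : Set.range β ⊆ Set.range j := by
    have h1 : β ⁻¹ᵁ j.opensRange = ⊤ := by
      refine (IsLocalRing.closedPoint_mem_iff _).1 ⟨z, ?_⟩
      have h2 : j z = (varietyIso E).inv.base ((E.torusChart U hU D h).base z) :=
        congrArg (fun f : (trivialDivisor M U hU).chart.toLocallyRingedSpace ⟶
          (colimit E.diagram).toLocallyRingedSpace => f.base z) hj
      rw [h2, hz, ← genericι_closedPoint]
      rfl
    rintro _ ⟨x, rfl⟩
    have h2 : x ∈ β ⁻¹ᵁ j.opensRange := h1 ▸ trivial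
    exact h2
  obtain ⟨ψ, hψ⟩ := exists_chartHom_eq (IsOpenImmersion.lift j β hrange)
  have hα : (genericι K).toLRSHom ≫ α.1 = chartPoint D (ψ.comp (algebraInclusion h)) := by
    rw [← Spec_map_comp_torusChart, ← cancel_mono (varietyIso E).inv]
    refine Eq.trans ?_ (Category.assoc _ _ _).symm
    rw [← hj, hψ]
    exact congrArg Scheme.Hom.toLRSHom (IsOpenImmersion.lift_fac j β hrange).symm
  have hψC : ∀ c : ℂ, ψ (algebraMap ℂ _ c) = algebraMap ℂ K⸨X⸩ c := by
    have h1 : ((genericι K).toLRSHom ≫ α.1) ≫ E.str =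
        (Spec.map (CommRingCat.ofHom (algebraMap ℂ K⸨X⸩))).toLRSHom := by
      refine (Category.assoc _ _ _).trans ?_
      rw [α.2]
      exact congrArg Scheme.Hom.toLRSHom (Spec.map_comp _ _).symm
    rw [hα, chartPoint_comp_str] at h1
    intro c
    have h2 := Spec.map_injective (Scheme.Hom.ext' h1)
    exact congrArg (fun f : CommRingCat.of ℂ ⟶ CommRingCat.of K⸨X⸩ => f.hom c) h2
  obtain ⟨p, hx, hp⟩ := TorusPoint.exists_torusPoint hUa hUΓ ψ hψC
  exact ⟨p, (hasGenericPoint_iff hs).2 ⟨D, _, le_locus_of_trivialDivisor_le h hx,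
    hp.comp_algebraInclusion h, hα⟩⟩

/-! ### Limits, and the criterion for extension over a chart -/

open PolyhedralDivisor PowerSeries LaurentSeries

variable {C : Scheme.{0}} [C.Over SpecC] [IsSmoothProjectiveCurve C]

theorem EvalsTo.zpow {L : Type} [Field L] {g : Spec (CommRingCat.of L) ⟶ C} {f : C.functionField}
    {r : L} (h : EvalsTo g f r) (hr : r ≠ 0) (n : ℤ) : EvalsTo g (f ^ n) (r ^ n) := by
  cases n with
  | ofNat n => simpa using h.pow n
  | negSucc n =>
    rw [zpow_negSucc, zpow_negSucc]
    exact (h.pow (n + 1)).inv (mul_inv_cancel₀ (pow_ne_zero _ hr))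

namespace TorusPoint

variable {M : Type} [AddCommGroup M] {Γ : C.Opens} {K : Type} [Field K] [Algebra ℂ K]

theorem curvePoint_over (p : TorusPoint Γ M K) :
    p.curvePoint ≫ (C ↘ SpecC) = Spec.map (CommRingCat.ofHom (algebraMap ℂ K⸨X⸩)) :=
  (Category.assoc _ _ _).trans p.base_over

theorem exists_lift (p : TorusPoint Γ M K) : ∃ l : Spec (CommRingCat.of K⟦X⟧) ⟶ C,
    genericι K ≫ l = p.curvePoint ∧
      l ≫ (C ↘ SpecC) = Spec.map (CommRingCat.ofHom (algebraMap ℂ K⟦X⟧)) :=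
  exists_lift_of_valuationRing _ _ (p.curvePoint_over.trans (Spec.map_comp
    (CommRingCat.ofHom (algebraMap ℂ K⟦X⟧)) (CommRingCat.ofHom (algebraMap K⟦X⟧ K⸨X⸩))))

/-- The extension of the curve point to an `𝒪`-point of the complete curve `C`. -/
def lift (p : TorusPoint Γ M K) : Spec (CommRingCat.of K⟦X⟧) ⟶ C := p.exists_lift.choose

/-- The image of the closed point of `Spec 𝒪` under the extension of the curve point. -/
def limit (p : TorusPoint Γ M K) : C := p.lift (IsLocalRing.closedPoint K⟦X⟧)

theorem genericι_comp_lift (p : TorusPoint Γ M K) : genericι K ≫ p.lift = p.curvePoint :=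
  p.exists_lift.choose_spec.1

theorem lift_over (p : TorusPoint Γ M K) :
    p.lift ≫ (C ↘ SpecC) = Spec.map (CommRingCat.ofHom (algebraMap ℂ K⟦X⟧)) :=
  p.exists_lift.choose_spec.2

theorem eq_lift {p : TorusPoint Γ M K} {l : Spec (CommRingCat.of K⟦X⟧) ⟶ C}
    (h : genericι K ≫ l = p.curvePoint) : l = p.lift :=
  hom_ext_of_valuationRing (K := K⸨X⸩) (h.trans p.genericι_comp_lift.symm)

theorem center_specializes (p : TorusPoint Γ M K) : p.center ⤳ p.limit := by
  have h1 : p.center = p.lift (genericι K (IsLocalRing.closedPoint K⸨X⸩)) := by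
    rw [center, ← genericι_comp_lift]
    rfl
  rw [h1]
  exact (IsLocalRing.specializes_closedPoint _).map p.lift.continuous

theorem center_mem_of_limit_mem {p : TorusPoint Γ M K} {U : C.Opens} (h : p.limit ∈ U) :
    p.center ∈ U :=
  p.center_specializes.mem_open U.2 h

/-- The extension to `C` is unique, and it lies in the open `Γ` as soon as its closed point does. -/
theorem isHorizontal_iff {p : TorusPoint Γ M K} : p.IsHorizontal ↔ p.limit ∈ Γ := by
  constructor
  · rintro ⟨γ, hγ⟩
    have h1 : γ.1 ≫ Γ.ι = p.lift := eq_lift (by rw [← Category.assoc, hγ]; rfl)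
    rw [limit, ← h1]
    exact (γ.1 (IsLocalRing.closedPoint K⟦X⟧)).2
  · intro h
    have hrange : Set.range p.lift ⊆ Set.range Γ.ι := by
      rw [Scheme.Opens.range_ι]
      rintro _ ⟨z, rfl⟩
      have h1 := Scheme.preimage_eq_top_of_closedPoint_mem (R := CommRingCat.of K⟦X⟧) p.lift h
      have h2 : z ∈ p.lift ⁻¹ᵁ Γ := h1 ▸ trivial
      exact h2
    refine ⟨⟨IsOpenImmersion.lift Γ.ι p.lift hrange, ?_⟩, ?_⟩
    · rw [IsOverC, IsOpenImmersion.lift_fac_assoc]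
      exact p.lift_over
    · rw [← cancel_mono Γ.ι, Category.assoc, IsOpenImmersion.lift_fac]
      exact p.genericι_comp_lift

theorem evalsTo_curvePoint {p : TorusPoint Γ M K} {f : C.functionField} {r : K⟦X⟧}
    (h : EvalsTo p.lift f r) : EvalsTo p.curvePoint f (algebraMap K⟦X⟧ K⸨X⸩ r) := by
  rw [← p.genericι_comp_lift]
  exact h.comp _

/-- The curve point tends to the closed point `c` with the multiplicity `ℓ`. -/
structure HasIndex (p : TorusPoint Γ M K) (c : ClosedPt C) (ℓ : ℕ) : Prop where
  center_eq : p.center = genericPoint C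
  limit_eq : p.limit = c.1
  pos : 1 ≤ ℓ
  order_eq : ∀ f r, f ≠ 0 → EvalsTo p.curvePoint f r → r.order = ℓ * ord c f

theorem HasIndex.exists_evalsTo {p : TorusPoint Γ M K} {c : ClosedPt C} {ℓ : ℕ} (h : p.HasIndex c ℓ)
    (f : C.functionField) : ∃ r, EvalsTo p.curvePoint f r :=
  exists_evalsTo_of_eq_genericPoint h.center_eq f

theorem HasIndex.ne_zero {p : TorusPoint Γ M K} {c : ClosedPt C} {ℓ : ℕ} (h : p.HasIndex c ℓ)
    {f : C.functionField} {r : K⸨X⸩} (hf : f ≠ 0) (hr : EvalsTo p.curvePoint f r) : r ≠ 0 :=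
  (hr.isUnit h.center_eq hf).ne_zero

/-- Let `ℓ` be the order of the pull-back of a uniformizer at `c`. It is positive because a
uniformizer is not a unit at `c`; any other function is a power of the uniformizer times a unit at
`c`, and that unit pulls back to a unit of `𝒪`. -/
theorem exists_hasIndex {p : TorusPoint Γ M K} {c : ClosedPt C} (hc : p.limit = c.1)
    (hx : p.center = genericPoint C) : ∃ ℓ, p.HasIndex c ℓ := by
  obtain ⟨π, hπ, hπ1⟩ := exists_ord_eq_one c
  obtain ⟨s, hs⟩ := exists_evalsTo_of_ord_nonneg (f := π) c hc fun _ => by rw [hπ1]; exact one_pos.le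
  have hs' := evalsTo_curvePoint hs
  have hs0 := (hs'.isUnit hx hπ).ne_zero
  have hs00 : s ≠ 0 := by
    rintro rfl
    exact hs0 (map_zero _)
  have h1 : (algebraMap K⟦X⟧ K⸨X⸩ s).order ≠ 0 := by
    rw [Ne, ← isUnit_iff_order_eq_zero hs00, hs.isUnit_iff c hc hπ, hπ1]
    exact one_ne_zero
  obtain ⟨ℓ, hℓ⟩ := Int.eq_ofNat_of_zero_le (order_algebraMap_nonneg s)
  refine ⟨ℓ, hx, hc, by lia, fun f r hf hr => ?_⟩
  have hg : f * π ^ (-ord c f) ≠ 0 := mul_ne_zero hf (zpow_ne_zero _ hπ)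
  have hg0 : ord c (f * π ^ (-ord c f)) = 0 := by
    rw [ord_mul c hf (zpow_ne_zero _ hπ), ord_zpow, hπ1]
    ring
  obtain ⟨u, hu⟩ := exists_evalsTo_of_ord_nonneg (f := f * π ^ (-ord c f)) c hc
    fun _ => hg0.ge
  have hu0 : IsUnit u := (hu.isUnit_iff c hc hg).2 hg0
  have h2 := (evalsTo_curvePoint hu).unique (hr.mul (hs'.zpow hs0 (-ord c f)))
  have h3 := (isUnit_iff_order_eq_zero hu0.ne_zero).1 hu0
  rw [h2, HahnSeries.order_mul (hr.isUnit hx hf).ne_zero (zpow_ne_zero _ hs0), order_zpow hs0,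
    hℓ] at h3
  linarith

theorem center_eq_genericPoint {p : TorusPoint Γ M K} (h : p.limit ≠ p.center) :
    p.center = genericPoint C := by
  refine (eq_genericPoint_or_isClosed p.center).resolve_right fun hc => h ?_
  have h1 := p.center_specializes.mem_closed hc rfl
  exact h1

theorem exists_hasIndex_of_not_isHorizontal [Nonempty Γ] {p : TorusPoint Γ M K}
    (h : ¬ p.IsHorizontal) : ∃ (c : ClosedPt C) (ℓ : ℕ), c.1 ∉ Γ ∧ p.HasIndex c ℓ := by
  rw [isHorizontal_iff] at h
  have hc : IsClosed {p.limit} := (eq_genericPoint_or_isClosed p.limit).resolve_left fun h1 =>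
    h (h1 ▸ genericPoint_mem Γ)
  obtain ⟨ℓ, hℓ⟩ := exists_hasIndex (p := p) (c := ⟨p.limit, hc⟩) rfl
    (center_eq_genericPoint fun h1 => h (h1 ▸ p.center_mem))
  exact ⟨_, ℓ, h, hℓ⟩

/-- The weight `ν` of a point: `χ^m` has the order `⟨m, ν⟩`. -/
def weight (p : TorusPoint Γ M K) : M →+ ℤ where
  toFun m := (p.charAt m).order
  map_zero' := by rw [charAt_zero, HahnSeries.order_one]
  map_add' m m' := by
    rw [charAt_add, HahnSeries.order_mul (p.charAt_ne_zero m) (p.charAt_ne_zero m')]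

theorem order_charAt (p : TorusPoint Γ M K) (m : M) : (p.charAt m).order = p.weight m := rfl

/-- The conditions under which the point extends to an arc of the chart of `D`. -/
structure AdmitsChart (p : TorusPoint Γ M K) (D : PolyhedralDivisor C M) : Prop where
  limit_mem : p.limit ∈ D.locus
  mem_tail : p.limit ∈ Γ → NQ.ofInt p.weight ∈ D.tail
  mem_coeff : ∀ c ℓ, c.1 ∉ Γ → p.HasIndex c ℓ → (ℓ : ℚ)⁻¹ • NQ.ofInt p.weight ∈ D.coeff c

variable [Module.Free ℤ M] [Module.Finite ℤ M] {D : PolyhedralDivisor C M} {p : TorusPoint Γ M K}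

theorem exists_evalsTo_lift
    (hsp : ∀ y : ClosedPt C, y.1 ∈ Γ → y.1 ∈ D.locus → D.coeff y = (D.tail : Set (NQ M)))
    (hc : p.limit ∈ D.locus) (hΓ : p.limit ∈ Γ) {m : M} {f : C.functionField} (hf : f ∈ D.piece m) :
    ∃ r, EvalsTo p.lift f r := by
  obtain h | h := eq_genericPoint_or_isClosed p.limit
  · exact exists_evalsTo_of_eq_genericPoint h f
  · refine exists_evalsTo_of_ord_nonneg ⟨p.limit, h⟩ rfl fun hf0 => ?_
    have h1 := (mem_piece_iff.1 hf hf0).2 ⟨p.limit, h⟩ 0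
      (by rw [hsp ⟨_, h⟩ hΓ hc]; exact D.tail.zero_mem)
    simpa using h1

theorem RestrictsTo.order_nonneg {ρ : D.algebra →+* K⸨X⸩} (hρ : p.RestrictsTo D ρ)
    {φ : D.algebra →+* K⟦X⟧} (hφ : (algebraMap K⟦X⟧ K⸨X⸩).comp φ = ρ) {m : M} {f : C.functionField}
    (hf : f ∈ D.piece m) {r : K⸨X⸩} (hr : EvalsTo p.curvePoint f r) (hr0 : r ≠ 0) :
    0 ≤ r.order + p.weight m := by
  obtain ⟨r', hr', h1⟩ := hρ m f hf
  rw [← hr.unique hr', ← hφ] at h1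
  have h2 := order_algebraMap_nonneg (φ (homogeneous hf))
  have h3 : algebraMap K⟦X⟧ K⸨X⸩ (φ (homogeneous hf)) = r * p.charAt m := h1
  rwa [h3, HahnSeries.order_mul hr0 (p.charAt_ne_zero m), order_charAt] at h2

/-- If the limit were outside the locus, a function with its only pole there would belong to `A(D)`
in degree zero, but its pull-back has negative order. -/
theorem limit_mem_of_comp_eq (hx : p.center ∈ D.locus) {ρ : D.algebra →+* K⸨X⸩}
    (hρ : p.RestrictsTo D ρ) {φ : D.algebra →+* K⟦X⟧} (hφ : (algebraMap K⟦X⟧ K⸨X⸩).comp φ = ρ) :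
    p.limit ∈ D.locus := by
  by_contra hcon
  obtain h | h := eq_genericPoint_or_isClosed p.limit
  · have : Nonempty D.locus := D.locus_nonempty.to_subtype
    exact hcon (h ▸ genericPoint_mem _)
  obtain ⟨ℓ, hℓ⟩ := exists_hasIndex (p := p) (c := ⟨p.limit, h⟩) rfl
    (center_eq_genericPoint fun h1 => hcon (h1 ▸ hx))
  obtain ⟨k₀, hk₀⟩ := exists_section_of_degree_pos (C := C)
    (G := Finsupp.single ⟨p.limit, h⟩ 1) (by simp) ⟨p.limit, h⟩ ∅ (by simp)
  obtain ⟨f, hf, hfz, hfc, -⟩ := hk₀ (k₀ + 1) (Nat.le_succ _)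
  have hfD : f ∈ D.piece 0 := by
    rw [mem_piece_iff]
    refine fun _ => ⟨fun v _ => (map_zero v).ge, fun y v hv => ?_⟩
    have h1 : (⟨p.limit, h⟩ : ClosedPt C) ≠ y := by
      rintro rfl
      exact hcon (mem_locus_of_mem_coeff hv)
    have h2 := hfz y
    rw [Finsupp.single_eq_of_ne h1.symm, mul_zero, add_zero] at h2
    rw [map_zero, add_zero]
    exact_mod_cast h2
  obtain ⟨r, hr⟩ := hℓ.exists_evalsTo f
  have h1 := hρ.order_nonneg hφ hfD hr (hℓ.ne_zero hf hr)
  rw [map_zero, add_zero, hℓ.order_eq f r hf hr] at h1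
  have h2 := hℓ.pos
  rw [Finsupp.single_eq_same] at hfc
  have h3 : ord ⟨p.limit, h⟩ f < 0 := by
    push_cast at hfc
    lia
  have h4 : (0 : ℤ) < ℓ := by exact_mod_cast h2
  nlinarith

/-- The inequalities which define the tail and the coefficient are tested, for each `m`, on a
section of some `D(k m)` which has the least possible order at the limit. -/
theorem admitsChart_of_comp_eq (hD : D.Proper)
    (hsp : ∀ y : ClosedPt C, y.1 ∈ Γ → y.1 ∈ D.locus → D.coeff y = (D.tail : Set (NQ M)))
    (hx : p.center ∈ D.locus) {ρ : D.algebra →+* K⸨X⸩}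
    (hρ : p.RestrictsTo D ρ) {φ : D.algebra →+* K⟦X⟧} (hφ : (algebraMap K⟦X⟧ K⸨X⸩).comp φ = ρ) :
    p.AdmitsChart D := by
  have hlim := limit_mem_of_comp_eq hx hρ hφ
  refine ⟨hlim, fun hΓ => mem_tail_iff.2 fun m hm => ?_, fun c ℓ hc hℓ => ?_⟩
  -- The section should pull back to a unit. If the limit is the generic point, every nonzero
  -- section does; at a closed point of `Γ` the value of `D(m)` is zero, so the section does not
  -- vanish there.
  · obtain ⟨k, f, hk, hf, hfD, r, hr, hru⟩ : ∃ (k : ℕ) (f : C.functionField), 0 < k ∧ f ≠ 0 ∧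
        f ∈ D.piece (k • m) ∧ ∃ r, EvalsTo p.lift f r ∧ IsUnit r := by
      obtain h | h := eq_genericPoint_or_isClosed p.limit
      · obtain ⟨y, hy⟩ := DivisorialFan.exists_closedPt_mem_locus D
        obtain ⟨k, f, hk, hf, hfD, -⟩ := hD.exists_mem_piece_ord_eq hm hy
        obtain ⟨r, hr⟩ := exists_evalsTo_of_eq_genericPoint h f
        exact ⟨k, f, hk, hf, hfD, r, hr, hr.isUnit h hf⟩
      · obtain ⟨k, f, hk, hf, hfD, hfo⟩ := hD.exists_mem_piece_ord_eq (y := ⟨p.limit, h⟩) hm hlim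
        have h1 : D.eval m ⟨p.limit, h⟩ = 0 := eval_eq_zero hm (hsp _ hΓ hlim)
        have h2 : ord ⟨p.limit, h⟩ f = 0 := by
          rw [h1, mul_zero, neg_zero] at hfo
          exact_mod_cast hfo
        obtain ⟨r, hr⟩ := exists_evalsTo_lift hsp hlim hΓ hfD
        exact ⟨k, f, hk, hf, hfD, r, hr, (hr.isUnit_iff ⟨p.limit, h⟩ rfl hf).2 h2⟩
    have h1 := hρ.order_nonneg hφ hfD (evalsTo_curvePoint hr)
      (algebraMap_laurentSeries_ne_zero hru.ne_zero)
    rw [(isUnit_iff_order_eq_zero hru.ne_zero).1 hru, zero_add, map_nsmul, nsmul_eq_mul] at h1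
    have h2 : (0 : ℤ) ≤ p.weight m := by
      by_contra! h3
      have h4 : (0 : ℤ) < k := by exact_mod_cast hk
      nlinarith
    change (0 : ℚ) ≤ (p.weight m : ℤ)
    exact_mod_cast h2
  · have hcD : c.1 ∈ D.locus := hℓ.limit_eq ▸ hlim
    refine (mem_coeff_iff hcD).2 fun m hm => ?_
    obtain ⟨k, f, hk, hf, hfD, hfo⟩ := hD.exists_mem_piece_ord_eq hm hcD
    obtain ⟨r, hr⟩ := hℓ.exists_evalsTo f
    have h1 := hρ.order_nonneg hφ hfD hr (hℓ.ne_zero hf hr)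
    rw [hℓ.order_eq f r hf hr, map_nsmul, nsmul_eq_mul] at h1
    have h2 : (0 : ℚ) ≤ ℓ * ord c f + k * p.weight m := by exact_mod_cast h1
    rw [hfo] at h2
    have hk' : (0 : ℚ) < k := by exact_mod_cast hk
    have hℓ' : (0 : ℚ) < ℓ := by exact_mod_cast hℓ.pos
    change D.eval m c ≤ (ℓ : ℚ)⁻¹ * (p.weight m : ℤ)
    rw [inv_mul_eq_div, le_div_iff₀ hℓ']
    by_contra! h3
    nlinarith

/-- It suffices that homogeneous elements pull back to series of nonnegative order. Outside `Γ` the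
order of `f χ^m` is `ℓ` times the value of the inequality of `D.piece m` at the point `ν / ℓ` of the
coefficient. -/
theorem AdmitsChart.exists_comp_eq [Nonempty Γ]
    (hsp : ∀ y : ClosedPt C, y.1 ∈ Γ → y.1 ∈ D.locus → D.coeff y = (D.tail : Set (NQ M)))
    (h : p.AdmitsChart D) {ρ : D.algebra →+* K⸨X⸩} (hρ : p.RestrictsTo D ρ) :
    ∃ φ : D.algebra →+* K⟦X⟧, (algebraMap K⟦X⟧ K⸨X⸩).comp φ = ρ := by
  refine exists_comp_eq_of_homogeneous algebraMap_laurentSeries_injective fun m f hf => ?_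
  obtain ⟨r, hr, h1⟩ := hρ m f hf
  rw [h1]
  by_cases hr0 : r = 0
  · rw [hr0, zero_mul]
    exact zero_mem _
  have hf0 := hr.ne_zero hr0
  obtain ⟨hm, hfD⟩ := mem_piece_iff.1 hf hf0
  refine (order_nonneg_iff (mul_ne_zero hr0 (p.charAt_ne_zero m))).1 ?_
  rw [HahnSeries.order_mul hr0 (p.charAt_ne_zero m), order_charAt]
  by_cases hΓ : p.limit ∈ Γ
  · obtain ⟨r₀, hr₀⟩ := exists_evalsTo_lift hsp h.limit_mem hΓ hf
    rw [hr.unique (evalsTo_curvePoint hr₀)]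
    have h2 : (0 : ℚ) ≤ (p.weight m : ℤ) := hm _ (h.mem_tail hΓ)
    exact add_nonneg (order_algebraMap_nonneg r₀) (by exact_mod_cast h2)
  · obtain ⟨c, ℓ, hc, hℓ⟩ := exists_hasIndex_of_not_isHorizontal (isHorizontal_iff.not.2 hΓ)
    have h2 : (0 : ℚ) ≤ ord c f + (ℓ : ℚ)⁻¹ * (p.weight m : ℤ) := hfD c _ (h.mem_coeff c ℓ hc hℓ)
    have hℓ' : (0 : ℚ) < ℓ := by exact_mod_cast hℓ.pos
    rw [hℓ.order_eq f r hf0 hr]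
    have h3 : (0 : ℚ) ≤ ℓ * (ord c f + (ℓ : ℚ)⁻¹ * (p.weight m : ℤ)) := mul_nonneg hℓ'.le h2
    rw [mul_add, mul_inv_cancel_left₀ hℓ'.ne'] at h3
    exact_mod_cast h3

end TorusPoint

/-! ### Arcs with a given generic point -/

open PolyhedralDivisor DivisorialFan PowerSeries LaurentSeries

variable {C : Scheme.{0}} [C.Over SpecC] [IsSmoothProjectiveCurve C]
  {M : Type} [AddCommGroup M] [Module.Free ℤ M] [Module.Finite ℤ M] {E : DivisorialFan C M}
  {Γ : C.Opens} {K : Type} [Field K] [Algebra ℂ K] {p : TorusPoint Γ M K}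

/-- The point to check is that the limit stays in the smaller locus: over `Γ` both coefficients are
tails and share `0`, and elsewhere they share `ν / ℓ`. -/
theorem TorusPoint.AdmitsChart.inf [Nonempty Γ] (hs : ∀ y : ClosedPt C, y.1 ∈ Γ → y ∉ E.special)
    {D D' D'' : PolyhedralDivisor C M} (hD : D ∈ E.divisors) (hD' : D' ∈ E.divisors)
    (ht : D''.tail = D.tail ⊓ D'.tail) (hc : ∀ y, D''.coeff y = D.coeff y ∩ D'.coeff y)
    (h : p.AdmitsChart D) (h' : p.AdmitsChart D') : p.AdmitsChart D'' where
  limit_mem := by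
    by_cases hΓ : p.limit ∈ Γ
    · obtain hg | hcl := eq_genericPoint_or_isClosed p.limit
      · have : Nonempty D''.locus := D''.locus_nonempty.to_subtype
        exact hg ▸ genericPoint_mem _
      · refine mem_locus_of_mem_coeff (y := ⟨p.limit, hcl⟩) (v := 0) ?_
        rw [hc, coeff_eq_tail_of_mem hs hD hΓ h.limit_mem,
          coeff_eq_tail_of_mem hs hD' hΓ h'.limit_mem]
        exact ⟨D.tail.zero_mem, D'.tail.zero_mem⟩
    · obtain ⟨c, ℓ, hcΓ, hℓ⟩ :=
        exists_hasIndex_of_not_isHorizontal (TorusPoint.isHorizontal_iff.not.2 hΓ)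
      have h1 : (ℓ : ℚ)⁻¹ • NQ.ofInt p.weight ∈ D''.coeff c := by
        rw [hc]
        exact ⟨h.mem_coeff c ℓ hcΓ hℓ, h'.mem_coeff c ℓ hcΓ hℓ⟩
      exact hℓ.limit_eq ▸ mem_locus_of_mem_coeff h1
  mem_tail hΓ := ht ▸ ⟨h.mem_tail hΓ, h'.mem_tail hΓ⟩
  mem_coeff c ℓ hcΓ hℓ := by
    rw [hc]
    exact ⟨h.mem_coeff c ℓ hcΓ hℓ, h'.mem_coeff c ℓ hcΓ hℓ⟩

theorem Arc.HasGenericPoint.mem_openTorus {α : Arc E K} (h : α.HasGenericPoint p) :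
    α.1.base (genericPoint (Spec (CommRingCat.of K⟦X⟧))) ∈ E.openTorus Γ := by
  obtain ⟨U, hU, D, hD, hΓ, g, ψ, hUa, hg, hψ, hα⟩ := h
  refine ⟨U, hU, D, hD, hUa, hΓ,
    Spec.map (CommRingCat.ofHom ψ.toRingHom) (IsLocalRing.closedPoint K⸨X⸩), ?_⟩
  rw [← genericι_closedPoint]
  exact congrArg (fun f : (Spec (CommRingCat.of K⸨X⸩)).toLocallyRingedSpace ⟶ E.variety =>
    f.base (IsLocalRing.closedPoint K⸨X⸩)) hα.symm

theorem exists_admitsChart (hs : ∀ y : ClosedPt C, y.1 ∈ Γ → y ∉ E.special) {α : Arc E K}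
    (h : α.HasGenericPoint p) : ∃ (D : E.divisors) (φ : D.1.algebra →+* K⟦X⟧),
      α.1 = chartPoint D φ ∧ p.RestrictsTo D.1 ((algebraMap K⟦X⟧ K⸨X⸩).comp φ) ∧
        p.AdmitsChart D.1 := by
  obtain ⟨D, φ, hα⟩ := exists_eq_chartPoint α.1
  obtain ⟨D₀, ρ, hx, hρ, h0⟩ := (hasGenericPoint_iff hs).1 h
  rw [hα, genericι_comp_chartPoint] at h0
  obtain ⟨hx', hρ'⟩ := hρ.of_chartPoint_eq hs h0.symm hx
  exact ⟨D, φ, hα, hρ', TorusPoint.admitsChart_of_comp_eq (E.proper D.1 D.2)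
    (fun _ h1 h2 => coeff_eq_tail_of_mem hs D.2 h1 h2) hx' hρ' rfl⟩

theorem exists_arc [Nonempty Γ] (hs : ∀ y : ClosedPt C, y.1 ∈ Γ → y ∉ E.special)
    {D : PolyhedralDivisor C M} (hD : D ∈ E.divisors) (h : p.AdmitsChart D) :
    ∃ α : ArcOver E Γ K, α.1.HasGenericPoint p := by
  have hsp : ∀ y : ClosedPt C, y.1 ∈ Γ → y.1 ∈ D.locus → D.coeff y = (D.tail : Set (NQ M)) :=
    fun _ h1 h2 => coeff_eq_tail_of_mem hs hD h1 h2
  have hx := TorusPoint.center_mem_of_limit_mem h.limit_mem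
  obtain ⟨ρ, hρ⟩ := TorusPoint.exists_restrictsTo_of_center_mem hx hsp
  obtain ⟨φ, hφ⟩ := h.exists_comp_eq hsp hρ
  have hφC : φ.comp (algebraMap ℂ D.algebra) = algebraMap ℂ K⟦X⟧ := by
    ext1 c
    refine algebraMap_laurentSeries_injective ?_
    rw [algebraMap_laurentSeries_apply, ← hρ.map_algebraMap c, ← hφ]
    rfl
  let α : Arc E K := ⟨chartPoint ⟨D, hD⟩ φ, by rw [chartPoint_comp_str, hφC]⟩
  have hα : α.HasGenericPoint p := (hasGenericPoint_iff hs).2 ⟨⟨D, hD⟩, ρ, hx, hρ,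
    (genericι_comp_chartPoint (D := ⟨D, hD⟩) φ).trans (by rw [hφ])⟩
  exact ⟨⟨α, hα.mem_openTorus⟩, hα⟩

/-- The generic point extends over the charts of both arcs, hence over that of the intersection.
Both arcs are the extension found there, as `𝒪` embeds in `𝒦`. -/
theorem arc_eq_of_hasGenericPoint [Nonempty Γ] (hs : ∀ y : ClosedPt C, y.1 ∈ Γ → y ∉ E.special)
    {α α' : Arc E K} (h : α.HasGenericPoint p) (h' : α'.HasGenericPoint p) : α = α' := by
  obtain ⟨D, φ, hα, hρ, hadm⟩ := exists_admitsChart hs h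
  obtain ⟨D', φ', hα', hρ', hadm'⟩ := exists_admitsChart hs h'
  obtain ⟨D₃, hD₃, h₃, h₃', ht, hc⟩ := exists_inter D.2 D'.2
  have hadm₃ := hadm.inf hs D.2 D'.2 ht hc hadm'
  have hsp : ∀ y : ClosedPt C, y.1 ∈ Γ → y.1 ∈ D₃.locus → D₃.coeff y = (D₃.tail : Set (NQ M)) :=
    fun _ h1 h2 => coeff_eq_tail_of_mem hs hD₃ h1 h2
  obtain ⟨ρ₃, hρ₃⟩ := TorusPoint.exists_restrictsTo_of_center_mem
    (TorusPoint.center_mem_of_limit_mem hadm₃.limit_mem) hsp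
  obtain ⟨φ₃, rfl⟩ := hadm₃.exists_comp_eq hsp hρ₃
  have key : ∀ (D₀ : E.divisors) (φ₀ : D₀.1.algebra →+* K⟦X⟧) (h₀ : D₃ ≤ D₀.1),
      p.RestrictsTo D₀.1 ((algebraMap K⟦X⟧ K⸨X⸩).comp φ₀) →
      chartPoint D₀ φ₀ = chartPoint (⟨D₃, hD₃⟩ : E.divisors) φ₃ := by
    intro D₀ φ₀ h₀ hρ₀
    have h1 : φ₃.comp (algebraInclusion h₀) = φ₀ := by
      ext1 a
      exact algebraMap_laurentSeries_injective
        (RingHom.congr_fun ((hρ₃.comp_algebraInclusion h₀).unique hρ₀) a)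
    rw [← h1]
    exact chartPoint_comp_algebraInclusion (D := ⟨D₃, hD₃⟩) h₀ φ₃
  exact Subtype.ext (hα.trans ((key D φ h₃ hρ).trans ((key D' φ' h₃' hρ').symm.trans hα'.symm)))

/-! ### Expansions in powers of a uniformizer -/

open PowerSeries LaurentSeries

variable {C : Scheme.{0}} [C.Over SpecC] [IsSmoothProjectiveCurve C] {y : ClosedPt C}
  {π : C.functionField} {K : Type} [Field K] [Algebra ℂ K]

section Expansion

theorem ne_zero_of_ord_eq_one (hπ : ord y π = 1) : π ≠ 0 := by
  rintro rfl
  rw [ord_zero] at hπ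
  exact zero_ne_one hπ

theorem pow_mul_mem_ordGE_iff (hπ : ord y π = 1) {n k : ℤ} {m : ℕ} (hk : k = n + m)
    {f : C.functionField} : π ^ m * f ∈ ordGE y k ↔ f ∈ ordGE y n := by
  have hπ0 := ne_zero_of_ord_eq_one hπ
  by_cases hf : f = 0
  · simp [hf]
  simp only [mem_ordGE, ne_eq, mul_eq_zero, hf, pow_eq_zero_iff', hπ0, false_and, or_self,
    not_false_eq_true, forall_true_left]
  rw [ord_mul y (pow_ne_zero _ hπ0) hf, ord_pow, hπ]
  subst hk
  constructor <;> intro h <;> linarith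

theorem aeval_mem_ordGE (hπ : ord y π = 1) (P : Polynomial ℂ) : Polynomial.aeval π P ∈ ordGE y 0 := by
  induction P using Polynomial.induction_on' with
  | add P Q hP hQ =>
    rw [map_add]
    exact add_mem hP hQ
  | monomial n c =>
    rw [Polynomial.aeval_monomial, ← Algebra.smul_def]
    refine Submodule.smul_mem _ _ ?_
    rw [mem_ordGE]
    intro _
    rw [ord_pow, hπ]
    positivity

theorem exists_sub_algebraMap_mem_ordGE {f : C.functionField} (hf : f ∈ ordGE y 0) :
    ∃ c : ℂ, f - algebraMap ℂ _ c ∈ ordGE y 1 := by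
  have h0 : 0 ≤ ord y f := by
    by_cases h : f = 0
    · rw [h, ord_zero]
    · exact mem_ordGE.1 hf h
  obtain ⟨c, hc | hc⟩ := exists_ord_sub_pos y h0
  · exact ⟨c, by rw [hc, sub_self]; exact zero_mem _⟩
  · exact ⟨c, mem_ordGE.2 fun _ => hc⟩

/-- Taylor polynomials: as the residue field is `ℂ`, each step finds one more coefficient. -/
theorem exists_sub_aeval_mem_ordGE (hπ : ord y π = 1) {f : C.functionField} (hf : f ∈ ordGE y 0)
    (n : ℕ) : ∃ P : Polynomial ℂ, f - Polynomial.aeval π P ∈ ordGE y n := by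
  have hπ0 := ne_zero_of_ord_eq_one hπ
  induction n with
  | zero => exact ⟨0, by simpa using hf⟩
  | succ n ih =>
    obtain ⟨P, hP⟩ := ih
    have h1 : f - Polynomial.aeval π P = π ^ n * ((π ^ n)⁻¹ * (f - Polynomial.aeval π P)) := by
      rw [mul_inv_cancel_left₀ (pow_ne_zero _ hπ0)]
    rw [h1, pow_mul_mem_ordGE_iff hπ (n := 0) (by simp)] at hP
    obtain ⟨c, hc⟩ := exists_sub_algebraMap_mem_ordGE hP
    refine ⟨P + Polynomial.monomial n c, ?_⟩
    rw [← pow_mul_mem_ordGE_iff hπ (k := ((n + 1 : ℕ) : ℤ)) (m := n) (by push_cast; ring)] at hc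
    convert hc using 1
    rw [mul_sub, mul_inv_cancel_left₀ (pow_ne_zero _ hπ0), map_add, Polynomial.aeval_monomial]
    ring

theorem X_pow_dvd_of_aeval_mem_ordGE (hπ : ord y π = 1) {n : ℕ} {P : Polynomial ℂ}
    (h : Polynomial.aeval π P ∈ ordGE y n) : (Polynomial.X : Polynomial ℂ) ^ n ∣ P := by
  induction n generalizing P with
  | zero => simp
  | succ n ih =>
    have h1 : Polynomial.aeval π P =
        π ^ 1 * Polynomial.aeval π P.divX + algebraMap ℂ _ (P.coeff 0) := by
      have h2 := congrArg (Polynomial.aeval π) P.divX_mul_X_add.symm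
      rw [map_add, map_mul, Polynomial.aeval_X, Polynomial.aeval_C] at h2
      exact h2.trans (by ring)
    have h2 : π ^ 1 * Polynomial.aeval π P.divX ∈ ordGE y 1 :=
      (pow_mul_mem_ordGE_iff hπ (n := 0) (by simp)).2 (aeval_mem_ordGE hπ _)
    have h3 : Polynomial.aeval π P ∈ ordGE y 1 := ordGE_mono (by push_cast; lia) h
    have h4 : algebraMap ℂ C.functionField (P.coeff 0) ∈ ordGE y 1 := by
      have := sub_mem h3 h2
      rwa [h1, add_sub_cancel_left] at this
    have h5 : P.coeff 0 = 0 := by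
      by_contra h6
      have h7 := mem_ordGE.1 h4 (by simpa using h6)
      rw [ord_algebraMap y h6] at h7
      exact absurd h7 (by norm_num)
    rw [h5, map_zero, add_zero] at h1
    rw [h1, pow_mul_mem_ordGE_iff hπ (n := (n : ℤ)) (by push_cast; ring)] at h
    have h8 := mul_dvd_mul_right (ih h) Polynomial.X
    rw [← pow_succ] at h8
    have h9 := P.divX_mul_X_add
    rw [h5, map_zero, add_zero] at h9
    rwa [h9] at h8

theorem X_pow_dvd_aeval {s : K⟦X⟧} (hs : (PowerSeries.X : K⟦X⟧) ∣ s) {n : ℕ} {P : Polynomial ℂ}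
    (h : (Polynomial.X : Polynomial ℂ) ^ n ∣ P) :
    (PowerSeries.X : K⟦X⟧) ^ n ∣ Polynomial.aeval s P := by
  obtain ⟨Q, rfl⟩ := h
  rw [map_mul, map_pow, Polynomial.aeval_X]
  exact (pow_dvd_pow_of_dvd hs n).mul_right _

/-- The power series `b` is obtained from the expansion of `f` in powers of `π` by the substitution
of `s` for `π`. -/
def IsExpansion (y : ClosedPt C) (π : C.functionField) (s : K⟦X⟧) (f : C.functionField)
    (b : K⟦X⟧) : Prop :=
  ∀ n : ℕ, ∃ P : Polynomial ℂ, f - Polynomial.aeval π P ∈ ordGE y n ∧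
    (PowerSeries.X : K⟦X⟧) ^ n ∣ b - Polynomial.aeval s P

variable {s : K⟦X⟧} {f f' : C.functionField} {b b' : K⟦X⟧}

theorem eq_zero_of_X_pow_dvd (h : ∀ n : ℕ, (PowerSeries.X : K⟦X⟧) ^ n ∣ b) : b = 0 := by
  ext n
  rw [PowerSeries.X_pow_dvd_iff.1 (h (n + 1)) n (Nat.lt_succ_self n), map_zero]

theorem IsExpansion.unique (hπ : ord y π = 1) (hs : (PowerSeries.X : K⟦X⟧) ∣ s)
    (h : IsExpansion y π s f b) (h' : IsExpansion y π s f b') : b = b' := by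
  rw [← sub_eq_zero]
  refine eq_zero_of_X_pow_dvd fun n => ?_
  obtain ⟨P, hP, hb⟩ := h n
  obtain ⟨P', hP', hb'⟩ := h' n
  have h1 : Polynomial.aeval π (P' - P) ∈ ordGE y n := by
    have := sub_mem hP hP'
    rwa [sub_sub_sub_cancel_left, ← map_sub] at this
  have h2 := X_pow_dvd_aeval hs (X_pow_dvd_of_aeval_mem_ordGE hπ h1)
  have h3 : b - b' = (b - Polynomial.aeval s P) - (b' - Polynomial.aeval s P') -
      Polynomial.aeval s (P' - P) := by
    rw [map_sub]
    ring
  rw [h3]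
  exact dvd_sub (dvd_sub hb hb') h2

theorem isExpansion_aeval (P : Polynomial ℂ) :
    IsExpansion y π s (Polynomial.aeval π P) (Polynomial.aeval s P) :=
  fun _ => ⟨P, by rw [sub_self]; exact zero_mem _, by rw [sub_self]; exact dvd_zero _⟩

theorem IsExpansion.add (h : IsExpansion y π s f b) (h' : IsExpansion y π s f' b') :
    IsExpansion y π s (f + f') (b + b') := by
  intro n
  obtain ⟨P, hP, hb⟩ := h n
  obtain ⟨P', hP', hb'⟩ := h' n
  refine ⟨P + P', ?_, ?_⟩
  · rw [map_add, add_sub_add_comm]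
    exact add_mem hP hP'
  · rw [map_add, add_sub_add_comm]
    exact dvd_add hb hb'

theorem IsExpansion.mul (hπ : ord y π = 1) (hf : f ∈ ordGE y 0) (h : IsExpansion y π s f b)
    (h' : IsExpansion y π s f' b') : IsExpansion y π s (f * f') (b * b') := by
  intro n
  obtain ⟨P, hP, hb⟩ := h n
  obtain ⟨P', hP', hb'⟩ := h' n
  refine ⟨P * P', ?_, ?_⟩
  · have h1 : f * f' - Polynomial.aeval π (P * P') = f * (f' - Polynomial.aeval π P') +
        Polynomial.aeval π P' * (f - Polynomial.aeval π P) := by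
      rw [map_mul]
      ring
    rw [h1]
    refine add_mem ?_ ?_
    · simpa using mul_mem_ordGE hf hP'
    · simpa using mul_mem_ordGE (aeval_mem_ordGE hπ P') hP
  · have h1 : b * b' - Polynomial.aeval s (P * P') = b * (b' - Polynomial.aeval s P') +
        Polynomial.aeval s P' * (b - Polynomial.aeval s P) := by
      rw [map_mul]
      ring
    rw [h1]
    exact dvd_add (hb'.mul_left _) (hb.mul_left _)

theorem exists_isExpansion (hπ : ord y π = 1) (hs : (PowerSeries.X : K⟦X⟧) ∣ s)
    (hf : f ∈ ordGE y 0) : ∃ b : K⟦X⟧, IsExpansion y π s f b := by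
  choose P hP using exists_sub_aeval_mem_ordGE hπ hf
  -- The coefficient of degree `k` is stable from `P (k + 1)` on, since later Taylor polynomials
  -- differ from it by multiples of `X ^ (k + 1)` and `X` divides `s`.
  refine ⟨PowerSeries.mk fun k => PowerSeries.coeff k (Polynomial.aeval s (P (k + 1))),
    fun n => ⟨P n, hP n, ?_⟩⟩
  rw [PowerSeries.X_pow_dvd_iff]
  intro k hk
  rw [map_sub, PowerSeries.coeff_mk, ← map_sub, ← map_sub]
  have h1 : Polynomial.aeval π (P (k + 1) - P n) ∈ ordGE y ((k + 1 : ℕ) : ℤ) := by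
    have h2 := sub_mem (ordGE_mono (by exact_mod_cast hk) (hP n)) (hP (k + 1))
    rwa [sub_sub_sub_cancel_left, ← map_sub] at h2
  exact PowerSeries.X_pow_dvd_iff.1 (X_pow_dvd_aeval hs (X_pow_dvd_of_aeval_mem_ordGE hπ h1)) k
    (Nat.lt_succ_self k)

theorem IsExpansion.X_dvd (hπ : ord y π = 1) (hs : (PowerSeries.X : K⟦X⟧) ∣ s)
    (hf : f ∈ ordGE y 1) (h : IsExpansion y π s f b) : (PowerSeries.X : K⟦X⟧) ∣ b := by
  obtain ⟨P, hP, hb⟩ := h 1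
  have h1 : Polynomial.aeval π P ∈ ordGE y ((1 : ℕ) : ℤ) := by
    have := sub_mem hf hP
    rwa [sub_sub_cancel] at this
  have h2 := X_pow_dvd_aeval hs (X_pow_dvd_of_aeval_mem_ordGE hπ h1)
  rw [pow_one] at hb h2
  simpa using dvd_add hb h2

theorem algebraMap_stalk_mem_ordGE (a : C.presheaf.stalk y.1) :
    algebraMap _ C.functionField a ∈ ordGE y 0 :=
  mem_ordGE.2 fun _ => ord_algebraMap_nonneg y a

/-- The substitution `π ↦ s`. Uniqueness of expansions makes it a ring homomorphism; it is local
because elements of the maximal ideal expand without constant term. -/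
theorem exists_expansionHom (hπ : ord y π = 1) (hs : (PowerSeries.X : K⟦X⟧) ∣ s) :
    ∃ θ : C.presheaf.stalk y.1 →+* K⟦X⟧, IsLocalHom θ ∧
      ∀ a, IsExpansion y π s (algebraMap _ C.functionField a) (θ a) := by
  choose θ hθ using fun a : C.presheaf.stalk y.1 =>
    exists_isExpansion hπ hs (algebraMap_stalk_mem_ordGE a)
  have hone : IsExpansion y π s 1 1 := by simpa using isExpansion_aeval (y := y) (π := π) (s := s) 1
  have hzero : IsExpansion y π s 0 0 := by simpa using isExpansion_aeval (y := y) (π := π) (s := s) 0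
  let Θ : C.presheaf.stalk y.1 →+* K⟦X⟧ :=
    { toFun := θ
      map_one' := (hθ 1).unique hπ hs (by rwa [map_one])
      map_zero' := (hθ 0).unique hπ hs (by rwa [map_zero])
      map_add' := fun a b => (hθ (a + b)).unique hπ hs (by rw [map_add]; exact (hθ a).add (hθ b))
      map_mul' := fun a b => (hθ (a * b)).unique hπ hs (by
        rw [map_mul]
        exact (hθ a).mul hπ (algebraMap_stalk_mem_ordGE a) (hθ b)) }
  refine ⟨Θ, ⟨fun a ha => ?_⟩, hθ⟩
  by_contra hcon
  have h1 : algebraMap _ C.functionField a ∈ ordGE y 1 := by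
    refine mem_ordGE.2 fun h0 => (ord_pos_iff y ?_).2 ((IsLocalRing.mem_maximalIdeal _).2 hcon)
    rintro rfl
    exact h0 (map_zero _)
  exact PowerSeries.X_prime.not_isUnit (isUnit_of_dvd_unit ((hθ a).X_dvd hπ hs h1) ha)

end Expansion

section Lift

variable {s : K⟦X⟧}

theorem evalsTo_aeval {R : Type} [CommRing R] [IsLocalRing R] [Algebra ℂ R]
    {l : Spec (CommRingCat.of R) ⟶ C}
    (hl : l ≫ (C ↘ SpecC) = Spec.map (CommRingCat.ofHom (algebraMap ℂ R))) {s : R}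
    (h : EvalsTo l π s) (P : Polynomial ℂ) :
    EvalsTo l (Polynomial.aeval π P) (Polynomial.aeval s P) := by
  induction P using Polynomial.induction_on' with
  | add P Q hP hQ =>
    rw [map_add, map_add]
    exact hP.add hQ
  | monomial n c =>
    rw [Polynomial.aeval_monomial, Polynomial.aeval_monomial]
    exact (comp_over_eq_iff.1 hl c).mul (h.pow n)

/-- The remainder of a Taylor polynomial is `π ^ n` times a regular function, so its pull-back is
divisible by `s ^ n`. Hence an arc through `y` over `ℂ` is determined by the pull-back of `π`. -/
theorem EvalsTo.isExpansion (hπ : ord y π = 1) (hs : (PowerSeries.X : K⟦X⟧) ∣ s)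
    {l : Spec (CommRingCat.of K⟦X⟧) ⟶ C}
    (hl : l ≫ (C ↘ SpecC) = Spec.map (CommRingCat.ofHom (algebraMap ℂ K⟦X⟧)))
    (hy : l (IsLocalRing.closedPoint K⟦X⟧) = y.1) (h : EvalsTo l π s) {f : C.functionField}
    {r : K⟦X⟧} (hr : EvalsTo l f r) : IsExpansion y π s f r := by
  intro n
  have hf : f ∈ ordGE y 0 := mem_ordGE.2 fun _ => hr.ord_nonneg y hy
  obtain ⟨P, hP⟩ := exists_sub_aeval_mem_ordGE hπ hf n
  refine ⟨P, hP, ?_⟩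
  have hπ0 := ne_zero_of_ord_eq_one hπ
  have h1 : f - Polynomial.aeval π P = π ^ n * ((π ^ n)⁻¹ * (f - Polynomial.aeval π P)) := by
    rw [mul_inv_cancel_left₀ (pow_ne_zero _ hπ0)]
  rw [h1, pow_mul_mem_ordGE_iff hπ (n := 0) (by simp)] at hP
  obtain ⟨r', hr'⟩ := exists_evalsTo_of_ord_nonneg (g := l) y hy (mem_ordGE.1 hP)
  have h2 := (h.pow n).mul hr'
  rw [← h1] at h2
  rw [(hr.sub (evalsTo_aeval hl h P)).unique h2]
  exact (pow_dvd_pow_of_dvd hs n).mul_right _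

theorem lift_eq_of_evalsTo (hπ : ord y π = 1) (hs : (PowerSeries.X : K⟦X⟧) ∣ s)
    {l l' : Spec (CommRingCat.of K⟦X⟧) ⟶ C}
    (hl : l ≫ (C ↘ SpecC) = Spec.map (CommRingCat.ofHom (algebraMap ℂ K⟦X⟧)))
    (hl' : l' ≫ (C ↘ SpecC) = Spec.map (CommRingCat.ofHom (algebraMap ℂ K⟦X⟧)))
    (hy : l (IsLocalRing.closedPoint K⟦X⟧) = y.1) (hy' : l' (IsLocalRing.closedPoint K⟦X⟧) = y.1)
    (h : EvalsTo l π s) (h' : EvalsTo l' π s) : l = l' :=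
  hom_ext_of_evalsTo (hy.trans hy'.symm) fun _ _ _ hr hr' =>
    (h.isExpansion hπ hs hl hy hr).unique hπ hs (h'.isExpansion hπ hs hl' hy' hr')

theorem exists_lift_evalsTo (hπ : ord y π = 1) (hs : (PowerSeries.X : K⟦X⟧) ∣ s) :
    ∃ l : Spec (CommRingCat.of K⟦X⟧) ⟶ C,
      l ≫ (C ↘ SpecC) = Spec.map (CommRingCat.ofHom (algebraMap ℂ K⟦X⟧)) ∧
        l (IsLocalRing.closedPoint K⟦X⟧) = y.1 ∧ EvalsTo l π s := by
  obtain ⟨θ, hθ, hexp⟩ := exists_expansionHom hπ hs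
  have key : ∀ (f : C.functionField) (b : K⟦X⟧), f ∈ ordGE y 0 → IsExpansion y π s f b →
      EvalsTo (Spec.map (CommRingCat.ofHom θ) ≫ C.fromSpecStalk y.1) f b := by
    intro f b hf hb
    rw [evalsTo_Spec_map_comp_fromSpecStalk]
    by_cases hf0 : f = 0
    · subst hf0
      refine ⟨0, map_zero _, (hexp 0).unique hπ hs ?_⟩
      rwa [map_zero]
    · obtain ⟨a, rfl⟩ := (ord_nonneg_iff y hf0).1 (mem_ordGE.1 hf hf0)
      exact ⟨a, rfl, (hexp a).unique hπ hs hb⟩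
  refine ⟨Spec.map (CommRingCat.ofHom θ) ≫ C.fromSpecStalk y.1, ?_, ?_, ?_⟩
  · rw [comp_over_eq_iff]
    intro c
    have h1 := isExpansion_aeval (y := y) (π := π) (s := s) (Polynomial.C c)
    rw [Polynomial.aeval_C, Polynomial.aeval_C] at h1
    refine key _ _ ?_ h1
    simpa using aeval_mem_ordGE hπ (Polynomial.C c)
  · have : IsLocalHom (CommRingCat.ofHom θ).hom := hθ
    refine (Scheme.Hom.comp_apply _ _ _).trans ?_
    refine (congrArg _ (Spec_closedPoint (f := CommRingCat.ofHom θ))).trans ?_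
    exact Scheme.fromSpecStalk_closedPoint
  · refine key _ _ ?_ ?_
    · simpa using aeval_mem_ordGE hπ Polynomial.X
    · simpa using isExpansion_aeval (y := y) (π := π) (s := s) Polynomial.X

variable {M : Type} [AddCommGroup M] {Γ : C.Opens} [Nonempty Γ]

theorem exists_torusPoint_evalsTo (hπ : ord y π = 1) (hs : (PowerSeries.X : K⟦X⟧) ∣ s) (hs0 : s ≠ 0)
    (χ : AddMonoidAlgebra ℂ M →ₐ[ℂ] K⸨X⸩) : ∃ p : TorusPoint Γ M K, p.char = χ ∧
      p.center = genericPoint C ∧ p.limit = y.1 ∧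
        EvalsTo p.curvePoint π (algebraMap K⟦X⟧ K⸨X⸩ s) := by
  obtain ⟨l, hl, hy, h⟩ := exists_lift_evalsTo (K := K) hπ hs
  have hg := h.comp (algebraMap K⟦X⟧ K⸨X⸩)
  have hx : (genericι K ≫ l) (IsLocalRing.closedPoint K⸨X⸩) = genericPoint C := by
    -- If the image of `Spec 𝒦` were closed it would be `y`, and `π`, which is no unit at `y`, would
    -- pull back to zero.
    refine (eq_genericPoint_or_isClosed _).resolve_right fun hc => ?_
    have h1 : (genericι K ≫ l) (IsLocalRing.closedPoint K⸨X⸩) ⤳ y.1 := by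
      rw [← hy]
      exact (IsLocalRing.specializes_closedPoint
        (genericι K (IsLocalRing.closedPoint K⸨X⸩))).map l.continuous
    have h2 : y.1 = (genericι K ≫ l) (IsLocalRing.closedPoint K⸨X⸩) := h1.mem_closed hc rfl
    have h3 := (hg.isUnit_iff y h2.symm (ne_zero_of_ord_eq_one hπ)).1
      (IsUnit.mk0 _ (algebraMap_laurentSeries_ne_zero hs0))
    rw [hπ] at h3
    exact one_ne_zero h3
  have hrange : Set.range (genericι K ≫ l) ⊆ Set.range Γ.ι := by
    rw [Scheme.Opens.range_ι]
    rintro _ ⟨z, rfl⟩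
    have h1 := Scheme.preimage_eq_top_of_closedPoint_mem (R := CommRingCat.of K⸨X⸩) (genericι K ≫ l)
      (U := Γ) (hx ▸ genericPoint_mem Γ)
    have h2 : z ∈ (genericι K ≫ l) ⁻¹ᵁ Γ := h1 ▸ trivial
    exact h2
  let p : TorusPoint Γ M K :=
    { base := IsOpenImmersion.lift Γ.ι (genericι K ≫ l) hrange
      base_over := by
        rw [IsOverC, IsOpenImmersion.lift_fac_assoc, Category.assoc, hl]
        exact (Spec.map_comp _ _).symm
      char := χ }
  have hp : p.curvePoint = genericι K ≫ l := IsOpenImmersion.lift_fac _ _ _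
  refine ⟨p, rfl, ?_, ?_, hp ▸ hg⟩
  · rw [TorusPoint.center, hp]
    exact hx
  · rw [TorusPoint.limit, ← TorusPoint.eq_lift hp.symm]
    exact hy

end Lift

open PowerSeries LaurentSeries

/-! ### Membership in the support -/

section Hyperspace

variable {C : Scheme.{0}} {M : Type} [AddCommGroup M]

theorem Hyperspace.mk_eq_mk_iff {y y' : ClosedPt C} {ν ν' : NQ M} {ℓ ℓ' : ℚ≥0} :
    Hyperspace.mk y ν ℓ = .mk y' ν' ℓ' ↔
      (y = y' ∧ ν = ν' ∧ ℓ = ℓ') ∨ (ℓ = 0 ∧ ℓ' = 0 ∧ ν = ν') := by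
  refine (Quotient.eq (r := hyperspaceSetoid C M)).trans ?_
  change ((y, ν, ℓ) = (y', ν', ℓ') ∨ _) ↔ _
  rw [Prod.mk.injEq, Prod.mk.injEq]

theorem Hyperspace.mk_zero_eq (y y' : ClosedPt C) (ν : NQ M) :
    Hyperspace.mk y ν 0 = .mk y' ν 0 := mk_eq_mk_iff.2 (Or.inr ⟨rfl, rfl, rfl⟩)

theorem NQ.ofInt_injective : Function.Injective (NQ.ofInt (M := M)) := by
  intro ν ν' h
  ext m
  have h1 : ((ν m : ℤ) : ℚ) = (ν' m : ℤ) := DFunLike.congr_fun h m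
  exact_mod_cast h1

variable [C.Over SpecC] [IsSmoothProjectiveCurve C] {E : DivisorialFan C M} {Γ : C.Opens}

theorem DivisorialFan.mk_zero_mem_supportOver_iff {y : ClosedPt C} {ν : NQ M} :
    Hyperspace.mk y ν 0 ∈ E.supportOver Γ ↔ ∃ D ∈ E.divisors, ν ∈ D.tail := by
  simp only [supportOver, Set.mem_sdiff, Set.mem_iUnion, exists_prop]
  constructor
  · rintro ⟨⟨D, hD, y', ν', ℓ', hy', hc, h⟩, -⟩
    refine ⟨D, hD, ?_⟩
    obtain ⟨-, rfl, rfl⟩ | ⟨-, rfl, rfl⟩ := Hyperspace.mk_eq_mk_iff.1 h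
    · exact PolyhedralDivisor.mem_cayleyCone_zero_iff.1 hc
    · exact PolyhedralDivisor.mem_cayleyCone_zero_iff.1 hc
  · rintro ⟨D, hD, h⟩
    refine ⟨⟨D, hD, ?_⟩, ?_⟩
    · have : Nonempty D.locus := D.locus_nonempty.to_subtype
      obtain ⟨y', hy'⟩ := exists_closedPt_mem D.locus
      exact ⟨y', ν, 0, hy', PolyhedralDivisor.mem_cayleyCone_zero_iff.2 h,
        Hyperspace.mk_zero_eq _ _ _⟩
    · rintro ⟨y', ν', ℓ', -, hpos, h⟩
      obtain ⟨-, -, rfl⟩ | ⟨-, rfl, -⟩ := Hyperspace.mk_eq_mk_iff.1 h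
      · exact lt_irrefl _ hpos
      · exact lt_irrefl _ hpos

theorem DivisorialFan.mk_mem_supportOver_iff_of_pos {y : ClosedPt C} {ν : NQ M} {ℓ : ℚ≥0}
    (hℓ : 0 < ℓ) : Hyperspace.mk y ν ℓ ∈ E.supportOver Γ ↔
      y.1 ∉ Γ ∧ ∃ D ∈ E.divisors, (ℓ : ℚ)⁻¹ • ν ∈ D.coeff y := by
  have hℓ' : (0 : ℚ) < ℓ := by exact_mod_cast hℓ
  simp only [supportOver, Set.mem_sdiff, Set.mem_iUnion, exists_prop]
  constructor
  · rintro ⟨⟨D, hD, y', ν', ℓ', hy', hc, h⟩, h2⟩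
    refine ⟨fun hy => h2 ⟨y, ν, ℓ, hy, hℓ, rfl⟩, D, hD, ?_⟩
    obtain ⟨rfl, rfl, rfl⟩ | ⟨h0, -⟩ := Hyperspace.mk_eq_mk_iff.1 h
    · exact (PolyhedralDivisor.mem_cayleyCone_iff_of_pos hℓ').1 hc
    · exact absurd h0 hℓ.ne'
  · rintro ⟨hy, D, hD, h⟩
    refine ⟨⟨D, hD, y, ν, ℓ, PolyhedralDivisor.mem_locus_of_mem_coeff h,
      (PolyhedralDivisor.mem_cayleyCone_iff_of_pos hℓ').2 h, rfl⟩, ?_⟩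
    rintro ⟨y', ν', ℓ', hy', hpos, h⟩
    obtain ⟨rfl, -⟩ | ⟨-, rfl, -⟩ := Hyperspace.mk_eq_mk_iff.1 h
    · exact hy hy'
    · exact lt_irrefl _ hpos

end Hyperspace

/-! ### Orbits of the torus -/

section Orbit

variable {K : Type} [Field K]

theorem eqPowMulUnit_X_pow_mul (n : ℕ) (u : K⟦X⟧ˣ) :
    EqPowMulUnit (algebraMap K⟦X⟧ K⸨X⸩ ((PowerSeries.X : K⟦X⟧) ^ n * u)) n u := by
  rw [EqPowMulUnit, map_mul, LaurentSeries.coe_algebraMap, HahnSeries.ofPowerSeries_X_pow]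

theorem EqPowMulUnit.mul {x x' : K⸨X⸩} {n n' : ℤ} {u u' : K⟦X⟧ˣ} (h : EqPowMulUnit x n u)
    (h' : EqPowMulUnit x' n' u') : EqPowMulUnit (x * x') (n + n') (u * u') := by
  rw [EqPowMulUnit] at *
  rw [h, h', Units.val_mul, map_mul, mul_mul_mul_comm, HahnSeries.single_mul_single, one_mul]

theorem eqPowMulUnit_one : EqPowMulUnit (1 : K⸨X⸩) 0 1 := by
  rw [EqPowMulUnit, Units.val_one, map_one (algebraMap K⟦X⟧ K⸨X⸩), mul_one]
  rfl

variable [Algebra ℂ K] {M : Type} [AddCommGroup M] {ν : M →+ ℤ}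

/-- The unit factor is determined by the series and the exponent, so it is automatically
multiplicative in `m`. -/
theorem mem_torusOrbit_iff {χ : AddMonoidAlgebra ℂ M →ₐ[ℂ] K⸨X⸩} : χ ∈ torusOrbit ν K ↔
    ∀ m, ∃ u, EqPowMulUnit (χ (AddMonoidAlgebra.single m 1)) (ν m) u := by
  refine ⟨fun ⟨ω, h⟩ m => ⟨_, h m⟩, fun h => ?_⟩
  choose u hu using h
  refine ⟨⟨⟨fun m => u m.toAdd, ?_⟩, fun m m' => ?_⟩, hu⟩
  · have h1 := hu 0
    rw [map_zero ν] at h1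
    exact h1.unit_unique ((map_one χ).symm ▸ eqPowMulUnit_one)
  · have h1 := hu (m.toAdd + m'.toAdd)
    rw [map_add ν, ← mul_one (1 : ℂ), ← AddMonoidAlgebra.single_mul_single, map_mul] at h1
    exact h1.unit_unique ((hu _).mul (hu _))

theorem torusOrbit_nonempty (ν : M →+ ℤ) : (torusOrbit ν K).Nonempty := by
  let F : Multiplicative M →* K⸨X⸩ :=
    { toFun := fun m => HahnSeries.single (ν m.toAdd) 1
      map_one' := by rw [toAdd_one, map_zero]; rfl
      map_mul' := fun m m' => by
        rw [toAdd_mul, map_add, HahnSeries.single_mul_single, one_mul] }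
  refine ⟨AddMonoidAlgebra.lift ℂ K⸨X⸩ M F, mem_torusOrbit_iff.2 fun m => ⟨1, ?_⟩⟩
  rw [EqPowMulUnit, Units.val_one, map_one (algebraMap K⟦X⟧ K⸨X⸩), mul_one]
  exact (AddMonoidAlgebra.lift_single _ _ _).trans
    ((Algebra.smul_def _ _).trans (by rw [map_one, one_mul]; rfl))

end Orbit

variable {C : Scheme.{0}} [C.Over SpecC] [IsSmoothProjectiveCurve C] {M : Type} [AddCommGroup M]
  {Γ : C.Opens} {K : Type} [Field K] [Algebra ℂ K]

/-! ### The triple attached to a point -/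

namespace TorusPoint

section Val

variable {p : TorusPoint Γ M K}

theorem mem_torusOrbit_iff_weight {ν : M →+ ℤ} : p.char ∈ torusOrbit ν K ↔ p.weight = ν := by
  rw [mem_torusOrbit_iff]
  refine ⟨fun h => AddMonoidHom.ext fun m => ?_, ?_⟩
  · obtain ⟨u, hu⟩ := h m
    exact hu.order_eq
  · rintro rfl m
    exact exists_eqPowMulUnit (p.charAt_ne_zero m)

/-- There is a function with a single pole at `c` that vanishes at `y`. -/
theorem exists_ord_neg_ord_pos {c y : ClosedPt C} (h : c ≠ y) : ∃ f : C.functionField, f ≠ 0 ∧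
    ord c f < 0 ∧ 0 < ord y f ∧ ∀ z, z ≠ c → 0 ≤ ord z f := by
  obtain ⟨k₀, hk₀⟩ := exists_section_of_degree_pos (C := C)
    (G := Finsupp.single c 1) (by simp) c {y} (by simpa using h)
  obtain ⟨f, hf, hfz, hfc, hfy⟩ := hk₀ (k₀ + 1) (Nat.le_succ _)
  have hz : ∀ z, z ≠ c → ord z f = ord z f + (k₀ + 1 : ℕ) * Finsupp.single c (1 : ℤ) z :=
    fun z hz => by rw [Finsupp.single_eq_of_ne hz, mul_zero, add_zero]
  refine ⟨f, hf, ?_, ?_, fun z hzc => ?_⟩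
  · rw [Finsupp.single_eq_same] at hfc
    push_cast at hfc
    lia
  · rw [hz y h.symm]
    exact hfy y (Finset.mem_singleton_self y)
  · rw [hz z hzc]
    exact hfz z

theorem HasIndex.unique {c c' : ClosedPt C} {ℓ ℓ' : ℕ} (h : p.HasIndex c ℓ)
    (h' : p.HasIndex c' ℓ') : c = c' ∧ ℓ = ℓ' := by
  obtain rfl : c = c' := Subtype.ext (h.limit_eq.symm.trans h'.limit_eq)
  refine ⟨rfl, ?_⟩
  obtain ⟨π, hπ, hπ1⟩ := exists_ord_eq_one c
  obtain ⟨r, hr⟩ := h.exists_evalsTo π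
  have h1 := (h.order_eq π r hπ hr).symm.trans (h'.order_eq π r hπ hr)
  rw [hπ1, mul_one, mul_one] at h1
  exact_mod_cast h1

theorem HasIndex.not_isHorizontal {c : ClosedPt C} {ℓ : ℕ} (h : p.HasIndex c ℓ) (hc : c.1 ∉ Γ) :
    ¬ p.IsHorizontal := fun h1 => hc (h.limit_eq ▸ isHorizontal_iff.1 h1)

theorem germToFunctionField_ne_zero [Nonempty Γ] {f : Γ(C, Γ)} (hf : f ≠ 0) :
    C.germToFunctionField Γ f ≠ 0 := by
  rw [← map_zero (C.germToFunctionField Γ).hom]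
  exact (Scheme.germToFunctionField_injective C Γ).ne hf

/-- `HasVal` tests only functions regular on `Γ`, whereas `HasIndex` concerns all rational functions
at the limit `c`. Functions with a single pole at `c`, which is outside `Γ`, show that both
determine the same point and multiplicity. -/
theorem hasVal_iff [Nonempty Γ] {ξ : Hyperspace C M} : p.HasVal ξ ↔
    (p.IsHorizontal ∧ ∃ y, ξ = .mk y (NQ.ofInt p.weight) 0) ∨
      ∃ (c : ClosedPt C) (ℓ : ℕ), c.1 ∉ Γ ∧ p.HasIndex c ℓ ∧ ξ = .mk c (NQ.ofInt p.weight) ℓ := by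
  constructor
  · rintro ⟨y, ν, ℓ, rfl, hν, h⟩
    obtain rfl : p.weight = ν := mem_torusOrbit_iff_weight.1 (mem_torusOrbit_iff.2 hν)
    obtain ⟨h1, rfl⟩ | ⟨h1, hℓ, hf⟩ := h
    · exact Or.inl ⟨h1, y, by rw [Nat.cast_zero]⟩
    · obtain ⟨c, ℓ', hc, hi⟩ := exists_hasIndex_of_not_isHorizontal h1
      have key : ∀ f : C.functionField, f ≠ 0 → (∀ z, z ≠ c → 0 ≤ ord z f) →
          (ℓ' : ℤ) * ord c f = ℓ * ord y f := by
        intro f hf0 hz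
        obtain ⟨s, rfl⟩ := exists_section_of_ord_nonneg Γ (f := f) fun _ z hzΓ =>
          hz z fun h => hc (h ▸ hzΓ)
        obtain ⟨u, hu⟩ := hf s fun h => hf0 (by rw [h, map_zero])
        rw [← hu.order_eq]
        exact (hi.order_eq _ _ hf0 (evalsTo_pull p.base s)).symm
      have hpos := hi.pos
      -- Otherwise a function with its only pole at `c` and a zero at `y` would have a pull-back of
      -- both negative and positive order.
      obtain rfl : c = y := by
        by_contra hcy
        obtain ⟨f, hf0, h1, h2, h3⟩ := exists_ord_neg_ord_pos hcy
        have h4 := key f hf0 h3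
        have h5 : (0 : ℤ) < ℓ := by exact_mod_cast hℓ
        have h6 : (0 : ℤ) < ℓ' := by exact_mod_cast hpos
        exact absurd h4 ((mul_neg_of_pos_of_neg h6 h1).trans (mul_pos h5 h2)).ne
      obtain ⟨y', hy'⟩ := exists_closedPt_mem Γ
      obtain ⟨f, hf0, h1, -, h3⟩ := exists_ord_neg_ord_pos (c := c) (y := y')
        fun h => hc (h ▸ hy')
      have h4 := mul_right_cancel₀ h1.ne (key f hf0 h3)
      obtain rfl : ℓ' = ℓ := by exact_mod_cast h4
      exact Or.inr ⟨c, ℓ', hc, hi, rfl⟩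
  · have hw := mem_torusOrbit_iff.1 (mem_torusOrbit_iff_weight (p := p).2 rfl)
    rintro (⟨h, y, rfl⟩ | ⟨c, ℓ, hc, hi, rfl⟩)
    · exact ⟨y, p.weight, 0, by rw [Nat.cast_zero], hw, Or.inl ⟨h, rfl⟩⟩
    · refine ⟨c, p.weight, ℓ, rfl, hw, Or.inr ⟨hi.not_isHorizontal hc, hi.pos, fun f hf => ?_⟩⟩
      have h1 := evalsTo_pull p.base f
      have h2 := germToFunctionField_ne_zero hf
      exact eqPowMulUnit_iff.2 ⟨hi.ne_zero h2 h1, hi.order_eq _ _ h2 h1⟩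

theorem exists_hasVal [Nonempty Γ] (p : TorusPoint Γ M K) : ∃ ξ : Hyperspace C M, p.HasVal ξ := by
  by_cases h : p.IsHorizontal
  · obtain ⟨y, -⟩ := exists_closedPt_mem Γ
    exact ⟨_, hasVal_iff.2 (Or.inl ⟨h, y, rfl⟩)⟩
  · obtain ⟨c, ℓ, hc, hi⟩ := exists_hasIndex_of_not_isHorizontal h
    exact ⟨_, hasVal_iff.2 (Or.inr ⟨c, ℓ, hc, hi, rfl⟩)⟩

theorem HasVal.unique [Nonempty Γ] {ξ ξ' : Hyperspace C M} (h : p.HasVal ξ) (h' : p.HasVal ξ') :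
    ξ = ξ' := by
  obtain ⟨h1, y, rfl⟩ | ⟨c, ℓ, hc, hi, rfl⟩ := hasVal_iff.1 h <;>
  obtain ⟨h1', y', rfl⟩ | ⟨c', ℓ', hc', hi', rfl⟩ := hasVal_iff.1 h'
  · exact Hyperspace.mk_zero_eq _ _ _
  · exact absurd h1 (hi'.not_isHorizontal hc')
  · exact absurd h1' (hi.not_isHorizontal hc)
  · obtain ⟨rfl, rfl⟩ := hi.unique hi'
    rfl

theorem hasVal_mk_zero_iff [Nonempty Γ] {y : ClosedPt C} {ν : M →+ ℤ} :
    p.HasVal (.mk y (NQ.ofInt ν) 0) ↔ p.IsHorizontal ∧ p.weight = ν := by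
  rw [hasVal_iff]
  constructor
  · rintro (⟨h, y', hy'⟩ | ⟨c, ℓ, hc, hi, h⟩)
    · refine ⟨h, NQ.ofInt_injective ?_⟩
      obtain ⟨-, h1, -⟩ | ⟨-, -, h1⟩ := Hyperspace.mk_eq_mk_iff.1 hy' <;> exact h1.symm
    · have h0 : (ℓ : ℚ≥0) = 0 := by
        obtain ⟨-, -, h1⟩ | ⟨-, h1, -⟩ := Hyperspace.mk_eq_mk_iff.1 h
        exacts [h1.symm, h1]
      have := hi.pos
      rw [Nat.cast_eq_zero] at h0
      lia
  · rintro ⟨h, rfl⟩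
    exact Or.inl ⟨h, y, rfl⟩

theorem hasVal_mk_iff_of_pos [Nonempty Γ] {y : ClosedPt C} {ν : M →+ ℤ} {ℓ : ℕ} (hℓ : 1 ≤ ℓ) :
    p.HasVal (.mk y (NQ.ofInt ν) ℓ) ↔ y.1 ∉ Γ ∧ p.HasIndex y ℓ ∧ p.weight = ν := by
  have h0 : (ℓ : ℚ≥0) ≠ 0 := by
    rw [Nat.cast_ne_zero]
    lia
  rw [hasVal_iff]
  constructor
  · rintro (⟨-, y', h⟩ | ⟨c, ℓ', hc, hi, h⟩)
    · obtain ⟨-, -, h1⟩ | ⟨h1, -, -⟩ := Hyperspace.mk_eq_mk_iff.1 h <;> exact absurd h1 h0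
    · obtain ⟨rfl, h2, h3⟩ | ⟨h1, -, -⟩ := Hyperspace.mk_eq_mk_iff.1 h
      · rw [Nat.cast_inj] at h3
        subst h3
        exact ⟨hc, hi, NQ.ofInt_injective h2.symm⟩
      · exact absurd h1 h0
  · rintro ⟨hy, hi, rfl⟩
    exact Or.inr ⟨y, ℓ, hy, hi, rfl⟩

variable {E : DivisorialFan C M}

/-- Translates the criterion for extension over some chart into membership in the support. -/
theorem HasVal.mem_supportOver_iff [Nonempty Γ]
    (ht : ∀ y : ClosedPt C, y.1 ∈ Γ → ∀ D ∈ E.divisors,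
      ∃ D' ∈ E.divisors, y.1 ∈ D'.locus ∧ D.tail ≤ D'.tail) {ξ : Hyperspace C M} (h : p.HasVal ξ) :
    ξ ∈ E.supportOver Γ ↔ ∃ D ∈ E.divisors, p.AdmitsChart D := by
  obtain ⟨hh, y, rfl⟩ | ⟨c, ℓ, hc, hi, rfl⟩ := hasVal_iff.1 h
  · replace h := isHorizontal_iff.1 hh
    rw [DivisorialFan.mk_zero_mem_supportOver_iff]
    refine ⟨?_, fun ⟨D, hD, hp⟩ => ⟨D, hD, hp.mem_tail h⟩⟩
    rintro ⟨D, hD, hp⟩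
    have hi : ∀ c ℓ, c.1 ∉ Γ → ¬ p.HasIndex c ℓ := fun c ℓ hc hi => hc (hi.limit_eq ▸ h)
    obtain hg | hcl := eq_genericPoint_or_isClosed p.limit
    · have : Nonempty D.locus := D.locus_nonempty.to_subtype
      exact ⟨D, hD, hg ▸ genericPoint_mem D.locus, fun _ => hp, fun c ℓ hc h1 => absurd h1 (hi c ℓ hc)⟩
    -- The locus of `D` may miss the limit; the hypothesis on tails replaces `D` by a polyhedral
    -- divisor defined there.
    · obtain ⟨D', hD', hy, hle⟩ := ht ⟨_, hcl⟩ h D hD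
      exact ⟨D', hD', hy, fun _ => hle hp, fun c ℓ hc h1 => absurd h1 (hi c ℓ hc)⟩
  · have hℓ : (0 : ℚ≥0) < ℓ := by exact_mod_cast hi.pos
    rw [DivisorialFan.mk_mem_supportOver_iff_of_pos hℓ, NNRat.cast_natCast]
    constructor
    · rintro ⟨-, D, hD, h⟩
      refine ⟨D, hD, hi.limit_eq ▸ PolyhedralDivisor.mem_locus_of_mem_coeff h,
        fun h1 => absurd (hi.limit_eq ▸ h1) hc, fun c' ℓ' _ h' => ?_⟩
      obtain ⟨rfl, rfl⟩ := hi.unique h'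
      exact h
    · rintro ⟨D, hD, h⟩
      exact ⟨hc, D, hD, h.mem_coeff c ℓ hc hi⟩

end Val

/-! ### Points with a given triple -/

section Points

variable {p p' : TorusPoint Γ M K}

theorem ext_of_curvePoint (h : p.curvePoint = p'.curvePoint) (hχ : p.char = p'.char) : p = p' := by
  have h1 : p.base = p'.base := (cancel_mono Γ.ι).1 h
  cases p
  cases p'
  simp_all

variable {y : ClosedPt C} {π : C.functionField} {ℓ : ℕ} {u : K⟦X⟧ˣ}

theorem HasIndex.exists_unit (h : p.HasIndex y ℓ) (hπ : ord y π = 1) : ∃ u : K⟦X⟧ˣ,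
    EvalsTo p.curvePoint π (algebraMap K⟦X⟧ K⸨X⸩ ((PowerSeries.X : K⟦X⟧) ^ ℓ * u)) := by
  have hπ0 := ne_zero_of_ord_eq_one hπ
  obtain ⟨r, hr⟩ := h.exists_evalsTo π
  obtain ⟨u, hu⟩ := eqPowMulUnit_iff.2 ⟨h.ne_zero hπ0 hr, h.order_eq π r hπ0 hr⟩
  rw [hπ, mul_one] at hu
  refine ⟨u, ?_⟩
  rwa [eqPowMulUnit_X_pow_mul ℓ u, ← hu]

theorem evalsTo_lift_of_ord_nonneg {s : K⟦X⟧} (hy : p.limit = y.1) (hf : 0 ≤ ord y π)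
    (h : EvalsTo p.curvePoint π (algebraMap K⟦X⟧ K⸨X⸩ s)) : EvalsTo p.lift π s := by
  obtain ⟨r, hr⟩ := exists_evalsTo_of_ord_nonneg y hy fun _ => hf
  rwa [← algebraMap_laurentSeries_injective ((evalsTo_curvePoint hr).unique h)]

theorem eq_of_evalsTo {s : K⟦X⟧} (hs : (PowerSeries.X : K⟦X⟧) ∣ s) (hπ : ord y π = 1)
    (hy : p.limit = y.1) (hy' : p'.limit = y.1)
    (h : EvalsTo p.curvePoint π (algebraMap K⟦X⟧ K⸨X⸩ s))
    (h' : EvalsTo p'.curvePoint π (algebraMap K⟦X⟧ K⸨X⸩ s)) (hχ : p.char = p'.char) : p = p' := by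
  have hπ' : 0 ≤ ord y π := by rw [hπ]; exact zero_le_one
  refine ext_of_curvePoint ?_ hχ
  rw [← genericι_comp_lift, ← genericι_comp_lift, lift_eq_of_evalsTo hπ hs p.lift_over p'.lift_over
    hy hy' (evalsTo_lift_of_ord_nonneg hy hπ' h) (evalsTo_lift_of_ord_nonneg hy' hπ' h')]

theorem pullEq_of_evalsTo [Nonempty Γ] (hx : p.center = genericPoint C)
    (h : EvalsTo p.curvePoint π (algebraMap K⟦X⟧ K⸨X⸩ ((PowerSeries.X : K⟦X⟧) ^ ℓ * u))) :
    p.PullEq π ℓ u := by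
  intro a b hb hab
  have h1 := evalsTo_pull p.base b
  have h2 : pull p.base b ≠ 0 := (h1.isUnit hx (germToFunctionField_ne_zero hb)).ne_zero
  refine ⟨h2, ?_⟩
  have h3 := evalsTo_pull p.base a
  rw [hab] at h3
  rw [h3.unique (h.mul h1), mul_div_cancel_right₀ _ h2]
  exact eqPowMulUnit_X_pow_mul ℓ u

/-- Substitution of `t ^ ℓ * u` for the uniformizer; the order of this series identifies the
multiplicity as `ℓ`. -/
theorem exists_hasIndex_evalsTo [Nonempty Γ] (hπ : ord y π = 1) (hℓ : 1 ≤ ℓ) (u : K⟦X⟧ˣ)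
    (χ : AddMonoidAlgebra ℂ M →ₐ[ℂ] K⸨X⸩) : ∃ p : TorusPoint Γ M K, p.char = χ ∧ p.HasIndex y ℓ ∧
      EvalsTo p.curvePoint π (algebraMap K⟦X⟧ K⸨X⸩ ((PowerSeries.X : K⟦X⟧) ^ ℓ * u)) := by
  obtain ⟨p, hχ, hx, hy, h⟩ := exists_torusPoint_evalsTo (Γ := Γ) hπ
    (s := (PowerSeries.X : K⟦X⟧) ^ ℓ * (u : K⟦X⟧))
    ((dvd_pow_self _ (Nat.one_le_iff_ne_zero.1 hℓ)).mul_right _)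
    (mul_ne_zero (pow_ne_zero _ PowerSeries.X_ne_zero) u.ne_zero) χ
  obtain ⟨ℓ', hi⟩ := exists_hasIndex hy hx
  have h1 := hi.order_eq _ _ (ne_zero_of_ord_eq_one hπ) h
  rw [(eqPowMulUnit_X_pow_mul ℓ u).order_eq, hπ, mul_one] at h1
  obtain rfl : ℓ = ℓ' := by exact_mod_cast h1
  exact ⟨p, hχ, hi, h⟩

/-- The point of `Γ × T` given by an `𝒪`-point of `Γ` and a point of `T`. -/
def ofCurveArc (γ : CurveArc Γ K) (χ : AddMonoidAlgebra ℂ M →ₐ[ℂ] K⸨X⸩) : TorusPoint Γ M K where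
  base := genericι K ≫ γ.1
  base_over := by
    rw [IsOverC, Category.assoc, γ.2]
    exact (Spec.map_comp _ _).symm
  char := χ

theorem curveArc_ext {γ γ' : CurveArc Γ K} (h : genericι K ≫ γ.1 = genericι K ≫ γ'.1) : γ = γ' := by
  refine Subtype.ext ((cancel_mono Γ.ι).1 (hom_ext_of_valuationRing (K := K⸨X⸩) ?_))
  have h1 := congrArg (· ≫ Γ.ι) h
  simp only [Category.assoc] at h1
  exact h1

theorem exists_isHorizontal [Nonempty Γ] (χ : AddMonoidAlgebra ℂ M →ₐ[ℂ] K⸨X⸩) :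
    ∃ p : TorusPoint Γ M K, p.char = χ ∧ p.IsHorizontal := by
  obtain ⟨z, hz⟩ := exists_closedPt_mem Γ
  obtain ⟨π, -, hπ⟩ := exists_ord_eq_one z
  obtain ⟨p, hχ, -, hy, -⟩ := exists_torusPoint_evalsTo (Γ := Γ) hπ dvd_rfl
    (PowerSeries.X_ne_zero (R := K)) χ
  exact ⟨p, hχ, isHorizontal_iff.2 (hy ▸ hz)⟩

end Points

end TorusPoint

open PowerSeries LaurentSeries

/-! ### The valuation map and its fibres -/

section Main

variable {C : Scheme.{0}} [C.Over SpecC] [IsSmoothProjectiveCurve C] {M : Type} [AddCommGroup M]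
  [Module.Free ℤ M] [Module.Finite ℤ M] {E : DivisorialFan C M} {Γ : C.Opens} [Nonempty Γ]
  {K : Type} [Field K] [Algebra ℂ K]

/-- Arcs are identified with the points of `Γ × T` whose triple lies in the support, so the image
and the fibres can be computed on such points. -/
theorem exists_gen_val (hs : ∀ y : ClosedPt C, y.1 ∈ Γ → y ∉ E.special)
    (ht : ∀ y : ClosedPt C, y.1 ∈ Γ → ∀ D ∈ E.divisors,
      ∃ D' ∈ E.divisors, y.1 ∈ D'.locus ∧ D.tail ≤ D'.tail) :
    ∃ (gen : ArcOver E Γ K → TorusPoint Γ M K) (val : ArcOver E Γ K → Hyperspace C M),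
      (∀ α p, α.1.HasGenericPoint p ↔ p = gen α) ∧ (∀ α ξ, (gen α).HasVal ξ ↔ ξ = val α) ∧
      Function.Injective gen ∧ (∀ α, val α ∈ E.supportOver Γ) ∧
      ∀ p ξ, p.HasVal ξ → ξ ∈ E.supportOver Γ → ∃ α, gen α = p ∧ val α = ξ := by
  choose gen hgen using exists_hasGenericPoint (E := E) (K := K) hs
  choose val hval using fun α => (gen α).exists_hasVal
  refine ⟨gen, val, fun α p => ⟨fun h => HasGenericPoint.unique hs h (hgen α), ?_⟩,
    fun α ξ => ⟨fun h => h.unique (hval α), ?_⟩, fun α α' h => ?_, fun α => ?_,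
    fun p ξ hp hξ => ?_⟩
  · rintro rfl
    exact hgen α
  · rintro rfl
    exact hval α
  · exact Subtype.ext (arc_eq_of_hasGenericPoint hs (hgen α) (h ▸ hgen α'))
  · obtain ⟨D, φ, -, -, h⟩ := exists_admitsChart hs (hgen α)
    exact ((hval α).mem_supportOver_iff ht).2 ⟨D.1, D.2, h⟩
  · obtain ⟨D, hD, h⟩ := (hp.mem_supportOver_iff ht).1 hξ
    obtain ⟨α, hα⟩ := exists_arc hs hD h
    obtain rfl : gen α = p := HasGenericPoint.unique hs (hgen α) hα
    exact ⟨α, rfl, (hval α).unique hp⟩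

/-- For any integral point there is a `𝒦`-point of `Γ × T` with this value, unless it lies over
a point of `Γ` at positive height. -/
theorem exists_hasVal_eq {y : ClosedPt C} {ν : M →+ ℤ} {ℓ : ℕ} (h : ℓ = 0 ∨ y.1 ∉ Γ) :
    ∃ p : TorusPoint Γ M K, p.HasVal (.mk y (NQ.ofInt ν) ℓ) := by
  obtain ⟨χ, hχ⟩ := torusOrbit_nonempty (K := K) ν
  obtain rfl | hℓ := Nat.eq_zero_or_pos ℓ
  · obtain ⟨p, rfl, hp⟩ := TorusPoint.exists_isHorizontal (Γ := Γ) χ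
    refine ⟨p, ?_⟩
    rw [Nat.cast_zero]
    exact TorusPoint.hasVal_mk_zero_iff.2 ⟨hp, TorusPoint.mem_torusOrbit_iff_weight.1 hχ⟩
  · obtain ⟨π, -, hπ⟩ := exists_ord_eq_one y
    obtain ⟨p, rfl, hp, -⟩ := TorusPoint.exists_hasIndex_evalsTo (Γ := Γ) (K := K) hπ hℓ 1 χ
    exact ⟨p, (TorusPoint.hasVal_mk_iff_of_pos hℓ).2
      ⟨h.resolve_left hℓ.ne', hp, TorusPoint.mem_torusOrbit_iff_weight.1 hχ⟩⟩

end Main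

end TVariety

end

theorem mainTheorem4 {C : Scheme.{0}} [C.Over TVariety.SpecC] [TVariety.IsSmoothProjectiveCurve C]
    {M : Type} [AddCommGroup M] [Module.Free ℤ M] [Module.Finite ℤ M]
    (E : TVariety.DivisorialFan C M) (U : C.Opens) [Nonempty U]
    (hspecial : ∀ y : TVariety.ClosedPt C, y.1 ∈ U → y ∉ E.special)
    (htail : ∀ y : TVariety.ClosedPt C, y.1 ∈ U → ∀ D ∈ E.divisors,
      ∃ D' ∈ E.divisors, y.1 ∈ D'.locus ∧ D.tail ≤ D'.tail)
    (K : Type) [Field K] [Algebra ℂ K] :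
    ∃ (gen : TVariety.ArcOver E U K → TVariety.TorusPoint U M K)
      (val : TVariety.ArcOver E U K → TVariety.Hyperspace C M),
      (∀ α p, α.1.HasGenericPoint p ↔ p = gen α) ∧
      (∀ α ξ, (gen α).HasVal ξ ↔ ξ = val α) ∧
      Set.range val = E.supportOver U ∩ TVariety.Hyperspace.integral C M ∧
      (∀ (y : TVariety.ClosedPt C) (ν : M →+ ℤ),
        TVariety.Hyperspace.mk y (TVariety.NQ.ofInt ν) 0 ∈ E.supportOver U →
        ∃ e : {α // val α = TVariety.Hyperspace.mk y (TVariety.NQ.ofInt ν) 0} ≃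
            TVariety.CurveArc U K × TVariety.torusOrbit ν K,
          ∀ α, TVariety.genericι K ≫ (e α).1.1 = (gen α.1).base ∧
            ((e α).2 : AddMonoidAlgebra ℂ M →ₐ[ℂ] LaurentSeries K) = (gen α.1).char) ∧
      (∀ (y : TVariety.ClosedPt C) (ν : M →+ ℤ) (ℓ : ℕ), 1 ≤ ℓ →
        TVariety.Hyperspace.mk y (TVariety.NQ.ofInt ν) ℓ ∈ E.supportOver U →
        ∀ π : C.functionField, TVariety.ord y π = 1 →
        ∃ e : {α // val α = TVariety.Hyperspace.mk y (TVariety.NQ.ofInt ν) ℓ} ≃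
            (PowerSeries K)ˣ × TVariety.torusOrbit ν K,
          ∀ α, (gen α.1).PullEq π ℓ (e α).1 ∧
            ((e α).2 : AddMonoidAlgebra ℂ M →ₐ[ℂ] LaurentSeries K) = (gen α.1).char) := by
  obtain ⟨gen, val, hgen, hval, hinj, hmem, hsurj⟩ :=
    TVariety.exists_gen_val (K := K) hspecial htail
  have hfib : ∀ α ξ, val α = ξ ↔ (gen α).HasVal ξ := fun α ξ => eq_comm.trans (hval α ξ).symm
  refine ⟨gen, val, hgen, hval, ?_, fun y ν hξ => ?_, fun y ν ℓ hℓ hξ π hπ => ?_⟩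
  · ext ξ
    constructor
    · rintro ⟨α, rfl⟩
      obtain ⟨y, ν, ℓ, h, -⟩ := (hval α _).2 rfl
      exact ⟨hmem α, y, ν, ℓ, h⟩
    · rintro ⟨hξ, y, ν, ℓ, rfl⟩
      -- The points of positive height over `U` have been removed from the support.
      have h : ℓ = 0 ∨ y.1 ∉ U := by
        refine (Nat.eq_zero_or_pos ℓ).imp_right fun hℓ => ?_
        exact ((TVariety.DivisorialFan.mk_mem_supportOver_iff_of_pos
          (by exact_mod_cast hℓ)).1 hξ).1
      obtain ⟨p, hp⟩ := TVariety.exists_hasVal_eq (K := K) (ν := ν) h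
      obtain ⟨α, -, hα⟩ := hsurj p _ hp hξ
      exact ⟨α, hα⟩
  · have hiff := fun α : {α // val α = TVariety.Hyperspace.mk y (TVariety.NQ.ofInt ν) 0} =>
      TVariety.TorusPoint.hasVal_mk_zero_iff.1 ((hfib _ _).1 α.2)
    -- The extension to an `𝒪`-point is unique, so this choice is harmless.
    choose γ hγ using fun α => (hiff α).1
    let F : {α // val α = TVariety.Hyperspace.mk y (TVariety.NQ.ofInt ν) 0} →
        TVariety.CurveArc U K × TVariety.torusOrbit ν K := fun α =>
      (γ α, ⟨(gen α.1).char, TVariety.TorusPoint.mem_torusOrbit_iff_weight.2 (hiff α).2⟩)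
    have hF : Function.Bijective F := by
      refine ⟨fun α α' h => Subtype.ext (hinj ?_), fun ⟨γ₀, χ, hχ⟩ => ?_⟩
      · obtain ⟨h1, h2⟩ := Prod.mk.inj h
        refine TVariety.TorusPoint.ext_of_curvePoint ?_ (Subtype.mk.inj h2)
        rw [TVariety.TorusPoint.curvePoint, TVariety.TorusPoint.curvePoint, ← hγ α, ← hγ α', h1]
      · obtain ⟨α, hα, hα'⟩ := hsurj (TVariety.TorusPoint.ofCurveArc γ₀ χ) _
          (TVariety.TorusPoint.hasVal_mk_zero_iff.2
            ⟨⟨γ₀, rfl⟩, TVariety.TorusPoint.mem_torusOrbit_iff_weight.1 hχ⟩) hξ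
        refine ⟨⟨α, hα'⟩, Prod.ext (TVariety.TorusPoint.curveArc_ext ?_) (Subtype.ext ?_)⟩
        · exact (hγ ⟨α, hα'⟩).trans (congrArg TVariety.TorusPoint.base hα)
        · exact congrArg TVariety.TorusPoint.char hα
    exact ⟨Equiv.ofBijective F hF, fun α => ⟨hγ α, rfl⟩⟩
  · have hiff := fun α : {α // val α = TVariety.Hyperspace.mk y (TVariety.NQ.ofInt ν) ℓ} =>
      (TVariety.TorusPoint.hasVal_mk_iff_of_pos hℓ).1 ((hfib _ _).1 α.2)
    -- The pull-back of `π` has order `ℓ`, and `u` is its unit factor.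
    choose u hu using fun α => (hiff α).2.1.exists_unit hπ
    have hX : ∀ u : (PowerSeries K)ˣ,
        (PowerSeries.X : PowerSeries K) ∣ (PowerSeries.X : PowerSeries K) ^ ℓ * u :=
      fun u => (dvd_pow_self _ (Nat.one_le_iff_ne_zero.1 hℓ)).mul_right _
    let F : {α // val α = TVariety.Hyperspace.mk y (TVariety.NQ.ofInt ν) ℓ} →
        (PowerSeries K)ˣ × TVariety.torusOrbit ν K := fun α =>
      (u α, ⟨(gen α.1).char, TVariety.TorusPoint.mem_torusOrbit_iff_weight.2 (hiff α).2.2⟩)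
    have hF : Function.Bijective F := by
      refine ⟨fun α α' h => Subtype.ext (hinj ?_), fun ⟨u₀, χ, hχ⟩ => ?_⟩
      · obtain ⟨h1, h2⟩ := Prod.mk.inj h
        -- An arc of the curve through `y` is determined by the pull-back `t ^ ℓ * u` of `π`.
        exact TVariety.TorusPoint.eq_of_evalsTo (hX (u α)) hπ (hiff α).2.1.limit_eq
          (hiff α').2.1.limit_eq (hu α) (h1 ▸ hu α') (Subtype.mk.inj h2)
      · have hy := ((TVariety.DivisorialFan.mk_mem_supportOver_iff_of_pos
          (by exact_mod_cast hℓ)).1 hξ).1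
        obtain ⟨p, rfl, hi, hp⟩ :=
          TVariety.TorusPoint.exists_hasIndex_evalsTo (Γ := U) hπ hℓ u₀ χ
        obtain ⟨α, rfl, hα⟩ := hsurj p _ ((TVariety.TorusPoint.hasVal_mk_iff_of_pos hℓ).2
          ⟨hy, hi, TVariety.TorusPoint.mem_torusOrbit_iff_weight.1 hχ⟩) hξ
        refine ⟨⟨α, hα⟩, Prod.ext ?_ rfl⟩
        have h1 := TVariety.eqPowMulUnit_X_pow_mul ℓ u₀
        rw [hp.unique (hu ⟨α, hα⟩)] at h1
        exact (TVariety.eqPowMulUnit_X_pow_mul ℓ _).unit_unique h1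
    exact ⟨Equiv.ofBijective F hF, fun α =>
      ⟨TVariety.TorusPoint.pullEq_of_evalsTo (hiff α).2.1.center_eq (hu α), rfl⟩⟩
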